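/- **Setting.** Let $u_0(x)=\sum_{p=1}^P\frac{c_p}{x-z_p}+\mathrm{c.c.}$ with $c_p\ne 0$, $\mathrm{Im}\,z_p>0$, $\mathrm{Re}\,z_1<\dots<\mathrm{Re}\,z_P$ and $u_0\in L^1(\mathbb R)$, and suppose that $u_0$ is a rational Klaus–Shaw potential: there is $x_{\mathrm c}\in\mathbb R$, the only real zero of $u_0'$, such that $u_0$ is strictly monotone on $(-\infty,x_{\mathrm c})$ and on $(x_{\mathrm c},\infty)$. Put $M=2\pi i\sum_p c_p=\int_{\mathbb R}u_0$ and $h(x;\lambda)=\lambda x+f(x)$, $f(x)=\sum_p c_p\left(\mathrm{Log}(i(x-z_p))+\tfrac{\pi i}{2}\right)+\mathrm{c.c.}$ (principal branch), so that $f'=u_0$; the critical points of $h$ are the zeros of $\lambda+u_0$ in $\mathbb C$. The bulk is $\mathcal B=\{\lambda:-\sup u_0<\lambda<-\inf u_0\}$, and $\lambda$ lies outside the bulk if $\lambda\notin\overline{\mathcal B}$. For $\lambda\in\mathcal B$ let $x_-(\lambda)<x_+(\lambda)$ be the two real solutions of $u_0(x)=-\lambda$, let $x_1,\dots,x_{P-1}$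 be the critical points of $h(\cdot;\lambda)$ in the open upper half-plane (with multiplicities), and put $$\theta_+(\lambda)=\int_0^\lambda x_+(\eta)\,d\eta,\quad \Psi^-(x;\lambda)=(x-x_-(\lambda))\frac{\prod_{p=1}^{P-1}(x-x_p)}{\prod_{p=1}^{P}(x-z_p)},\quad e^{-i\psi_+(\lambda)-i\pi/4}=\frac{\Psi^-(x_+(\lambda);\lambda)}{|\Psi^-(x_+(\lambda);\lambda)|}.$$ **The reflection coefficient.** For $\lambda>0$ and $\epsilon>0$ let $A^>_{mp}=\int_{\tilde C_m}\frac{e^{-ih(z;\lambda)/\epsilon}}{z-z_p}\,dz$ and $b^>_m=-\lambda\int_{\tilde C_m}e^{-ih(z;\lambda)/\epsilon}\,dz$ ($1\le m,p\le P$), where $e^{-ih/\epsilon}$ is continued analytically along $\tilde C_m$ from its values for $\mathrm{Re}\,z<\mathrm{Re}\,z_1$, and $\tilde C_m$ begins at $-i\infty$ to the left of all poles of $u_0$, and either encircles $z_1,\dots,z_m$ once counterclockwise (passing between them and the points $z_p^*$, and not encircling the remaining poles) and returns to $-i\infty$ to the left of all poles, or, if $ic_m/\epsilon$ is a negative integer,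 ends at $z_m$ within the plane cut along the vertical half-lines from $z_p$ to $z_p+i\infty$ and from $z_p^*$ to $z_p^*-i\infty$. (These are the boundary values, from the upper half $\lambda$-plane, of the analogous quantities for $\lambda<0$, whose contours have their tails at $+i\infty$.) Then $$\beta(\lambda)=\frac{i}{\epsilon}e^{iM/\epsilon}\int_{-\infty}^{\infty}e^{-ih(z;\lambda)/\epsilon}\Big(u_0(z)-\sum_{p=1}^P\frac{v_p}{z-z_p}\Big)dz\ \text{ (improper integral)},\qquad \mathbf A^>\mathbf v=\mathbf b^>.$$ **Suitable modifications.** A suitable modification of the system $\mathbf A^>\mathbf v=\mathbf b^>$ exists at $\lambda$ if there are contours $W_1,\dots,W_P$ in $\mathbb C\setminus\{z_p,z_p^*\}$, independent of $\epsilon$, with branches of $h$ along them, such that (i) each $W_m$ passes through exactly one critical point of $h(\cdot;\lambda)$, and $\mathrm{Re}\{-ih\}$ along $W_m$ has its strict maximum there; (ii) the association of critical points to contours is one-to-one, critical points being counted with multiplicity; (iii) for all sufficiently small $\epsilon>0$ there is an invertible matrix $\mathbf N$ such that $\mathbf N\mathbf A^>$ and $\mathbf N\mathbf b^>$ have the same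 form as $\mathbf A^>$ and $\mathbf b^>$, with (absolutely convergent) integrals over $W_m$ in place of $\tilde C_m$. **Theorem.** Let $u_0$ be a rational Klaus–Shaw potential and let $\lambda>0$ be such that a suitable modification of the linear system $\mathbf A^>\mathbf v=\mathbf b^>$ exists. If $\lambda\in\mathcal B$ or $\lambda\notin\overline{\mathcal B}$, then $\beta(\lambda)$ is well defined for all sufficiently small $\epsilon>0$, and the following holds as $\epsilon\downarrow 0$. 1. If $\lambda\notin\overline{\mathcal B}$ (which is true for every $\lambda>0$ if $u_0$ is positive), then $\beta(\lambda)$ is exponentially small: $\beta(\lambda)=O(e^{-\kappa/\epsilon})$ for some $\kappa>0$. 2. If $\lambda\in\mathcal B$, then $$\beta(\lambda)=-\sqrt{\frac{2\pi\lambda\,(x_+(\lambda)-x_-(\lambda))}{\epsilon}}\;e^{-\frac{i}{\epsilon}\theta_+(\lambda)-i\psi_+(\lambda)}+o(\epsilon^{-1/2}),$$ and the error term is $O(\epsilon^{1/2})$ if all critical points of $h(\cdot;\lambda)$ in $\mathbb C$ are simple. -/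

import Mathlib

open Filter Topology Set MeasureTheory Asymptotics Polynomial

open scoped ComplexConjugate

noncomputable section

namespace BenjaminOno

/-! ### Rational Klaus-Shaw potentials -/

/-- The rational function `∑ c_p / (x - z_p) + conj c_p / (x - conj z_p)` of a complex variable. -/
def potentialC {P : ℕ} (c z : Fin P → ℂ) (x : ℂ) : ℂ :=
  ∑ p, (c p / (x - z p) + conj (c p) / (x - conj (z p)))

/-- The real potential `u₀`: on the real line the values of `potentialC` are real. -/
def potential {P : ℕ} (c z : Fin P → ℂ) (x : ℝ) : ℝ := (potentialC c z (x : ℂ)).re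

/-- Rational Klaus-Shaw potentials: nonzero residues, poles in the upper half-plane with
increasing real parts, `u₀ ∈ L¹(ℝ)`, and `u₀` is strictly monotone on both sides of some real
point `x_c`, which is its unique real critical point. -/
structure IsRationalKlausShaw {P : ℕ} (c z : Fin P → ℂ) : Prop where
  residue_ne_zero : ∀ p, c p ≠ 0
  pole_im_pos : ∀ p, 0 < (z p).im
  pole_re_strictMono : StrictMono fun p => (z p).re
  integrable : Integrable (potential c z)
  klausShaw : ∃ xc : ℝ,
    (StrictMonoOn (potential c z) (Iio xc) ∨ StrictAntiOn (potential c z) (Iio xc)) ∧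
    (StrictMonoOn (potential c z) (Ioi xc) ∨ StrictAntiOn (potential c z) (Ioi xc)) ∧
    ∀ x, deriv (potential c z) x = 0 ↔ x = xc

/-- The bulk `{lam : -sup u₀ < lam < -inf u₀}`. -/
def bulk {P : ℕ} (c z : Fin P → ℂ) : Set ℝ :=
  {lam | -sSup (range (potential c z)) < lam ∧ lam < -sInf (range (potential c z))}

/-- `x₋(lam)`: the smallest real solution of `u₀(x) = -lam`. -/
def xMinus {P : ℕ} (c z : Fin P → ℂ) (lam : ℝ) : ℝ := sInf {x : ℝ | potential c z x = -lam}

/-- `x₊(lam)`: the largest real solution of `u₀(x) = -lam`. -/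
def xPlus {P : ℕ} (c z : Fin P → ℂ) (lam : ℝ) : ℝ := sSup {x : ℝ | potential c z x = -lam}

/-- `θ₊(lam) = ∫₀^lam x₊(η) dη`. -/
def thetaPlus {P : ℕ} (c z : Fin P → ℂ) (lam : ℝ) : ℝ := ∫ η in (0 : ℝ)..lam, xPlus c z η

/-- The constant `M = 2πi (c₁ + ⋯ + c_P) = ∫ u₀`. -/
def mass {P : ℕ} (c : Fin P → ℂ) : ℂ := 2 * (Real.pi : ℂ) * Complex.I * ∑ p, c p

/-! ### Critical points of `h(x; lam) = lam x + f(x)`, where `f' = u₀` -/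

/-- The numerator of the rational function `h'(x; lam) = lam + u₀(x)` over the common denominator
`∏ (x - z_p) (x - conj z_p)`. -/
def criticalPoly {P : ℕ} (c z : Fin P → ℂ) (lam : ℝ) : ℂ[X] :=
  C (lam : ℂ) * ∏ q, ((X - C (z q)) * (X - C (conj (z q)))) +
    ∑ p, (C (c p) * (X - C (conj (z p))) + C (conj (c p)) * (X - C (z p))) *
      ∏ q ∈ Finset.univ.erase p, ((X - C (z q)) * (X - C (conj (z q))))

theorem criticalPoly_eval {P : ℕ} (c z : Fin P → ℂ) (lam : ℝ) (x : ℂ)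
    (h₁ : ∀ p, x ≠ z p) (h₂ : ∀ p, x ≠ conj (z p)) :
    (criticalPoly c z lam).eval x =
      ((lam : ℂ) + potentialC c z x) * ∏ q, ((x - z q) * (x - conj (z q))) := by
  simp only [criticalPoly, potentialC, eval_add, eval_mul, eval_C, eval_prod, eval_sub, eval_X,
    eval_finsetSum, add_mul, Finset.sum_mul]
  congr 1
  refine Finset.sum_congr rfl fun p _ => ?_
  rw [← Finset.mul_prod_erase Finset.univ (fun q => (x - z q) * (x - conj (z q)))
    (Finset.mem_univ p)]
  have h3 : x - z p ≠ 0 := sub_ne_zero.mpr (h₁ p)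
  have h4 : x - conj (z p) ≠ 0 := sub_ne_zero.mpr (h₂ p)
  field_simp

/-- The critical points of `h(·; lam)` in the complex plane, listed with their multiplicities
as zeros of `h'`. -/
def criticalPoints {P : ℕ} (c z : Fin P → ℂ) (lam : ℝ) : Multiset ℂ := (criticalPoly c z lam).roots

/-- All critical points of `h(·; lam)` are simple. -/
def AllCriticalPointsSimple {P : ℕ} (c z : Fin P → ℂ) (lam : ℝ) : Prop :=
  (criticalPoints c z lam).Nodup

open Classical in
/-- For `lam` in the bulk, `Ψ⁻(x; lam) = (x - x₋) ∏ (x - x_p) / ∏ (x - z_p)`, where `x_p` runs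
through the critical points of `h` in the open upper half-plane (with multiplicities). -/
def PsiMinus {P : ℕ} (c z : Fin P → ℂ) (lam : ℝ) (x : ℂ) : ℂ :=
  (x - (xMinus c z lam : ℂ)) *
    (((criticalPoints c z lam).filter fun w => 0 < w.im).map fun w => x - w).prod /
      ∏ p, (x - z p)

/-! ### The phase `h` and the linear system at `lam > 0`

`f(x) = ∑ c_p (Log (i (x - z_p)) + πi/2) + c.c.` has vertical branch cuts from the points `z_p`
(upwards) and `conj z_p` (downwards). -/

/-- The antiderivative `f` of `u₀`, on the complex plane cut along the vertical half-lines. -/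
def antideriv {P : ℕ} (c z : Fin P → ℂ) (x : ℂ) : ℂ :=
  ∑ p, (c p * (Complex.log (Complex.I * (x - z p)) + Real.pi * Complex.I / 2) +
    conj (c p) * (Complex.log (-Complex.I * (x - conj (z p))) - Real.pi * Complex.I / 2))

/-- The continuation of `f` (from the strip to the right of `z_m`) leftwards through the upper
branch cuts of `z_m, …, z_1`: the logarithms of these points are continued counterclockwise. -/
def antiderivCont {P : ℕ} (c z : Fin P → ℂ) (m : Fin P) (x : ℂ) : ℂ :=
  ∑ p, (c p * ((if p ≤ m then Complex.log (-Complex.I * (x - z p)) + Real.pi * Complex.I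
      else Complex.log (Complex.I * (x - z p))) + Real.pi * Complex.I / 2) +
    conj (c p) * (Complex.log (-Complex.I * (x - conj (z p))) - Real.pi * Complex.I / 2))

/-- `e^{-i h(x; lam) / ε}`. -/
def expFactor {P : ℕ} (c z : Fin P → ℂ) (lam ε : ℝ) (x : ℂ) : ℂ :=
  Complex.exp (-Complex.I * (lam * x + antideriv c z x) / ε)

/-- `e^{-i h(x; lam) / ε}` with `h` continued through the cuts of `z_m, …, z_1`. -/
def expFactorCont {P : ℕ} (c z : Fin P → ℂ) (m : Fin P) (lam ε : ℝ) (x : ℂ) : ℂ :=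
  Complex.exp (-Complex.I * (lam * x + antiderivCont c z m x) / ε)

/-- A number larger than the moduli of all the poles. -/
def outerRadius {P : ℕ} (z : Fin P → ℂ) : ℝ := 1 + ∑ p, ‖z p‖

/-- An abscissa to the right of `z_m` and, if there is one, to the left of the next pole. -/
def rightAbscissa {P : ℕ} (z : Fin P → ℂ) (m : Fin P) : ℝ :=
  if h : m.1 + 1 < P then ((z m).re + (z ⟨m.1 + 1, h⟩).re) / 2 else outerRadius z

/-- The integral of `e^{-ih/ε} g` along a loop from `-i∞` to `-i∞` (both tails to the left of all
poles) around `z_1, …, z_m` counterclockwise. For negative `lam` the contour comes from `i∞` to the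
left of all poles, passes below `z_1, …, z_m` and returns to `i∞` between `z_m` and the next
pole; when `lam` moves to the positive half-line through the upper half-plane both tails
rotate by `π` through the left half-plane, and the integrand is continued through the upper
branch cuts along the returning part. The loop is realized by straight pieces: up the line
`Re = -R`, along the real axis to `b`, up to the height `R`, back to the line `Re = -R`, and
down along it, the last two with the continued integrand. -/
def loopIntegral {P : ℕ} (c z : Fin P → ℂ) (lam ε : ℝ) (m : Fin P) (g : ℂ → ℂ) : ℂ :=
  let R : ℝ := outerRadius z
  let b : ℝ := rightAbscissa z m
  let F : ℂ → ℂ := fun x => expFactor c z lam ε x * g x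
  let Fc : ℂ → ℂ := fun x => expFactorCont c z m lam ε x * g x
  (∫ t in Iic (0 : ℝ), F (-(R : ℂ) + t * Complex.I) * Complex.I) +
    (∫ s in (-R)..b, F (s : ℂ)) +
    (∫ t in (0 : ℝ)..R, F ((b : ℂ) + t * Complex.I) * Complex.I) -
    (∫ s in (-R)..b, Fc ((s : ℂ) + R * Complex.I)) -
    ∫ t in Iic R, Fc (-(R : ℂ) + t * Complex.I) * Complex.I

/-- The integral of `e^{-ih/ε} g` along a contour from `-i∞`, to the left of all poles, to `z_m`
inside the domain of analyticity of `f`. -/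
def endpointIntegral {P : ℕ} (c z : Fin P → ℂ) (lam ε : ℝ) (m : Fin P) (g : ℂ → ℂ) : ℂ :=
  let R : ℝ := outerRadius z
  let F : ℂ → ℂ := fun x => expFactor c z lam ε x * g x
  (∫ t in Iic (0 : ℝ), F (-(R : ℂ) + t * Complex.I) * Complex.I) +
    (∫ s in (-R)..(z m).re, F (s : ℂ)) +
    ∫ t in (0 : ℝ)..(z m).im, F (((z m).re : ℂ) + t * Complex.I) * Complex.I

open Classical in
/-- The integral over the `m`-th contour of the linear system for `lam > 0`: the contour ends at
`z_m` if `i c_m / ε` is a negative integer and is the loop around `z_1, …, z_m` otherwise. -/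
def rowIntegral {P : ℕ} (c z : Fin P → ℂ) (lam ε : ℝ) (m : Fin P) (g : ℂ → ℂ) : ℂ :=
  if ∃ n : ℕ, 0 < n ∧ Complex.I * c m / ε = -(n : ℂ) then endpointIntegral c z lam ε m g
  else loopIntegral c z lam ε m g

/-- The matrix `A^>(lam)`. -/
def jostMatrix {P : ℕ} (c z : Fin P → ℂ) (lam ε : ℝ) : Matrix (Fin P) (Fin P) ℂ :=
  Matrix.of fun m p => rowIntegral c z lam ε m fun x => 1 / (x - z p)

/-- The right-hand side `b^>(lam)`. -/
def jostVector {P : ℕ} (c z : Fin P → ℂ) (lam ε : ℝ) : Fin P → ℂ :=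
  fun m => -(lam : ℂ) * rowIntegral c z lam ε m fun _ => 1

/-! ### The reflection coefficient -/

/-- `I` is the value of the convergent improper integral of `g` over the real line. -/
def HasImproperIntegral (g : ℝ → ℂ) (I : ℂ) : Prop :=
  (∀ a b : ℝ, IntervalIntegrable g volume a b) ∧
    Tendsto (fun q : ℝ × ℝ => ∫ x in q.1..q.2, g x) (atBot ×ˢ atTop) (𝓝 I)

/-- `β = (i/ε) e^{iM/ε} ∫ e^{-ih/ε} (u₀ - ∑ v_p / (x - z_p)) dx` for a solution `v` of
`A^> v = b^>`. -/
def IsReflectionCoefficient {P : ℕ} (c z : Fin P → ℂ) (lam ε : ℝ) (β : ℂ) : Prop :=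
  ∃ v : Fin P → ℂ, (jostMatrix c z lam ε).mulVec v = jostVector c z lam ε ∧
    ∃ I : ℂ, HasImproperIntegral
        (fun x => expFactor c z lam ε x * ((potential c z x : ℂ) - ∑ p, v p / ((x : ℂ) - z p))) I ∧
      β = Complex.I / ε * Complex.exp (Complex.I * mass c / ε) * I

/-! ### Suitable modifications of the linear system -/

/-- A piecewise continuously differentiable contour in the plane without the points
`z_p, conj z_p`, parametrized by `ℝ`, with continuous branches along it of the logarithms of
`x - z_p` and `x - conj z_p`. -/
structure BranchedContour {P : ℕ} (z : Fin P → ℂ) where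
  path : ℝ → ℂ
  logUpper : Fin P → ℝ → ℂ
  logLower : Fin P → ℝ → ℂ
  continuous_path : Continuous path
  piecewise_smooth : ∃ S : Finset ℝ, (∀ t ∉ S, ContDiffAt ℝ 1 path t) ∧
    ∀ t ∈ S, (∃ l, Tendsto (deriv path) (𝓝[<] t) (𝓝 l)) ∧ ∃ r, Tendsto (deriv path) (𝓝[>] t) (𝓝 r)
  continuous_logUpper : ∀ p, Continuous (logUpper p)
  continuous_logLower : ∀ p, Continuous (logLower p)
  exp_logUpper : ∀ p t, Complex.exp (logUpper p t) = path t - z p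
  exp_logLower : ∀ p t, Complex.exp (logLower p t) = path t - conj (z p)

/-- The branch of `h(·; lam)` along the contour (`Log (i (x - z_p)) + πi/2` is a branch of
`log (x - z_p) + πi`). -/
def BranchedContour.phase {P : ℕ} {z : Fin P → ℂ} (W : BranchedContour z) (c : Fin P → ℂ)
    (lam : ℝ) (t : ℝ) : ℂ :=
  lam * W.path t + ∑ p, (c p * (W.logUpper p t + Real.pi * Complex.I) +
    conj (c p) * (W.logLower p t - Real.pi * Complex.I))

/-- The integrand of `∫_W e^{-ih/ε} g dx` in the parameter of the contour. -/
def BranchedContour.integrand {P : ℕ} {z : Fin P → ℂ} (W : BranchedContour z) (c : Fin P → ℂ)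
    (lam ε : ℝ) (g : ℂ → ℂ) (t : ℝ) : ℂ :=
  Complex.exp (-Complex.I * W.phase c lam t / ε) * g (W.path t) * deriv W.path t

/-- There is a suitable modification of the linear system `A^> v = b^>`: there are contours
`W_m`, with branches of `h`, such that
(i) each `W_m` passes through exactly one critical point of `h`, at which the maximum of
`Re (-ih)` along `W_m` is attained;
(ii) the critical points of different contours are different members of the list of critical
points (with multiplicities);
(iii) for all small `ε`, an invertible matrix `N` turns `A^>` and `b^>` into the matrix and the
vector of the same form with (absolutely convergent) integrals over the contours `W_m`. -/
def HasSuitableModification {P : ℕ} (c z : Fin P → ℂ) (lam : ℝ) : Prop :=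
  ∃ (W : Fin P → BranchedContour z) (τ : Fin P → ℝ),
    (∀ m s, (W m).path s ∈ criticalPoints c z lam ↔ s = τ m) ∧
    (∀ m s, s ≠ τ m → (-Complex.I * (W m).phase c lam s).re <
      (-Complex.I * (W m).phase c lam (τ m)).re) ∧
    Multiset.map (fun m => (W m).path (τ m)) Finset.univ.val ≤ criticalPoints c z lam ∧
    ∀ᶠ ε : ℝ in 𝓝[>] 0,
      (∀ m, Integrable ((W m).integrand c lam ε fun _ => 1)) ∧
      (∀ m p, Integrable ((W m).integrand c lam ε fun x => 1 / (x - z p))) ∧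
      ∃ N : Matrix (Fin P) (Fin P) ℂ, IsUnit N ∧
        (N * jostMatrix c z lam ε = Matrix.of fun m p =>
          ∫ t, (W m).integrand c lam ε (fun x => 1 / (x - z p)) t) ∧
        N.mulVec (jostVector c z lam ε) = fun m =>
          -(lam : ℂ) * ∫ t, (W m).integrand c lam ε (fun _ => 1) t

end BenjaminOno

end

open BenjaminOno

/-! The asymptotics follow from an analytic description of the solutions of the linear system.
Write `E = e^{-ih/ε}` and `G(x) = μ + ∑ w_p / (x - z_p)`; the system `A^> v = b^>` says that the
row integrals of `E G` vanish for `μ = λ`, `w = v`. Let `Φ` be the primitive of `E G` that vanishes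
at `-i∞` to the left of the poles.

*Vanishing rows.* The rows vanish only if `Φ`, continued through the upper branch cuts, picks up the
same monodromy factors as `E`. Then `n = Φ / E` is single-valued in the plane with the lower cuts
only, where it solves `n' = G + (i/ε) h' n`; the poles `z_p` are regular singular points of this
equation, and a single-valued solution is analytic there (`exists_isJostQuotient`).

*The forcing `G`.* The homogeneous equation is neutral on the real axis, which bounds `n` on it by a
multiple of the size `γ = |μ| + ∑ |w_p|` of `G`; the equation at infinity and the maximum principle
extend the bound to the closed upper half-plane (`exists_bound_upper`), and where `u₀` decreases it
extends to a strip below the axis (`exists_bound_lower`). On a circle in this region around `P`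
critical points `r` of `h`, the equation, solved for `h' n`, gives `n = O(εγ)`, hence so inside, and
`G = -(i/ε) h' n + O(εγ)`. So `G` is small at the points `r`, and its numerator, a polynomial with
leading coefficient `μ`, equals `μ ∏ (x - r) + O(εγ)` (`HasRemainderBound`). Outside the bulk all
`P` critical points in the upper half-plane are used, in the bulk the `P - 1` such points and `x₋`,
next to which `u₀` decreases. For `μ = 0` this gives `G = 0`, so that the system is uniquely solvable
for small `ε`; for `μ = λ` it gives `G = λ Ψ⁻ + O(ε)`.

*The integral.* Since `E (u₀ - ∑ v_p / (x - z_p))` is the derivative of `iεE - Φ`, the reflection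
coefficient is `-(i/ε) e^{iM/ε} J` with the limit `J` of `Φ` at `-i∞` to the right of the poles
(`IsReflectionCoefficient.exists_hasRightLimit`). Outside the bulk `λ + u₀ > 0` on the real axis, the
path from left to right can be taken below the axis, and `J` is exponentially small. In the bulk the
path is taken above the axis up to a neighbourhood of `x₊`, where `n` is bounded and `E` small,
crosses the axis at `x₊` on the line of steepest descent and goes on below the axis; Laplace's method
gives the leading term `(1 - i) √(πε / u₀'(x₊)) E(x₊) λ Ψ⁻(x₊)` of `J`
(`exists_norm_rightLimit_sub_le`). Its modulus is evaluated by factoring `h''(x₊)` over the critical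
points (`IsWell.norm_PsiMinus_sq`), and its phase by `h(x₊(λ); λ) = M + θ₊(λ)`, which holds because
`x₊(λ)` is the derivative of the critical value (`IsWell.criticalValue_eq`). -/

noncomputable section

namespace BenjaminOno

variable {P : ℕ} {c z : Fin P → ℂ} {lam ε : ℝ}

/-! ### Branches of the phase -/

/-- The antiderivative of `u₀` whose upper branch cuts from `z_p`, `p < k`, point downwards: the
logarithms of these points are continued counterclockwise through the upward cuts. The case `k = 0`
is `antideriv` and the case `k = m + 1` is `antiderivCont c z m`. -/
def branchAntideriv (c z : Fin P → ℂ) (k : ℕ) (x : ℂ) : ℂ :=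
  ∑ p, (c p * ((if p.1 < k then Complex.log (-Complex.I * (x - z p)) + Real.pi * Complex.I
      else Complex.log (Complex.I * (x - z p))) + Real.pi * Complex.I / 2) +
    conj (c p) * (Complex.log (-Complex.I * (x - conj (z p))) - Real.pi * Complex.I / 2))

/-- The factor `e^{-ih/ε}` formed with `branchAntideriv c z k`. -/
def branchExp (c z : Fin P → ℂ) (lam ε : ℝ) (k : ℕ) (x : ℂ) : ℂ :=
  Complex.exp (-Complex.I * (lam * x + branchAntideriv c z k x) / ε)

/-- The plane without the branch cuts of `branchAntideriv c z k`. -/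
def branchDomain (z : Fin P → ℂ) (k : ℕ) : Set ℂ :=
  {x | ∀ p : Fin P, (if p.1 < k then -Complex.I * (x - z p) else Complex.I * (x - z p)) ∈
      Complex.slitPlane ∧ -Complex.I * (x - conj (z p)) ∈ Complex.slitPlane}

theorem antideriv_eq_branchAntideriv (x : ℂ) : antideriv c z x = branchAntideriv c z 0 x := by
  simp [antideriv, branchAntideriv]

theorem antiderivCont_eq_branchAntideriv (m : Fin P) (x : ℂ) :
    antiderivCont c z m x = branchAntideriv c z (m.1 + 1) x := by
  simp only [antiderivCont, branchAntideriv, Fin.le_def, Nat.lt_succ_iff]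

theorem expFactor_eq_branchExp : expFactor c z lam ε = branchExp c z lam ε 0 := by
  ext x; simp [expFactor, branchExp, antideriv_eq_branchAntideriv]

theorem expFactorCont_eq_branchExp (m : Fin P) :
    expFactorCont c z m lam ε = branchExp c z lam ε (m.1 + 1) := by
  ext x; simp [expFactorCont, branchExp, antiderivCont_eq_branchAntideriv]

theorem branchExp_ne_zero (k : ℕ) (x : ℂ) : branchExp c z lam ε k x ≠ 0 := Complex.exp_ne_zero _

theorem mem_branchDomain_iff {k : ℕ} {x : ℂ} :
    x ∈ branchDomain z k ↔ ∀ p : Fin P,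
      (x.re = (z p).re → (p.1 < k → (z p).im < x.im) ∧ (k ≤ p.1 → x.im < (z p).im)) ∧
      (x.re = (z p).re → -(z p).im < x.im) := by
  simp only [branchDomain, Set.mem_ofPred_eq]
  refine forall_congr' fun p => and_congr ?_ ?_
  · split_ifs with h
    · simp [Complex.mem_slitPlane_iff, h, sub_eq_zero]
      tauto
    · simp [Complex.mem_slitPlane_iff, h, sub_eq_zero, not_lt.mp h]
      tauto
  · simp [Complex.mem_slitPlane_iff, sub_eq_zero]
    constructor
    · rintro (h | h) h'
      · linarith
      · exact absurd h'.symm h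
    · intro h
      by_cases h' : x.re = (z p).re
      · left; linarith [h h']
      · exact Or.inr (Ne.symm h')

theorem isOpen_branchDomain (k : ℕ) : IsOpen (branchDomain z k) := by
  have : branchDomain z k = ⋂ p : Fin P,
      ({x | (if p.1 < k then -Complex.I * (x - z p) else Complex.I * (x - z p)) ∈
      Complex.slitPlane} ∩ {x | -Complex.I * (x - conj (z p)) ∈ Complex.slitPlane}) := by
    ext x; simp [branchDomain]
  rw [this]
  refine isOpen_iInter_of_finite fun p => IsOpen.inter ?_ ?_
  · refine Complex.isOpen_slitPlane.preimage ?_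
    split_ifs <;> fun_prop
  · exact Complex.isOpen_slitPlane.preimage (by fun_prop)

theorem ne_pole_of_mem_branchDomain {k : ℕ} {x : ℂ} (hx : x ∈ branchDomain z k) (p : Fin P) :
    x ≠ z p ∧ x ≠ conj (z p) := by
  have := hx p
  refine ⟨?_, ?_⟩
  · rintro h
    have h1 := this.1
    rw [h] at h1
    simp at h1
  · rintro h
    have h1 := this.2
    rw [h] at h1
    simp at h1

theorem hasDerivAt_branchAntideriv {k : ℕ} {x : ℂ} (hx : x ∈ branchDomain z k) :
    HasDerivAt (branchAntideriv c z k) (potentialC c z x) x := by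
  unfold branchAntideriv potentialC
  refine HasDerivAt.fun_sum fun p _ => ?_
  have hne := ne_pole_of_mem_branchDomain hx p
  have h0 := hx p
  have h3 : x - z p ≠ 0 := sub_ne_zero.mpr hne.1
  have h4 : x - conj (z p) ≠ 0 := sub_ne_zero.mpr hne.2
  have hI : Complex.I ≠ 0 := Complex.I_ne_zero
  have hl : HasDerivAt (fun x => Complex.log (-Complex.I * (x - conj (z p))))
      (-Complex.I * 1 / (-Complex.I * (x - conj (z p)))) x :=
    HasDerivAt.clog (((hasDerivAt_id x).sub_const _).const_mul _) h0.2
  have hu : HasDerivAt (fun x => if p.1 < k then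
      Complex.log (-Complex.I * (x - z p)) + Real.pi * Complex.I
      else Complex.log (Complex.I * (x - z p))) (1 / (x - z p)) x := by
    by_cases hk : p.1 < k
    · simp only [hk, if_true] at h0 ⊢
      have := (HasDerivAt.clog (((hasDerivAt_id x).sub_const (z p)).const_mul (-Complex.I))
        h0.1).add_const (Real.pi * Complex.I)
      refine this.congr_deriv ?_
      simp only [id]
      field_simp
    · simp only [hk, if_false] at h0 ⊢
      have := (HasDerivAt.clog (((hasDerivAt_id x).sub_const (z p)).const_mul (Complex.I))
        h0.1)
      refine this.congr_deriv ?_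
      simp only [id]
      field_simp
  refine (((hu.add_const (Real.pi * Complex.I / 2)).const_mul (c p)).add
    ((hl.sub_const (Real.pi * Complex.I / 2)).const_mul (conj (c p)))).congr_deriv ?_
  field_simp

theorem hasDerivAt_branchExp {k : ℕ} {x : ℂ} (hx : x ∈ branchDomain z k) :
    HasDerivAt (branchExp c z lam ε k)
      (-(Complex.I / ε) * (lam + potentialC c z x) * branchExp c z lam ε k x) x := by
  unfold branchExp
  refine (((((hasDerivAt_id x).const_mul (lam : ℂ)).add
    (hasDerivAt_branchAntideriv (c := c) hx)).const_mul (-Complex.I)).div_const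
      (ε : ℂ)).cexp.congr_deriv ?_
  simp only [id, mul_one, Pi.add_apply]
  ring

theorem log_neg_I_mul_of_re_pos {w : ℂ} (hw : 0 < w.re ∨ w.re = 0 ∧ 0 < w.im) :
    Complex.log (-Complex.I * w) + Real.pi * Complex.I = Complex.log (Complex.I * w) := by
  have h2 : Complex.arg (-(-Complex.I * w)) = Complex.arg (-Complex.I * w) + Real.pi :=
    Complex.arg_neg_eq_arg_add_pi_iff.mpr (by simpa using hw)
  have h3 : -(-Complex.I * w) = Complex.I * w := by ring
  rw [h3] at h2
  rw [Complex.log, Complex.log, h2]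
  push_cast
  simp
  ring

theorem log_neg_I_mul_of_re_neg {w : ℂ} (hw : w.re < 0) :
    Complex.log (-Complex.I * w) + Real.pi * Complex.I =
      Complex.log (Complex.I * w) + 2 * Real.pi * Complex.I := by
  have h : 0 < (-Complex.I * w).im := by simpa using hw
  have h2 := Complex.arg_neg_eq_arg_sub_pi_of_im_pos h
  have h3 : -(-Complex.I * w) = Complex.I * w := by ring
  rw [h3] at h2
  rw [Complex.log, Complex.log, h2]
  push_cast
  simp
  ring

theorem branchAntideriv_succ (p : Fin P) (x : ℂ) :
    branchAntideriv c z (p.1 + 1) x = branchAntideriv c z p.1 x +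
      c p * (Complex.log (-Complex.I * (x - z p)) + Real.pi * Complex.I -
        Complex.log (Complex.I * (x - z p))) := by
  rw [← sub_eq_iff_eq_add']
  unfold branchAntideriv
  rw [← Finset.sum_sub_distrib, Finset.sum_eq_single p]
  · simp; ring
  · intro q _ hq
    have : q.1 < p.1 + 1 ↔ q.1 < p.1 := by
      have : q.1 ≠ p.1 := fun h => hq (Fin.ext h)
      omega
    simp [this]
  · simp

/-- To the right of `z_p`, and on its upper cut, the continuation through the cut of `z_p` changes
nothing. -/
theorem branchExp_succ_of_re_lt (p : Fin P) {x : ℂ}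
    (hx : (z p).re < x.re ∨ x.re = (z p).re ∧ (z p).im < x.im) :
    branchExp c z lam ε (p.1 + 1) x = branchExp c z lam ε p.1 x := by
  unfold branchExp
  rw [branchAntideriv_succ, log_neg_I_mul_of_re_pos (by simpa [sub_eq_zero] using hx)]
  simp

/-- To the left of `z_p` the continuation through the cut of `z_p` multiplies `e^{-ih/ε}` by the
monodromy factor. -/
theorem branchExp_succ_of_lt_re (p : Fin P) {x : ℂ} (hx : x.re < (z p).re) :
    branchExp c z lam ε (p.1 + 1) x =
      Complex.exp (2 * Real.pi * c p / ε) * branchExp c z lam ε p.1 x := by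
  unfold branchExp
  rw [branchAntideriv_succ, log_neg_I_mul_of_re_neg (by simpa using hx), ← Complex.exp_add]
  congr 1
  have := Complex.I_sq
  linear_combination (-2 * Real.pi * c p / ε) * this

/-- In a strip to the right of `z_p` for all `p < k` the branch `k` is the principal one. -/
theorem branchExp_eq_zero_branch {k : ℕ} (hk : k ≤ P) {x : ℂ}
    (hx : ∀ p : Fin P, p.1 < k → (z p).re < x.re) :
    branchExp c z lam ε k x = branchExp c z lam ε 0 x := by
  induction k with
  | zero => rfl
  | succ k ih =>
    rw [← ih (by omega) fun p hp => hx p (by omega)]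
    exact branchExp_succ_of_re_lt ⟨k, by omega⟩ (Or.inl (hx _ (by simp)))

theorem conj_antideriv_ofReal (hz : ∀ p, 0 < (z p).im) (x : ℝ) :
    conj (antideriv c z x) = antideriv c z x := by
  unfold antideriv
  rw [map_sum]
  refine Finset.sum_congr rfl fun p _ => ?_
  have h1 : conj (Complex.log (Complex.I * (x - z p))) =
      Complex.log (-Complex.I * (x - conj (z p))) := by
    rw [← Complex.log_conj]
    · simp
    · intro h
      rw [Complex.arg_eq_pi_iff] at h
      have := h.1
      simp at this
      linarith [hz p]
  have h2 : conj (Complex.log (-Complex.I * (x - conj (z p)))) =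
      Complex.log (Complex.I * (x - z p)) := by
    rw [← h1, Complex.conj_conj]
  simp only [map_add, map_mul, map_sub, h1, h2, map_div₀, Complex.conj_ofReal, Complex.conj_I,
    Complex.conj_conj, map_ofNat]
  ring

theorem antideriv_ofReal_im (hz : ∀ p, 0 < (z p).im) (x : ℝ) : (antideriv c z x).im = 0 :=
  Complex.conj_eq_iff_im.mp (conj_antideriv_ofReal hz x)

theorem norm_branchExp_zero (x : ℂ) :
    ‖branchExp c z lam ε 0 x‖ = Real.exp ((lam * x.im + (antideriv c z x).im) / ε) := by
  rw [branchExp, Complex.norm_exp, ← antideriv_eq_branchAntideriv]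
  congr 1
  rw [Complex.div_ofReal_re]
  simp

theorem norm_branchExp_ofReal (hz : ∀ p, 0 < (z p).im) (x : ℝ) :
    ‖branchExp c z lam ε 0 x‖ = 1 := by
  rw [norm_branchExp_zero, antideriv_ofReal_im hz]
  simp

theorem conj_potentialC (x : ℂ) : conj (potentialC c z x) = potentialC c z (conj x) := by
  unfold potentialC
  rw [map_sum]
  refine Finset.sum_congr rfl fun p _ => ?_
  simp only [map_add, map_div₀, map_sub, Complex.conj_conj]
  ring

theorem potentialC_ofReal (x : ℝ) : potentialC c z x = (potential c z x : ℂ) := by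
  have : conj (potentialC c z x) = potentialC c z x := by
    rw [conj_potentialC, Complex.conj_ofReal]
  exact (Complex.conj_eq_iff_re.mp this).symm

/-! ### Primitives on vertically star-shaped domains -/

theorem hasDerivAt_comp_line {ψ : ℂ → ℂ} {ψ' a d : ℂ} {t : ℝ} (h : HasDerivAt ψ ψ' (a + t * d)) :
    HasDerivAt (fun s : ℝ => ψ (a + s * d)) (d * ψ') t := by
  have h2 : HasDerivAt (fun y : ℂ => a + y * d) d (t : ℂ) := by
    simpa using ((hasDerivAt_id (t : ℂ)).mul_const d).const_add a
  have h3 := (HasDerivAt.comp (t : ℂ) h h2).comp_ofReal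
  simpa [mul_comm, Function.comp_def] using h3

theorem hasDerivAt_comp_horizontal {ψ : ℂ → ℂ} {ψ' b : ℂ} {t : ℝ} (h : HasDerivAt ψ ψ' (t + b)) :
    HasDerivAt (fun s : ℝ => ψ (s + b)) ψ' t := by
  have h2 := hasDerivAt_comp_line (ψ := ψ) (a := b) (d := 1) (t := t) (ψ' := ψ')
    (by simpa [add_comm] using h)
  simpa [add_comm] using h2

/-- A holomorphic function on an open set which, with each of its points, contains the vertical
segment down (or up) to the line `Im = y₀`, has a primitive there: integrate along the line and
then along the vertical segment. -/
theorem exists_primitive_of_vertically_starshaped {U : Set ℂ} (hU : IsOpen U) (y₀ : ℝ)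
    {J : Set ℝ} (hJ : J.OrdConnected) (hUJ : ∀ x ∈ U, x.re ∈ J)
    (hbase : ∀ s ∈ J, (s + y₀ * Complex.I : ℂ) ∈ U)
    (hcol : ∀ x ∈ U, ∀ t ∈ uIcc y₀ x.im, (x.re + t * Complex.I : ℂ) ∈ U)
    {f : ℂ → ℂ} (hf : DifferentiableOn ℂ f U) :
    ∃ Φ : ℂ → ℂ, ∀ x ∈ U, HasDerivAt Φ (f x) x := by
  rcases U.eq_empty_or_nonempty with rfl | ⟨x₀, hx₀⟩
  · exact ⟨0, by simp⟩
  have hfc : ContinuousOn f U := hf.continuousOn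
  refine ⟨fun x => (∫ s in x₀.re..x.re, f (s + y₀ * Complex.I)) +
    Complex.I * ∫ t in y₀..x.im, f (x.re + t * Complex.I), fun x hx => ?_⟩
  -- a tube around the vertical segment below `x` stays in `U`
  have hKc : IsCompact ((fun t : ℝ => (x.re + t * Complex.I : ℂ)) '' uIcc y₀ x.im) :=
    isCompact_uIcc.image (by fun_prop)
  have hKU : ((fun t : ℝ => (x.re + t * Complex.I : ℂ)) '' uIcc y₀ x.im) ⊆ U := by
    rintro _ ⟨t, ht, rfl⟩
    exact hcol x hx t ht
  obtain ⟨δ, hδ, hδU⟩ := hKc.exists_thickening_subset_open hU hKU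
  obtain ⟨r, hr, hrU⟩ := Metric.isOpen_iff.mp hU x hx
  obtain ⟨ψ, hψ⟩ := (hf.mono hrU).isExactOn_ball
  set ρ := min (δ / 2) r with hρ
  have hρ0 : 0 < ρ := by positivity
  have hre : ∀ w : ℂ, w ∈ Metric.ball x ρ → |w.re - x.re| < ρ ∧ |w.im - x.im| < ρ := by
    intro w hw
    rw [Metric.mem_ball, dist_eq_norm] at hw
    exact ⟨lt_of_le_of_lt (by simpa using Complex.abs_re_le_norm (w - x)) hw,
      lt_of_le_of_lt (by simpa using Complex.abs_im_le_norm (w - x)) hw⟩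
  have htube : ∀ s t : ℝ, |s - x.re| < ρ → (∃ t' ∈ uIcc y₀ x.im, |t - t'| < ρ) →
      (s + t * Complex.I : ℂ) ∈ U := by
    rintro s t hs ⟨t', ht', htt'⟩
    refine hδU (Metric.mem_thickening_iff.mpr ⟨_, ⟨t', ht', rfl⟩, ?_⟩)
    rw [dist_eq_norm]
    refine lt_of_le_of_lt (Complex.norm_le_abs_re_add_abs_im _) ?_
    simp only [Complex.sub_re, Complex.add_re, Complex.ofReal_re, Complex.mul_re, Complex.I_re,
      mul_zero, Complex.ofReal_im, Complex.I_im, mul_one, sub_self, add_zero, Complex.sub_im,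
      Complex.add_im, Complex.mul_im, zero_add]
    have := min_le_left (δ / 2) r
    linarith
  refine ((hψ x (Metric.mem_ball_self hr)).const_add
    ((∫ s in x₀.re..x.re, f (s + y₀ * Complex.I)) +
    (Complex.I * ∫ t in y₀..x.im, f (x.re + t * Complex.I)) - ψ x)).congr_of_eventuallyEq ?_
  filter_upwards [Metric.ball_mem_nhds x hρ0] with w hw
  have hwr : w ∈ Metric.ball x r := Metric.ball_subset_ball (min_le_right _ _) hw
  obtain ⟨hw1, hw2⟩ := hre w hw
  have hsre : ∀ s ∈ uIcc x.re w.re, |s - x.re| < ρ := fun s hs =>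
    lt_of_le_of_lt (abs_sub_left_of_mem_uIcc hs) hw1
  have hexim : ∀ t ∈ uIcc y₀ w.im, ∃ t' ∈ uIcc y₀ x.im, |t - t'| < ρ := by
    intro t ht
    by_cases h : t ∈ uIcc y₀ x.im
    · exact ⟨t, h, by simpa using hρ0⟩
    · refine ⟨x.im, right_mem_uIcc, ?_⟩
      rw [mem_uIcc] at ht h
      rw [abs_lt] at hw2 ⊢
      constructor <;> grind
  have hbot : ∀ a ∈ J, ∀ b ∈ J, IntervalIntegrable (fun s : ℝ => f (s + y₀ * Complex.I))
      volume a b := fun a ha b hb => by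
    refine ContinuousOn.intervalIntegrable (hfc.comp (by fun_prop) fun s hs => ?_)
    exact hbase s (hJ.uIcc_subset ha hb hs)
  have hxJ := hUJ x hx
  have hwJ : w.re ∈ J := hUJ w (hrU hwr)
  have hc1 : ContinuousOn (fun t : ℝ => f (x.re + t * Complex.I)) (uIcc y₀ w.im) :=
    hfc.comp (by fun_prop) fun t ht => htube _ _ (by simpa using hρ0) (hexim t ht)
  have hc2 : ContinuousOn (fun t : ℝ => f (x.re + t * Complex.I)) (uIcc y₀ x.im) :=
    hfc.comp (by fun_prop) fun t ht => hcol x hx t ht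
  have hballsub : ∀ s t : ℝ, s ∈ uIcc x.re w.re → t ∈ uIcc x.im w.im →
      (s + t * Complex.I : ℂ) ∈ Metric.ball x r := by
    intro s t hs ht
    rw [Metric.mem_ball, dist_eq_norm] at hwr ⊢
    refine lt_of_le_of_lt ?_ hwr
    rw [Complex.norm_eq_sqrt_sq_add_sq, Complex.norm_eq_sqrt_sq_add_sq]
    refine Real.sqrt_le_sqrt ?_
    have e1 := sq_le_sq.mpr (abs_sub_left_of_mem_uIcc hs)
    have e2 := sq_le_sq.mpr (abs_sub_left_of_mem_uIcc ht)
    simpa using add_le_add e1 e2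
  -- Cauchy's theorem on the rectangle between the two columns
  have hrect := Complex.integral_boundary_rect_eq_zero_of_differentiableOn f
    (x.re + y₀ * Complex.I) (w.re + w.im * Complex.I) (hf.mono fun y hy => by
      simp only [Complex.mem_reProdIm] at hy
      simp only [Complex.add_re, Complex.ofReal_re, Complex.mul_re, Complex.I_re, mul_zero,
        Complex.ofReal_im, Complex.I_im, mul_one, sub_self, add_zero, Complex.add_im,
        Complex.mul_im, zero_add] at hy
      rw [← Complex.re_add_im y]
      exact htube _ _ (hsre _ hy.1) (hexim _ hy.2))
  simp only [Complex.add_re, Complex.ofReal_re, Complex.mul_re, Complex.I_re, mul_zero,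
    Complex.ofReal_im, Complex.I_im, mul_one, sub_self, add_zero, Complex.add_im,
    Complex.mul_im, zero_add, smul_eq_mul] at hrect
  have hft1 : ∫ s in x.re..w.re, f (s + w.im * Complex.I) =
      ψ (w.re + w.im * Complex.I) - ψ (x.re + w.im * Complex.I) := by
    have hm : ∀ s ∈ uIcc x.re w.re, (s + w.im * Complex.I : ℂ) ∈ Metric.ball x r :=
      fun s hs => hballsub s w.im hs right_mem_uIcc
    refine intervalIntegral.integral_eq_sub_of_hasDerivAt (f := fun s : ℝ =>
      ψ (s + w.im * Complex.I)) (fun s hs => ?_) ?_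
    · exact hasDerivAt_comp_horizontal (hψ _ (hm s hs))
    · exact ContinuousOn.intervalIntegrable ((hfc.mono hrU).comp (by fun_prop) hm)
  have hft2 : Complex.I * ∫ t in x.im..w.im, f (x.re + t * Complex.I) =
      ψ (x.re + w.im * Complex.I) - ψ (x.re + x.im * Complex.I) := by
    have hm : ∀ t ∈ uIcc x.im w.im, (x.re + t * Complex.I : ℂ) ∈ Metric.ball x r :=
      fun t ht => hballsub x.re t left_mem_uIcc ht
    rw [← intervalIntegral.integral_const_mul]
    refine intervalIntegral.integral_eq_sub_of_hasDerivAt (f := fun t : ℝ =>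
      ψ (x.re + t * Complex.I)) (fun t ht => ?_) ?_
    · exact hasDerivAt_comp_line (hψ _ (hm t ht))
    · exact (ContinuousOn.intervalIntegrable
        ((hfc.mono hrU).comp (by fun_prop) hm)).const_mul _
  have hadd1 := intervalIntegral.integral_add_adjacent_intervals
    (hbot _ (hUJ x₀ hx₀) _ hxJ) (hbot _ hxJ _ hwJ)
  have hadd2 := intervalIntegral.integral_add_adjacent_intervals (hc2.intervalIntegrable (μ := volume))
    (IntervalIntegrable.trans hc2.intervalIntegrable.symm (hc1.intervalIntegrable (μ := volume)))
  rw [Complex.re_add_im] at hft1 hft2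
  rw [← hadd1]
  linear_combination hft1 + hft2 + hrect - Complex.I * hadd2

/-! ### Bounds at infinity and growth of the exponential factor -/

/-- The forcing term `G(x) = μ + ∑ w_p / (x - z_p)` of the Jost equation. The linear system
`A^> v = b^>` says that `e^{-ih/ε} G` with `μ = λ`, `w = v` has vanishing row integrals. -/
def forcing (z : Fin P → ℂ) (μ : ℂ) (w : Fin P → ℂ) (x : ℂ) : ℂ := μ + ∑ p, w p / (x - z p)

/-- The size `|μ| + ∑ |w_p|` of the coefficients of `forcing z μ w`. -/
def forcingNorm (μ : ℂ) (w : Fin P → ℂ) : ℝ := ‖μ‖ + ∑ p, ‖w p‖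

theorem forcingNorm_nonneg (μ : ℂ) (w : Fin P → ℂ) : 0 ≤ forcingNorm μ w := by
  unfold forcingNorm; positivity

theorem norm_le_forcingNorm (μ : ℂ) (w : Fin P → ℂ) : ‖μ‖ ≤ forcingNorm μ w := by
  unfold forcingNorm
  have : 0 ≤ ∑ p, ‖w p‖ := by positivity
  linarith

theorem sum_norm_le_forcingNorm (μ : ℂ) (w : Fin P → ℂ) : ∑ p, ‖w p‖ ≤ forcingNorm μ w := by
  unfold forcingNorm
  linarith [norm_nonneg μ]

theorem one_le_outerRadius (z : Fin P → ℂ) : 1 ≤ outerRadius z := by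
  unfold outerRadius
  have : 0 ≤ ∑ p, ‖z p‖ := by positivity
  linarith

theorem norm_pole_lt_outerRadius (p : Fin P) : ‖z p‖ < outerRadius z := by
  unfold outerRadius
  have := Finset.single_le_sum (f := fun p => ‖z p‖) (fun _ _ => norm_nonneg _) (Finset.mem_univ p)
  linarith

theorem pole_re_im_bounds (p : Fin P) : -outerRadius z < (z p).re ∧ (z p).re < outerRadius z ∧
    (z p).im < outerRadius z ∧ -outerRadius z < (z p).im := by
  have h := norm_pole_lt_outerRadius (z := z) p
  have h1 := abs_le.mp (Complex.abs_re_le_norm (z p))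
  have h2 := abs_le.mp (Complex.abs_im_le_norm (z p))
  exact ⟨by linarith [h1.1], by linarith [h1.2], by linarith [h2.2], by linarith [h2.1]⟩

theorem half_norm_le_norm_sub {x y : ℂ} {R : ℝ} (hy : ‖y‖ < R) (hx : 2 * R ≤ ‖x‖) :
    ‖x‖ / 2 ≤ ‖x - y‖ := by
  have := norm_sub_norm_le x y
  linarith

theorem norm_sum_div_le {ι : Type*} (s : Finset ι) (a y : ι → ℂ) (x : ℂ) {d : ℝ} (hd : 0 < d)
    (h : ∀ i ∈ s, d ≤ ‖x - y i‖) : ‖∑ i ∈ s, a i / (x - y i)‖ ≤ (∑ i ∈ s, ‖a i‖) / d := by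
  refine (norm_sum_le _ _).trans ?_
  rw [Finset.sum_div]
  refine Finset.sum_le_sum fun i hi => ?_
  rw [norm_div]
  gcongr
  exact h i hi

theorem norm_potentialC_le {x : ℂ} (hx : 2 * outerRadius z ≤ ‖x‖) :
    ‖potentialC c z x‖ ≤ 4 * (∑ p, ‖c p‖) / ‖x‖ := by
  have hR := one_le_outerRadius z
  have hx0 : 0 < ‖x‖ / 2 := by linarith
  unfold potentialC
  rw [Finset.sum_add_distrib]
  refine (norm_add_le _ _).trans ?_
  have h1 := norm_sum_div_le Finset.univ c z x hx0 fun p _ =>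
    half_norm_le_norm_sub (norm_pole_lt_outerRadius p) hx
  have h2 := norm_sum_div_le Finset.univ (fun p => conj (c p)) (fun p => conj (z p)) x hx0
    fun p _ => half_norm_le_norm_sub (by simpa using norm_pole_lt_outerRadius (z := z) p) hx
  simp only [RCLike.norm_conj] at h2
  calc _ ≤ _ := add_le_add h1 h2
    _ = _ := by field_simp; ring

theorem norm_sum_poles_le (w : Fin P → ℂ) {x : ℂ} (hx : 2 * outerRadius z ≤ ‖x‖) :
    ‖∑ p, w p / (x - z p)‖ ≤ 2 * (∑ p, ‖w p‖) / ‖x‖ := by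
  have hR := one_le_outerRadius z
  have hx0 : 0 < ‖x‖ / 2 := by linarith
  have h1 := norm_sum_div_le Finset.univ w z x hx0 fun p _ =>
    half_norm_le_norm_sub (norm_pole_lt_outerRadius p) hx
  calc _ ≤ _ := h1
    _ = _ := by field_simp

/-- A radius outside of which `|u₀| ≤ η`. -/
theorem exists_radius_potentialC_le (c z : Fin P → ℂ) {η : ℝ} (hη : 0 < η) :
    ∃ Y : ℝ, 2 * outerRadius z ≤ Y ∧ ∀ x : ℂ, Y ≤ ‖x‖ → ‖potentialC c z x‖ ≤ η := by
  refine ⟨max (2 * outerRadius z) (4 * (∑ p, ‖c p‖) / η), le_max_left _ _, fun x hx => ?_⟩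
  have hx1 := (le_max_left _ _).trans hx
  have hx2 := (le_max_right _ _).trans hx
  have hR := one_le_outerRadius z
  refine (norm_potentialC_le hx1).trans ?_
  rw [div_le_iff₀ hη] at hx2
  rw [div_le_iff₀ (by linarith)]
  linarith

theorem norm_forcing_le (μ : ℂ) (w : Fin P → ℂ) {x : ℂ} {d : ℝ} (hd : 0 < d)
    (h : ∀ p, d ≤ ‖x - z p‖) : ‖forcing z μ w x‖ ≤ (1 + 1 / d) * forcingNorm μ w := by
  unfold forcing
  refine (norm_add_le _ _).trans ?_
  have h1 := norm_sum_div_le Finset.univ w z x hd fun p _ => h p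
  have h2 := norm_le_forcingNorm μ w
  have h3 : (∑ p, ‖w p‖) / d ≤ forcingNorm μ w / d := by
    gcongr; exact sum_norm_le_forcingNorm μ w
  calc _ ≤ forcingNorm μ w + forcingNorm μ w / d := by linarith
    _ = _ := by ring

theorem norm_forcing_le_of_le_norm (μ : ℂ) (w : Fin P → ℂ) {x : ℂ}
    (hx : 2 * outerRadius z ≤ ‖x‖) : ‖forcing z μ w x‖ ≤ 2 * forcingNorm μ w := by
  have := norm_forcing_le (z := z) μ w (x := x) one_pos fun p => by
    have := half_norm_le_norm_sub (norm_pole_lt_outerRadius (z := z) p) hx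
    linarith [one_le_outerRadius z]
  linarith

theorem differentiableAt_forcing (μ : ℂ) (w : Fin P → ℂ) {x : ℂ} (h : ∀ p, x ≠ z p) :
    DifferentiableAt ℂ (forcing z μ w) x := by
  unfold forcing
  refine (differentiableAt_const _).add (DifferentiableAt.fun_sum fun p _ => ?_)
  exact (differentiableAt_const _).div (by fun_prop) (sub_ne_zero.mpr (h p))

theorem differentiableAt_potentialC {x : ℂ} (h : ∀ p, x ≠ z p) (h' : ∀ p, x ≠ conj (z p)) :
    DifferentiableAt ℂ (potentialC c z) x := by
  unfold potentialC
  refine DifferentiableAt.fun_sum fun p _ => ?_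
  have h1 : DifferentiableAt ℂ (fun x => c p / (x - z p)) x :=
    (differentiableAt_const _).div (by fun_prop) (sub_ne_zero.mpr (h p))
  have h2 : DifferentiableAt ℂ (fun x => conj (c p) / (x - conj (z p))) x :=
    (differentiableAt_const _).div (by fun_prop) (sub_ne_zero.mpr (h' p))
  exact h1.add h2

theorem differentiableOn_branchExp_mul_forcing (k : ℕ) (μ : ℂ) (w : Fin P → ℂ) :
    DifferentiableOn ℂ (fun x => branchExp c z lam ε k x * forcing z μ w x) (branchDomain z k) :=
  fun _ hx => ((hasDerivAt_branchExp hx).differentiableAt.mul (differentiableAt_forcing μ w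
    fun p => (ne_pole_of_mem_branchDomain hx p).1)).differentiableWithinAt

/-- Along a segment with `Re (-i h' d) ≥ κ` the modulus of `e^{-ih/ε}` grows at the rate `κ / ε`. -/
theorem norm_branchExp_le_of_re_ge (hε : 0 < ε) {k : ℕ} {a d : ℂ} {s₀ s₁ κ : ℝ} (h01 : s₀ ≤ s₁)
    (hdom : ∀ s ∈ Icc s₀ s₁, a + s * d ∈ branchDomain z k)
    (hκ : ∀ s ∈ Icc s₀ s₁, κ ≤ (-Complex.I * (lam + potentialC c z (a + s * d)) * d).re) :
    ‖branchExp c z lam ε k (a + s₀ * d)‖ ≤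
      ‖branchExp c z lam ε k (a + s₁ * d)‖ * Real.exp (-(κ * (s₁ - s₀) / ε)) := by
  set r : ℝ → ℝ := fun s =>
    (-Complex.I * (lam * (a + s * d) + branchAntideriv c z k (a + s * d)) / ε).re with hr
  have hder : ∀ s ∈ Icc s₀ s₁, HasDerivAt r
      ((-Complex.I * (lam + potentialC c z (a + s * d)) * d).re / ε) s := by
    intro s hs
    have h1 : HasDerivAt (fun x => -Complex.I * (lam * x + branchAntideriv c z k x) / ε)
        (-Complex.I * (lam * 1 + potentialC c z (a + s * d)) / ε) (a + s * d) :=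
      ((((hasDerivAt_id _).const_mul (lam : ℂ)).add
        (hasDerivAt_branchAntideriv (c := c) (hdom s hs))).const_mul (-Complex.I)).div_const _
    have h2 := hasDerivAt_comp_line h1
    have h3 := (Complex.reCLM.hasFDerivAt.comp_hasDerivAt s h2)
    refine h3.congr_deriv ?_
    simp only [Complex.reCLM_apply, mul_one]
    rw [← Complex.div_ofReal_re]
    congr 1
    ring
  have hmv : κ / ε * (s₁ - s₀) ≤ r s₁ - r s₀ := by
    refine (convex_Icc s₀ s₁).mul_sub_le_image_sub_of_le_deriv
      (fun s hs => (hder s hs).continuousAt.continuousWithinAt)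
      (fun s hs => (hder s (interior_subset hs)).differentiableAt.differentiableWithinAt)
      (fun s hs => ?_) s₀ (left_mem_Icc.mpr h01) s₁ (right_mem_Icc.mpr h01) h01
    rw [(hder s (interior_subset hs)).deriv]
    gcongr
    exact hκ s (interior_subset hs)
  have hn : ∀ s : ℝ, ‖branchExp c z lam ε k (a + s * d)‖ = Real.exp (r s) := fun s => by
    rw [branchExp, Complex.norm_exp]
  rw [hn, hn, ← Real.exp_add, Real.exp_le_exp]
  have : κ / ε * (s₁ - s₀) = κ * (s₁ - s₀) / ε := by ring
  linarith

/-- If `Q' = e^{-ih/ε} H` on a vertical ray going down from `a`, on which `Re h' ≥ λ / 2`, and `Q`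
vanishes at the lower end, then `Q` is small with `e^{-ih/ε}`. -/
theorem norm_le_of_tendsto_zero_down (hε : 0 < ε) (hlam : 0 < lam) {k : ℕ} {a : ℂ} {Q H : ℂ → ℂ}
    {B : ℝ} (hdom : ∀ s : ℝ, 0 ≤ s → a - s * Complex.I ∈ branchDomain z k)
    (hσ : ∀ s : ℝ, 0 ≤ s → ‖potentialC c z (a - s * Complex.I)‖ ≤ lam / 2)
    (hQ : ∀ s : ℝ, 0 ≤ s → HasDerivAt Q (branchExp c z lam ε k (a - s * Complex.I) *
      H (a - s * Complex.I)) (a - s * Complex.I))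
    (hH : ∀ s : ℝ, 0 ≤ s → ‖H (a - s * Complex.I)‖ ≤ B)
    (hlim : Tendsto (fun s : ℝ => Q (a - s * Complex.I)) atTop (𝓝 0)) :
    ‖Q a‖ ≤ 2 * ε / lam * B * ‖branchExp c z lam ε k a‖ := by
  have hB : 0 ≤ B := (norm_nonneg _).trans (hH 0 le_rfl)
  set M := ‖branchExp c z lam ε k a‖ with hM
  have e1 : ∀ s : ℝ, a - s * Complex.I = a + s * (-Complex.I) := fun s => by ring
  have hE : ∀ s : ℝ, 0 ≤ s → ‖branchExp c z lam ε k (a - s * Complex.I)‖ ≤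
      M * Real.exp (-(lam / 2 * s / ε)) := by
    intro s hs
    have := norm_branchExp_le_of_re_ge (c := c) (z := z) (lam := lam) hε (k := k) (a := a)
      (d := Complex.I) (s₀ := -s) (s₁ := 0) (κ := lam / 2) (by linarith) (fun t ht => by
        have := hdom (-t) (by linarith [ht.2])
        simpa [sub_eq_add_neg] using this) (fun t ht => by
        have := hσ (-t) (by linarith [ht.2])
        have h2 := (abs_le.mp (Complex.abs_re_le_norm (potentialC c z (a - (-t : ℝ) * Complex.I)))).1
        have h3 : (a - (-t : ℝ) * Complex.I : ℂ) = a + t * Complex.I := by push_cast; ring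
        rw [h3] at h2 this
        simp
        linarith)
    simpa [sub_eq_add_neg, hM] using this
  have key : ∀ T : ℝ, 0 ≤ T → ‖Q (a - T * Complex.I) - Q a‖ ≤ 2 * ε / lam * B * M := by
    intro T hT
    have h := image_norm_le_of_norm_deriv_right_le_deriv_boundary
      (f := fun s : ℝ => Q (a + s * (-Complex.I)) - Q a)
      (f' := fun s : ℝ => -Complex.I * (branchExp c z lam ε k (a - s * Complex.I) *
        H (a - s * Complex.I))) (a := 0) (b := T)
      (B := fun s => 2 * ε / lam * B * M * (1 - Real.exp (-(lam / 2 * s / ε))))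
      (B' := fun s => B * M * Real.exp (-(lam / 2 * s / ε)))
      (fun s hs => by
        have := hQ s hs.1
        rw [e1] at this
        exact ((hasDerivAt_comp_line this).continuousAt.sub continuousAt_const).continuousWithinAt)
      (fun s hs => by
        have := hQ s hs.1
        rw [e1 s] at this ⊢
        exact ((hasDerivAt_comp_line this).sub_const _).hasDerivWithinAt)
      (by simp)
      (fun s => by
        have h1 : HasDerivAt (fun s : ℝ => -(lam / 2 * s / ε)) (-(lam / 2 * 1 / ε)) s :=
          ((((hasDerivAt_id s).const_mul (lam / 2))).div_const ε).neg
        refine ((h1.exp.const_sub 1).const_mul _).congr_deriv ?_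
        field_simp)
      (fun s hs => by
        rw [norm_mul, norm_neg, Complex.norm_I, one_mul, norm_mul]
        calc _ ≤ (M * Real.exp (-(lam / 2 * s / ε))) * B :=
              mul_le_mul (hE s hs.1) (hH s hs.1) (norm_nonneg _) (by positivity)
          _ = _ := by ring)
      (right_mem_Icc.mpr hT)
    rw [← e1] at h
    refine h.trans ?_
    have : 0 ≤ 2 * ε / lam * B * M := by positivity
    nlinarith [Real.exp_pos (-(lam / 2 * T / ε))]
  have hlim2 : Tendsto (fun s : ℝ => ‖Q (a - s * Complex.I) - Q a‖) atTop (𝓝 ‖0 - Q a‖) :=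
    (hlim.sub_const _).norm
  rw [zero_sub, norm_neg] at hlim2
  exact le_of_tendsto hlim2 (by filter_upwards [eventually_ge_atTop 0] with T hT using key T hT)

/-! ### Primitives of `e^{-ih/ε} G` that vanish at `-i∞` -/

theorem isPreconnected_of_vertically_starshaped {U : Set ℂ} (y₀ : ℝ)
    {J : Set ℝ} (hJ : J.OrdConnected) (hUJ : ∀ x ∈ U, x.re ∈ J)
    (hbase : ∀ s ∈ J, (s + y₀ * Complex.I : ℂ) ∈ U)
    (hcol : ∀ x ∈ U, ∀ t ∈ uIcc y₀ x.im, (x.re + t * Complex.I : ℂ) ∈ U) : IsPreconnected U := by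
  rcases U.eq_empty_or_nonempty with rfl | ⟨x₀, hx₀⟩
  · exact isPreconnected_empty
  refine isPreconnected_of_forall (x₀.re + y₀ * Complex.I) fun y hy => ?_
  refine ⟨((fun s : ℝ => (s + y₀ * Complex.I : ℂ)) '' uIcc x₀.re y.re) ∪
    ((fun t : ℝ => (y.re + t * Complex.I : ℂ)) '' uIcc y₀ y.im), ?_, ?_, ?_, ?_⟩
  · rintro _ (⟨s, hs, rfl⟩ | ⟨t, ht, rfl⟩)
    · exact hbase s (hJ.uIcc_subset (hUJ _ hx₀) (hUJ _ hy) hs)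
    · exact hcol y hy t ht
  · exact Or.inl ⟨x₀.re, left_mem_uIcc, rfl⟩
  · exact Or.inr ⟨y.im, right_mem_uIcc, by simp⟩
  · refine IsPreconnected.union (y.re + y₀ * Complex.I) ⟨y.re, right_mem_uIcc, rfl⟩
      ⟨y₀, left_mem_uIcc, rfl⟩ ?_ ?_
    · exact isPreconnected_uIcc.image _ (by fun_prop)
    · exact isPreconnected_uIcc.image _ (by fun_prop)

/-- The domain of the branch `k` to the left of the poles whose upper cuts point upwards; for
`k = 0` the whole cut plane. -/
def leftDomain (z : Fin P → ℂ) (k : ℕ) : Set ℂ :=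
  branchDomain z k ∩ {x | 0 < k → ∀ p : Fin P, k ≤ p.1 → x.re < (z p).re}

theorem isOpen_leftDomain (k : ℕ) : IsOpen (leftDomain z k) := by
  refine (isOpen_branchDomain k).inter ?_
  have : {x : ℂ | 0 < k → ∀ p : Fin P, k ≤ p.1 → x.re < (z p).re} =
      ⋂ p : Fin P, {x : ℂ | 0 < k → k ≤ p.1 → x.re < (z p).re} := by
    ext x; simp only [mem_iInter, mem_ofPred_eq]; tauto
  rw [this]
  refine isOpen_iInter_of_finite fun p => ?_
  by_cases h : 0 < k ∧ k ≤ p.1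
  · simp only [h.1, h.2, forall_const]
    exact isOpen_lt Complex.continuous_re continuous_const
  · convert isOpen_univ
    ext x; simp only [mem_ofPred_eq, mem_univ, iff_true]; tauto

theorem re_add_mul_I (s t : ℝ) : (s + t * Complex.I : ℂ).re = s := by simp

theorem im_add_mul_I (s t : ℝ) : (s + t * Complex.I : ℂ).im = t := by simp

/-- The height of a horizontal line contained in `leftDomain z k`. -/
def baseHeight (z : Fin P → ℂ) (k : ℕ) : ℝ := if k = 0 then 0 else outerRadius z

theorem leftDomain_starshaped (hz : ∀ p, 0 < (z p).im) (k : ℕ) :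
    (∀ x ∈ leftDomain z k, x.re ∈ {s : ℝ | 0 < k → ∀ p : Fin P, k ≤ p.1 → s < (z p).re}) ∧
    (∀ s ∈ {s : ℝ | 0 < k → ∀ p : Fin P, k ≤ p.1 → s < (z p).re},
      (s + baseHeight z k * Complex.I : ℂ) ∈ leftDomain z k) ∧
    (∀ x ∈ leftDomain z k, ∀ t ∈ uIcc (baseHeight z k) x.im,
      (x.re + t * Complex.I : ℂ) ∈ leftDomain z k) := by
  refine ⟨fun x hx => hx.2, fun s hs => ⟨?_, ?_⟩, fun x hx t ht => ⟨?_, ?_⟩⟩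
  · rw [mem_branchDomain_iff]
    intro p
    rw [re_add_mul_I, im_add_mul_I]
    have h1 := hz p
    have h2 := (pole_re_im_bounds (z := z) p).2.2.1
    unfold baseHeight
    refine ⟨fun h => ⟨fun h3 => ?_, fun h3 => ?_⟩, fun h => ?_⟩
    · rw [if_neg (by omega)]; exact h2
    · split_ifs with h4
      · exact h1
      · have := hs (by omega) p h3
        linarith
    · split_ifs <;> linarith
  · simpa using hs
  · have h0 := mem_branchDomain_iff.mp hx.1
    rw [mem_branchDomain_iff]
    intro p
    have h0 := h0 p
    have h1 := hz p
    have h2 := (pole_re_im_bounds (z := z) p).2.2.1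
    rw [re_add_mul_I, im_add_mul_I]
    have h5 := hx.2
    simp only [mem_ofPred_eq] at h5
    rw [baseHeight, mem_uIcc] at ht
    refine ⟨fun h => ⟨fun h3 => ?_, fun h3 => ?_⟩, fun h => ?_⟩
    · have := (h0.1 h).1 h3
      rw [if_neg (by omega)] at ht
      rcases ht with ht | ht <;> linarith
    · split_ifs at ht with h4
      · have := (h0.1 h).2 h3
        rcases ht with ht | ht <;> linarith
      · have := h5 (by omega) p h3
        linarith
    · have h6 := h0.2 h
      split_ifs at ht with h4
      · rcases ht with ht | ht <;> linarith
      · rcases ht with ht | ht <;> linarith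
  · have := hx.2
    simpa using this

theorem ordConnected_leftRe (k : ℕ) :
    {s : ℝ | 0 < k → ∀ p : Fin P, k ≤ p.1 → s < (z p).re}.OrdConnected :=
  ⟨fun _ _ _ hb _ hx hk p hp => lt_of_le_of_lt hx.2 (hb hk p hp)⟩

theorem mem_leftDomain_of_re_lt {k : ℕ} {x : ℂ} (h : ∀ p, x.re < (z p).re) :
    x ∈ leftDomain z k := by
  refine ⟨mem_branchDomain_iff.mpr fun p => ?_, fun _ p _ => h p⟩
  exact ⟨fun h' => absurd h' (h p).ne, fun h' => absurd h' (h p).ne⟩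

theorem mem_branchDomain_of_re_ne {k : ℕ} {x : ℂ} (h : ∀ p, x.re ≠ (z p).re) :
    x ∈ branchDomain z k :=
  mem_branchDomain_iff.mpr fun p => ⟨fun h' => absurd h' (h p), fun h' => absurd h' (h p)⟩

/-- `Φ` is the primitive of `e^{-ih/ε} G` on `leftDomain z k` which vanishes at `-i∞` on the left. -/
structure IsBranchPrimitive (c z : Fin P → ℂ) (lam ε : ℝ) (k : ℕ) (μ : ℂ) (w : Fin P → ℂ)
    (Φ : ℂ → ℂ) : Prop where
  hasDerivAt : ∀ x ∈ leftDomain z k,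
    HasDerivAt Φ (branchExp c z lam ε k x * forcing z μ w x) x
  bottom : Tendsto (fun t : ℝ => Φ (-(outerRadius z : ℂ) + t * Complex.I)) atBot (𝓝 0)

theorem norm_branchExp_tail (hε : 0 < ε) {k : ℕ} {x Y : ℝ}
    (hY : ∀ y : ℂ, Y ≤ ‖y‖ → ‖potentialC c z y‖ ≤ lam / 2)
    {t₀ : ℝ} (ht₀ : t₀ ≤ -Y) (hY0 : 0 ≤ Y)
    (hdom : ∀ t : ℝ, t ≤ t₀ → (x + t * Complex.I : ℂ) ∈ branchDomain z k) {t : ℝ} (ht : t ≤ t₀) :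
    ‖branchExp c z lam ε k (x + t * Complex.I)‖ ≤
      ‖branchExp c z lam ε k (x + t₀ * Complex.I)‖ *
        Real.exp (-(lam / 2 * (t₀ - t) / ε)) := by
  refine norm_branchExp_le_of_re_ge hε ht (fun s hs => hdom s hs.2) fun s hs => ?_
  have h1 : Y ≤ ‖(x + s * Complex.I : ℂ)‖ := by
    refine le_trans ?_ (Complex.abs_im_le_norm _)
    rw [im_add_mul_I, abs_of_nonpos (by linarith [hs.2])]
    linarith [hs.2]
  have h2 := (abs_le.mp (Complex.abs_re_le_norm (potentialC c z (x + s * Complex.I)))).1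
  have h3 := hY _ h1
  simp
  linarith

theorem integrableOn_branchExp_mul (hε : 0 < ε) (hlam : 0 < lam) {k : ℕ} {x a : ℝ}
    (hdom : ∀ t : ℝ, t ≤ a → (x + t * Complex.I : ℂ) ∈ branchDomain z k) (μ : ℂ) (w : Fin P → ℂ) :
    IntegrableOn (fun t : ℝ => Complex.I * (branchExp c z lam ε k (x + t * Complex.I) *
      forcing z μ w (x + t * Complex.I))) (Iic a) := by
  obtain ⟨Y, hYR, hY⟩ := exists_radius_potentialC_le c z (η := lam / 2) (by positivity)
  have hY0 : 0 ≤ Y := by linarith [one_le_outerRadius z]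
  have hcont : ContinuousOn (fun t : ℝ => Complex.I * (branchExp c z lam ε k (x + t * Complex.I) *
      forcing z μ w (x + t * Complex.I))) (Iic a) := by
    refine continuousOn_const.mul ((differentiableOn_branchExp_mul_forcing k μ w).continuousOn.comp
      (by fun_prop) fun t ht => hdom t ht)
  set t₀ := min a (-Y) with ht₀
  have hunion : Iic a = Iic t₀ ∪ Icc t₀ a := by
    rw [Iic_union_Icc_eq_Iic (min_le_left _ _)]
  rw [hunion]
  refine IntegrableOn.union ?_ ((hcont.mono Icc_subset_Iic_self).integrableOn_Icc)
  set M := ‖branchExp c z lam ε k (x + t₀ * Complex.I)‖ with hM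
  have hint : IntegrableOn (fun t : ℝ => M * (2 * forcingNorm μ w) *
      Real.exp (-(lam / 2 * t₀ / ε)) * Real.exp (lam / (2 * ε) * t)) (Iic t₀) :=
    (integrableOn_exp_mul_Iic (by positivity) _).const_mul _
  refine Integrable.mono' hint
    ((hcont.mono (Iic_subset_Iic.mpr (min_le_left _ _))).aestronglyMeasurable measurableSet_Iic) ?_
  filter_upwards [ae_restrict_mem measurableSet_Iic] with t ht
  have h1 := norm_branchExp_tail hε hY (min_le_right a (-Y)) hY0
    (fun t ht => hdom t (ht.trans (min_le_left _ _))) (mem_Iic.mp ht) (c := c)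
  have h2 : ‖forcing z μ w (x + t * Complex.I)‖ ≤ 2 * forcingNorm μ w := by
    refine norm_forcing_le_of_le_norm μ w (hYR.trans ?_)
    refine le_trans ?_ (Complex.abs_im_le_norm _)
    have h3 : t ≤ -Y := (mem_Iic.mp ht).trans (min_le_right _ _)
    rw [im_add_mul_I, abs_of_nonpos (by linarith)]
    linarith
  rw [norm_mul, Complex.norm_I, one_mul, norm_mul]
  calc _ ≤ (M * Real.exp (-(lam / 2 * (t₀ - t) / ε))) * (2 * forcingNorm μ w) :=
        mul_le_mul h1 h2 (norm_nonneg _) (by positivity)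
    _ = M * (2 * forcingNorm μ w) * (Real.exp (-(lam / 2 * t₀ / ε)) *
        Real.exp (lam / (2 * ε) * t)) := by
      rw [← Real.exp_add]
      have : -(lam / 2 * (t₀ - t) / ε) = -(lam / 2 * t₀ / ε) + lam / (2 * ε) * t := by
        field_simp; ring
      rw [this]; ring
    _ = _ := by ring

theorem column_eq (t : ℝ) : (-(outerRadius z : ℂ) + t * Complex.I) =
    ((-outerRadius z : ℝ) : ℂ) + t * Complex.I := by push_cast; ring

theorem column_mem_leftDomain (k : ℕ) (t : ℝ) :
    (-(outerRadius z : ℂ) + t * Complex.I) ∈ leftDomain z k := by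
  refine mem_leftDomain_of_re_lt fun p => ?_
  rw [column_eq, re_add_mul_I]
  exact (pole_re_im_bounds p).1

theorem exists_isBranchPrimitive (hε : 0 < ε) (hlam : 0 < lam) (hz : ∀ p, 0 < (z p).im) (k : ℕ)
    (μ : ℂ) (w : Fin P → ℂ) : ∃ Φ, IsBranchPrimitive c z lam ε k μ w Φ := by
  have h := leftDomain_starshaped hz k
  obtain ⟨Φ, hΦ⟩ := exists_primitive_of_vertically_starshaped (isOpen_leftDomain k) _
    (ordConnected_leftRe k) h.1 h.2.1 h.2.2
    ((differentiableOn_branchExp_mul_forcing (c := c) (lam := lam) (ε := ε) k μ w).mono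
      inter_subset_left)
  have hlim := tendsto_limUnder_of_hasDerivAt_of_integrableOn_Iic (a := 0)
    (f := fun t : ℝ => Φ (((-outerRadius z : ℝ) : ℂ) + t * Complex.I))
    (fun t _ => hasDerivAt_comp_line (hΦ _ (column_eq (z := z) t ▸ column_mem_leftDomain k t)))
    (integrableOn_branchExp_mul hε hlam
      (fun t _ => (column_eq (z := z) t ▸ column_mem_leftDomain k t).1) μ w)
  refine ⟨fun x => Φ x - limUnder atBot
    (fun t : ℝ => Φ (((-outerRadius z : ℝ) : ℂ) + t * Complex.I)),
    fun x hx => (hΦ x hx).sub_const _, ?_⟩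
  simp only [column_eq]
  have h2 := hlim.sub_const
    (limUnder atBot (fun t : ℝ => Φ (((-outerRadius z : ℝ) : ℂ) + t * Complex.I)))
  rwa [sub_self] at h2

/-- A primitive that vanishes at the lower end of one column does so on the neighbouring ones. -/
theorem tendsto_zero_column (hε : 0 < ε) (hlam : 0 < lam) {k : ℕ} {μ : ℂ} {w : Fin P → ℂ}
    {Φ : ℂ → ℂ} {x₀ x₁ : ℝ}
    (hdom : ∀ s ∈ uIcc x₀ x₁, ∀ t : ℝ, (s + t * Complex.I : ℂ) ∈ branchDomain z k)
    (hΦ : ∀ s ∈ uIcc x₀ x₁, ∀ t : ℝ, HasDerivAt Φ (branchExp c z lam ε k (s + t * Complex.I) *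
      forcing z μ w (s + t * Complex.I)) (s + t * Complex.I))
    (h0 : Tendsto (fun t : ℝ => Φ (x₀ + t * Complex.I)) atBot (𝓝 0)) :
    Tendsto (fun t : ℝ => Φ (x₁ + t * Complex.I)) atBot (𝓝 0) := by
  obtain ⟨Y, hYR, hY⟩ := exists_radius_potentialC_le c z (η := lam / 2) (by positivity)
  have hY0 : 0 ≤ Y := by linarith [one_le_outerRadius z]
  have hcont : ContinuousOn (fun s : ℝ => ‖branchExp c z lam ε k (s + (-Y : ℝ) * Complex.I)‖)
      (uIcc x₀ x₁) := by
    refine ContinuousOn.norm fun s hs => ?_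
    exact ((hasDerivAt_comp_horizontal
      (hasDerivAt_branchExp (hdom s hs (-Y)))).continuousAt).continuousWithinAt
  obtain ⟨M, hM⟩ := (isCompact_uIcc (a := x₀) (b := x₁)).bddAbove_image hcont
  have hM' : ∀ s ∈ uIcc x₀ x₁, ‖branchExp c z lam ε k (s + (-Y : ℝ) * Complex.I)‖ ≤ M :=
    fun s hs => hM ⟨s, hs, rfl⟩
  have hdiff : ∀ᶠ t : ℝ in atBot, ‖Φ (x₁ + t * Complex.I) - Φ (x₀ + t * Complex.I)‖ ≤
      M * Real.exp (-(lam / 2 * (-Y - t) / ε)) * (2 * forcingNorm μ w) * |x₁ - x₀| := by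
    filter_upwards [eventually_le_atBot (-Y)] with t ht
    have := (convex_uIcc x₀ x₁).norm_image_sub_le_of_norm_hasDerivWithin_le
      (f := fun s : ℝ => Φ (s + t * Complex.I))
      (f' := fun s : ℝ => branchExp c z lam ε k (s + t * Complex.I) *
        forcing z μ w (s + t * Complex.I))
      (C := M * Real.exp (-(lam / 2 * (-Y - t) / ε)) * (2 * forcingNorm μ w))
      (fun s hs => (hasDerivAt_comp_horizontal (hΦ s hs t)).hasDerivWithinAt) (fun s hs => ?_)
      left_mem_uIcc right_mem_uIcc
    · simpa using this
    · rw [norm_mul]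
      have h1 := norm_branchExp_tail hε hY le_rfl hY0 (fun t _ => hdom s hs t) ht (c := c)
      have h2 : ‖forcing z μ w (s + t * Complex.I)‖ ≤ 2 * forcingNorm μ w := by
        refine norm_forcing_le_of_le_norm μ w (hYR.trans ?_)
        refine le_trans ?_ (Complex.abs_im_le_norm _)
        rw [im_add_mul_I, abs_of_nonpos (by linarith)]
        linarith
      have h3 := hM' s hs
      refine mul_le_mul (h1.trans ?_) h2 (norm_nonneg _) ?_
      · gcongr
      · have := (norm_nonneg _).trans h3
        positivity
  have hexp : Tendsto (fun t : ℝ => M * Real.exp (-(lam / 2 * (-Y - t) / ε)) *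
      (2 * forcingNorm μ w) * |x₁ - x₀|) atBot (𝓝 0) := by
    have h1 : Tendsto (fun t : ℝ => -(lam / 2 * (-Y - t) / ε)) atBot atBot := by
      have h2 : (fun t : ℝ => -(lam / 2 * (-Y - t) / ε)) =
          fun t => lam / (2 * ε) * t + lam / 2 * Y / ε := by
        ext t; field_simp; ring
      rw [h2]
      exact tendsto_atBot_add_const_right _ _ (tendsto_id.const_mul_atBot (by positivity))
    have h3 := ((Real.tendsto_exp_atBot.comp h1).const_mul M).mul_const
      (2 * forcingNorm μ w) |>.mul_const |x₁ - x₀|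
    simpa using h3
  have h4 := (squeeze_zero_norm' hdiff hexp).add h0
  simpa using h4

/-! ### The row integrals in terms of primitives -/

theorem rightAbscissa_bounds (hmono : StrictMono fun p => (z p).re) (m : Fin P) :
    -outerRadius z < rightAbscissa z m ∧ (∀ p : Fin P, p.1 < m.1 + 1 → (z p).re < rightAbscissa z m) ∧
      ∀ p : Fin P, m.1 + 1 ≤ p.1 → rightAbscissa z m < (z p).re := by
  unfold rightAbscissa
  have hm := pole_re_im_bounds (z := z) m
  split_ifs with h
  · have h1 : (z m).re < (z ⟨m.1 + 1, h⟩).re := hmono (by simp [Fin.lt_def])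
    refine ⟨by linarith [hm.1], fun p hp => ?_, fun p hp => ?_⟩
    · have : (z p).re ≤ (z m).re := hmono.monotone (by rw [Fin.le_def]; omega)
      linarith
    · have : (z ⟨m.1 + 1, h⟩).re ≤ (z p).re := hmono.monotone (by rw [Fin.le_def]; exact hp)
      linarith
  · refine ⟨by linarith [hm.1, hm.2.1], fun p _ => (pole_re_im_bounds p).2.1, fun p hp => ?_⟩
    have := p.2
    omega

theorem real_mem_leftDomain (hz : ∀ p, 0 < (z p).im) (s : ℝ) : (s : ℂ) ∈ leftDomain z 0 := by
  have := (leftDomain_starshaped hz 0).2.1 s (by simp)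
  simpa [baseHeight] using this

theorem topLine_mem_leftDomain (hz : ∀ p, 0 < (z p).im) {k : ℕ} (hk : 0 < k) {s : ℝ}
    (hs : ∀ p : Fin P, k ≤ p.1 → s < (z p).re) :
    (s + outerRadius z * Complex.I : ℂ) ∈ leftDomain z k := by
  have := (leftDomain_starshaped hz k).2.1 s (fun _ => hs)
  rw [baseHeight, if_neg (by omega)] at this
  exact this

theorem integral_column (hε : 0 < ε) (hlam : 0 < lam) {k : ℕ} {μ : ℂ} {w : Fin P → ℂ} {Φ : ℂ → ℂ}
    (hΦ : IsBranchPrimitive c z lam ε k μ w Φ) (a : ℝ) :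
    ∫ t in Iic a, branchExp c z lam ε k (-(outerRadius z : ℂ) + t * Complex.I) *
      forcing z μ w (-(outerRadius z : ℂ) + t * Complex.I) * Complex.I =
      Φ (-(outerRadius z : ℂ) + a * Complex.I) := by
  have h := integral_Iic_of_hasDerivAt_of_tendsto' (a := a)
    (f := fun t : ℝ => Φ (-(outerRadius z : ℂ) + t * Complex.I))
    (fun t _ => hasDerivAt_comp_line (hΦ.hasDerivAt _ (column_mem_leftDomain k t))) (by
      simp only [column_eq]
      exact integrableOn_branchExp_mul hε hlam
        (fun t _ => (column_eq (z := z) t ▸ column_mem_leftDomain k t).1) μ w) hΦ.bottom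
  rw [sub_zero] at h
  rw [← h]
  congr 1
  ext t
  ring

theorem IsBranchPrimitive.continuousOn_integrand {k : ℕ} {μ : ℂ} {w : Fin P → ℂ} :
    ContinuousOn (fun x => branchExp c z lam ε k x * forcing z μ w x) (leftDomain z k) :=
  (differentiableOn_branchExp_mul_forcing k μ w).continuousOn.mono inter_subset_left

theorem IsBranchPrimitive.integral_horizontal {k : ℕ} {μ : ℂ} {w : Fin P → ℂ} {Φ : ℂ → ℂ}
    (hΦ : IsBranchPrimitive c z lam ε k μ w Φ) {a b : ℝ} {y : ℂ}
    (h : ∀ s ∈ uIcc a b, (s + y : ℂ) ∈ leftDomain z k) :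
    ∫ s in a..b, branchExp c z lam ε k (s + y) * forcing z μ w (s + y) = Φ (b + y) - Φ (a + y) :=
  intervalIntegral.integral_eq_sub_of_hasDerivAt (f := fun s : ℝ => Φ (s + y))
    (fun s hs => hasDerivAt_comp_horizontal (hΦ.hasDerivAt _ (h s hs)))
    ((IsBranchPrimitive.continuousOn_integrand.comp (by fun_prop) h).intervalIntegrable)

theorem IsBranchPrimitive.integral_vertical {k : ℕ} {μ : ℂ} {w : Fin P → ℂ} {Φ : ℂ → ℂ}
    (hΦ : IsBranchPrimitive c z lam ε k μ w Φ) {a b : ℝ} {x : ℂ}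
    (h : ∀ t ∈ uIcc a b, (x + t * Complex.I : ℂ) ∈ leftDomain z k) :
    ∫ t in a..b, branchExp c z lam ε k (x + t * Complex.I) * forcing z μ w (x + t * Complex.I) *
      Complex.I = Φ (x + b * Complex.I) - Φ (x + a * Complex.I) := by
  have := intervalIntegral.integral_eq_sub_of_hasDerivAt
    (f := fun t : ℝ => Φ (x + t * Complex.I))
    (fun t ht => hasDerivAt_comp_line (hΦ.hasDerivAt _ (h t ht)))
    (((IsBranchPrimitive.continuousOn_integrand.comp (by fun_prop) h).intervalIntegrable).const_mul
      Complex.I)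
  rw [← this]
  congr 1
  ext t
  ring

theorem loopIntegral_forcing (hε : 0 < ε) (hlam : 0 < lam) (hz : ∀ p, 0 < (z p).im)
    (hmono : StrictMono fun p => (z p).re) (m : Fin P) {μ : ℂ} {w : Fin P → ℂ} {Φ Φc : ℂ → ℂ}
    (hΦ : IsBranchPrimitive c z lam ε 0 μ w Φ)
    (hΦc : IsBranchPrimitive c z lam ε (m.1 + 1) μ w Φc) :
    loopIntegral c z lam ε m (forcing z μ w) =
      Φ (rightAbscissa z m + outerRadius z * Complex.I) -
        Φc (rightAbscissa z m + outerRadius z * Complex.I) := by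
  obtain ⟨hb0, hb1, hb2⟩ := rightAbscissa_bounds hmono m
  have hR := one_le_outerRadius z
  unfold loopIntegral
  simp only [expFactor_eq_branchExp, expFactorCont_eq_branchExp]
  rw [integral_column hε hlam hΦ, integral_column hε hlam hΦc]
  have h1 := hΦ.integral_horizontal (a := -outerRadius z) (b := rightAbscissa z m) (y := 0)
    (fun s _ => by simpa using real_mem_leftDomain hz s)
  have h2 := hΦ.integral_vertical (a := 0) (b := outerRadius z) (x := rightAbscissa z m)
    (fun t _ => ⟨mem_branchDomain_of_re_ne fun p => by
      rw [re_add_mul_I]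
      rcases lt_or_ge p.1 (m.1 + 1) with h | h
      · exact (hb1 p h).ne'
      · exact (hb2 p h).ne, by simp⟩)
  have h3 := hΦc.integral_horizontal (a := -outerRadius z) (b := rightAbscissa z m)
    (y := outerRadius z * Complex.I) (fun s hs => topLine_mem_leftDomain hz (by omega) fun p hp => by
      rw [uIcc_of_le hb0.le] at hs
      exact lt_of_le_of_lt hs.2 (hb2 p hp))
  simp only [add_zero] at h1
  rw [h1, h2, h3]
  simp
  ring

/-- The endpoint integral, given the limit of the primitive at the endpoint `z_m`. -/
theorem endpointIntegral_forcing (hε : 0 < ε) (hlam : 0 < lam) (hz : ∀ p, 0 < (z p).im)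
    (hmono : StrictMono fun p => (z p).re) (m : Fin P) {μ : ℂ} {w : Fin P → ℂ} {Φ : ℂ → ℂ} {L : ℂ}
    (hΦ : IsBranchPrimitive c z lam ε 0 μ w Φ)
    (hint : IntervalIntegrable (fun t : ℝ => branchExp c z lam ε 0 ((z m).re + t * Complex.I) *
      forcing z μ w ((z m).re + t * Complex.I)) volume 0 (z m).im)
    (hL : Tendsto (fun t : ℝ => Φ ((z m).re + t * Complex.I)) (𝓝[<] (z m).im) (𝓝 L)) :
    endpointIntegral c z lam ε m (forcing z μ w) = L := by
  unfold endpointIntegral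
  simp only [expFactor_eq_branchExp]
  rw [integral_column hε hlam hΦ]
  have h1 := hΦ.integral_horizontal (a := -outerRadius z) (b := (z m).re) (y := 0)
    (fun s _ => by simpa using real_mem_leftDomain hz s)
  have hdom : ∀ t : ℝ, 0 ≤ t → t < (z m).im →
      ((z m).re + t * Complex.I : ℂ) ∈ leftDomain z 0 := fun t ht0 ht => by
    refine ⟨mem_branchDomain_iff.mpr fun p => ?_, by simp⟩
    rw [re_add_mul_I, im_add_mul_I]
    refine ⟨fun h => ?_, fun _ => by linarith [hz p]⟩
    have : m = p := hmono.injective h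
    subst this
    simp [ht]
  have h2 := intervalIntegral.integral_eq_sub_of_hasDerivAt_of_tendsto (a := 0) (b := (z m).im)
    (f := fun t : ℝ => Φ ((z m).re + t * Complex.I)) (hz m)
    (fun t ht => hasDerivAt_comp_line (hΦ.hasDerivAt _ (hdom t ht.1.le ht.2)))
    (hint.const_mul Complex.I) (fa := Φ (z m).re) (fb := L) (by
      have := (hasDerivAt_comp_line (hΦ.hasDerivAt _ (hdom 0 le_rfl (hz m)))).continuousAt
      have h3 := this.tendsto
      simp only [Complex.ofReal_zero, zero_mul, add_zero] at h3
      exact h3.mono_left nhdsWithin_le_nhds) hL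
  simp only [add_zero] at h1
  have h3 : (∫ t in (0 : ℝ)..(z m).im, branchExp c z lam ε 0 ((z m).re + t * Complex.I) *
      forcing z μ w ((z m).re + t * Complex.I) * Complex.I) = L - Φ (z m).re := by
    rw [← h2]
    congr 1
    ext t
    ring
  rw [h1, h3]
  simp

/-! ### Continuation across the upper branch cuts -/

theorem sub_eq_sub_of_hasDerivAt {U : Set ℂ} (hU : IsOpen U) (hU' : IsPreconnected U)
    {f g f' : ℂ → ℂ} (hf : ∀ x ∈ U, HasDerivAt f (f' x) x) (hg : ∀ x ∈ U, HasDerivAt g (f' x) x)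
    {x y : ℂ} (hx : x ∈ U) (hy : y ∈ U) : f x - g x = f y - g y := by
  have h : ∀ x ∈ U, HasDerivAt (fun x => f x - g x) 0 x := fun x hx => by
    have := (hf x hx).fun_sub (hg x hx)
    rwa [sub_self] at this
  exact hU.is_const_of_deriv_eq_zero hU'
    (fun x hx => (h x hx).differentiableAt.differentiableWithinAt) (fun x hx => (h x hx).deriv) hx hy

theorem isPreconnected_branchDomain_inter_left (hz : ∀ p, 0 < (z p).im) {k : ℕ} {ρ : ℝ}
    (hρ : ∀ p : Fin P, k ≤ p.1 → ρ ≤ (z p).re) :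
    IsPreconnected (branchDomain z k ∩ {x | x.re < ρ}) := by
  refine isPreconnected_of_vertically_starshaped (outerRadius z) (J := Iio ρ) ordConnected_Iio
    (fun x hx => hx.2) (fun s hs => ⟨?_, by simpa using hs⟩) fun x hx t ht => ⟨?_, ?_⟩
  · rw [mem_branchDomain_iff]
    intro p
    rw [re_add_mul_I, im_add_mul_I]
    have h1 := hz p
    have h2 := (pole_re_im_bounds (z := z) p).2.2.1
    refine ⟨fun h => ⟨fun _ => h2, fun h3 => ?_⟩, fun _ => by linarith⟩
    have := hρ p h3
    have := mem_Iio.mp hs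
    linarith
  · have h0 := mem_branchDomain_iff.mp hx.1
    rw [mem_branchDomain_iff]
    intro p
    have h0 := h0 p
    have h1 := hz p
    have h2 := (pole_re_im_bounds (z := z) p).2.2.1
    rw [re_add_mul_I, im_add_mul_I]
    rw [mem_uIcc] at ht
    refine ⟨fun h => ⟨fun h3 => ?_, fun h3 => ?_⟩, fun h => ?_⟩
    · have := (h0.1 h).1 h3
      rcases ht with ht | ht <;> linarith
    · have := hρ p h3
      have := hx.2
      simp only [mem_ofPred_eq] at this
      linarith
    · have h6 := h0.2 h
      rcases ht with ht | ht <;> linarith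
  · have := hx.2
    simpa using this

/-- The ball of radius `r` around `z_p` lies in the upper half-plane and meets no branch cut except
those of `z_p`. -/
def IsIsolating (z : Fin P → ℂ) (p : Fin P) (r : ℝ) : Prop :=
  ∀ x ∈ Metric.ball (z p) r, 0 < x.im ∧
    ∀ q, q ≠ p → (x.re < (z q).re ↔ (z p).re < (z q).re) ∧ x.re ≠ (z q).re

theorem exists_isolating_radius (hz : ∀ p, 0 < (z p).im) (hmono : StrictMono fun p => (z p).re)
    (p : Fin P) : ∃ r : ℝ, 0 < r ∧ IsIsolating z p r := by
  have hev : ∀ᶠ x in 𝓝 (z p), 0 < x.im ∧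
      ∀ q, q ≠ p → (x.re < (z q).re ↔ (z p).re < (z q).re) ∧ x.re ≠ (z q).re := by
    refine (Complex.continuous_im.continuousAt.eventually (lt_mem_nhds (hz p))).and ?_
    rw [eventually_all]
    intro q
    by_cases hq : q = p
    · simp [hq]
    · have hne : (z p).re ≠ (z q).re := fun h => hq (hmono.injective h.symm)
      rcases lt_or_gt_of_ne hne with h | h
      · filter_upwards [Complex.continuous_re.continuousAt.eventually (gt_mem_nhds h)] with x hx _
        exact ⟨⟨fun _ => h, fun _ => hx⟩, hx.ne⟩
      · filter_upwards [Complex.continuous_re.continuousAt.eventually (lt_mem_nhds h)] with x hx _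
        exact ⟨⟨fun h' => absurd h' (not_lt.mpr hx.le), fun h' => absurd h' (not_lt.mpr h.le)⟩,
          hx.ne'⟩
  exact Metric.eventually_nhds_iff_ball.mp hev

/-- If `i c_p / ε = -n`, then near `z_p` the factor `e^{-ih/ε}` is `(x - z_p)^n` times a
nonvanishing holomorphic function. -/
theorem exists_local_factorization (hz : ∀ p, 0 < (z p).im)
    (p : Fin P) {n : ℕ} (hn : Complex.I * c p / ε = -(n : ℂ))
    {r : ℝ} (hr : IsIsolating z p r) :
    ∃ g : ℂ → ℂ, DifferentiableOn ℂ g (Metric.ball (z p) r) ∧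
      (∀ x ∈ Metric.ball (z p) r, g x ≠ 0) ∧
      ∀ x, x ≠ z p → branchExp c z lam ε 0 x = (Complex.I * (x - z p)) ^ n * g x := by
  classical
  set φ : ℂ → ℂ := fun x => (∑ q, (c q * ((if q = p then 0 else Complex.log (Complex.I * (x - z q)))
      + Real.pi * Complex.I / 2) +
    conj (c q) * (Complex.log (-Complex.I * (x - conj (z q))) - Real.pi * Complex.I / 2))) with hφ
  refine ⟨fun x => Complex.exp (-Complex.I * (lam * x + φ x) / ε), ?_,
    fun x _ => Complex.exp_ne_zero _, fun x hx => ?_⟩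
  · have hφd : ∀ x ∈ Metric.ball (z p) r, DifferentiableAt ℂ φ x := by
      intro x hx
      obtain ⟨h1, h2⟩ := hr x hx
      rw [hφ]
      refine DifferentiableAt.fun_sum fun q _ => ?_
      have hl : DifferentiableAt ℂ (fun x => Complex.log (-Complex.I * (x - conj (z q)))) x := by
        refine DifferentiableAt.clog (by fun_prop) ?_
        rw [Complex.mem_slitPlane_iff]
        left
        have := hz q
        simp
        linarith
      have hu : DifferentiableAt ℂ (fun x => if q = p then 0 else
          Complex.log (Complex.I * (x - z q))) x := by
        by_cases hq : q = p
        · simp [hq]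
        · simp only [hq, if_false]
          refine DifferentiableAt.clog (by fun_prop) ?_
          rw [Complex.mem_slitPlane_iff]
          right
          have := (h2 q hq).2
          simpa [sub_eq_zero] using this
      exact ((hu.add_const _).const_mul _).add ((hl.sub_const _).const_mul _)
    intro x hx
    have := hφd x hx
    exact (DifferentiableAt.cexp (by fun_prop)).differentiableWithinAt
  · have hsum : branchAntideriv c z 0 x = c p * Complex.log (Complex.I * (x - z p)) + φ x := by
      rw [← sub_eq_iff_eq_add, branchAntideriv, hφ, ← Finset.sum_sub_distrib,
        Finset.sum_eq_single p]
      · simp; ring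
      · intro q _ hq
        simp [hq]
      · simp
    have hne : Complex.I * (x - z p) ≠ 0 := mul_ne_zero Complex.I_ne_zero (sub_ne_zero.mpr hx)
    have hpow : (Complex.I * (x - z p)) ^ n =
        Complex.exp (n * Complex.log (Complex.I * (x - z p))) := by
      rw [Complex.exp_nat_mul, Complex.exp_log hne]
    rw [hpow, ← Complex.exp_add, branchExp, hsum]
    congr 1
    linear_combination -Complex.log (Complex.I * (x - z p)) * hn

/-- In the situation of `exists_local_factorization`, `e^{-ih/ε} G` is holomorphic at `z_p`. -/
theorem exists_local_integrand (hz : ∀ p, 0 < (z p).im) (p : Fin P) {n : ℕ} (hn0 : 0 < n)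
    (hn : Complex.I * c p / ε = -(n : ℂ)) (μ : ℂ) (w : Fin P → ℂ)
    {r : ℝ} (hr : IsIsolating z p r) :
    ∃ F : ℂ → ℂ, DifferentiableOn ℂ F (Metric.ball (z p) r) ∧
      ∀ x, x ≠ z p → branchExp c z lam ε 0 x * forcing z μ w x = F x := by
  classical
  obtain ⟨g, hg, -, hg2⟩ := exists_local_factorization (lam := lam) hz p hn hr
  refine ⟨fun x => Complex.I ^ n * (x - z p) ^ (n - 1) * g x *
    ((x - z p) * (μ + ∑ q ∈ Finset.univ.erase p, w q / (x - z q)) + w p), ?_, fun x hx => ?_⟩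
  · have h1 : DifferentiableOn ℂ (fun x => ∑ q ∈ Finset.univ.erase p, w q / (x - z q))
        (Metric.ball (z p) r) := by
      intro x hx
      refine (DifferentiableAt.fun_sum fun q hq => ?_).differentiableWithinAt
      refine (differentiableAt_const _).div (by fun_prop) (sub_ne_zero.mpr fun h => ?_)
      exact ((hr x hx).2 q (Finset.ne_of_mem_erase hq)).2 (by rw [h])
    fun_prop
  · rw [hg2 x hx, forcing, ← Finset.add_sum_erase _ _ (Finset.mem_univ p)]
    have h1 : x - z p ≠ 0 := sub_ne_zero.mpr hx
    obtain ⟨k, rfl⟩ : ∃ k, n = k + 1 := ⟨n - 1, by omega⟩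
    simp only [Nat.add_sub_cancel, mul_pow, pow_succ]
    field_simp
    ring

theorem isPreconnected_slit_ball (a : ℂ) {r : ℝ} (hr : 0 < r) {s : ℝ} (hs : s = 1 ∨ s = -1) :
    IsPreconnected (Metric.ball a r ∩ {x | x.re = a.re → s * (x.im - a.im) < 0}) := by
  set b : ℂ := a - (s * (r / 2) : ℝ) * Complex.I with hb
  have hbre : b.re = a.re := by simp [hb]
  have hbim : b.im = a.im - s * (r / 2) := by simp [hb]
  have hs2 : s * s = 1 := by rcases hs with rfl | rfl <;> norm_num
  have hbb : b ∈ Metric.ball a r := by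
    rw [Metric.mem_ball, dist_eq_norm, hb, sub_sub_cancel_left, norm_neg, norm_mul, Complex.norm_I,
      Complex.norm_real, Real.norm_eq_abs, abs_mul]
    have h2 : |r / 2| = r / 2 := abs_of_pos (by linarith)
    rcases hs with rfl | rfl <;> simp [h2] <;> linarith
  refine isPreconnected_of_forall b fun y hy => ⟨segment ℝ b y, ?_, left_mem_segment ℝ b y,
    right_mem_segment ℝ b y, (convex_segment b y).isPreconnected⟩
  intro x hx
  refine ⟨(convex_ball a r).segment_subset hbb hy.1 hx, ?_⟩
  obtain ⟨α, β, hα, hβ, hαβ, rfl⟩ := hx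
  intro h
  have hy2 := hy.2
  simp only [mem_ofPred_eq] at hy2
  simp only [Complex.add_re, Complex.real_smul, Complex.mul_re, Complex.ofReal_re,
    Complex.ofReal_im, zero_mul, sub_zero, Complex.add_im, Complex.mul_im, hbre, hbim, add_zero]
    at h ⊢
  obtain rfl : α = 1 - β := by linarith
  have h3 : β * (y.re - a.re) = 0 := by linarith
  have h4 : s * ((1 - β) * (a.im - s * (r / 2)) + β * y.im - a.im) =
      -(1 - β) * (r / 2) * (s * s) + β * (s * (y.im - a.im)) := by ring
  rw [h4, hs2]
  rcases mul_eq_zero.mp h3 with h5 | h5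
  · subst h5
    linarith
  · have h6 := hy2 (by linarith)
    rcases hβ.eq_or_lt with h7 | h7
    · subst h7; linarith
    · have : β * (s * (y.im - a.im)) < 0 := mul_neg_of_pos_of_neg h7 h6
      have : 0 ≤ (1 - β) * (r / 2) := by positivity
      linarith

/-! ### Endpoint rows and linearity of the rows -/

theorem IsIsolating.mem_leftDomain_zero (hz : ∀ p, 0 < (z p).im) {p : Fin P} {r : ℝ}
    (hr : IsIsolating z p r) {x : ℂ} (hx : x ∈ Metric.ball (z p) r)
    (hx2 : x.re = (z p).re → 1 * (x.im - (z p).im) < 0) : x ∈ leftDomain z 0 := by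
  refine ⟨mem_branchDomain_iff.mpr fun q => ?_, by simp⟩
  have h1 := hr x hx
  by_cases hq : q = p
  · subst hq
    refine ⟨fun h => ⟨by omega, fun _ => by linarith [hx2 h]⟩, fun _ => ?_⟩
    linarith [h1.1, hz q]
  · exact ⟨fun h => absurd h (h1.2 q hq).2, fun h => absurd h (h1.2 q hq).2⟩

/-- For an endpoint row the primitive extends holomorphically to a full neighbourhood of `z_m`, and
the row integral is its value at `z_m`. -/
theorem exists_endpoint_primitive (hε : 0 < ε) (hlam : 0 < lam) (hz : ∀ p, 0 < (z p).im)
    (hmono : StrictMono fun p => (z p).re) (m : Fin P) {n : ℕ} (hn0 : 0 < n)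
    (hn : Complex.I * c m / ε = -(n : ℂ)) {μ : ℂ} {w : Fin P → ℂ} {Φ : ℂ → ℂ}
    (hΦ : IsBranchPrimitive c z lam ε 0 μ w Φ) {r : ℝ} (hr0 : 0 < r) (hr : IsIsolating z m r) :
    ∃ ψ F : ℂ → ℂ, (∀ x ∈ Metric.ball (z m) r, HasDerivAt ψ (F x) x) ∧
      (∀ x, x ≠ z m → branchExp c z lam ε 0 x * forcing z μ w x = F x) ∧
      (∀ x ∈ Metric.ball (z m) r, (x.re = (z m).re → 1 * (x.im - (z m).im) < 0) → Φ x = ψ x) ∧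
      endpointIntegral c z lam ε m (forcing z μ w) = ψ (z m) := by
  obtain ⟨F, hF, hF2⟩ := exists_local_integrand (lam := lam) hz m hn0 hn μ w hr
  obtain ⟨ψ₀, hψ₀⟩ := hF.isExactOn_ball
  set U := Metric.ball (z m) r ∩ {x | x.re = (z m).re → 1 * (x.im - (z m).im) < 0} with hU
  have hUne : ∀ x ∈ U, x ≠ z m := by
    rintro x hx rfl
    have := hx.2 rfl
    simp at this
  have hUeq : U = Metric.ball (z m) r ∩ leftDomain z 0 := by
    ext x
    refine ⟨fun hx => ⟨hx.1, hr.mem_leftDomain_zero hz hx.1 hx.2⟩, fun hx => ⟨hx.1, fun h => ?_⟩⟩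
    have := ((mem_branchDomain_iff.mp hx.2.1 m).1 h).2 (by omega)
    linarith
  have hUo : IsOpen U := hUeq ▸ Metric.isOpen_ball.inter (isOpen_leftDomain 0)
  have hUc : IsPreconnected U := isPreconnected_slit_ball (z m) hr0 (Or.inl rfl)
  -- a point of the ball below `z_m`
  set a : ℂ := (z m).re + ((z m).im - r / 2 : ℝ) * Complex.I with ha
  have haU : a ∈ U := by
    refine ⟨?_, fun _ => by rw [ha, im_add_mul_I]; linarith⟩
    have : a - z m = (-(r / 2) : ℝ) * Complex.I := by
      rw [ha]; nth_rewrite 3 [← Complex.re_add_im (z m)]; push_cast; ring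
    rw [Metric.mem_ball, dist_eq_norm, this, norm_mul, Complex.norm_I, Complex.norm_real,
      Real.norm_eq_abs, abs_neg, abs_of_pos (by linarith)]
    linarith
  have hconst : ∀ x ∈ U, Φ x - ψ₀ x = Φ a - ψ₀ a := fun x hx =>
    sub_eq_sub_of_hasDerivAt hUo hUc (f' := F)
      (fun y hy => (hF2 y (hUne y hy)) ▸ hΦ.hasDerivAt y (hr.mem_leftDomain_zero hz hy.1 hy.2))
      (fun y hy => hψ₀ y hy.1) hx haU
  refine ⟨fun x => ψ₀ x + (Φ a - ψ₀ a), F, fun x hx => (hψ₀ x hx).add_const _, hF2,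
    fun x hx hx2 => ?_, ?_⟩
  · linear_combination hconst x ⟨hx, hx2⟩
  · have him : 0 < (z m).im - r / 2 := by
      have := (hr a haU.1).1
      rwa [ha, im_add_mul_I] at this
    have hline : ∀ t ∈ Icc ((z m).im - r / 2) (z m).im,
        ((z m).re + t * Complex.I : ℂ) ∈ Metric.ball (z m) r := by
      intro t ht
      have h1 : ((z m).re + t * Complex.I : ℂ) - z m = (t - (z m).im : ℝ) * Complex.I := by
        nth_rewrite 2 [← Complex.re_add_im (z m)]; push_cast; ring
      rw [Metric.mem_ball, dist_eq_norm, h1, norm_mul, Complex.norm_I, Complex.norm_real,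
        Real.norm_eq_abs, mul_one, abs_lt]
      constructor <;> linarith [ht.1, ht.2]
    have hlineU : ∀ t ∈ Ico ((z m).im - r / 2) (z m).im, ((z m).re + t * Complex.I : ℂ) ∈ U := by
      intro t ht
      refine ⟨hline t ⟨ht.1, ht.2.le⟩, fun _ => ?_⟩
      rw [im_add_mul_I]
      linarith [ht.2]
    refine endpointIntegral_forcing hε hlam hz hmono m hΦ ?_ ?_
    · refine IntervalIntegrable.trans (b := (z m).im - r / 2) ?_ ?_
      · refine ContinuousOn.intervalIntegrable
          (IsBranchPrimitive.continuousOn_integrand.comp (by fun_prop) fun t ht => ?_)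
        rw [uIcc_of_le him.le] at ht
        refine ⟨mem_branchDomain_iff.mpr fun p => ?_, by simp⟩
        rw [re_add_mul_I, im_add_mul_I]
        refine ⟨fun h => ?_, fun _ => by linarith [hz p, ht.1]⟩
        have : m = p := hmono.injective h
        subst this
        exact ⟨by omega, fun _ => by linarith [ht.2]⟩
      · have h1 : IntervalIntegrable (fun t : ℝ => F ((z m).re + t * Complex.I)) volume
            ((z m).im - r / 2) (z m).im := by
          refine ContinuousOn.intervalIntegrable
            (hF.continuousOn.comp (by fun_prop) fun t ht => ?_)
          rw [uIcc_of_le (by linarith)] at ht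
          exact hline t ht
        refine h1.congr_uIoo fun t ht => ?_
        rw [uIoo_of_le (by linarith)] at ht
        exact (hF2 _ (hUne _ (hlineU t ⟨ht.1.le, ht.2⟩))).symm
    · have hcont : ContinuousAt (fun t : ℝ => ψ₀ ((z m).re + t * Complex.I) + (Φ a - ψ₀ a))
          (z m).im :=
        ((hasDerivAt_comp_line (hψ₀ _ (hline _ ⟨by linarith, le_rfl⟩))).add_const _).continuousAt
      have h2 := hcont.tendsto.mono_left (nhdsWithin_le_nhds (s := Iio (z m).im))
      rw [Complex.re_add_im] at h2
      refine h2.congr' ?_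
      filter_upwards [Ico_mem_nhdsLT (show (z m).im - r / 2 < (z m).im by linarith)] with t ht
      linear_combination -hconst _ (hlineU t ht)

theorem forcing_linear (μ : ℂ) (w : Fin P → ℂ) (x : ℂ) :
    forcing z μ w x = μ * forcing z 1 0 x + ∑ p, w p * forcing z 0 (Pi.single p 1) x := by
  simp only [forcing, Pi.zero_apply, zero_div, Finset.sum_const_zero, add_zero, mul_one, zero_add,
    add_right_inj]
  refine Finset.sum_congr rfl fun p _ => ?_
  rw [Finset.sum_eq_single p]
  · simp; ring
  · intro q _ hq
    simp [hq]
  · simp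

theorem IsBranchPrimitive.linear {k : ℕ} {μ : ℂ} {w : Fin P → ℂ} {Φ₁ : ℂ → ℂ}
    {Φ : Fin P → ℂ → ℂ} (h₁ : IsBranchPrimitive c z lam ε k 1 0 Φ₁)
    (h : ∀ p, IsBranchPrimitive c z lam ε k 0 (Pi.single p 1) (Φ p)) :
    IsBranchPrimitive c z lam ε k μ w (fun x => μ * Φ₁ x + ∑ p, w p * Φ p x) := by
  refine ⟨fun x hx => ?_, ?_⟩
  · refine (((h₁.hasDerivAt x hx).const_mul μ).add (HasDerivAt.fun_sum (u := Finset.univ)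
      fun p _ => ((h p).hasDerivAt x hx).const_mul (w p))).congr_deriv ?_
    rw [forcing_linear μ w, mul_add, Finset.mul_sum]
    congr 1
    · ring
    · exact Finset.sum_congr rfl fun p _ => by ring
  · have := (h₁.bottom.const_mul μ).add (tendsto_finsetSum Finset.univ
      fun p _ => ((h p).bottom.const_mul (w p)))
    simpa using this

theorem rowIntegral_forcing (hε : 0 < ε) (hlam : 0 < lam) (hz : ∀ p, 0 < (z p).im)
    (hmono : StrictMono fun p => (z p).re) (m : Fin P) (μ : ℂ) (w : Fin P → ℂ) :
    rowIntegral c z lam ε m (forcing z μ w) = μ * rowIntegral c z lam ε m (fun _ => 1) +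
      ∑ p, w p * rowIntegral c z lam ε m (fun x => 1 / (x - z p)) := by
  have e1 : (fun _ => 1 : ℂ → ℂ) = forcing z 1 0 := by ext x; simp [forcing]
  have e2 : ∀ p, (fun x => 1 / (x - z p) : ℂ → ℂ) = forcing z 0 (Pi.single p 1) := by
    intro p
    ext x
    rw [forcing, Finset.sum_eq_single p]
    · simp
    · intro q _ hq
      simp [hq]
    · simp
  rw [e1]
  simp only [e2]
  obtain ⟨Φ₁, h₁⟩ := exists_isBranchPrimitive (c := c) hε hlam hz 0 1 0
  choose Φ h using fun p => exists_isBranchPrimitive (c := c) hε hlam hz 0 0 (Pi.single p 1)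
  have h₂ := IsBranchPrimitive.linear (μ := μ) (w := w) h₁ h
  unfold rowIntegral
  split_ifs with hm
  · obtain ⟨n, hn0, hn⟩ := hm
    obtain ⟨r, hr0, hr⟩ := exists_isolating_radius hz hmono m
    -- the three kinds of row values are limits of the primitives at `z_m` from below
    have key : ∀ {μ : ℂ} {w : Fin P → ℂ} {Φ : ℂ → ℂ}, IsBranchPrimitive c z lam ε 0 μ w Φ →
        Tendsto (fun t : ℝ => Φ (z m - t * Complex.I)) (𝓝[>] 0)
          (𝓝 (endpointIntegral c z lam ε m (forcing z μ w))) := by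
      intro μ w Φ hΦ
      obtain ⟨ψ, F, hψ, -, hψ3, hψ4⟩ := exists_endpoint_primitive hε hlam hz hmono m hn0 hn hΦ hr0 hr
      rw [hψ4]
      have hc : ContinuousAt (fun t : ℝ => ψ (z m + t * (-Complex.I))) 0 :=
        (hasDerivAt_comp_line (hψ _ (by simpa using hr0))).continuousAt
      have h2 := hc.tendsto.mono_left (nhdsWithin_le_nhds (s := Ioi 0))
      simp only [Complex.ofReal_zero, zero_mul, add_zero] at h2
      refine h2.congr' ?_
      filter_upwards [Ioo_mem_nhdsGT hr0] with t ht
      have e3 : z m + t * (-Complex.I) = z m - t * Complex.I := by ring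
      rw [e3]
      refine (hψ3 _ ?_ fun _ => ?_).symm
      · rw [Metric.mem_ball, dist_eq_norm, sub_sub_cancel_left, norm_neg, norm_mul, Complex.norm_I,
          Complex.norm_real, Real.norm_eq_abs, abs_of_pos ht.1]
        linarith [ht.2]
      · simp [ht.1]
    refine tendsto_nhds_unique (key h₂) ?_
    exact ((key h₁).const_mul μ).add (tendsto_finsetSum Finset.univ
      fun p _ => ((key (h p)).const_mul (w p)))
  · obtain ⟨Ψ₁, g₁⟩ := exists_isBranchPrimitive (c := c) hε hlam hz (m.1 + 1) 1 0
    choose Ψ g using fun p =>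
      exists_isBranchPrimitive (c := c) hε hlam hz (m.1 + 1) 0 (Pi.single p 1)
    rw [loopIntegral_forcing hε hlam hz hmono m h₂ (IsBranchPrimitive.linear g₁ g),
      loopIntegral_forcing hε hlam hz hmono m h₁ g₁]
    simp only [loopIntegral_forcing hε hlam hz hmono m (h _) (g _), mul_sub,
      Finset.sum_sub_distrib]
    ring

/-! ### Vanishing rows: the branches fit together -/

theorem mem_branchDomain_succ_of_lt {p : Fin P} {x : ℂ} (hx : x ∈ branchDomain z p.1)
    (hxp : x.re < (z p).re) : x ∈ branchDomain z (p.1 + 1) := by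
  rw [mem_branchDomain_iff] at hx ⊢
  intro q
  refine ⟨fun h => ⟨fun h1 => ?_, fun h1 => ((hx q).1 h).2 (by omega)⟩, (hx q).2⟩
  rcases Nat.lt_succ_iff_lt_or_eq.mp h1 with h2 | h2
  · exact ((hx q).1 h).1 h2
  · have : q = p := Fin.ext h2
    subst this
    exact absurd h hxp.ne

/-- To the left of `z_p` the primitives of two consecutive branches differ by the monodromy
factor, since both vanish at `-i∞`. -/
theorem IsBranchPrimitive.succ_eq_of_lt_re (hz : ∀ p, 0 < (z p).im)
    (hmono : StrictMono fun p => (z p).re) {p : Fin P} {μ : ℂ} {w : Fin P → ℂ} {Φ Φ' : ℂ → ℂ}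
    (h : IsBranchPrimitive c z lam ε p.1 μ w Φ) (h' : IsBranchPrimitive c z lam ε (p.1 + 1) μ w Φ')
    {x : ℂ} (hx : x ∈ branchDomain z p.1) (hxp : x.re < (z p).re) :
    Φ' x = Complex.exp (2 * Real.pi * c p / ε) * Φ x := by
  set κ := Complex.exp (2 * Real.pi * c p / ε) with hκ
  have hlt : ∀ y : ℂ, y.re < (z p).re → ∀ q : Fin P, p.1 ≤ q.1 → y.re < (z q).re :=
    fun y hy q hq => lt_of_lt_of_le hy (hmono.monotone (Fin.le_def.mpr hq))
  have hconn := isPreconnected_branchDomain_inter_left (ρ := (z p).re) hz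
    (fun q hq => (hmono.monotone (Fin.le_def.mpr hq) : (z p).re ≤ (z q).re))
  have hopen : IsOpen (branchDomain z p.1 ∩ {x | x.re < (z p).re}) :=
    (isOpen_branchDomain _).inter (isOpen_lt Complex.continuous_re continuous_const)
  have hcol : ∀ t : ℝ, (-(outerRadius z : ℂ) + t * Complex.I) ∈
      branchDomain z p.1 ∩ {x | x.re < (z p).re} := fun t => by
    refine ⟨(column_mem_leftDomain _ t).1, ?_⟩
    rw [column_eq]
    simpa using (pole_re_im_bounds (z := z) p).1
  have hconst : ∀ y ∈ branchDomain z p.1 ∩ {x | x.re < (z p).re}, Φ' x - κ * Φ x =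
      Φ' y - κ * Φ y := fun y hy =>
    sub_eq_sub_of_hasDerivAt hopen hconn
      (f' := fun x => κ * (branchExp c z lam ε p.1 x * forcing z μ w x))
      (fun y hy => by
        have := h'.hasDerivAt y ⟨mem_branchDomain_succ_of_lt hy.1 hy.2,
          fun _ q hq => hlt y hy.2 q (by omega)⟩
        rwa [branchExp_succ_of_lt_re p hy.2, ← hκ, mul_assoc] at this)
      (fun y hy => (h.hasDerivAt y ⟨hy.1, fun _ q hq => hlt y hy.2 q hq⟩).const_mul κ) ⟨hx, hxp⟩ hy
  have hlim := h'.bottom.sub (h.bottom.const_mul κ)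
  have hlim2 := hlim.congr fun t => (hconst _ (hcol t)).symm
  have := tendsto_nhds_unique hlim2 tendsto_const_nhds
  linear_combination -this

/-- The vertical strip between `z_p` and the next pole. -/
def rightStrip (z : Fin P → ℂ) (p : Fin P) : Set ℂ :=
  {x | (z p).re < x.re ∧ ∀ q : Fin P, p.1 + 1 ≤ q.1 → x.re < (z q).re}

theorem isOpen_rightStrip (p : Fin P) : IsOpen (rightStrip z p) := by
  have : rightStrip z p = {x | (z p).re < x.re} ∩
      ⋂ q : Fin P, {x : ℂ | p.1 + 1 ≤ q.1 → x.re < (z q).re} := by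
    ext x; simp [rightStrip]
  rw [this]
  refine (isOpen_lt continuous_const Complex.continuous_re).inter
    (isOpen_iInter_of_finite fun q => ?_)
  by_cases h : p.1 + 1 ≤ q.1
  · simp only [h, forall_const]
    exact isOpen_lt Complex.continuous_re continuous_const
  · simp [h]

theorem convex_rightStrip (p : Fin P) : Convex ℝ (rightStrip z p) := by
  have : rightStrip z p = Complex.reLm ⁻¹' {s : ℝ | (z p).re < s ∧
      ∀ q : Fin P, p.1 + 1 ≤ q.1 → s < (z q).re} := rfl
  rw [this]
  refine Convex.linear_preimage (Set.OrdConnected.convex ⟨?_⟩) _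
  exact fun a ha b hb x hx => ⟨lt_of_lt_of_le ha.1 hx.1, fun q hq => lt_of_le_of_lt hx.2 (hb.2 q hq)⟩

theorem re_lt_of_mem_rightStrip (hmono : StrictMono fun p => (z p).re) {p : Fin P} {x : ℂ}
    (hx : x ∈ rightStrip z p) (q : Fin P) (hq : q.1 < p.1 + 1) : (z q).re < x.re :=
  lt_of_le_of_lt (hmono.monotone (Fin.le_def.mpr (by omega)) : (z q).re ≤ (z p).re) hx.1

theorem re_ne_of_mem_rightStrip (hmono : StrictMono fun p => (z p).re) {p : Fin P} {x : ℂ}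
    (hx : x ∈ rightStrip z p) (q : Fin P) : x.re ≠ (z q).re := by
  rcases lt_or_ge q.1 (p.1 + 1) with h | h
  · exact (re_lt_of_mem_rightStrip hmono hx q h).ne'
  · exact (hx.2 q h).ne

theorem IsBranchPrimitive.succ_sub_eq_const (hmono : StrictMono fun p => (z p).re) {p : Fin P}
    {μ : ℂ} {w : Fin P → ℂ} {Φ Φ' : ℂ → ℂ}
    (h : IsBranchPrimitive c z lam ε 0 μ w Φ) (h' : IsBranchPrimitive c z lam ε (p.1 + 1) μ w Φ')
    {x y : ℂ} (hx : x ∈ rightStrip z p) (hy : y ∈ rightStrip z p) :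
    Φ' x - Φ x = Φ' y - Φ y :=
  sub_eq_sub_of_hasDerivAt (isOpen_rightStrip p) (convex_rightStrip p).isPreconnected
    (f' := fun x => branchExp c z lam ε 0 x * forcing z μ w x)
    (fun a ha => by
      have := h'.hasDerivAt a ⟨mem_branchDomain_of_re_ne (re_ne_of_mem_rightStrip hmono ha),
        fun _ => ha.2⟩
      rwa [branchExp_eq_zero_branch (by have := p.2; omega) (re_lt_of_mem_rightStrip hmono ha)]
        at this)
    (fun a ha => h.hasDerivAt a ⟨mem_branchDomain_of_re_ne (re_ne_of_mem_rightStrip hmono ha),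
      by simp⟩) hx hy

theorem exp_monodromy_eq_one {p : Fin P} {n : ℕ} (hn : Complex.I * c p / ε = -(n : ℂ)) :
    Complex.exp (2 * Real.pi * c p / ε) = 1 := by
  have : 2 * Real.pi * c p / ε = n * (2 * Real.pi * Complex.I) := by
    linear_combination (-2 * Real.pi * Complex.I) * hn + 2 * Real.pi * c p / ε * Complex.I_sq
  rw [this, Complex.exp_nat_mul_two_pi_mul_I]

/-- If the row `p` vanishes, the primitive continued through the cuts of `z_0, …, z_p` agrees with
the original one in the strip to the right of `z_p`. -/
theorem succ_eq_of_rowIntegral_eq_zero (hε : 0 < ε) (hlam : 0 < lam) (hz : ∀ p, 0 < (z p).im)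
    (hmono : StrictMono fun p => (z p).re) {p : Fin P} {μ : ℂ} {w : Fin P → ℂ} {Φ Φp Φ' : ℂ → ℂ}
    (h : IsBranchPrimitive c z lam ε 0 μ w Φ) (hp : IsBranchPrimitive c z lam ε p.1 μ w Φp)
    (h' : IsBranchPrimitive c z lam ε (p.1 + 1) μ w Φ')
    (hleft : ∀ x : ℂ, (∀ q : Fin P, q.1 < p.1 → (z q).re < x.re) → x.re < (z p).re → Φp x = Φ x)
    (hrow : rowIntegral c z lam ε p (forcing z μ w) = 0)
    {x : ℂ} (hx : x ∈ rightStrip z p) : Φ' x = Φ x := by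
  rw [rowIntegral] at hrow
  split_ifs at hrow with hex
  · obtain ⟨n, hn0, hn⟩ := hex
    obtain ⟨r, hr0, hr⟩ := exists_isolating_radius hz hmono p
    obtain ⟨ψ, F, hψ, hF, hψ3, -⟩ := exists_endpoint_primitive hε hlam hz hmono p hn0 hn h hr0 hr
    have hreal : ∀ s : ℝ, |s| < r → z p + s ∈ Metric.ball (z p) r := fun s hs => by
      rw [Metric.mem_ball, dist_eq_norm, add_sub_cancel_left, Complex.norm_real]
      exact hs
    have hr2 : |r / 2| < r := by rw [abs_of_pos (by linarith)]; linarith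
    have hr3 : |-(r / 2)| < r := by rwa [abs_neg]
    set U := Metric.ball (z p) r ∩ {x | x.re = (z p).re → -1 * (x.im - (z p).im) < 0} with hU
    have hUlt : ∀ y ∈ Metric.ball (z p) r, ∀ q : Fin P, q.1 < p.1 → (z q).re < y.re := by
      intro y hy q hq
      have h1 : (z q).re < (z p).re := hmono (Fin.lt_def.mpr hq)
      have h2 := (hr y hy).2 q (by rintro rfl; omega)
      have h3 := h2.1.not.mpr (not_lt.mpr h1.le)
      exact lt_of_le_of_ne (not_lt.mp h3) h2.2.symm
    have hUgt : ∀ y ∈ Metric.ball (z p) r, ∀ q : Fin P, p.1 + 1 ≤ q.1 → y.re < (z q).re := by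
      intro y hy q hq
      exact ((hr y hy).2 q (by rintro rfl; omega)).1.mpr (hmono (Fin.lt_def.mpr (by omega)))
    have hUdom : ∀ y ∈ U, y ∈ leftDomain z (p.1 + 1) := by
      intro y hy
      refine ⟨mem_branchDomain_iff.mpr fun q => ?_, fun _ => hUgt y hy.1⟩
      have h1 := hr y hy.1
      by_cases hq : q = p
      · subst hq
        refine ⟨fun h => ⟨fun _ => by linarith [hy.2 h], by omega⟩, fun _ => ?_⟩
        linarith [h1.1, hz q]
      · exact ⟨fun h => absurd h (h1.2 q hq).2, fun h => absurd h (h1.2 q hq).2⟩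
    have hUE : ∀ y ∈ U, branchExp c z lam ε (p.1 + 1) y = branchExp c z lam ε 0 y := by
      intro y hy
      rw [← branchExp_eq_zero_branch p.2.le (hUlt y hy.1)]
      rcases lt_or_ge y.re (z p).re with h1 | h1
      · rw [branchExp_succ_of_lt_re p h1, exp_monodromy_eq_one hn, one_mul]
      · refine branchExp_succ_of_re_lt p ?_
        rcases h1.lt_or_eq with h2 | h2
        · exact Or.inl h2
        · exact Or.inr ⟨h2.symm, by linarith [hy.2 h2.symm]⟩
    have hUeq : U = Metric.ball (z p) r ∩ leftDomain z (p.1 + 1) := by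
      ext y
      refine ⟨fun hy => ⟨hy.1, hUdom y hy⟩, fun hy => ⟨hy.1, fun h => ?_⟩⟩
      have := ((mem_branchDomain_iff.mp hy.2.1 p).1 h).1 (by omega)
      linarith
    have hUo : IsOpen U := hUeq ▸ Metric.isOpen_ball.inter (isOpen_leftDomain _)
    have hUc : IsPreconnected U := isPreconnected_slit_ball (z p) hr0 (Or.inr rfl)
    have hxl : z p + (-(r / 2) : ℝ) ∈ U :=
      ⟨hreal _ hr3, fun h => by simp at h; linarith⟩
    have hxr : z p + (r / 2 : ℝ) ∈ U :=
      ⟨hreal _ hr2, fun h => by simp at h; linarith⟩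
    have h1 := sub_eq_sub_of_hasDerivAt hUo hUc (f' := F) (f := Φ') (g := ψ)
      (fun y hy => by
        have h2 := h'.hasDerivAt y (hUdom y hy)
        rwa [hUE y hy, hF y ?_] at h2
        rintro rfl
        have := hy.2 rfl
        simp at this)
      (fun y hy => hψ y hy.1) hxl hxr
    have hlt : (z p + (-(r / 2) : ℝ)).re < (z p).re := by
      rw [Complex.add_re, Complex.ofReal_re]; linarith
    have hmem : z p + (-(r / 2) : ℝ) ∈ branchDomain z p.1 := by
      refine mem_branchDomain_of_re_ne fun q => ?_
      by_cases hq : q = p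
      · rw [hq]; exact hlt.ne
      · exact ((hr _ hxl.1).2 q hq).2
    have h3 := hp.succ_eq_of_lt_re hz hmono h' hmem hlt
    rw [exp_monodromy_eq_one hn, one_mul, hleft _ (hUlt _ hxl.1) hlt,
      hψ3 _ hxl.1 (fun h => absurd h hlt.ne)] at h3
    have hgt : (z p).re < (z p + (r / 2 : ℝ)).re := by
      rw [Complex.add_re, Complex.ofReal_re]; linarith
    have h4 := hψ3 _ hxr.1 (fun h => absurd h hgt.ne')
    have h5 := h.succ_sub_eq_const hmono h' hx (y := z p + (r / 2 : ℝ)) ⟨hgt, hUgt _ hxr.1⟩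
    linear_combination h5 + h3 - h1 - h4
  · rw [loopIntegral_forcing hε hlam hz hmono p h h'] at hrow
    obtain ⟨-, hb1, hb2⟩ := rightAbscissa_bounds hmono p
    have h5 := h.succ_sub_eq_const hmono h' hx
      (y := rightAbscissa z p + outerRadius z * Complex.I)
      ⟨by rw [re_add_mul_I]; exact hb1 p (by omega), fun q hq => by
        rw [re_add_mul_I]; exact hb2 q hq⟩
    linear_combination h5 - hrow

/-- If all rows vanish, the quotients of the primitives by their exponential factors agree. -/
theorem branch_quotients_agree (hε : 0 < ε) (hlam : 0 < lam) (hz : ∀ p, 0 < (z p).im)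
    (hmono : StrictMono fun p => (z p).re) {μ : ℂ} {w : Fin P → ℂ} {Φ : ℕ → ℂ → ℂ}
    (hΦ : ∀ k, IsBranchPrimitive c z lam ε k μ w (Φ k))
    (hrow : ∀ p, rowIntegral c z lam ε p (forcing z μ w) = 0) (k : ℕ) (hk : k ≤ P)
    {x : ℂ} (hx : ∀ p, x.re ≠ (z p).re) (hxk : 0 < k → ∀ p : Fin P, k ≤ p.1 → x.re < (z p).re) :
    Φ k x * branchExp c z lam ε 0 x = branchExp c z lam ε k x * Φ 0 x := by
  induction k generalizing x with
  | zero => ring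
  | succ k ih =>
    have hkP : k < P := hk
    set p : Fin P := ⟨k, hkP⟩ with hp
    have hle : ∀ q : Fin P, k ≤ q.1 → (z p).re ≤ (z q).re :=
      fun q hq => hmono.monotone (Fin.le_def.mpr hq)
    rcases lt_or_gt_of_ne (hx p) with h1 | h1
    · have h2 := (hΦ k).succ_eq_of_lt_re (p := p) hz hmono (hΦ (k + 1))
        (mem_branchDomain_of_re_ne hx) h1
      have h3 := ih (by omega) hx fun _ q hq => lt_of_lt_of_le h1 (hle q hq)
      have h4 := branchExp_succ_of_lt_re (c := c) (lam := lam) (ε := ε) p h1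
      simp only [hp] at h4
      rw [h2, h4]
      linear_combination Complex.exp (2 * Real.pi * c p / ε) * h3
    · have hxS : x ∈ rightStrip z p := ⟨h1, hxk (by omega)⟩
      have h2 := succ_eq_of_rowIntegral_eq_zero hε hlam hz hmono (p := p) (hΦ 0) (hΦ k) (hΦ (k + 1))
        (fun y hy hyp => by
          have hyne : ∀ q, y.re ≠ (z q).re := fun q => by
            rcases lt_or_ge q.1 k with h | h
            · exact (hy q h).ne'
            · exact (lt_of_lt_of_le hyp (hle q h)).ne
          have h3 := ih (by omega) hyne fun _ q hq => lt_of_lt_of_le hyp (hle q hq)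
          rw [branchExp_eq_zero_branch (k := k) (by omega) hy] at h3
          exact mul_right_cancel₀ (branchExp_ne_zero 0 y) (by rw [h3]; ring))
        (hrow p) hxS
      have h4 : branchExp c z lam ε (k + 1) x = branchExp c z lam ε 0 x :=
        branchExp_eq_zero_branch hk (re_lt_of_mem_rightStrip hmono hxS)
      rw [h2, h4]
      ring

/-! ### Single-valued solutions at a regular singular point -/

/-- A solution of `(x - a) n' = Γ + B n` in a punctured ball grows at most like a power of
`1 / |x - a|`: this is Grönwall's inequality along the radii. -/
theorem exists_pow_isBigO_of_regular_singular {a : ℂ} {r : ℝ} (hr : 0 < r) {n Γ B : ℂ → ℂ}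
    (hΓ : ContinuousOn Γ (Metric.ball a r)) (hB : ContinuousOn B (Metric.ball a r))
    (hn : ∀ x ∈ Metric.ball a r, x ≠ a → HasDerivAt n ((Γ x + B x * n x) / (x - a)) x) :
    ∃ K : ℕ, (fun x => (x - a) ^ K * n x) =O[𝓝[≠] a] fun _ => (1 : ℝ) := by
  set r₁ := r / 2 with hr₁
  have hr₁0 : 0 < r₁ := by positivity
  have hsub : Metric.closedBall a r₁ ⊆ Metric.ball a r := Metric.closedBall_subset_ball (by linarith)
  obtain ⟨C, hC⟩ := (isCompact_closedBall a r₁).exists_bound_of_continuousOn (hΓ.mono hsub)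
  obtain ⟨N₀, hN₀⟩ := (isCompact_closedBall a r₁).exists_bound_of_continuousOn (hB.mono hsub)
  obtain ⟨N, hN⟩ := exists_nat_ge (max N₀ 1)
  have hN1 : (1 : ℝ) ≤ N := (le_max_right _ _).trans hN
  obtain ⟨M, hM⟩ := (isCompact_sphere a r₁).exists_bound_of_continuousOn (f := n) fun x hx =>
    (hn x (hsub (Metric.sphere_subset_closedBall hx)) (by
      rintro rfl; simp at hx; linarith)).continuousAt.continuousWithinAt
  have hC0 : 0 ≤ C := (norm_nonneg _).trans (hC a (Metric.mem_closedBall_self hr₁0.le))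
  refine ⟨N, IsBigO.of_bound ((M + C) * r₁ ^ N) ?_⟩
  have hmem : Metric.ball a r₁ ∩ {a}ᶜ ∈ 𝓝[≠] a :=
    inter_mem (mem_nhdsWithin_of_mem_nhds (Metric.ball_mem_nhds a hr₁0)) self_mem_nhdsWithin
  filter_upwards [hmem] with x hx
  have hxa : x - a ≠ 0 := sub_ne_zero.mpr hx.2
  have hρ : 0 < ‖x - a‖ := norm_pos_iff.mpr hxa
  have hρ1 : ‖x - a‖ < r₁ := by simpa [dist_eq_norm] using hx.1
  set ρ := ‖x - a‖ with hρdef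
  set d : ℂ := (x - a) / ρ with hd
  have hdn : ‖d‖ = 1 := by rw [hd, norm_div, Complex.norm_real, norm_norm, div_self hρ.ne']
  have hd0 : d ≠ 0 := by rw [← norm_pos_iff, hdn]; exact one_pos
  set γ : ℝ → ℂ := fun t => a + (r₁ * Real.exp (-t) : ℝ) * d with hγ
  have hγn : ∀ t, ‖γ t - a‖ = r₁ * Real.exp (-t) := fun t => by
    rw [hγ]
    simp only [add_sub_cancel_left, norm_mul, hdn, mul_one, Complex.norm_real, Real.norm_eq_abs]
    rw [abs_of_pos hr₁0, abs_of_pos (Real.exp_pos _)]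
  have hγa : ∀ t, γ t ≠ a := fun t h => by
    have := hγn t
    rw [h, sub_self, norm_zero] at this
    have := mul_pos hr₁0 (Real.exp_pos (-t))
    linarith
  have hγc : ∀ t, 0 ≤ t → γ t ∈ Metric.closedBall a r₁ := fun t ht => by
    rw [Metric.mem_closedBall, dist_eq_norm, hγn]
    have : Real.exp (-t) ≤ 1 := Real.exp_le_one_iff.mpr (by linarith)
    nlinarith
  have hder : ∀ t, 0 ≤ t → HasDerivAt (fun t => n (γ t)) (-(Γ (γ t) + B (γ t) * n (γ t))) t := by
    intro t ht
    have h1 : HasDerivAt (fun t : ℝ => r₁ * Real.exp (-t)) (-(r₁ * Real.exp (-t))) t := by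
      have := ((hasDerivAt_neg t).exp).const_mul r₁
      refine this.congr_deriv ?_
      ring
    have h2 := hasDerivAt_comp_line (ψ := n) (a := a) (d := d) (t := r₁ * Real.exp (-t))
      (hn _ (hsub (hγc t ht)) (hγa t))
    have h3 := HasDerivAt.scomp t h2 h1
    refine h3.congr_deriv ?_
    have h4 : γ t - a = (r₁ * Real.exp (-t) : ℝ) * d := by rw [hγ]; ring
    have h5 : γ t - a ≠ 0 := sub_ne_zero.mpr (hγa t)
    have h6 : ((r₁ * Real.exp (-t) : ℝ) : ℂ) * d ≠ 0 := h4 ▸ h5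
    change _ • (d * ((Γ (γ t) + B (γ t) * n (γ t)) / (γ t - a))) = _
    rw [h4, Complex.real_smul, Complex.ofReal_neg]
    have h7 : ((r₁ * Real.exp (-t) : ℝ) : ℂ) ≠ 0 := left_ne_zero_of_mul h6
    field_simp
  set T := Real.log (r₁ / ρ) with hT
  have hT0 : 0 ≤ T := Real.log_nonneg (by rw [le_div_iff₀ hρ]; linarith)
  have hexpT : Real.exp T = r₁ / ρ := Real.exp_log (by positivity)
  have hγT : γ T = x := by
    have : r₁ * Real.exp (-T) = ρ := by rw [Real.exp_neg, hexpT]; field_simp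
    have hρc : (ρ : ℂ) ≠ 0 := by exact_mod_cast hρ.ne'
    rw [hγ]
    simp only [this, hd]
    field_simp
    ring
  have hgr := norm_le_gronwallBound_of_norm_deriv_right_le (f := fun t => n (γ t)) (δ := M)
    (K := N) (ε := C) (a := 0) (b := T)
    (fun t ht => (hder t ht.1).continuousAt.continuousWithinAt)
    (fun t ht => (hder t ht.1).hasDerivWithinAt) (hM _ (by
      rw [mem_sphere_iff_norm, hγn]; simp)) (fun t ht => by
      have h1 := hC _ (hγc t ht.1)
      have h2 := hN₀ _ (hγc t ht.1)
      have h3 : N₀ ≤ N := (le_max_left _ _).trans hN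
      rw [norm_neg]
      refine (norm_add_le _ _).trans ?_
      rw [norm_mul]
      have := mul_le_mul_of_nonneg_right (h2.trans h3) (norm_nonneg (n (γ t)))
      linarith) T (right_mem_Icc.mpr hT0)
  simp only [hγT, sub_zero] at hgr
  rw [gronwallBound_of_K_ne_0 (by linarith)] at hgr
  have hM0 : 0 ≤ M := (norm_nonneg _).trans (hM (γ 0) (by rw [mem_sphere_iff_norm, hγn]; simp))
  have hexpN : Real.exp (N * T) = (r₁ / ρ) ^ N := by rw [Real.exp_nat_mul, hexpT]
  have h1 : ‖n x‖ ≤ (M + C) * (r₁ / ρ) ^ N := by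
    refine hgr.trans ?_
    simp only [hexpN]
    have h2 : C / N ≤ C := div_le_self hC0 hN1
    have h3 : 0 ≤ C / N := by positivity
    have h4 : 0 ≤ (r₁ / ρ) ^ N := by positivity
    nlinarith [mul_le_mul_of_nonneg_right h2 h4]
  rw [norm_mul, norm_pow, norm_one, mul_one]
  calc ρ ^ N * ‖n x‖ ≤ ρ ^ N * ((M + C) * (r₁ / ρ) ^ N) := by gcongr
    _ = (M + C) * r₁ ^ N := by rw [div_pow]; field_simp

/-- One order of a pole of a single-valued solution of `(x - a) n' = Γ + B n` is removed unless the
order is `-B(a)`, and also in this case if the leading coefficient vanishes. -/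
theorem isBigO_pow_of_isBigO_pow_succ {a : ℂ} {r : ℝ} (hr : 0 < r) {n Γ B : ℂ → ℂ} {K : ℕ}
    (hΓ : ContinuousOn Γ (Metric.ball a r)) (hB : ContinuousOn B (Metric.ball a r))
    (hn : ∀ x ∈ Metric.ball a r, x ≠ a → HasDerivAt n ((Γ x + B x * n x) / (x - a)) x)
    (hK : (fun x => (x - a) ^ (K + 1) * n x) =O[𝓝[≠] a] fun _ => (1 : ℝ))
    (hres : (K + 1 : ℂ) + B a ≠ 0 ∨ Tendsto (fun t : ℝ => (t * (-Complex.I)) ^ (K + 1) *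
      n (a + t * (-Complex.I))) (𝓝[>] 0) (𝓝 0)) :
    (fun x => (x - a) ^ K * n x) =O[𝓝[≠] a] fun _ => (1 : ℝ) := by
  set A₀ : ℂ → ℂ := fun x => (x - a) ^ (K + 1) * n x with hA₀
  have hball : Metric.ball a r ∈ 𝓝 a := Metric.ball_mem_nhds a hr
  have hpow : ∀ x : ℂ, HasDerivAt (fun x => (x - a) ^ (K + 1)) ((K + 1 : ℕ) * (x - a) ^ K) x :=
    fun x => by simpa using ((hasDerivAt_id x).sub_const a).fun_pow (K + 1)
  have hA₀d : ∀ x ∈ Metric.ball a r, x ≠ a → HasDerivAt A₀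
      ((K + 1 : ℕ) * (x - a) ^ K * n x + (x - a) ^ (K + 1) * ((Γ x + B x * n x) / (x - a))) x :=
    fun x hx hxa => (hpow x).mul (hn x hx hxa)
  set A := Function.update A₀ a (limUnder (𝓝[≠] a) A₀) with hA
  have hbdd : IsBoundedUnder (· ≤ ·) (𝓝[≠] a) fun x => ‖A₀ x - A₀ a‖ := by
    have h1 : (fun x => A₀ x - A₀ a) =O[𝓝[≠] a] fun _ => (1 : ℝ) :=
      hK.sub (isBigO_const_const _ one_ne_zero _)
    exact (isBigO_one_iff ℝ).mp h1
  have hAd : DifferentiableOn ℂ A (Metric.ball a r) :=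
    Complex.differentiableOn_update_limUnder_of_isLittleO hball
      (fun x hx => (hA₀d x hx.1 hx.2).differentiableAt.differentiableWithinAt)
      hbdd.isLittleO_sub_self_inv
  have hAeq : ∀ x, x ≠ a → A x = A₀ x := fun x hx => by rw [hA, Function.update_of_ne hx]
  have hAcont : ContinuousAt A a := (hAd.differentiableAt hball).continuousAt
  have hAa : A a = 0 := by
    rcases hres with hres | hres
    · -- compare the values of both sides of the differential equation at `a`
      have hderiv : ContinuousAt (deriv A) a :=
        ((hAd.analyticOnNhd Metric.isOpen_ball).deriv a (Metric.mem_ball_self hr)).continuousAt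
      have h1 : ∀ x ∈ Metric.ball a r, x ≠ a →
          (x - a) * deriv A x - (x - a) ^ (K + 1) * Γ x = ((K + 1 : ℂ) + B x) * A x := by
        intro x hx hxa
        have h2 : A =ᶠ[𝓝 x] A₀ := by
          filter_upwards [isOpen_ne.mem_nhds hxa] with y hy using hAeq y hy
        rw [h2.deriv_eq, (hA₀d x hx hxa).deriv, hAeq x hxa, hA₀]
        have h3 : x - a ≠ 0 := sub_ne_zero.mpr hxa
        push_cast
        field_simp
        ring
      have hl : Tendsto (fun x => (x - a) * deriv A x - (x - a) ^ (K + 1) * Γ x) (𝓝[≠] a)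
          (𝓝 0) := by
        have hΓa := hΓ.continuousAt hball
        have : ContinuousAt (fun x => (x - a) * deriv A x - (x - a) ^ (K + 1) * Γ x) a := by
          fun_prop
        have h2 := this.tendsto.mono_left (nhdsWithin_le_nhds (s := {a}ᶜ))
        simpa using h2
      have hrr : Tendsto (fun x => ((K + 1 : ℂ) + B x) * A x) (𝓝[≠] a)
          (𝓝 (((K + 1 : ℂ) + B a) * A a)) := by
        have hBa := hB.continuousAt hball
        have : ContinuousAt (fun x => ((K + 1 : ℂ) + B x) * A x) a := by fun_prop
        exact this.tendsto.mono_left (nhdsWithin_le_nhds (s := {a}ᶜ))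
      have hev : (fun x => (x - a) * deriv A x - (x - a) ^ (K + 1) * Γ x) =ᶠ[𝓝[≠] a]
          fun x => ((K + 1 : ℂ) + B x) * A x := by
        filter_upwards [mem_nhdsWithin_of_mem_nhds hball, self_mem_nhdsWithin] with x hx hxa
          using h1 x hx hxa
      have := tendsto_nhds_unique (hl.congr' hev) hrr
      exact (mul_eq_zero.mp this.symm).resolve_left hres
    · have hline : Tendsto (fun t : ℝ => a + t * (-Complex.I)) (𝓝[>] 0) (𝓝 a) := by
        have : ContinuousAt (fun t : ℝ => a + t * (-Complex.I)) 0 := by fun_prop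
        have h2 := this.tendsto.mono_left (nhdsWithin_le_nhds (s := Ioi 0))
        simpa using h2
      have h2 := hAcont.tendsto.comp hline
      refine tendsto_nhds_unique h2 (hres.congr' ?_)
      filter_upwards [self_mem_nhdsWithin] with t ht
      have hne : a + t * (-Complex.I) ≠ a := by
        have : t ≠ 0 := (mem_Ioi.mp ht).ne'
        simp [this]
      rw [Function.comp_apply, hAeq _ hne, hA₀]
      simp
  have hds : ContinuousAt (dslope A a) a := continuousAt_dslope_same.mpr (hAd.differentiableAt hball)
  have hO : (dslope A a) =O[𝓝[≠] a] fun _ => (1 : ℝ) :=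
    (hds.isBigO_one ℝ).mono nhdsWithin_le_nhds
  refine hO.congr' ?_ EventuallyEq.rfl
  filter_upwards [self_mem_nhdsWithin] with x hx
  have hxa : x - a ≠ 0 := sub_ne_zero.mpr hx
  rw [dslope_of_ne _ hx, slope_def_field, hAa, hAeq x hx, hA₀]
  field_simp
  ring

/-- A single-valued solution of `(x - a) n' = Γ + B n` in a punctured ball has a removable
singularity at `a`, unless `-B(a)` is a positive integer, where an additional condition excludes
a pole. -/
theorem isBigO_one_of_regular_singular {a : ℂ} {r : ℝ} (hr : 0 < r) {n Γ B : ℂ → ℂ}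
    (hΓ : ContinuousOn Γ (Metric.ball a r)) (hB : ContinuousOn B (Metric.ball a r))
    (hn : ∀ x ∈ Metric.ball a r, x ≠ a → HasDerivAt n ((Γ x + B x * n x) / (x - a)) x)
    (hres : ∀ K : ℕ, (K + 1 : ℂ) + B a ≠ 0 ∨ Tendsto (fun t : ℝ =>
      (t * (-Complex.I)) ^ (K + 1) * n (a + t * (-Complex.I))) (𝓝[>] 0) (𝓝 0)) :
    n =O[𝓝[≠] a] fun _ => (1 : ℝ) := by
  obtain ⟨K, hK⟩ := exists_pow_isBigO_of_regular_singular hr hΓ hB hn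
  induction K with
  | zero => simpa using hK
  | succ K ih => exact ih (isBigO_pow_of_isBigO_pow_succ hr hΓ hB hn hK (hres K))

/-! ### The quotient `n = Φ / e^{-ih/ε}` in the plane with the lower cuts -/

/-- The plane cut along the vertical half-lines from `conj z_p` downwards. -/
def lowerCutPlane (z : Fin P → ℂ) : Set ℂ := {x | ∀ p, x.re = (z p).re → -(z p).im < x.im}

theorem ne_conj_pole_of_mem_lowerCutPlane {x : ℂ} (hx : x ∈ lowerCutPlane z) (p : Fin P) :
    x ≠ conj (z p) := by
  rintro rfl
  have := hx p (by simp)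
  simp at this

theorem mem_lowerCutPlane_of_im_pos (hz : ∀ p, 0 < (z p).im) {x : ℂ} (hx : 0 ≤ x.im) :
    x ∈ lowerCutPlane z := fun p _ => by linarith [hz p]

/-- An analytic function `n` in the plane with the lower cuts with `Φ = e^{-ih/ε} n` for a
primitive `Φ` of `e^{-ih/ε} G` that vanishes at `-i∞` to the left of the poles, where `G` is
the rational function `forcing z μ w`; thus `n' = G + (i/ε) h' n`. -/
structure IsJostQuotient (c z : Fin P → ℂ) (lam ε : ℝ) (μ : ℂ) (w : Fin P → ℂ) (Φ n : ℂ → ℂ) :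
    Prop where
  primitive : IsBranchPrimitive c z lam ε 0 μ w Φ
  eq_mul : ∀ x ∈ branchDomain z 0, Φ x = branchExp c z lam ε 0 x * n x
  differentiableAt : ∀ x ∈ lowerCutPlane z, DifferentiableAt ℂ n x
  hasDerivAt : ∀ x ∈ lowerCutPlane z, (∀ p, x ≠ z p) →
    HasDerivAt n (forcing z μ w x + Complex.I / ε * (lam + potentialC c z x) * n x) x

theorem hasDerivAt_div_branchExp {k : ℕ} {μ : ℂ} {w : Fin P → ℂ} {Φ : ℂ → ℂ}
    (h : IsBranchPrimitive c z lam ε k μ w Φ) {x : ℂ} (hx : x ∈ leftDomain z k) :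
    HasDerivAt (fun x => Φ x / branchExp c z lam ε k x)
      (forcing z μ w x + Complex.I / ε * (lam + potentialC c z x) *
        (Φ x / branchExp c z lam ε k x)) x := by
  have hE := branchExp_ne_zero (c := c) (z := z) (lam := lam) (ε := ε) k x
  refine ((h.hasDerivAt x hx).fun_div (hasDerivAt_branchExp hx.1) hE).congr_deriv ?_
  field_simp
  ring

/-- If all rows vanish, the quotients of the branches define a single function off the poles. -/
theorem exists_glued_quotient (hε : 0 < ε) (hlam : 0 < lam) (hz : ∀ p, 0 < (z p).im)
    (hmono : StrictMono fun p => (z p).re) {μ : ℂ} {w : Fin P → ℂ} {Φ : ℂ → ℂ}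
    (hΦ : IsBranchPrimitive c z lam ε 0 μ w Φ)
    (hrow : ∀ p, rowIntegral c z lam ε p (forcing z μ w) = 0) :
    ∃ n : ℂ → ℂ, (∀ x ∈ branchDomain z 0, Φ x = branchExp c z lam ε 0 x * n x) ∧
      ∀ x ∈ lowerCutPlane z, (∀ p, x ≠ z p) →
        HasDerivAt n (forcing z μ w x + Complex.I / ε * (lam + potentialC c z x) * n x) x := by
  classical
  choose Φ' hΦ' using fun k => exists_isBranchPrimitive (c := c) (z := z) hε hlam hz k μ w
  set Ψ : ℕ → ℂ → ℂ := fun k => if k = 0 then Φ else Φ' k with hΨ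
  have hΨp : ∀ k, IsBranchPrimitive c z lam ε k μ w (Ψ k) := by
    intro k
    rcases Nat.eq_zero_or_pos k with rfl | hk
    · simpa [hΨ] using hΦ
    · simpa [hΨ, hk.ne'] using hΦ' k
  have hagree := branch_quotients_agree hε hlam hz hmono hΨp hrow
  set E : ℕ → ℂ → ℂ := fun k => branchExp c z lam ε k with hE
  have hE0 : ∀ k x, E k x ≠ 0 := fun k x => branchExp_ne_zero k x
  set n : ℂ → ℂ := fun x => if x ∈ branchDomain z 0 then Ψ 0 x / E 0 x else
    ∑ p : Fin P, if x.re = (z p).re then Ψ (p.1 + 1) x / E (p.1 + 1) x else 0 with hn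
  refine ⟨n, fun x hx => ?_, fun x hx hxp => ?_⟩
  · have : n x = Ψ 0 x / E 0 x := by simp only [hn, if_pos hx]
    rw [this]
    have h0 : Ψ 0 = Φ := by simp [hΨ]
    rw [h0]
    exact (mul_div_cancel₀ _ (hE0 0 x)).symm
  · suffices h : ∃ k, x ∈ leftDomain z k ∧ n =ᶠ[𝓝 x] fun y => Ψ k y / E k y by
      obtain ⟨k, hk, hev⟩ := h
      have := (hasDerivAt_div_branchExp (hΨp k) hk).congr_of_eventuallyEq hev
      rw [hev.eq_of_nhds]
      exact this
    by_cases hx0 : x ∈ branchDomain z 0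
    · refine ⟨0, ⟨hx0, fun h => (lt_irrefl _ h).elim⟩, ?_⟩
      filter_upwards [(isOpen_branchDomain 0).mem_nhds hx0] with y hy
      simp only [hn, if_pos hy]
    · obtain ⟨p, hp, hpi⟩ : ∃ p, x.re = (z p).re ∧ (z p).im < x.im := by
        by_contra! hcon
        apply hx0
        rw [mem_branchDomain_iff]
        refine fun p => ⟨fun hp => ⟨fun h => (Nat.not_lt_zero _ h).elim, fun _ => ?_⟩, hx p⟩
        exact lt_of_le_of_ne (hcon p hp) fun him => hxp p (Complex.ext hp him)
      have hlt : ∀ q : Fin P, q.1 < p.1 → (z q).re < x.re := fun q hq => hp ▸ hmono hq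
      have hgt : ∀ q : Fin P, p.1 + 1 ≤ q.1 → x.re < (z q).re := fun q hq =>
        hp ▸ hmono (Fin.lt_def.mpr (by omega))
      have hmem : x ∈ leftDomain z (p.1 + 1) := by
        refine ⟨mem_branchDomain_iff.mpr fun q => ⟨fun hq => ⟨fun hqp => ?_, fun hqp => ?_⟩, hx q⟩,
          fun _ => hgt⟩
        · rcases Nat.lt_succ_iff_lt_or_eq.mp hqp with h | h
          · exact absurd hq (hlt q h).ne'
          · rw [Fin.ext h]; exact hpi
        · exact absurd hq (hgt q hqp).ne
      refine ⟨p.1 + 1, hmem, ?_⟩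
      have hopen : IsOpen {y : ℂ | ∀ q : Fin P, q.1 < p.1 → (z q).re < y.re} := by
        simp only [ofPred_forall]
        exact isOpen_iInter_of_finite fun q => isOpen_iInter_of_finite fun _ =>
          isOpen_lt continuous_const Complex.continuous_re
      filter_upwards [(isOpen_leftDomain (p.1 + 1)).mem_nhds hmem, hopen.mem_nhds hlt] with y hy hyl
      have hyne : ∀ q, q ≠ p → y.re ≠ (z q).re := by
        intro q hq
        rcases lt_or_gt_of_ne (Fin.val_ne_of_ne hq) with h | h
        · exact (hyl q h).ne'
        · exact (hy.2 (Nat.succ_pos _) q h).ne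
      by_cases hyp : y.re = (z p).re
      · have hy0 : y ∉ branchDomain z 0 := fun h => by
          have h1 := (((mem_branchDomain_iff.mp h) p).1 hyp).2 (Nat.zero_le _)
          have h2 := (((mem_branchDomain_iff.mp hy.1) p).1 hyp).1 (Nat.lt_succ_self _)
          linarith
        simp only [hn, if_neg hy0]
        rw [Finset.sum_eq_single p (fun q _ hq => if_neg (hyne q hq)) (by simp), if_pos hyp]
      · have hgen : ∀ q, y.re ≠ (z q).re := fun q => by
          rcases eq_or_ne q p with rfl | h
          · exact hyp
          · exact hyne q h
        have h1 := hagree (p.1 + 1) p.2 hgen hy.2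
        simp only [hn, if_pos (mem_branchDomain_of_re_ne hgen)]
        rw [div_eq_div_iff (hE0 _ _) (hE0 _ _)]
        rw [h1]
        ring

theorem sum_div_eq_add_erase (a : Fin P → ℂ) (p : Fin P) (x : ℂ) :
    ∑ q, a q / (x - z q) = a p / (x - z p) + ∑ q ∈ Finset.univ.erase p, a q / (x - z q) :=
  (Finset.add_sum_erase _ _ (Finset.mem_univ p)).symm

theorem continuousOn_sum_div (s : Finset (Fin P)) (a y : Fin P → ℂ) {U : Set ℂ}
    (h : ∀ x ∈ U, ∀ q ∈ s, x ≠ y q) : ContinuousOn (fun x => ∑ q ∈ s, a q / (x - y q)) U :=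
  continuousOn_finsetSum _ fun q hq => continuousOn_const.div (by fun_prop) fun x hx =>
    sub_ne_zero.mpr (h x hx q hq)

theorem isBigO_one_of_rows_zero (hε : 0 < ε) (hlam : 0 < lam) (hz : ∀ p, 0 < (z p).im)
    (hmono : StrictMono fun p => (z p).re) {μ : ℂ} {w : Fin P → ℂ} {Φ n : ℂ → ℂ}
    (hΦ : IsBranchPrimitive c z lam ε 0 μ w Φ)
    (hrow : ∀ p, rowIntegral c z lam ε p (forcing z μ w) = 0)
    (hn : ∀ x ∈ branchDomain z 0, Φ x = branchExp c z lam ε 0 x * n x)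
    (hd : ∀ x ∈ lowerCutPlane z, (∀ p, x ≠ z p) →
      HasDerivAt n (forcing z μ w x + Complex.I / ε * (lam + potentialC c z x) * n x) x)
    (p : Fin P) : n =O[𝓝[≠] (z p)] fun _ => (1 : ℝ) := by
  classical
  obtain ⟨r, hr0, hr⟩ := exists_isolating_radius hz hmono p
  have hne : ∀ x ∈ Metric.ball (z p) r, ∀ q, q ≠ p → x ≠ z q := fun x hx q hq h =>
    ((hr x hx).2 q hq).2 (by rw [h])
  have hnec : ∀ x ∈ Metric.ball (z p) r, ∀ q, x ≠ conj (z q) := fun x hx q h => by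
    have := (hr x hx).1
    rw [h, Complex.conj_im] at this
    linarith [hz q]
  have hεc : (ε : ℂ) ≠ 0 := by exact_mod_cast hε.ne'
  set Γ : ℂ → ℂ := fun x => w p + (x - z p) *
    (μ + ∑ q ∈ Finset.univ.erase p, w q / (x - z q)) with hΓ
  set B : ℂ → ℂ := fun x => Complex.I / ε * (c p + (x - z p) *
    (lam + (∑ q ∈ Finset.univ.erase p, c q / (x - z q) +
      ∑ q, conj (c q) / (x - conj (z q))))) with hB
  have hc1 : ∀ a : Fin P → ℂ, ContinuousOn (fun x => ∑ q ∈ Finset.univ.erase p, a q / (x - z q))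
      (Metric.ball (z p) r) := fun a => continuousOn_sum_div _ a z fun x hx q hq =>
    hne x hx q (Finset.ne_of_mem_erase hq)
  have hc2 : ContinuousOn (fun x => ∑ q, conj (c q) / (x - conj (z q))) (Metric.ball (z p) r) :=
    continuousOn_sum_div _ (fun q => conj (c q)) (fun q => conj (z q)) fun x hx q _ => hnec x hx q
  have hΓc : ContinuousOn Γ (Metric.ball (z p) r) :=
    continuousOn_const.add (ContinuousOn.mul (by fun_prop) (continuousOn_const.add (hc1 w)))
  have hBc : ContinuousOn B (Metric.ball (z p) r) :=
    continuousOn_const.mul (continuousOn_const.add (ContinuousOn.mul (by fun_prop)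
      (continuousOn_const.add ((hc1 c).add hc2))))
  have hBp : B (z p) = Complex.I * c p / ε := by
    simp only [hB, sub_self, zero_mul, add_zero]; ring
  refine isBigO_one_of_regular_singular hr0 hΓc hBc (fun x hx hxp => ?_) fun K => ?_
  · have hxq : ∀ q, x ≠ z q := fun q => by
      rcases eq_or_ne q p with rfl | h
      · exact hxp
      · exact hne x hx q h
    refine (hd x (mem_lowerCutPlane_of_im_pos hz (hr x hx).1.le) hxq).congr_deriv ?_
    have h0 : x - z p ≠ 0 := sub_ne_zero.mpr hxp
    rw [forcing, potentialC, Finset.sum_add_distrib, sum_div_eq_add_erase w p,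
      sum_div_eq_add_erase c p, hΓ, hB]
    field_simp
    ring
  · by_cases hK : (K + 1 : ℂ) + B (z p) = 0
    · right
      have hex : Complex.I * c p / ε = -((K + 1 : ℕ) : ℂ) := by
        rw [← hBp]
        push_cast
        linear_combination hK
      obtain ⟨g, hgd, hg0, hg⟩ := exists_local_factorization (lam := lam) hz p hex hr
      obtain ⟨ψ, F, hψ, -, hψΦ, hend⟩ :=
        exists_endpoint_primitive hε hlam hz hmono p (Nat.succ_pos K) hex hΦ hr0 hr
      have hψ0 : ψ (z p) = 0 := by
        rw [← hend, ← hrow p, rowIntegral, if_pos ⟨K + 1, Nat.succ_pos K, hex⟩]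
      have hmem : Metric.ball (z p) r ∈ 𝓝 (z p) := Metric.ball_mem_nhds _ hr0
      have hcont : ContinuousAt (fun x => ψ x / (Complex.I ^ (K + 1) * g x)) (z p) := by
        have h1 := (hψ _ (Metric.mem_ball_self hr0)).continuousAt
        have h2 := (hgd.differentiableAt hmem).continuousAt
        exact h1.div (continuousAt_const.mul h2)
          (mul_ne_zero (pow_ne_zero _ Complex.I_ne_zero) (hg0 _ (Metric.mem_ball_self hr0)))
      have hline : Tendsto (fun t : ℝ => z p + t * (-Complex.I)) (𝓝[>] 0) (𝓝 (z p)) := by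
        have : ContinuousAt (fun t : ℝ => z p + t * (-Complex.I)) 0 := by fun_prop
        have h2 := this.tendsto.mono_left (nhdsWithin_le_nhds (s := Ioi 0))
        simpa using h2
      have hlim := hcont.tendsto.comp hline
      rw [hψ0, zero_div] at hlim
      refine hlim.congr' ?_
      filter_upwards [hline hmem, self_mem_nhdsWithin] with t ht ht0
      have ht0' : (0 : ℝ) < t := ht0
      set x : ℂ := z p + t * (-Complex.I) with hx
      have hxz : x - z p = t * (-Complex.I) := by rw [hx]; ring
      have htc : (t : ℂ) ≠ 0 := by exact_mod_cast ht0'.ne'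
      have hxz0 : x - z p ≠ 0 := by
        rw [hxz]; exact mul_ne_zero htc (neg_ne_zero.mpr Complex.I_ne_zero)
      have him : x.re = (z p).re → 1 * (x.im - (z p).im) < 0 := fun _ => by
        rw [hx]; simp [ht0']
      have hx0 := (hr.mem_leftDomain_zero hz ht him).1
      have h1 := hn x hx0
      rw [hψΦ x ht him, hg x (sub_ne_zero.mp hxz0)] at h1
      rw [← hxz]
      change ψ x / (Complex.I ^ (K + 1) * g x) = _
      rw [h1, mul_pow]
      have h2 := hg0 x ht
      have h3 := pow_ne_zero (K + 1) Complex.I_ne_zero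
      field_simp
    · exact Or.inl hK

/-- If all rows vanish on `G`, there is an analytic quotient `n`. -/
theorem exists_isJostQuotient (hε : 0 < ε) (hlam : 0 < lam) (hz : ∀ p, 0 < (z p).im)
    (hmono : StrictMono fun p => (z p).re) {μ : ℂ} {w : Fin P → ℂ}
    (hrow : ∀ p, rowIntegral c z lam ε p (forcing z μ w) = 0) :
    ∃ Φ n, IsJostQuotient c z lam ε μ w Φ n := by
  classical
  obtain ⟨Φ, hΦ⟩ := exists_isBranchPrimitive (c := c) (z := z) hε hlam hz 0 μ w
  obtain ⟨n, hn, hd⟩ := exists_glued_quotient hε hlam hz hmono hΦ hrow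
  have hO := isBigO_one_of_rows_zero hε hlam hz hmono hΦ hrow hn hd
  set N : ℂ → ℂ := fun x => if x ∈ range z then limUnder (𝓝[≠] x) n else n x with hN
  have hNn : ∀ x, (∀ p, x ≠ z p) → N x = n x := fun x hx => by
    simp only [hN]
    rw [if_neg]
    rintro ⟨p, rfl⟩
    exact hx p rfl
  have hopen : IsOpen {x : ℂ | ∀ p, x ≠ z p} := by
    simp only [ofPred_forall]
    exact isOpen_iInter_of_finite fun p => isOpen_ne
  have hode : ∀ x ∈ lowerCutPlane z, (∀ p, x ≠ z p) →
      HasDerivAt N (forcing z μ w x + Complex.I / ε * (lam + potentialC c z x) * N x) x := by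
    intro x hx hxp
    rw [hNn x hxp]
    refine (hd x hx hxp).congr_of_eventuallyEq ?_
    filter_upwards [hopen.mem_nhds hxp] with y hy using hNn y hy
  refine ⟨Φ, N, hΦ, fun x hx => ?_, fun x hx => ?_, hode⟩
  · rw [hNn x fun p => (ne_pole_of_mem_branchDomain hx p).1]
    exact hn x hx
  · by_cases hxp : ∀ p, x ≠ z p
    · exact (hode x hx hxp).differentiableAt
    · push Not at hxp
      obtain ⟨p, rfl⟩ := hxp
      obtain ⟨r, hr0, hr⟩ := exists_isolating_radius hz hmono p
      have hball : Metric.ball (z p) r ∈ 𝓝 (z p) := Metric.ball_mem_nhds _ hr0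
      have hne : ∀ x ∈ Metric.ball (z p) r, x ≠ z p → ∀ q, x ≠ z q := fun x hx hxp q => by
        rcases eq_or_ne q p with rfl | h
        · exact hxp
        · exact fun hq => ((hr x hx).2 q h).2 (by rw [hq])
      have hbdd : IsBoundedUnder (· ≤ ·) (𝓝[≠] (z p)) fun x => ‖n x - n (z p)‖ := by
        have h1 : (fun x => n x - n (z p)) =O[𝓝[≠] (z p)] fun _ => (1 : ℝ) :=
          (hO p).sub (isBigO_const_const _ one_ne_zero _)
        exact (isBigO_one_iff ℝ).mp h1
      have hAd := Complex.differentiableOn_update_limUnder_of_isLittleO hball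
        (fun x hx => ((hd x (mem_lowerCutPlane_of_im_pos hz (hr x hx.1).1.le)
          (hne x hx.1 hx.2)).differentiableAt.differentiableWithinAt)) hbdd.isLittleO_sub_self_inv
      refine (hAd.differentiableAt hball).congr_of_eventuallyEq ?_
      filter_upwards [hball] with y hy
      rcases eq_or_ne y (z p) with rfl | h
      · simp [hN]
      · rw [Function.update_of_ne h, hNn y (hne y hy h)]

/-! ### Bounds for the quotient -/

theorem abs_re_le_norm_sub_mul_I (a : ℂ) (s : ℝ) : |a.re| ≤ ‖a - s * Complex.I‖ := by
  simpa using Complex.abs_re_le_norm (a - s * Complex.I)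

theorem tendsto_branchExp_down (hε : 0 < ε) (hlam : 0 < lam) {a : ℂ}
    (hdom : ∀ t : ℝ, (a.re + t * Complex.I : ℂ) ∈ branchDomain z 0) :
    Tendsto (fun s : ℝ => branchExp c z lam ε 0 (a - s * Complex.I)) atTop (𝓝 0) := by
  obtain ⟨Y, hYR, hY⟩ := exists_radius_potentialC_le c z (half_pos hlam)
  have hY0 : 0 ≤ Y := by linarith [one_le_outerRadius z]
  have hlim : Tendsto (fun s : ℝ => ‖branchExp c z lam ε 0 (a.re + (-Y : ℝ) * Complex.I)‖ *
      Real.exp (-(lam / 2 * (-Y - (a.im - s)) / ε))) atTop (𝓝 0) := by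
    rw [← mul_zero ‖branchExp c z lam ε 0 (a.re + (-Y : ℝ) * Complex.I)‖]
    refine Tendsto.const_mul _ (Real.tendsto_exp_neg_atTop_nhds_zero.comp ?_)
    have h1 : Tendsto (fun s : ℝ => lam / 2 / ε * s + lam / 2 / ε * (-Y - a.im)) atTop atTop :=
      tendsto_atTop_add_const_right _ _ (tendsto_id.const_mul_atTop (by positivity))
    refine h1.congr fun s => ?_
    ring
  refine squeeze_zero_norm' ?_ hlim
  filter_upwards [eventually_ge_atTop (a.im + Y)] with s hs
  have := norm_branchExp_tail (c := c) (lam := lam) hε (x := a.re) hY le_rfl hY0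
    (fun t _ => hdom t) (t := a.im - s) (by linarith)
  refine le_trans (le_of_eq ?_) this
  congr 2
  apply Complex.ext <;> simp

/-- Bounds for a primitive of `e^{-ih/ε} G` that vanishes at `-i∞`, in columns far from the poles:
`Φ / e^{-ih/ε}` is of order `ε`, and tends to `iεμ/λ` as the column moves to infinity. -/
theorem norm_primitive_le_of_far (hε : 0 < ε) (hlam : 0 < lam) {μ : ℂ} {w : Fin P → ℂ} {Φ : ℂ → ℂ}
    {a : ℂ} (hRa : 2 * outerRadius z ≤ |a.re|)
    (hσ : ∀ x : ℂ, |a.re| ≤ ‖x‖ → ‖potentialC c z x‖ ≤ lam / 2)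
    (hdom : ∀ t : ℝ, (a.re + t * Complex.I : ℂ) ∈ branchDomain z 0)
    (hΦ : ∀ t : ℝ, HasDerivAt Φ (branchExp c z lam ε 0 (a.re + t * Complex.I) *
      forcing z μ w (a.re + t * Complex.I)) (a.re + t * Complex.I))
    (hlim : Tendsto (fun t : ℝ => Φ (a.re + t * Complex.I)) atBot (𝓝 0)) :
    ‖Φ a‖ ≤ 4 * ε / lam * forcingNorm μ w * ‖branchExp c z lam ε 0 a‖ ∧
    ‖Φ a - Complex.I * ε * μ / lam * branchExp c z lam ε 0 a‖ ≤
      2 * ε / lam * ((2 * ∑ p, ‖w p‖ + ‖μ‖ / lam * (4 * ∑ p, ‖c p‖)) / |a.re|) *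
        ‖branchExp c z lam ε 0 a‖ := by
  have hcol : ∀ s : ℝ, a - s * Complex.I = a.re + ((a.im - s : ℝ) : ℂ) * Complex.I := fun s => by
    apply Complex.ext <;> simp
  have hdom' : ∀ s : ℝ, 0 ≤ s → a - s * Complex.I ∈ branchDomain z 0 := fun s _ => by
    rw [hcol]; exact hdom _
  have hΦ' : ∀ s : ℝ, HasDerivAt Φ (branchExp c z lam ε 0 (a - s * Complex.I) *
      forcing z μ w (a - s * Complex.I)) (a - s * Complex.I) := fun s => by
    rw [hcol]; exact hΦ _
  have hlim' : Tendsto (fun s : ℝ => Φ (a - s * Complex.I)) atTop (𝓝 0) := by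
    have h1 : Tendsto (fun s : ℝ => a.im - s) atTop atBot :=
      tendsto_atBot_add_const_left _ _ tendsto_neg_atTop_atBot
    refine (hlim.comp h1).congr fun s => ?_
    rw [Function.comp_apply, hcol]
  have hσ' : ∀ s : ℝ, 0 ≤ s → ‖potentialC c z (a - s * Complex.I)‖ ≤ lam / 2 := fun s _ =>
    hσ _ (abs_re_le_norm_sub_mul_I a s)
  have hR : ∀ s : ℝ, 2 * outerRadius z ≤ ‖a - s * Complex.I‖ := fun s =>
    hRa.trans (abs_re_le_norm_sub_mul_I a s)
  have ha0 : 0 < |a.re| := by linarith [one_le_outerRadius z]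
  constructor
  · refine (norm_le_of_tendsto_zero_down hε hlam hdom' hσ' (fun s _ => hΦ' s)
      (fun s _ => norm_forcing_le_of_le_norm μ w (hR s)) hlim').trans (le_of_eq ?_)
    ring
  · have hεc : (ε : ℂ) ≠ 0 := by exact_mod_cast hε.ne'
    have hlc : (lam : ℂ) ≠ 0 := by exact_mod_cast hlam.ne'
    refine norm_le_of_tendsto_zero_down (k := 0) (a := a)
      (Q := fun x => Φ x - Complex.I * ε * μ / lam * branchExp c z lam ε 0 x)
      (H := fun x => ∑ p, w p / (x - z p) - μ / lam * potentialC c z x) hε hlam hdom' hσ'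
      (fun s hs => ?_) (fun s _ => ?_) ?_
    · refine ((hΦ' s).sub ((hasDerivAt_branchExp (hdom' s hs)).const_mul
        (Complex.I * ε * μ / lam))).congr_deriv ?_
      rw [forcing]
      field_simp
      ring_nf
      simp only [Complex.I_sq]
      ring
    · have h0 : 0 < ‖a - s * Complex.I‖ := ha0.trans_le (abs_re_le_norm_sub_mul_I a s)
      refine (norm_sub_le _ _).trans ?_
      rw [norm_mul, norm_div, Complex.norm_real, Real.norm_eq_abs, abs_of_pos hlam]
      have h1 := norm_sum_poles_le w (hR s)
      have h2 := norm_potentialC_le (c := c) (hR s)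
      calc _ ≤ 2 * (∑ p, ‖w p‖) / ‖a - s * Complex.I‖ +
            ‖μ‖ / lam * (4 * (∑ p, ‖c p‖) / ‖a - s * Complex.I‖) := by gcongr
        _ = (2 * ∑ p, ‖w p‖ + ‖μ‖ / lam * (4 * ∑ p, ‖c p‖)) / ‖a - s * Complex.I‖ := by ring
        _ ≤ _ := by
          apply div_le_div_of_nonneg_left _ ha0 (abs_re_le_norm_sub_mul_I a s)
          positivity
    · have := hlim'.sub ((tendsto_branchExp_down (c := c) (z := z) hε hlam hdom).const_mul
        (Complex.I * ε * μ / lam))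
      simpa using this

theorem column_mem_branchDomain_of_far {x : ℝ} (hx : 2 * outerRadius z ≤ |x|) (k : ℕ) (t : ℝ) :
    (x + t * Complex.I : ℂ) ∈ branchDomain z k := by
  refine mem_branchDomain_of_re_ne fun p h => ?_
  rw [re_add_mul_I] at h
  have h1 := pole_re_im_bounds (z := z) p
  have h2 := one_le_outerRadius z
  rw [h] at hx
  rcases abs_cases (z p).re with h3 | h3 <;> linarith [h1.1, h1.2.1]

theorem left_mem_leftDomain {x s t : ℝ} (hx : x ≤ -(2 * outerRadius z))
    (hs : s ∈ uIcc (-outerRadius z) x) (k : ℕ) : (s + t * Complex.I : ℂ) ∈ leftDomain z k := by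
  refine mem_leftDomain_of_re_lt fun p => ?_
  have h2 := one_le_outerRadius z
  rw [uIcc_of_ge (by linarith)] at hs
  rw [re_add_mul_I]
  linarith [(pole_re_im_bounds (z := z) p).1, hs.2]

theorem IsBranchPrimitive.tendsto_left (hε : 0 < ε) (hlam : 0 < lam) {μ : ℂ} {w : Fin P → ℂ}
    {Φ : ℂ → ℂ} (h : IsBranchPrimitive c z lam ε 0 μ w Φ) {x : ℝ} (hx : x ≤ -(2 * outerRadius z)) :
    Tendsto (fun t : ℝ => Φ (x + t * Complex.I)) atBot (𝓝 0) := by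
  refine tendsto_zero_column (x₀ := -outerRadius z) hε hlam
    (fun s hs t => (left_mem_leftDomain hx hs 0).1)
    (fun s hs t => h.hasDerivAt _ (left_mem_leftDomain hx hs 0)) ?_
  refine h.bottom.congr fun t => ?_
  rw [column_eq]

theorem IsJostQuotient.left_bounds (hε : 0 < ε) (hlam : 0 < lam) {μ : ℂ} {w : Fin P → ℂ}
    {Φ n : ℂ → ℂ} (h : IsJostQuotient c z lam ε μ w Φ n) {a : ℂ}
    (hRa : a.re ≤ -(2 * outerRadius z))
    (hσ : ∀ x : ℂ, |a.re| ≤ ‖x‖ → ‖potentialC c z x‖ ≤ lam / 2) :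
    ‖n a‖ ≤ 4 * ε / lam * forcingNorm μ w ∧
    ‖n a - Complex.I * ε * μ / lam‖ ≤
      2 * ε / lam * ((2 * ∑ p, ‖w p‖ + ‖μ‖ / lam * (4 * ∑ p, ‖c p‖)) / |a.re|) := by
  have hR : 2 * outerRadius z ≤ |a.re| := by
    rw [abs_of_nonpos (by linarith [one_le_outerRadius z])]; linarith
  have ha : (a.re + a.im * Complex.I : ℂ) = a := Complex.re_add_im a
  have hmem : ∀ t : ℝ, (a.re + t * Complex.I : ℂ) ∈ leftDomain z 0 := fun t =>
    left_mem_leftDomain hRa right_mem_uIcc 0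
  have hE : 0 < ‖branchExp c z lam ε 0 a‖ := norm_pos_iff.mpr (branchExp_ne_zero 0 a)
  obtain ⟨h1, h2⟩ := norm_primitive_le_of_far hε hlam hR hσ (fun t => (hmem t).1)
    (fun t => h.primitive.hasDerivAt _ (hmem t)) (h.primitive.tendsto_left hε hlam hRa)
  have hq := h.eq_mul a (ha ▸ (hmem a.im).1)
  rw [hq, norm_mul, mul_comm] at h1
  rw [hq, mul_comm (Complex.I * ε * μ / lam), ← mul_sub, norm_mul, mul_comm] at h2
  exact ⟨le_of_mul_le_mul_right h1 hE, le_of_mul_le_mul_right h2 hE⟩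

/-- Along a path on which the homogeneous equation is stable the norm of a solution grows at most
by the integral of the inhomogeneity. -/
theorem norm_le_of_stable {N g s : ℝ → ℂ} {a b K : ℝ} (hab : a ≤ b)
    (hN : ∀ t ∈ Icc a b, HasDerivAt N (g t + s t * N t) t)
    (hs : ∀ t ∈ Icc a b, (s t).re ≤ 0) (hg : ∀ t ∈ Icc a b, ‖g t‖ ≤ K) :
    ‖N b‖ ≤ ‖N a‖ + K * (b - a) := by
  -- the norm is regularized, since it is not differentiable at the zeros of `N`
  refine le_of_forall_pos_le_add fun δ hδ => ?_
  set r : ℝ → ℝ := fun t => √(‖N t‖ ^ 2 + δ ^ 2) with hr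
  have hpos : ∀ t, 0 < ‖N t‖ ^ 2 + δ ^ 2 := fun t => by positivity
  have hder : ∀ t ∈ Icc a b, HasDerivAt r
      ((2 * inner ℝ (N t) (g t + s t * N t)) / (2 * √(‖N t‖ ^ 2 + δ ^ 2))) t := fun t ht =>
    ((hN t ht).norm_sq.add_const _).sqrt (hpos t).ne'
  have hbound : ∀ t ∈ Icc a b,
      (2 * inner ℝ (N t) (g t + s t * N t)) / (2 * √(‖N t‖ ^ 2 + δ ^ 2)) ≤ K := by
    intro t ht
    have hK : 0 ≤ K := (norm_nonneg _).trans (hg t ht)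
    have hsq : 0 < √(‖N t‖ ^ 2 + δ ^ 2) := Real.sqrt_pos.mpr (hpos t)
    have hle : ‖N t‖ ≤ √(‖N t‖ ^ 2 + δ ^ 2) := Real.le_sqrt_of_sq_le (by nlinarith)
    rw [mul_div_mul_left _ _ two_ne_zero, div_le_iff₀ hsq, inner_add_right]
    have h1 : inner ℝ (N t) (g t) ≤ ‖N t‖ * ‖g t‖ := real_inner_le_norm _ _
    have h2 : inner ℝ (N t) (s t * N t) = (s t).re * ‖N t‖ ^ 2 := by
      rw [Complex.inner, ← Complex.normSq_eq_norm_sq, Complex.normSq_apply]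
      simp
      ring
    have h3 : (s t).re * ‖N t‖ ^ 2 ≤ 0 := mul_nonpos_of_nonpos_of_nonneg (hs t ht) (sq_nonneg _)
    have h4 : ‖N t‖ * ‖g t‖ ≤ √(‖N t‖ ^ 2 + δ ^ 2) * K :=
      mul_le_mul hle (hg t ht) (norm_nonneg _) hsq.le
    linarith
  have hcont : ContinuousOn r (Icc a b) := fun t ht => (hder t ht).continuousAt.continuousWithinAt
  have hmv := (convex_Icc a b).image_sub_le_mul_sub_of_deriv_le hcont
    (fun t ht => (hder t (interior_subset ht)).differentiableAt.differentiableWithinAt)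
    (fun t ht => by rw [(hder t (interior_subset ht)).deriv]; exact hbound t (interior_subset ht))
    a (left_mem_Icc.mpr hab) b (right_mem_Icc.mpr hab) hab
  have h1 : ‖N b‖ ≤ r b := Real.le_sqrt_of_sq_le (by nlinarith)
  have h2 : r a ≤ ‖N a‖ + δ := by
    refine Real.sqrt_le_iff.mpr ⟨by positivity, ?_⟩
    nlinarith [norm_nonneg (N a)]
  linarith

theorem IsJostQuotient.norm_le_of_stable_segment {μ : ℂ} {w : Fin P → ℂ}
    {Φ n : ℂ → ℂ} (h : IsJostQuotient c z lam ε μ w Φ n) (hε : 0 < ε) {a d : ℂ} {t₀ t₁ K : ℝ}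
    (h01 : t₀ ≤ t₁) (hdom : ∀ t ∈ Icc t₀ t₁, a + t * d ∈ lowerCutPlane z)
    (hne : ∀ t ∈ Icc t₀ t₁, ∀ p, a + t * d ≠ z p)
    (hstab : ∀ t ∈ Icc t₀ t₁, (Complex.I * (lam + potentialC c z (a + t * d)) * d).re ≤ 0)
    (hK : ∀ t ∈ Icc t₀ t₁, ‖forcing z μ w (a + t * d)‖ * ‖d‖ ≤ K) :
    ‖n (a + t₁ * d)‖ ≤ ‖n (a + t₀ * d)‖ + K * (t₁ - t₀) := by
  refine norm_le_of_stable (N := fun t : ℝ => n (a + t * d))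
    (g := fun t => d * forcing z μ w (a + t * d))
    (s := fun t => Complex.I * (lam + potentialC c z (a + t * d)) * d / ε) h01
    (fun t ht => ?_) (fun t ht => ?_) fun t ht => ?_
  · refine (hasDerivAt_comp_line (h.hasDerivAt _ (hdom t ht) (hne t ht))).congr_deriv ?_
    ring
  · rw [Complex.div_ofReal_re]
    exact div_nonpos_of_nonpos_of_nonneg (hstab t ht) hε.le
  · rw [norm_mul, mul_comm]
    exact hK t ht

theorem exists_pos_forall_le {ι : Type*} [Finite ι] {f : ι → ℝ} (h : ∀ i, 0 < f i) :
    ∃ d : ℝ, 0 < d ∧ ∀ i, d ≤ f i := by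
  cases isEmpty_or_nonempty ι
  · exact ⟨1, one_pos, fun i => (IsEmpty.false i).elim⟩
  · obtain ⟨i, hi⟩ := Finite.exists_min f
    exact ⟨f i, h i, hi⟩

theorem im_potentialC_ofReal (x : ℝ) : (potentialC c z x).im = 0 := by
  rw [potentialC_ofReal, Complex.ofReal_im]

/-- The homogeneous equation is neutral on the real axis, so `n` is of the order of the forcing
there. -/
theorem exists_bound_real (hz : ∀ p, 0 < (z p).im) (hlam : 0 < lam) (Y₀ : ℝ) :
    ∃ C : ℝ, 0 ≤ C ∧ ∀ ε : ℝ, 0 < ε → ε ≤ 1 → ∀ (μ : ℂ) (w : Fin P → ℂ) (Φ n : ℂ → ℂ),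
      IsJostQuotient c z lam ε μ w Φ n → ∀ x : ℝ, |x| ≤ Y₀ → ‖n x‖ ≤ C * forcingNorm μ w := by
  obtain ⟨Y', hYR, hY'⟩ := exists_radius_potentialC_le c z (half_pos hlam)
  obtain ⟨d, hd, hdz⟩ := exists_pos_forall_le hz
  set Y := max Y' Y₀ with hY
  have hY1 : Y' ≤ Y := le_max_left _ _
  have hR := one_le_outerRadius z
  have hYpos : 0 < Y := by linarith
  refine ⟨4 / lam + (1 + 1 / d) * (2 * Y), by positivity, fun ε hε hε1 μ w Φ n h x hx => ?_⟩
  have hxY := abs_le.mp (hx.trans (le_max_right Y' Y₀))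
  have hγ := forcingNorm_nonneg μ w
  have hleft : ‖n ((-Y : ℝ) : ℂ)‖ ≤ 4 / lam * forcingNorm μ w := by
    refine ((h.left_bounds hε hlam (a := ((-Y : ℝ) : ℂ))
      (by rw [Complex.ofReal_re]; linarith) fun y hy => hY' y (le_trans ?_ hy)).1).trans ?_
    · rw [Complex.ofReal_re, abs_neg, abs_of_nonneg (by linarith)]; exact hY1
    · gcongr
      nlinarith
  have := h.norm_le_of_stable_segment hε (a := 0) (d := 1) (t₀ := -Y) (t₁ := x)
    (K := (1 + 1 / d) * forcingNorm μ w) hxY.1 (fun t _ => ?_) (fun t _ p => ?_) (fun t _ => ?_)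
    fun t _ => ?_
  · simp only [zero_add, mul_one] at this
    refine this.trans ?_
    have h2 : (1 + 1 / d) * forcingNorm μ w * (x - -Y) ≤
        (1 + 1 / d) * forcingNorm μ w * (2 * Y) := by
      gcongr; linarith
    linarith
  · exact mem_lowerCutPlane_of_im_pos hz (by simp)
  · intro hp
    have := congrArg Complex.im hp
    simp at this
    linarith [hz p]
  · simp only [zero_add, mul_one]
    simp [im_potentialC_ofReal]
  · rw [norm_one, mul_one]
    refine norm_forcing_le μ w hd fun p => ?_
    have h1 := Complex.abs_im_le_norm (0 + (t : ℂ) * 1 - z p)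
    simp only [zero_add, mul_one, Complex.sub_im, Complex.ofReal_im, zero_sub, abs_neg] at h1 ⊢
    exact (hdz p).trans ((le_abs_self _).trans h1)

/-- In the closed upper half-plane `n` is of the order of the forcing: this holds on the real axis
and, by stability, on two segments that form a large triangle with it. -/
theorem exists_bound_upper (hz : ∀ p, 0 < (z p).im) (hlam : 0 < lam) (Y₀ : ℝ) :
    ∃ C : ℝ, 0 ≤ C ∧ ∀ ε : ℝ, 0 < ε → ε ≤ 1 → ∀ (μ : ℂ) (w : Fin P → ℂ) (Φ n : ℂ → ℂ),
      IsJostQuotient c z lam ε μ w Φ n → ∀ x : ℂ, 0 ≤ x.im → ‖x‖ ≤ Y₀ →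
        ‖n x‖ ≤ C * forcingNorm μ w := by
  obtain ⟨Y', hYR, hY'⟩ := exists_radius_potentialC_le c z (show 0 < lam / 4 by positivity)
  set Y := 2 * max Y' Y₀ with hY
  have hY1 : 2 * Y' ≤ Y := by rw [hY]; gcongr; exact le_max_left _ _
  have hY2 : 2 * Y₀ ≤ Y := by rw [hY]; gcongr; exact le_max_right _ _
  have hR := one_le_outerRadius z
  obtain ⟨C₀, hC₀, hreal⟩ := exists_bound_real (c := c) hz hlam Y
  refine ⟨C₀ + 4 * Y, by nlinarith, fun ε hε hε1 μ w Φ n h => ?_⟩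
  have hγ := forcingNorm_nonneg μ w
  have hY0 : 0 < Y := by linarith
  have hbase : ∀ x : ℝ, |x| ≤ Y → ‖n x‖ ≤ C₀ * forcingNorm μ w := hreal ε hε hε1 μ w Φ n h
  -- the two upper sides, of directions `s + i` with `s = ±1`
  have hside : ∀ s : ℝ, (s = 1 ∨ s = -1) → ∀ t : ℝ, 0 ≤ t → t ≤ Y →
      ‖n (((-s * Y : ℝ) : ℂ) + t * (s + Complex.I))‖ ≤ (C₀ + 4 * Y) * forcingNorm μ w := by
    intro s hs t ht htY
    have hre : ∀ τ : ℝ, (((-s * Y : ℝ) : ℂ) + τ * (s + Complex.I)).re = s * (τ - Y) := fun τ => by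
      simp; ring
    have him : ∀ τ : ℝ, (((-s * Y : ℝ) : ℂ) + τ * (s + Complex.I)).im = τ := fun τ => by simp
    have hnorm : ∀ τ : ℝ, Y' ≤ ‖((-s * Y : ℝ) : ℂ) + τ * (s + Complex.I)‖ := by
      intro τ
      by_cases hτ : Y' ≤ τ
      · refine le_trans ?_ (Complex.abs_im_le_norm _)
        rw [him]
        exact hτ.trans (le_abs_self _)
      · refine le_trans ?_ (Complex.abs_re_le_norm _)
        rw [hre, abs_mul]
        have : |s| = 1 := by rcases hs with rfl | rfl <;> simp
        rw [this, one_mul, abs_sub_comm]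
        refine le_trans ?_ (le_abs_self _)
        push Not at hτ
        linarith
    have hs1 : ‖(s + Complex.I : ℂ)‖ ≤ 2 := by
      refine (norm_add_le _ _).trans ?_
      rw [Complex.norm_real, Complex.norm_I]
      rcases hs with rfl | rfl <;> norm_num
    have := h.norm_le_of_stable_segment hε (a := ((-s * Y : ℝ) : ℂ)) (d := s + Complex.I)
      (t₀ := 0) (t₁ := t) (K := 4 * forcingNorm μ w) ht (fun τ hτ => ?_) (fun τ hτ p hp => ?_)
      (fun τ hτ => ?_) fun τ hτ => ?_
    · refine this.trans ?_
      have h1 : ‖n (((-s * Y : ℝ) : ℂ) + (0 : ℝ) * (s + Complex.I))‖ ≤ C₀ * forcingNorm μ w := by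
        rw [Complex.ofReal_zero, zero_mul, add_zero]
        refine hbase _ ?_
        rcases hs with rfl | rfl <;> simp [abs_of_pos hY0]
      have h2 : 4 * forcingNorm μ w * (t - 0) ≤ 4 * forcingNorm μ w * Y := by
        gcongr; linarith
      linarith
    · exact mem_lowerCutPlane_of_im_pos hz (by rw [him]; exact hτ.1)
    · have h1 := norm_pole_lt_outerRadius (z := z) p
      have h2 := hnorm τ
      rw [hp] at h2
      linarith
    · set u := potentialC c z (((-s * Y : ℝ) : ℂ) + τ * (s + Complex.I)) with hu
      have hu1 : ‖u‖ ≤ lam / 4 := hY' _ (hnorm τ)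
      have h1 := Complex.abs_re_le_norm u
      have h2 := Complex.abs_im_le_norm u
      have h3 := abs_le.mp (h1.trans hu1)
      have h4 := abs_le.mp (h2.trans hu1)
      have : (Complex.I * (lam + u) * (s + Complex.I)).re = -lam - u.re - s * u.im := by
        simp; ring
      rw [this]
      rcases hs with rfl | rfl <;> linarith [h3.1, h4.1, h4.2]
    · have := norm_forcing_le_of_le_norm μ w (hYR.trans (hnorm τ))
      calc _ ≤ (2 * forcingNorm μ w) * 2 := by gcongr
        _ = _ := by ring
  set U : Set ℂ := {x | 0 < x.im ∧ x.im < x.re + Y ∧ x.im < Y - x.re} with hU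
  set T : Set ℂ := {x | 0 ≤ x.im ∧ x.im ≤ x.re + Y ∧ x.im ≤ Y - x.re} with hT
  have hUopen : IsOpen U := by
    refine (isOpen_lt continuous_const Complex.continuous_im).inter
      ((isOpen_lt Complex.continuous_im (by fun_prop)).inter
        (isOpen_lt Complex.continuous_im (by fun_prop)))
  have hTclosed : IsClosed T := by
    refine (isClosed_le continuous_const Complex.continuous_im).inter
      ((isClosed_le Complex.continuous_im (by fun_prop)).inter
        (isClosed_le Complex.continuous_im (by fun_prop)))
  have hclos : closure U ⊆ T :=
    closure_minimal (fun x hx => ⟨hx.1.le, hx.2.1.le, hx.2.2.le⟩) hTclosed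
  have hbdry : ∀ x ∈ T, x ∉ U → ‖n x‖ ≤ (C₀ + 4 * Y) * forcingNorm μ w := by
    intro x hx hxU
    obtain ⟨h0, h1, h2⟩ := hx
    rcases h0.eq_or_lt with h0' | h0'
    · have hxr : x = (x.re : ℂ) := Complex.ext (by simp) (by simp [← h0'])
      rw [hxr]
      refine (hbase x.re (abs_le.mpr ⟨by linarith, by linarith⟩)).trans ?_
      nlinarith
    · rcases h1.eq_or_lt with h1' | h1'
      · have hx1 : x = ((-1 * Y : ℝ) : ℂ) + x.im * ((1 : ℝ) + Complex.I) := by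
          apply Complex.ext <;> simp; linarith
        rw [hx1]
        exact hside 1 (Or.inl rfl) x.im h0 (by linarith)
      · have h2' : x.im = Y - x.re := by
          by_contra hne
          exact hxU ⟨h0', h1', lt_of_le_of_ne h2 hne⟩
        have hx1 : x = ((- -1 * Y : ℝ) : ℂ) + x.im * ((-1 : ℝ) + Complex.I) := by
          apply Complex.ext <;> simp; linarith
        rw [hx1]
        exact hside (-1) (Or.inr rfl) x.im h0 (by linarith)
  intro x hx hxY
  have hxT : x ∈ T := by
    have h1 := abs_le.mp ((Complex.abs_re_le_norm x).trans hxY)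
    have h2 := abs_le.mp ((Complex.abs_im_le_norm x).trans hxY)
    exact ⟨hx, by linarith, by linarith⟩
  by_cases hxU : x ∈ U
  · have hbd : Bornology.IsBounded U := by
      refine (Metric.isBounded_closedBall (x := (0 : ℂ)) (r := 2 * Y)).subset fun y hy => ?_
      rw [mem_closedBall_zero_iff]
      refine (Complex.norm_le_abs_re_add_abs_im y).trans ?_
      obtain ⟨h1, h2, h3⟩ := hy
      have h4 : |y.re| ≤ Y := abs_le.mpr ⟨by linarith, by linarith⟩
      have h5 : |y.im| ≤ Y := abs_le.mpr ⟨by linarith, by linarith⟩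
      linarith
    refine Complex.norm_le_of_forall_mem_frontier_norm_le hbd
      (DifferentiableOn.diffContOnCl fun y hy => (h.differentiableAt y
        (mem_lowerCutPlane_of_im_pos hz (hclos hy).1)).differentiableWithinAt)
      (fun y hy => hbdry y (hclos hy.1) fun hyU => hy.2 (hUopen.interior_eq.symm ▸ hyU))
      (subset_closure hxU)
  · exact hbdry x hxT hxU

/-- A function that is real and strictly increasing on a segment of the real axis has nonpositive
imaginary part just below it. -/
theorem exists_strip_im_nonpos {f : ℂ → ℂ} {d A B : ℝ} (hd : 0 < d)
    (hf : DifferentiableOn ℂ f {x | |x.im| < d}) (hreal : ∀ x : ℝ, (f x).im = 0)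
    (hpos : ∀ x ∈ Icc A B, 0 < (deriv f (x : ℝ)).re) :
    ∃ ρ : ℝ, 0 < ρ ∧ ρ < d ∧ ∀ x : ℂ, A ≤ x.re → x.re ≤ B → -ρ ≤ x.im → x.im ≤ 0 →
      (f x).im ≤ 0 := by
  set V : Set ℂ := {x | |x.im| < d} with hV
  have hVo : IsOpen V := isOpen_lt (by fun_prop) continuous_const
  have hcont : ContinuousOn (fun x => (deriv f x).re) V :=
    Complex.continuous_re.comp_continuousOn (hf.deriv hVo).continuousOn
  set O := V ∩ (fun x => (deriv f x).re) ⁻¹' Ioi 0 with hO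
  have hOo : IsOpen O := hcont.isOpen_inter_preimage hVo isOpen_Ioi
  set K : Set ℂ := (fun x : ℝ => (x : ℂ)) '' Icc A B with hK
  have hKc : IsCompact K := isCompact_Icc.image Complex.continuous_ofReal
  have hKO : K ⊆ O := by
    rintro _ ⟨x, hx, rfl⟩
    exact ⟨by simp [hV, hd], hpos x hx⟩
  obtain ⟨δ, hδ, hδO⟩ := hKc.exists_thickening_subset_open hOo hKO
  refine ⟨min (δ / 2) (d / 2), by positivity, (min_le_right _ _).trans_lt (by linarith),
    fun x h1 h2 h3 h4 => ?_⟩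
  have hmem : ∀ τ ∈ Icc x.im 0, (x.re + τ * Complex.I : ℂ) ∈ O := by
    intro τ hτ
    apply hδO
    rw [Metric.mem_thickening_iff]
    refine ⟨(x.re : ℂ), ⟨x.re, ⟨h1, h2⟩, rfl⟩, ?_⟩
    rw [dist_eq_norm, add_sub_cancel_left, norm_mul, Complex.norm_real, Complex.norm_I, mul_one,
      Real.norm_eq_abs, abs_of_nonpos hτ.2]
    have := min_le_left (δ / 2) (d / 2)
    linarith [hτ.1]
  -- the imaginary part vanishes on the axis and has the derivative `Re f'` upwards
  have hder : ∀ τ ∈ Icc x.im 0, HasDerivAt (fun τ : ℝ => (f (x.re + τ * Complex.I)).im)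
      (deriv f (x.re + τ * Complex.I)).re τ := by
    intro τ hτ
    have hdiff := (hf.differentiableAt (hVo.mem_nhds (hmem τ hτ).1)).hasDerivAt
    have h2 := Complex.imCLM.hasFDerivAt.comp_hasDerivAt τ (hasDerivAt_comp_line (d := Complex.I) hdiff)
    refine h2.congr_deriv ?_
    simp
  have hmono : MonotoneOn (fun τ : ℝ => (f (x.re + τ * Complex.I)).im) (Icc x.im 0) := by
    refine monotoneOn_of_deriv_nonneg (convex_Icc _ _)
      (fun τ hτ => (hder τ hτ).continuousAt.continuousWithinAt)
      (fun τ hτ => (hder τ (interior_subset hτ)).differentiableAt.differentiableWithinAt)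
      fun τ hτ => ?_
    rw [(hder τ (interior_subset hτ)).deriv]
    exact le_of_lt (hmem τ (interior_subset hτ)).2
  have := hmono (left_mem_Icc.mpr h4) (right_mem_Icc.mpr h4) h4
  simp only [Complex.ofReal_zero, zero_mul, add_zero, hreal, Complex.re_add_im] at this
  exact this

theorem differentiableOn_potentialC_strip {d : ℝ} (hdz : ∀ p, d ≤ (z p).im) :
    DifferentiableOn ℂ (potentialC c z) {x | |x.im| < d} := fun x hx => by
  have h2 := abs_lt.mp (show |x.im| < d from hx)
  refine (differentiableAt_potentialC (fun p hp => ?_) fun p hp => ?_).differentiableWithinAt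
  · rw [hp] at h2; linarith [hdz p, h2.2]
  · rw [hp, Complex.conj_im] at h2; linarith [hdz p, h2.1]

/-- Below a part of the real axis on which `u₀` is decreasing, horizontal lines are stable. -/
theorem exists_bound_lower (hz : ∀ p, 0 < (z p).im) (hlam : 0 < lam) {B₁ : ℝ}
    (hdec : ∀ x : ℝ, x ≤ B₁ → (deriv (potentialC c z) x).re < 0) :
    ∃ C ρ : ℝ, 0 ≤ C ∧ 0 < ρ ∧ (∀ p, ρ < (z p).im) ∧ ∀ ε : ℝ, 0 < ε → ε ≤ 1 →
      ∀ (μ : ℂ) (w : Fin P → ℂ) (Φ n : ℂ → ℂ),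
      IsJostQuotient c z lam ε μ w Φ n → ∀ x : ℂ, x.re ≤ B₁ → -ρ ≤ x.im → x.im ≤ 0 →
        ‖n x‖ ≤ C * forcingNorm μ w := by
  obtain ⟨Y, hYR, hY⟩ := exists_radius_potentialC_le c z (half_pos hlam)
  obtain ⟨d, hd, hdz⟩ := exists_pos_forall_le hz
  have hR := one_le_outerRadius z
  have hdiff := differentiableOn_potentialC_strip (c := c) hdz
  obtain ⟨ρ, hρ, hρd, hρ'⟩ := exists_strip_im_nonpos (f := fun x => -potentialC c z x) (A := -Y)
    (B := B₁) hd hdiff.neg (fun x => by simp [im_potentialC_ofReal]) fun x hx => by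
      rw [deriv.fun_neg, Complex.neg_re]
      linarith [hdec x hx.2]
  refine ⟨4 / lam + (1 + 1 / d) * (B₁ + Y) * (if -Y ≤ B₁ then 1 else 0), ρ, ?_, hρ,
    fun p => hρd.trans_le (hdz p), fun ε hε hε1 μ w Φ n h x hxB hxρ hx0 => ?_⟩
  · split_ifs with h
    · have : 0 ≤ B₁ + Y := by linarith
      positivity
    · rw [mul_zero, add_zero]; positivity
  have hγ := forcingNorm_nonneg μ w
  have hleft : ∀ y : ℂ, y.re ≤ -Y → ‖n y‖ ≤ 4 / lam * forcingNorm μ w := fun y hy => by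
    refine ((h.left_bounds hε hlam (a := y)
      (by linarith) fun v hv => hY v (le_trans ?_ hv)).1).trans ?_
    · rw [abs_of_nonpos (by linarith)]; linarith
    · gcongr
      nlinarith
  by_cases hxY : x.re ≤ -Y
  · refine (hleft x hxY).trans (mul_le_mul_of_nonneg_right ?_ hγ)
    split_ifs with h
    · have : 0 ≤ B₁ + Y := by linarith
      have : 0 ≤ (1 + 1 / d) * (B₁ + Y) * 1 := by positivity
      linarith
    · linarith
  · push Not at hxY
    rw [if_pos (by linarith)]
    have hline : ∀ t : ℝ, x.im * Complex.I + t * 1 = (t + x.im * Complex.I : ℂ) := fun t => by ring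
    have hmemd : ∀ t : ℝ, ∀ p, -(z p).im < x.im := fun t p => by linarith [hdz p]
    have := h.norm_le_of_stable_segment hε (a := x.im * Complex.I) (d := 1) (t₀ := -Y) (t₁ := x.re)
      (K := (1 + 1 / d) * forcingNorm μ w) hxY.le (fun t _ p _ => ?_) (fun t _ p hp => ?_)
      (fun t ht => ?_) fun t _ => ?_
    · rw [hline, Complex.re_add_im] at this
      refine this.trans ?_
      have h1 := hleft (x.im * Complex.I + ((-Y : ℝ) : ℂ) * 1) (by simp)
      have h2 : (1 + 1 / d) * forcingNorm μ w * (x.re - -Y) ≤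
          (1 + 1 / d) * forcingNorm μ w * (B₁ + Y) := by
        gcongr; linarith
      linarith
    · rw [hline, im_add_mul_I]; exact hmemd t p
    · have := congrArg Complex.im hp
      rw [hline, im_add_mul_I] at this
      linarith [hz p]
    · rw [hline, mul_one]
      have him := hρ' (t + x.im * Complex.I) (by rw [re_add_mul_I]; exact ht.1)
        (by rw [re_add_mul_I]; exact ht.2.trans hxB) (by rwa [im_add_mul_I]) (by rwa [im_add_mul_I])
      rw [Complex.neg_im, neg_nonpos] at him
      simp
      exact him
    · rw [norm_one, mul_one]
      refine norm_forcing_le μ w hd fun p => ?_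
      have h1 := Complex.abs_im_le_norm (x.im * Complex.I + (t : ℂ) * 1 - z p)
      rw [hline, Complex.sub_im, im_add_mul_I, abs_of_nonpos (by linarith [hz p])] at h1
      rw [hline]
      linarith [hdz p]

/-! ### Division by a polynomial with roots in a disc -/

theorem eqOn_of_eqOn_diff_finite {f g : ℂ → ℂ} {U S : Set ℂ} (hU : IsOpen U) (hS : S.Finite)
    (hf : ContinuousOn f U) (hg : ContinuousOn g U) (h : ∀ x ∈ U, x ∉ S → f x = g x) :
    ∀ x ∈ U, f x = g x := by
  intro x hx
  have hUx : U ∈ 𝓝 x := hU.mem_nhds hx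
  have hSx : (S \ {x})ᶜ ∈ 𝓝 x :=
    (hS.subset sdiff_subset).isClosed.isOpen_compl.mem_nhds (by simp)
  refine tendsto_nhds_unique_of_eventuallyEq
    ((hf.continuousAt hUx).tendsto.mono_left (nhdsWithin_le_nhds (s := {x}ᶜ)))
    ((hg.continuousAt hUx).tendsto.mono_left nhdsWithin_le_nhds) ?_
  filter_upwards [mem_nhdsWithin_of_mem_nhds hUx, mem_nhdsWithin_of_mem_nhds hSx,
    self_mem_nhdsWithin] with y hy1 hy2 hy3
  exact h y hy1 fun hyS => hy2 ⟨hyS, hy3⟩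

theorem norm_dslope_le_of_mem_ball {c₀ r : ℂ} {ρ₁ ρ₂ B : ℝ} (h₁₂ : ρ₁ < ρ₂)
    (hr : r ∈ Metric.ball c₀ ρ₁) {F : ℂ → ℂ} (hF : DifferentiableOn ℂ F (Metric.ball c₀ ρ₂))
    (hB : ∀ y ∈ Metric.ball c₀ ρ₂, ‖F y‖ ≤ B) {y : ℂ} (hy : y ∈ Metric.ball c₀ ρ₂) :
    ‖dslope F r y‖ ≤ 4 / (ρ₂ - ρ₁) * B := by
  have hr2 : r ∈ Metric.ball c₀ ρ₂ := Metric.ball_subset_ball h₁₂.le hr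
  set ρ := max ((ρ₁ + ρ₂) / 2) ((dist y c₀ + ρ₂) / 2) with hρ
  have hρ1 : (ρ₁ + ρ₂) / 2 ≤ ρ := le_max_left _ _
  have hyρ : dist y c₀ < ρ := lt_of_lt_of_le (by linarith [Metric.mem_ball.mp hy]) (le_max_right _ _)
  have hρ2 : ρ < ρ₂ := max_lt (by linarith) (by linarith [Metric.mem_ball.mp hy])
  have hρ0 : 0 < ρ := dist_nonneg.trans_lt hyρ
  have hd : DifferentiableOn ℂ (dslope F r) (Metric.ball c₀ ρ₂) :=
    (Complex.differentiableOn_dslope (Metric.isOpen_ball.mem_nhds hr2)).mpr hF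
  have hB0 : 0 ≤ B := (norm_nonneg _).trans (hB y hy)
  refine Complex.norm_le_of_forall_mem_frontier_norm_le (U := Metric.ball c₀ ρ) Metric.isBounded_ball
    (DifferentiableOn.diffContOnCl ((hd.mono ?_))) (fun x hx => ?_)
    (subset_closure (Metric.mem_ball.mpr hyρ))
  · rw [closure_ball _ hρ0.ne']
    exact Metric.closedBall_subset_ball hρ2
  · rw [frontier_ball _ hρ0.ne', Metric.mem_sphere] at hx
    have h1 : (ρ₂ - ρ₁) / 2 ≤ ‖x - r‖ := by
      rw [← dist_eq_norm]
      have := dist_triangle_left x c₀ r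
      have h2 := Metric.mem_ball.mp hr
      have h3 := dist_triangle x r c₀
      linarith
    have h0 : 0 < ‖x - r‖ := by linarith
    have hxr : x ≠ r := by
      rintro rfl
      simp at h0
    rw [dslope_of_ne _ hxr, slope_def_field, norm_div, div_le_iff₀ h0]
    have h2 : ‖F x - F r‖ ≤ 2 * B := by
      refine (norm_sub_le _ _).trans ?_
      have := hB x (Metric.mem_ball.mpr (by linarith))
      have := hB r hr2
      linarith
    refine h2.trans ?_
    have h4 : 0 < ρ₂ - ρ₁ := by linarith
    calc 2 * B = 4 / (ρ₂ - ρ₁) * B * ((ρ₂ - ρ₁) / 2) := by field_simp; ring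
      _ ≤ _ := by gcongr

/-- A polynomial `D` of degree less than the number of the points `r` in a disc that is congruent
to a function `F` modulo `∏ (x - r)` there is bounded, at every point of the plane, by a multiple
of the supremum of `|F|` in a larger disc. -/
theorem exists_norm_eval_le_of_eq_prod_mul_add {c₀ : ℂ} {ρ₁ ρ₂ : ℝ} (h₁₂ : ρ₁ < ρ₂) (x : ℂ)
    (rs : List ℂ) (hrs : ∀ r ∈ rs, r ∈ Metric.ball c₀ ρ₁) :
    ∃ K : ℝ, 0 ≤ K ∧ ∀ (D : ℂ[X]) (A F : ℂ → ℂ) (B : ℝ), D.degree < rs.length →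
      ContinuousOn A (Metric.ball c₀ ρ₂) → DifferentiableOn ℂ F (Metric.ball c₀ ρ₂) → 0 ≤ B →
      (∀ y ∈ Metric.ball c₀ ρ₂, ‖F y‖ ≤ B) →
      (∀ y ∈ Metric.ball c₀ ρ₂, D.eval y = (rs.map fun r => y - r).prod * A y + F y) →
      ‖D.eval x‖ ≤ K * B := by
  induction rs with
  | nil =>
    refine ⟨0, le_rfl, fun D A F B hD _ _ _ _ _ => ?_⟩
    have : D = 0 := by
      rw [← Polynomial.degree_eq_bot]
      simpa using hD
    simp [this]
  | cons r rs ih =>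
    obtain ⟨K, hK, ih⟩ := ih fun s hs => hrs s (List.mem_cons_of_mem r hs)
    have hr := hrs r List.mem_cons_self
    have hr2 : r ∈ Metric.ball c₀ ρ₂ := Metric.ball_subset_ball h₁₂.le hr
    have h4 : 0 < ρ₂ - ρ₁ := by linarith
    refine ⟨‖x - r‖ * (K * (4 / (ρ₂ - ρ₁))) + 1, by positivity, fun D A F B hD hA hF hB0 hB heq => ?_⟩
    set D₁ := D /ₘ (X - C r) with hD₁
    have hdiv : ∀ y, D.eval y = (y - r) * D₁.eval y + D.eval r := fun y => by
      have h1 := Polynomial.modByMonic_add_div D (X - C r)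
      have h2 := congrArg (Polynomial.eval y) h1
      rw [Polynomial.modByMonic_X_sub_C_eq_C_eval] at h2
      simp only [eval_add, eval_mul, eval_sub, eval_X, eval_C] at h2
      rw [← h2]; ring
    have hDr : D.eval r = F r := by simpa using heq r hr2
    have hdeg : D₁.degree < rs.length := by
      by_cases hD0 : D = 0
      · rw [hD₁, hD0, Polynomial.zero_divByMonic, Polynomial.degree_zero]
        exact WithBot.bot_lt_coe _
      · refine (Polynomial.degree_divByMonic_lt D (X - C r) hD0 (by simp)).trans_le ?_
        rw [Polynomial.degree_eq_natDegree hD0] at hD ⊢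
        exact WithBot.coe_le_coe.mpr (Nat.lt_succ_iff.mp (WithBot.coe_lt_coe.mp hD))
    have hd : DifferentiableOn ℂ (dslope F r) (Metric.ball c₀ ρ₂) :=
      (Complex.differentiableOn_dslope (Metric.isOpen_ball.mem_nhds hr2)).mpr hF
    have hprod : Continuous fun y : ℂ => (rs.map fun r => y - r).prod :=
      continuous_list_prod _ fun s _ => by fun_prop
    have heq₁ := eqOn_of_eqOn_diff_finite (f := fun y => D₁.eval y)
      (g := fun y => (rs.map fun r => y - r).prod * A y + dslope F r y) Metric.isOpen_ball
      (finite_singleton r) D₁.continuous.continuousOn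
      ((hprod.continuousOn.mul hA).add hd.continuousOn) fun y hy hyr => by
        have hyr' : y ≠ r := hyr
        have h0 : y - r ≠ 0 := sub_ne_zero.mpr hyr'
        have h1 := heq y hy
        rw [hdiv y, List.map_cons, List.prod_cons, hDr] at h1
        rw [dslope_of_ne _ hyr', slope_def_field]
        field_simp
        linear_combination h1
    have h1 := ih D₁ A (dslope F r) (4 / (ρ₂ - ρ₁) * B) hdeg hA hd (by positivity)
      (fun y hy => norm_dslope_le_of_mem_ball h₁₂ hr hF hB hy) heq₁
    rw [hdiv x, hDr]
    refine (norm_add_le _ _).trans ?_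
    rw [norm_mul]
    have h2 := hB r hr2
    have h3 := mul_le_mul_of_nonneg_left h1 (norm_nonneg (x - r))
    nlinarith

/-! ### The forcing is determined by its value at infinity up to order `ε` -/

/-- The numerator of `G` minus `μ ∏ (x - r)`. -/
def remainderPoly (z : Fin P → ℂ) (rs : List ℂ) (μ : ℂ) (w : Fin P → ℂ) : ℂ[X] :=
  C μ * (∏ p, (X - C (z p)) - (rs.map fun r => X - C r).prod) +
    ∑ p, C (w p) * ∏ q ∈ Finset.univ.erase p, (X - C (z q))

theorem eval_list_prod_X_sub_C (rs : List ℂ) (x : ℂ) :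
    ((rs.map fun r => X - C r).prod).eval x = (rs.map fun r => x - r).prod := by
  rw [Polynomial.eval_list_prod, List.map_map]
  congr 1
  refine List.map_congr_left fun r _ => ?_
  simp

theorem degree_remainderPoly_lt {rs : List ℂ} (hlen : rs.length = P) (μ : ℂ) (w : Fin P → ℂ) :
    (remainderPoly z rs μ w).degree < rs.length := by
  have hm1 : (∏ p, (X - C (z p))).Monic := monic_prod_of_monic _ _ fun p _ => monic_X_sub_C _
  have hm2 : ((rs.map fun r => X - C r).prod).Monic := by
    have := monic_multisetProd_X_sub_C (rs : Multiset ℂ)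
    simpa using this
  have hd1 : (∏ p, (X - C (z p))).degree = (P : WithBot ℕ) := by
    rw [Polynomial.degree_prod]; simp
  have hd2 : ((rs.map fun r => X - C r).prod).degree = (P : WithBot ℕ) := by
    rw [Polynomial.degree_list_prod, List.map_map]
    have : (rs.map (Polynomial.degree ∘ fun r => X - C r)) = rs.map fun _ => (1 : WithBot ℕ) :=
      List.map_congr_left fun r _ => by simp
    rw [this]
    simp [hlen]
  rw [hlen, remainderPoly]
  refine (Polynomial.degree_add_le _ _).trans_lt (max_lt ?_ ?_)
  · refine lt_of_le_of_lt (b := (∏ p, (X - C (z p)) - (rs.map fun r => X - C r).prod).degree) ?_ ?_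
    · by_cases hμ : μ = 0
      · simp [hμ]
      · rw [Polynomial.degree_C_mul hμ]
    · rw [← hd1]
      exact Polynomial.degree_sub_lt_left (hd1.trans hd2.symm) hm1.ne_zero
        (by rw [hm1.leadingCoeff, hm2.leadingCoeff])
  · refine (Polynomial.degree_sum_le _ _).trans_lt ((Finset.sup_lt_iff (WithBot.bot_lt_coe P)).mpr
      fun p _ => ?_)
    by_cases hw : w p = 0
    · rw [hw]; simp only [map_zero, zero_mul, degree_zero]; exact WithBot.bot_lt_coe _
    · rw [Polynomial.degree_C_mul hw, Polynomial.degree_prod]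
      have hP : 0 < P := p.pos
      simp only [degree_X_sub_C, Finset.sum_const, Finset.card_erase_of_mem (Finset.mem_univ p),
        Finset.card_univ, Fintype.card_fin, nsmul_eq_mul, mul_one]
      exact WithBot.coe_lt_coe.mpr (Nat.sub_lt hP one_pos)

theorem prod_mul_forcing_eq (rs : List ℂ) (μ : ℂ) (w : Fin P → ℂ) {x : ℂ} (hx : ∀ p, x ≠ z p) :
    (∏ p, (x - z p)) * forcing z μ w x =
      (remainderPoly z rs μ w).eval x + μ * (rs.map fun r => x - r).prod := by
  rw [forcing, remainderPoly]
  simp only [eval_add, eval_mul, eval_C, eval_sub, eval_X, eval_prod, eval_finsetSum,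
    eval_list_prod_X_sub_C, mul_add, Finset.mul_sum]
  have : ∀ p, (∏ q, (x - z q)) * (w p / (x - z p)) =
      w p * ∏ q ∈ Finset.univ.erase p, (x - z q) := fun p => by
    rw [← Finset.mul_prod_erase Finset.univ (fun q => x - z q) (Finset.mem_univ p)]
    have h0 := sub_ne_zero.mpr (hx p)
    field_simp
  rw [Finset.sum_congr rfl fun p _ => this p]
  ring

theorem eval_remainderPoly_pole (rs : List ℂ) (μ : ℂ) (w : Fin P → ℂ) (p : Fin P) :
    (remainderPoly z rs μ w).eval (z p) =
      w p * ∏ q ∈ Finset.univ.erase p, (z p - z q) - μ * (rs.map fun r => z p - r).prod := by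
  rw [remainderPoly]
  simp only [eval_add, eval_mul, eval_C, eval_sub, eval_X, eval_prod, eval_finsetSum,
    eval_list_prod_X_sub_C]
  rw [Finset.prod_eq_zero (Finset.mem_univ p) (sub_self _), Finset.sum_eq_single p]
  · ring
  · intro q _ hq
    rw [Finset.prod_eq_zero (Finset.mem_erase.mpr ⟨hq.symm, Finset.mem_univ p⟩) (sub_self _),
      mul_zero]
  · simp

/-- Let the disc of radius `ρ₁` contain `P` critical points `r`, and let the circle of radius `ρ₂`
contain no critical points. If `n` is of the order of the forcing `G` in a larger disc, it is in
fact smaller by a factor `ε`, since `n = -iε (n' - G) / h'` on the circle. Hence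
`∏ (x - z_p) n'`, which is congruent to the numerator of `G` modulo `∏ (x - r)`, is small, and
the numerator of `G` is close to `μ ∏ (x - r)`. -/
theorem exists_norm_remainderPoly_le {c₀ : ℂ} {ρ₁ ρ₂ ρ₃ Cn : ℝ} (h₁ : 0 < ρ₁) (h₁₂ : ρ₁ < ρ₂)
    (h₂₃ : ρ₂ < ρ₃) (hdom : Metric.closedBall c₀ ρ₃ ⊆ lowerCutPlane z)
    (hpole : ∀ x ∈ Metric.sphere c₀ ρ₂, ∀ p, x ≠ z p)
    (hcrit : ∀ x ∈ Metric.sphere c₀ ρ₂, lam + potentialC c z x ≠ 0)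
    {rs : List ℂ} (hrs : ∀ r ∈ rs, r ∈ Metric.ball c₀ ρ₁) (hlen : rs.length = P) {R : ℂ[X]}
    (hR : criticalPoly c z lam = (rs.map fun r => X - C r).prod * R)
    (hn : ∀ ε : ℝ, 0 < ε → ε ≤ 1 → ∀ (μ : ℂ) (w : Fin P → ℂ) (Φ n : ℂ → ℂ),
      IsJostQuotient c z lam ε μ w Φ n → ∀ x ∈ Metric.closedBall c₀ ρ₃,
        ‖n x‖ ≤ Cn * forcingNorm μ w) (x : ℂ) :
    ∃ K : ℝ, 0 ≤ K ∧ ∀ ε : ℝ, 0 < ε → ε ≤ 1 → ∀ (μ : ℂ) (w : Fin P → ℂ) (Φ n : ℂ → ℂ),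
      IsJostQuotient c z lam ε μ w Φ n →
        ‖(remainderPoly z rs μ w).eval x‖ ≤ K * (ε * forcingNorm μ w) := by
  set ρm := (ρ₁ + ρ₂) / 2 with hρm
  have hm1 : ρ₁ < ρm := by rw [hρm]; linarith
  have hm2 : ρm < ρ₂ := by rw [hρm]; linarith
  obtain ⟨K, hK, hdiv⟩ := exists_norm_eval_le_of_eq_prod_mul_add (c₀ := c₀) hm1 x rs hrs
  have hsub : Metric.sphere c₀ ρ₂ ⊆ Metric.closedBall c₀ ρ₃ := fun y hy =>
    Metric.mem_closedBall.mpr ((Metric.mem_sphere.mp hy).le.trans h₂₃.le)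
  have hpotc : ContinuousOn (potentialC c z) (Metric.sphere c₀ ρ₂) := fun y hy =>
    (differentiableAt_potentialC (hpole y hy) fun p =>
      ne_conj_pole_of_mem_lowerCutPlane (hdom (hsub hy)) p).continuousAt.continuousWithinAt
  obtain ⟨M, hM⟩ := (isCompact_sphere c₀ ρ₂).exists_bound_of_continuousOn
    (f := fun y => (lam + potentialC c z y)⁻¹) ((continuousOn_const.add hpotc).inv₀ hcrit)
  choose Mp hMp using fun p => (isCompact_sphere c₀ ρ₂).exists_bound_of_continuousOn
    (f := fun y => (y - z p)⁻¹) ((continuousOn_id.sub continuousOn_const).inv₀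
      fun y hy => sub_ne_zero.mpr (hpole y hy p))
  obtain ⟨MZ, hMZ⟩ := (isCompact_closedBall c₀ ρ₂).exists_bound_of_continuousOn
    (f := fun y => ∏ p, (y - z p)) (by fun_prop)
  have hc₀ρ : (c₀ + ρ₂ : ℂ) ∈ Metric.sphere c₀ ρ₂ := by
    rw [Metric.mem_sphere, dist_eq_norm]
    simp [abs_of_pos (h₁.trans h₁₂)]
  have hM0 : 0 ≤ M := (norm_nonneg _).trans (hM _ hc₀ρ)
  have hMp0 : ∀ p, 0 ≤ Mp p := fun p => (norm_nonneg _).trans (hMp p _ hc₀ρ)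
  have hMZ0 : 0 ≤ MZ := (norm_nonneg _).trans (hMZ _ (Metric.sphere_subset_closedBall hc₀ρ))
  have hGb : ∀ (μ : ℂ) (w : Fin P → ℂ), ∀ y ∈ Metric.sphere c₀ ρ₂,
      ‖forcing z μ w y‖ ≤ (1 + ∑ p, Mp p) * forcingNorm μ w := by
    intro μ w y hy
    have hγ := forcingNorm_nonneg μ w
    rw [forcing]
    refine (norm_add_le _ _).trans ?_
    have h1 : ‖∑ p, w p / (y - z p)‖ ≤ ∑ p, Mp p * forcingNorm μ w := by
      refine (norm_sum_le _ _).trans (Finset.sum_le_sum fun p _ => ?_)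
      rw [div_eq_mul_inv, norm_mul, mul_comm]
      refine mul_le_mul (hMp p y hy) ?_ (norm_nonneg _) (hMp0 p)
      exact (Finset.single_le_sum (f := fun p => ‖w p‖) (fun q _ => norm_nonneg _)
        (Finset.mem_univ p)).trans (sum_norm_le_forcingNorm μ w)
    rw [← Finset.sum_mul] at h1
    have h2 := norm_le_forcingNorm μ w
    linarith
  set Cs := M * (|Cn| / (ρ₃ - ρ₂) + (1 + ∑ p, Mp p)) with hCs
  have h23 : 0 < ρ₃ - ρ₂ := by linarith
  have hsum0 : 0 ≤ ∑ p, Mp p := Finset.sum_nonneg fun p _ => hMp0 p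
  have hCs0 : 0 ≤ Cs := by positivity
  have hm2' : 0 < ρ₂ - ρm := by linarith
  refine ⟨K * (MZ * (Cs / (ρ₂ - ρm))), by positivity, fun ε hε hε1 μ w Φ n h => ?_⟩
  have hγ := forcingNorm_nonneg μ w
  have hεc : (ε : ℂ) ≠ 0 := by exact_mod_cast hε.ne'
  have hnd : ∀ y ∈ Metric.closedBall c₀ ρ₃, DifferentiableAt ℂ n y := fun y hy =>
    h.differentiableAt y (hdom hy)
  have hρ2 : 0 < ρ₂ := h₁.trans h₁₂
  have hderiv : ∀ {s t B : ℝ}, s < t → t ≤ ρ₃ → (∀ y ∈ Metric.closedBall c₀ t, ‖n y‖ ≤ B) →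
      ∀ y ∈ Metric.closedBall c₀ s, ‖deriv n y‖ ≤ B / (t - s) := by
    intro s t B hst ht hB y hy
    have hball : Metric.closedBall y (t - s) ⊆ Metric.closedBall c₀ t :=
      Metric.closedBall_subset_closedBall' (by linarith [Metric.mem_closedBall.mp hy])
    refine Complex.norm_deriv_le_of_forall_mem_sphere_norm_le (by linarith)
      (DifferentiableOn.diffContOnCl fun v hv => ?_) fun v hv =>
        hB v (hball (Metric.sphere_subset_closedBall hv))
    rw [closure_ball _ (by linarith)] at hv
    exact (hnd v (Metric.closedBall_subset_closedBall ht (hball hv))).differentiableWithinAt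
  -- on the circle the equation gains a factor `ε`
  have hsphere : ∀ y ∈ Metric.sphere c₀ ρ₂, ‖n y‖ ≤ Cs * (ε * forcingNorm μ w) := by
    intro y hy
    have h1 := (h.hasDerivAt y (hdom (hsub hy)) (hpole y hy)).deriv
    have h2 : n y = -Complex.I * ε * (deriv n y - forcing z μ w y) * (lam + potentialC c z y)⁻¹ := by
      rw [h1]
      have h3 := hcrit y hy
      field_simp
      ring_nf
      rw [Complex.I_sq]; ring
    have h3 := hderiv h₂₃ le_rfl (hn ε hε hε1 μ w Φ n h) y (Metric.sphere_subset_closedBall hy)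
    have h4 := hGb μ w y hy
    have h5 : ‖deriv n y - forcing z μ w y‖ ≤
        (|Cn| / (ρ₃ - ρ₂) + (1 + ∑ p, Mp p)) * forcingNorm μ w := by
      refine (norm_sub_le _ _).trans ?_
      have h6 : Cn * forcingNorm μ w / (ρ₃ - ρ₂) ≤ |Cn| / (ρ₃ - ρ₂) * forcingNorm μ w := by
        rw [mul_div_right_comm]
        gcongr
        exact le_abs_self _
      linarith
    rw [h2, norm_mul, norm_mul, norm_mul, norm_neg, Complex.norm_I, one_mul, Complex.norm_real,
      Real.norm_eq_abs, abs_of_pos hε]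
    calc ε * ‖deriv n y - forcing z μ w y‖ * ‖(lam + potentialC c z y)⁻¹‖
        ≤ ε * ((|Cn| / (ρ₃ - ρ₂) + (1 + ∑ p, Mp p)) * forcingNorm μ w) * M := by
          gcongr
          exact hM y hy
      _ = Cs * (ε * forcingNorm μ w) := by rw [hCs]; ring
  have hball2 : ∀ y ∈ Metric.closedBall c₀ ρ₂, ‖n y‖ ≤ Cs * (ε * forcingNorm μ w) := by
    intro y hy
    refine Complex.norm_le_of_forall_mem_frontier_norm_le (U := Metric.ball c₀ ρ₂)
      Metric.isBounded_ball (DifferentiableOn.diffContOnCl fun v hv => ?_) (fun v hv => ?_) ?_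
    · rw [closure_ball _ hρ2.ne'] at hv
      exact (hnd v (Metric.closedBall_subset_closedBall h₂₃.le hv)).differentiableWithinAt
    · rw [frontier_ball _ hρ2.ne'] at hv
      exact hsphere v hv
    · rwa [closure_ball _ hρ2.ne']
  have hball3 : Metric.ball c₀ ρm ⊆ Metric.closedBall c₀ ρ₃ :=
    Metric.ball_subset_closedBall.trans (Metric.closedBall_subset_closedBall (by linarith))
  have hFd : DifferentiableOn ℂ (fun y => (∏ p, (y - z p)) * deriv n y) (Metric.ball c₀ ρm) := by
    refine DifferentiableOn.mul (by fun_prop) (DifferentiableOn.deriv (fun y hy =>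
      (hnd y (hball3 hy)).differentiableWithinAt) Metric.isOpen_ball)
  have hAc : ContinuousOn (fun y => -μ - Complex.I / ε * (R.eval y * n y / ∏ p, (y - conj (z p))))
      (Metric.ball c₀ ρm) := by
    refine continuousOn_const.sub (continuousOn_const.mul (ContinuousOn.div
      (R.continuous.continuousOn.mul fun y hy => (hnd y (hball3 hy)).continuousAt.continuousWithinAt)
      (by fun_prop) fun y hy => ?_))
    exact Finset.prod_ne_zero_iff.mpr fun p _ =>
      sub_ne_zero.mpr (ne_conj_pole_of_mem_lowerCutPlane (hdom (hball3 hy)) p)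
  have hq : Continuous fun y : ℂ => (rs.map fun r => y - r).prod :=
    continuous_list_prod _ fun s _ => by fun_prop
  have hbound : ∀ y ∈ Metric.ball c₀ ρm, ‖(∏ p, (y - z p)) * deriv n y‖ ≤
      MZ * (Cs * (ε * forcingNorm μ w) / (ρ₂ - ρm)) := by
    intro y hy
    have hy' := Metric.ball_subset_closedBall hy
    rw [norm_mul]
    exact mul_le_mul (hMZ y (Metric.closedBall_subset_closedBall hm2.le hy'))
      (hderiv hm2 h₂₃.le hball2 y hy') (norm_nonneg _) hMZ0
  refine (hdiv (remainderPoly z rs μ w)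
    (fun y => -μ - Complex.I / ε * (R.eval y * n y / ∏ p, (y - conj (z p))))
    (fun y => (∏ p, (y - z p)) * deriv n y) _ (degree_remainderPoly_lt hlen μ w) hAc hFd
    (by positivity) hbound ?_).trans (le_of_eq (by ring))
  refine eqOn_of_eqOn_diff_finite Metric.isOpen_ball (finite_range z)
    (remainderPoly z rs μ w).continuous.continuousOn
    ((hq.continuousOn.mul hAc).add hFd.continuousOn) fun y hy hyz => ?_
  have hyp : ∀ p, y ≠ z p := fun p hp => hyz ⟨p, hp.symm⟩
  have hyc : ∀ p, y ≠ conj (z p) := ne_conj_pole_of_mem_lowerCutPlane (hdom (hball3 hy))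
  have hcp := criticalPoly_eval c z lam y hyp hyc
  rw [hR, eval_mul, eval_list_prod_X_sub_C, Finset.prod_mul_distrib] at hcp
  have hpf := prod_mul_forcing_eq rs μ w hyp
  rw [(h.hasDerivAt y (hdom (hball3 hy)) hyp).deriv]
  have hprod0 : ∏ p, (y - conj (z p)) ≠ 0 :=
    Finset.prod_ne_zero_iff.mpr fun p _ => sub_ne_zero.mpr (hyc p)
  field_simp
  linear_combination (-(ε : ℂ) * ∏ p, (y - conj (z p))) * hpf + (Complex.I * n y) * hcp

/-! ### Klaus-Shaw potentials on the real line -/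

theorem ofReal_ne_pole (hz : ∀ p, 0 < (z p).im) (x : ℝ) (p : Fin P) :
    (x : ℂ) ≠ z p ∧ (x : ℂ) ≠ conj (z p) := by
  constructor
  · intro h
    have := congrArg Complex.im h
    rw [Complex.ofReal_im] at this
    linarith [hz p]
  · intro h
    have := congrArg Complex.im h
    rw [Complex.ofReal_im, Complex.conj_im] at this
    linarith [hz p]

theorem differentiableAt_potentialC_ofReal (hz : ∀ p, 0 < (z p).im) (x : ℝ) :
    DifferentiableAt ℂ (potentialC c z) x :=
  differentiableAt_potentialC (fun p => (ofReal_ne_pole hz x p).1) fun p => (ofReal_ne_pole hz x p).2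

theorem hasDerivAt_potential (hz : ∀ p, 0 < (z p).im) (x : ℝ) :
    HasDerivAt (potential c z) (deriv (potentialC c z) x).re x :=
  (differentiableAt_potentialC_ofReal hz x).hasDerivAt.real_of_complex

theorem continuous_potential (hz : ∀ p, 0 < (z p).im) : Continuous (potential c z) :=
  continuous_iff_continuousAt.mpr fun x => (hasDerivAt_potential hz x).continuousAt

theorem tendsto_potential {l : Filter ℝ} (hl : Tendsto (fun x : ℝ => |x|) l atTop) :
    Tendsto (potential c z) l (𝓝 0) := by
  rw [Metric.tendsto_nhds]
  intro η hη
  obtain ⟨Y, -, hY⟩ := exists_radius_potentialC_le c z (half_pos hη)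
  filter_upwards [hl.eventually_ge_atTop Y] with x hx
  rw [dist_zero_right, Real.norm_eq_abs]
  have h1 := hY x (by rwa [Complex.norm_real, Real.norm_eq_abs])
  have h2 := Complex.abs_re_le_norm (potentialC c z x)
  rw [potential]
  linarith

/-- `u₀` is a well with bottom `x_c`: negative, and strictly monotone on both sides of `x_c`. -/
structure IsWell (c z : Fin P → ℂ) (xc : ℝ) : Prop where
  neg : ∀ x, potential c z x < 0
  deriv_neg : ∀ x, x < xc → deriv (potential c z) x < 0
  deriv_pos : ∀ x, xc < x → 0 < deriv (potential c z) x

theorem deriv_sign_of_strictMonoOn {f : ℝ → ℝ} {s : Set ℝ} (hs : IsOpen s)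
    (h0 : ∀ x ∈ s, deriv f x ≠ 0) (h : StrictMonoOn f s ∨ StrictAntiOn f s) :
    (∀ x ∈ s, 0 < deriv f x) ∨ ∀ x ∈ s, deriv f x < 0 := by
  rcases h with h | h
  · refine Or.inl fun x hx => lt_of_le_of_ne ?_ (h0 x hx).symm
    rw [← derivWithin_of_isOpen hs hx]
    exact h.monotoneOn.derivWithin_nonneg
  · refine Or.inr fun x hx => lt_of_le_of_ne ?_ (h0 x hx)
    rw [← derivWithin_of_isOpen hs hx]
    exact h.antitoneOn.derivWithin_nonpos

/-- A Klaus-Shaw potential vanishes at infinity, so it is a positive bump or a well. -/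
theorem IsRationalKlausShaw.pos_or_isWell (hu : IsRationalKlausShaw c z) :
    (∀ x, 0 < potential c z x) ∨ ∃ xc, IsWell c z xc := by
  have hz := hu.pole_im_pos
  obtain ⟨xc, hl, hr, hd⟩ := hu.klausShaw
  have hcont := continuous_potential (c := c) hz
  have hdl := deriv_sign_of_strictMonoOn isOpen_Iio
    (fun x (hx : x < xc) h => hx.ne ((hd x).mp h)) hl
  have hdr := deriv_sign_of_strictMonoOn isOpen_Ioi
    (fun x (hx : xc < x) h => hx.ne' ((hd x).mp h)) hr
  have htop : Tendsto (potential c z) atTop (𝓝 0) := tendsto_potential tendsto_abs_atTop_atTop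
  have hbot : Tendsto (potential c z) atBot (𝓝 0) := tendsto_potential tendsto_abs_atBot_atTop
  have hleft : ((∀ x ∈ Iio xc, 0 < deriv (potential c z) x) → ∀ x ≤ xc, 0 < potential c z x) ∧
      ((∀ x ∈ Iio xc, deriv (potential c z) x < 0) → ∀ x ≤ xc, potential c z x < 0) := by
    constructor
    · intro h x hx
      have hm : StrictMonoOn (potential c z) (Iic xc) := strictMonoOn_of_deriv_pos (convex_Iic _)
        hcont.continuousOn (by rwa [interior_Iic])
      have h1 : 0 ≤ potential c z (x - 1) := le_of_tendsto hbot (by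
        filter_upwards [eventually_le_atBot (x - 1)] with y hy
        exact hm.monotoneOn (mem_Iic.mpr (by linarith)) (mem_Iic.mpr (by linarith)) hy)
      exact h1.trans_lt (hm (mem_Iic.mpr (by linarith)) hx (by linarith))
    · intro h x hx
      have hm : StrictAntiOn (potential c z) (Iic xc) := strictAntiOn_of_deriv_neg (convex_Iic _)
        hcont.continuousOn (by rwa [interior_Iic])
      have h1 : potential c z (x - 1) ≤ 0 := ge_of_tendsto hbot (by
        filter_upwards [eventually_le_atBot (x - 1)] with y hy
        exact hm.antitoneOn (mem_Iic.mpr (by linarith)) (mem_Iic.mpr (by linarith)) hy)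
      exact (hm (mem_Iic.mpr (by linarith)) hx (by linarith)).trans_le h1
  have hright : ((∀ x ∈ Ioi xc, 0 < deriv (potential c z) x) → ∀ x ≥ xc, potential c z x < 0) ∧
      ((∀ x ∈ Ioi xc, deriv (potential c z) x < 0) → ∀ x ≥ xc, 0 < potential c z x) := by
    constructor
    · intro h x hx
      have hm : StrictMonoOn (potential c z) (Ici xc) := strictMonoOn_of_deriv_pos (convex_Ici _)
        hcont.continuousOn (by rwa [interior_Ici])
      have h1 : potential c z (x + 1) ≤ 0 := ge_of_tendsto htop (by
        filter_upwards [eventually_ge_atTop (x + 1)] with y hy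
        exact hm.monotoneOn (mem_Ici.mpr (by linarith)) (mem_Ici.mpr (by linarith)) hy)
      exact (hm hx (mem_Ici.mpr (by linarith)) (by linarith)).trans_le h1
    · intro h x hx
      have hm : StrictAntiOn (potential c z) (Ici xc) := strictAntiOn_of_deriv_neg (convex_Ici _)
        hcont.continuousOn (by rwa [interior_Ici])
      have h1 : 0 ≤ potential c z (x + 1) := le_of_tendsto htop (by
        filter_upwards [eventually_ge_atTop (x + 1)] with y hy
        exact hm.antitoneOn (mem_Ici.mpr (by linarith)) (mem_Ici.mpr (by linarith)) hy)
      exact h1.trans_lt (hm hx (mem_Ici.mpr (by linarith)) (by linarith))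
  rcases hdl with hdl | hdl <;> rcases hdr with hdr | hdr
  · have h1 := hleft.1 hdl xc le_rfl
    have h2 := hright.1 hdr xc le_rfl
    linarith
  · left
    intro x
    rcases le_total x xc with h | h
    · exact hleft.1 hdl x h
    · exact hright.2 hdr x h
  · right
    refine ⟨xc, fun x => ?_, hdl, hdr⟩
    rcases le_total x xc with h | h
    · exact hleft.2 hdl x h
    · exact hright.1 hdr x h
  · have h1 := hleft.2 hdl xc le_rfl
    have h2 := hright.2 hdr xc le_rfl
    linarith

theorem IsWell.strictAntiOn (hz : ∀ p, 0 < (z p).im) {xc : ℝ} (h : IsWell c z xc) :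
    StrictAntiOn (potential c z) (Iic xc) :=
  strictAntiOn_of_deriv_neg (convex_Iic _) (continuous_potential hz).continuousOn
    (by rw [interior_Iic]; exact h.deriv_neg)

theorem IsWell.strictMonoOn (hz : ∀ p, 0 < (z p).im) {xc : ℝ} (h : IsWell c z xc) :
    StrictMonoOn (potential c z) (Ici xc) :=
  strictMonoOn_of_deriv_pos (convex_Ici _) (continuous_potential hz).continuousOn
    (by rw [interior_Ici]; exact h.deriv_pos)

theorem IsWell.le (hz : ∀ p, 0 < (z p).im) {xc : ℝ} (h : IsWell c z xc) (x : ℝ) :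
    potential c z xc ≤ potential c z x := by
  rcases le_total x xc with hx | hx
  · exact (h.strictAntiOn hz).antitoneOn hx self_mem_Iic hx
  · exact (h.strictMonoOn hz).monotoneOn self_mem_Ici hx hx

theorem IsWell.sInf_eq (hz : ∀ p, 0 < (z p).im) {xc : ℝ} (h : IsWell c z xc) :
    sInf (range (potential c z)) = potential c z xc :=
  IsLeast.csInf_eq ⟨mem_range_self xc, by rintro _ ⟨x, rfl⟩; exact h.le hz x⟩

/-- The two solutions of `u₀ = -η` for a well. -/
theorem IsWell.exists_roots (hz : ∀ p, 0 < (z p).im) {xc : ℝ} (h : IsWell c z xc) {η : ℝ}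
    (hη0 : 0 < η) (hη : η < -potential c z xc) :
    xMinus c z η < xc ∧ xc < xPlus c z η ∧ potential c z (xMinus c z η) = -η ∧
      potential c z (xPlus c z η) = -η ∧ {x | potential c z x = -η} = {xMinus c z η, xPlus c z η} := by
  have hcont := continuous_potential (c := c) hz
  have htop : Tendsto (potential c z) atTop (𝓝 0) := tendsto_potential tendsto_abs_atTop_atTop
  have hbot : Tendsto (potential c z) atBot (𝓝 0) := tendsto_potential tendsto_abs_atBot_atTop
  obtain ⟨xp, hxp, hxpe⟩ : ∃ x, xc < x ∧ potential c z x = -η := by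
    obtain ⟨y, hy1, hy2⟩ := ((htop.eventually_const_lt (show -η < 0 by linarith)).and
      (eventually_gt_atTop xc)).exists
    obtain ⟨x, hx, hxe⟩ := intermediate_value_Icc hy2.le hcont.continuousOn
      (show -η ∈ Icc (potential c z xc) (potential c z y) from ⟨by linarith, hy1.le⟩)
    refine ⟨x, lt_of_le_of_ne hx.1 ?_, hxe⟩
    rintro rfl
    linarith
  obtain ⟨xm, hxm, hxme⟩ : ∃ x, x < xc ∧ potential c z x = -η := by
    obtain ⟨y, hy1, hy2⟩ := ((hbot.eventually_const_lt (show -η < 0 by linarith)).and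
      (eventually_lt_atBot xc)).exists
    obtain ⟨x, hx, hxe⟩ := intermediate_value_Icc' hy2.le hcont.continuousOn
      (show -η ∈ Icc (potential c z xc) (potential c z y) from ⟨by linarith, hy1.le⟩)
    refine ⟨x, lt_of_le_of_ne hx.2 ?_, hxe⟩
    rintro rfl
    linarith
  have hset : {x | potential c z x = -η} = {xm, xp} := by
    ext x
    constructor
    · intro (hx : potential c z x = -η)
      rcases le_total x xc with hxc | hxc
      · exact Or.inl ((h.strictAntiOn hz).injOn hxc hxm.le (hx.trans hxme.symm))
      · exact Or.inr ((h.strictMonoOn hz).injOn hxc hxp.le (hx.trans hxpe.symm))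
    · rintro (rfl | rfl)
      · exact hxme
      · exact hxpe
  have hm : xMinus c z η = xm := by
    rw [xMinus, hset, csInf_pair, inf_eq_left]; linarith
  have hp : xPlus c z η = xp := by
    rw [xPlus, hset, csSup_pair, sup_eq_right]; linarith
  rw [hm, hp]
  exact ⟨hxm, hxp, hxme, hxpe, hset⟩

theorem IsRationalKlausShaw.isWell_of_mem_bulk (hu : IsRationalKlausShaw c z) (hlam : 0 < lam)
    (h : lam ∈ bulk c z) : ∃ xc, IsWell c z xc ∧ lam < -potential c z xc := by
  rcases hu.pos_or_isWell with hpos | ⟨xc, hw⟩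
  · have h1 : 0 ≤ sInf (range (potential c z)) := Real.sInf_nonneg (by
      rintro _ ⟨x, rfl⟩; exact (hpos x).le)
    have h2 := h.2
    linarith
  · refine ⟨xc, hw, ?_⟩
    have := h.2
    rwa [hw.sInf_eq hu.pole_im_pos] at this

theorem not_mem_closure_bulk_of_pos (hlam : 0 < lam) (hpos : ∀ x, 0 < potential c z x) :
    lam ∉ closure (bulk c z) := by
  have h1 : 0 ≤ sInf (range (potential c z)) := Real.sInf_nonneg (by
    rintro _ ⟨x, rfl⟩; exact (hpos x).le)
  intro h
  have : closure (bulk c z) ⊆ Iic 0 :=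
    closure_minimal (fun t ht => by have := ht.2; exact mem_Iic.mpr (by linarith)) isClosed_Iic
  have := mem_Iic.mp (this h)
  linarith

theorem IsRationalKlausShaw.add_potential_pos (hu : IsRationalKlausShaw c z) (hlam : 0 < lam)
    (h : lam ∉ closure (bulk c z)) (x : ℝ) : 0 < lam + potential c z x := by
  rcases hu.pos_or_isWell with hpos | ⟨xc, hw⟩
  · linarith [hpos x]
  · have hz := hu.pole_im_pos
    have hsub : Ioo 0 (-potential c z xc) ⊆ bulk c z := by
      intro t ht
      refine ⟨?_, by rw [hw.sInf_eq hz]; exact ht.2⟩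
      have htop : Tendsto (potential c z) atTop (𝓝 0) := tendsto_potential tendsto_abs_atTop_atTop
      obtain ⟨y, hy⟩ := (htop.eventually_const_lt (show -t < 0 by linarith [ht.1])).exists
      have : potential c z y ≤ sSup (range (potential c z)) :=
        le_csSup ⟨0, by rintro _ ⟨x, rfl⟩; exact (hw.neg x).le⟩ (mem_range_self y)
      linarith
    by_contra hcon
    refine h (closure_mono hsub ?_)
    have h1 := hw.le hz x
    rw [closure_Ioo (by linarith [hw.neg xc] : (0 : ℝ) ≠ -potential c z xc)]
    exact ⟨hlam.le, by linarith⟩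

theorem tendsto_ofReal_div_sub (a : ℂ) : Tendsto (fun x : ℝ => (x : ℂ) / (x - a)) atTop (𝓝 1) := by
  have h0 : Tendsto (fun x : ℝ => ‖(x : ℂ) - a‖) atTop atTop := by
    refine tendsto_atTop_mono (fun x => ?_) (tendsto_atTop_add_const_right atTop (-‖a‖) tendsto_id)
    have := norm_sub_norm_le (x : ℂ) a
    rw [Complex.norm_real, Real.norm_eq_abs] at this
    have := le_abs_self x
    simp only [id]
    linarith
  have h1 : Tendsto (fun x : ℝ => ((x : ℂ) - a)) atTop (Bornology.cobounded ℂ) :=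
    tendsto_norm_atTop_iff_cobounded.mp h0
  have h2 : Tendsto (fun x : ℝ => 1 + a * ((x : ℂ) - a)⁻¹) atTop (𝓝 (1 + a * 0)) :=
    tendsto_const_nhds.add ((tendsto_inv₀_cobounded.comp h1).const_mul a)
  rw [mul_zero, add_zero] at h2
  refine h2.congr' ?_
  filter_upwards [h0.eventually_gt_atTop 0] with x hx
  have hx0 := norm_pos_iff.mp hx
  field_simp
  ring

theorem tendsto_mul_potential (c z : Fin P → ℂ) :
    Tendsto (fun x : ℝ => x * potential c z x) atTop (𝓝 (2 * ∑ p, (c p).re)) := by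
  have hlim : Tendsto (fun x : ℝ => (x : ℂ) * potentialC c z x) atTop
      (𝓝 (∑ p, (c p + conj (c p)))) := by
    simp only [potentialC, Finset.mul_sum]
    refine tendsto_finsetSum _ fun p _ => ?_
    have := ((tendsto_ofReal_div_sub (z p)).const_mul (c p)).add
      ((tendsto_ofReal_div_sub (conj (z p))).const_mul (conj (c p)))
    simp only [mul_one] at this
    refine this.congr fun x => ?_
    ring
  have h1 := Complex.continuous_re.tendsto _ |>.comp hlim
  have h2 : (∑ p, (c p + conj (c p))).re = 2 * ∑ p, (c p).re := by
    rw [Complex.re_sum, Finset.mul_sum]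
    refine Finset.sum_congr rfl fun p _ => ?_
    rw [Complex.add_re, Complex.conj_re]; ring
  rw [h2] at h1
  refine h1.congr fun x => ?_
  simp [potentialC_ofReal]

/-- Integrability excludes the term of order `1 / x` of `u₀` at infinity. -/
theorem IsRationalKlausShaw.sum_re_residue_eq_zero (hu : IsRationalKlausShaw c z) :
    ∑ p, (c p).re = 0 := by
  by_contra hne
  have hz := hu.pole_im_pos
  have hlim2 : Tendsto (fun x : ℝ => |x * potential c z x|) atTop (𝓝 |2 * ∑ p, (c p).re|) :=
    (tendsto_mul_potential c z).abs
  set s := |2 * ∑ p, (c p).re| with hsdef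
  have hs0 : 0 < s := abs_pos.mpr (mul_ne_zero two_ne_zero hne)
  obtain ⟨A, hA⟩ := (hlim2.eventually_const_lt (half_lt_self hs0)).exists_forall_of_atTop
  refine not_integrableOn_Ioi_inv (a := max A 1) ?_
  refine Integrable.mono' ((hu.integrable.norm.const_mul (2 / s)).integrableOn)
    (measurable_inv.aestronglyMeasurable) ?_
  filter_upwards [self_mem_ae_restrict measurableSet_Ioi] with x hx
  have hx1 : max A 1 < x := hx
  have hx0 : 0 < x := by linarith [le_max_right A 1]
  have h1 := hA x (by linarith [le_max_left A 1])
  rw [abs_mul, abs_of_pos hx0] at h1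
  rw [Real.norm_eq_abs, abs_of_pos (inv_pos.mpr hx0), Real.norm_eq_abs]
  rw [inv_eq_one_div, div_le_iff₀ hx0]
  have : 2 / s * |potential c z x| * x = 2 / s * (x * |potential c z x|) := by ring
  rw [this, div_mul_eq_mul_div, le_div_iff₀ hs0]
  linarith

/-! ### The critical points of `h` -/

open Classical in
/-- The critical points of `h` in the open upper half-plane, with multiplicities. -/
def upperPoints (c z : Fin P → ℂ) (lam : ℝ) : Multiset ℂ :=
  (criticalPoints c z lam).filter fun w => 0 < w.im

theorem mem_upperPoints {x : ℂ} : x ∈ upperPoints c z lam ↔ x ∈ criticalPoints c z lam ∧ 0 < x.im := by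
  rw [upperPoints, Multiset.mem_filter]

theorem degree_criticalPoly (hlam : lam ≠ 0) :
    (criticalPoly c z lam).natDegree = 2 * P ∧ (criticalPoly c z lam).leadingCoeff = lam := by
  have hlc : (lam : ℂ) ≠ 0 := by exact_mod_cast hlam
  set Q : Fin P → ℂ[X] := fun q => (X - C (z q)) * (X - C (conj (z q))) with hQ
  have hQm : ∀ q, (Q q).Monic := fun q => (monic_X_sub_C _).mul (monic_X_sub_C _)
  have hQd : ∀ q, (Q q).natDegree = 2 := fun q => by
    rw [hQ, Monic.natDegree_mul (monic_X_sub_C _) (monic_X_sub_C _)]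
    simp
  have hm : (∏ q, Q q).Monic := monic_prod_of_monic _ _ fun q _ => hQm q
  have hd : (∏ q, Q q).natDegree = 2 * P := by
    rw [natDegree_prod_of_monic _ _ fun q _ => hQm q, Finset.sum_congr rfl fun q _ => hQd q]
    simp [mul_comm]
  have hd1 : (C (lam : ℂ) * ∏ q, Q q).degree = (2 * P : ℕ) := by
    rw [degree_C_mul hlc, degree_eq_natDegree hm.ne_zero, hd]
  have hlt : (∑ p, (C (c p) * (X - C (conj (z p))) + C (conj (c p)) * (X - C (z p))) *
      ∏ q ∈ Finset.univ.erase p, Q q).degree < (C (lam : ℂ) * ∏ q, Q q).degree := by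
    rw [hd1]
    refine (degree_sum_le _ _).trans_lt ((Finset.sup_lt_iff (WithBot.bot_lt_coe _)).mpr fun p _ => ?_)
    have h1 : (C (c p) * (X - C (conj (z p))) + C (conj (c p)) * (X - C (z p))).degree ≤
        (1 : WithBot ℕ) := by
      have h2 : ∀ a b : ℂ, (C a * (X - C b)).degree ≤ (1 : WithBot ℕ) := fun a b => by
        by_cases ha : a = 0
        · simp [ha]
        · rw [degree_C_mul ha, degree_X_sub_C]
      exact (degree_add_le _ _).trans (max_le (h2 _ _) (h2 _ _))
    have h3 : (∏ q ∈ Finset.univ.erase p, Q q).degree = ((2 * (P - 1) : ℕ) : WithBot ℕ) := by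
      have hm' : (∏ q ∈ Finset.univ.erase p, Q q).Monic := monic_prod_of_monic _ _ fun q _ => hQm q
      rw [degree_eq_natDegree hm'.ne_zero, natDegree_prod_of_monic _ _ fun q _ => hQm q,
        Finset.sum_congr rfl fun q _ => hQd q]
      simp [Finset.card_erase_of_mem, mul_comm]
    rw [degree_mul, h3]
    have hP := p.pos
    refine (add_le_add_left h1 _).trans_lt ?_
    rw [← Nat.cast_one, ← Nat.cast_add]
    exact WithBot.coe_lt_coe.mpr (show 1 + 2 * (P - 1) < 2 * P by omega)
  have hcp : criticalPoly c z lam = C (lam : ℂ) * ∏ q, Q q +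
      ∑ p, (C (c p) * (X - C (conj (z p))) + C (conj (c p)) * (X - C (z p))) *
        ∏ q ∈ Finset.univ.erase p, Q q := rfl
  constructor
  · refine natDegree_eq_of_degree_eq_some ?_
    rw [hcp, degree_add_eq_left_of_degree_lt hlt, hd1]
  · rw [hcp, leadingCoeff_add_of_degree_lt' hlt, leadingCoeff_mul, leadingCoeff_C, hm.leadingCoeff,
      mul_one]

theorem criticalPoly_ne_zero (hlam : lam ≠ 0) : criticalPoly c z lam ≠ 0 := by
  intro h
  have := (degree_criticalPoly (c := c) (z := z) hlam).2
  rw [h, leadingCoeff_zero] at this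
  exact hlam (by exact_mod_cast this.symm)

theorem criticalPoly_eq_prod (hlam : lam ≠ 0) : criticalPoly c z lam =
    C (lam : ℂ) * ((criticalPoints c z lam).map fun r => X - C r).prod := by
  have := (IsAlgClosed.splits (criticalPoly c z lam)).eq_prod_roots
  rwa [(degree_criticalPoly hlam).2] at this

theorem card_criticalPoints (hlam : lam ≠ 0) :
    Multiset.card (criticalPoints c z lam) = 2 * P := by
  rw [criticalPoints, IsAlgClosed.card_roots_eq_natDegree, (degree_criticalPoly hlam).1]

theorem criticalPoints_map_conj :
    (criticalPoints c z lam).map conj = criticalPoints c z lam := by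
  have h : (criticalPoly c z lam).map (starRingEnd ℂ) = criticalPoly c z lam := by
    simp only [criticalPoly, Polynomial.map_add, Polynomial.map_mul, Polynomial.map_C,
      Polynomial.map_prod, Polynomial.map_sub, Polynomial.map_X, Polynomial.map_sum,
      Complex.conj_ofReal, Complex.conj_conj]
    simp only [mul_comm (X - C (conj (z _))), add_comm (C (conj (c _)) * _)]
  have := (IsAlgClosed.splits (criticalPoly c z lam)).roots_map (starRingEnd ℂ)
  rw [h] at this
  exact this.symm

open Classical in
theorem criticalPoints_eq_add :
    criticalPoints c z lam = (criticalPoints c z lam).filter (fun w => w.im = 0) +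
      (upperPoints c z lam + (upperPoints c z lam).map conj) := by
  have hlow : (upperPoints c z lam).map conj =
      (criticalPoints c z lam).filter (fun w => w.im < 0) := by
    conv_rhs => rw [← criticalPoints_map_conj, Multiset.filter_map]
    rw [upperPoints]
    congr 1
    exact Multiset.filter_congr fun w _ => by simp
  rw [hlow, upperPoints]
  conv_lhs => rw [← Multiset.filter_add_not (fun w : ℂ => w.im = 0) (criticalPoints c z lam)]
  congr 1
  conv_lhs => rw [← Multiset.filter_add_not (fun w : ℂ => 0 < w.im)
    ((criticalPoints c z lam).filter fun w => ¬ w.im = 0)]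
  rw [Multiset.filter_filter, Multiset.filter_filter]
  congr 1
  · exact Multiset.filter_congr fun w _ => ⟨fun h => h.1, fun h => ⟨h, h.ne'⟩⟩
  · refine Multiset.filter_congr fun w _ => ⟨fun h => ?_, fun h => ⟨h.le.not_gt, h.ne⟩⟩
    exact lt_of_le_of_ne (not_lt.mp h.1) h.2

theorem prod_poles_ofReal (x : ℝ) :
    ∏ q, (((x : ℂ) - z q) * (x - conj (z q))) = ((‖∏ q, ((x : ℂ) - z q)‖ ^ 2 : ℝ) : ℂ) := by
  rw [Complex.ofReal_pow, ← Complex.mul_conj', map_prod, ← Finset.prod_mul_distrib]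
  refine Finset.prod_congr rfl fun q _ => ?_
  rw [map_sub, Complex.conj_ofReal]

theorem prod_poles_ofReal_ne_zero (hz : ∀ p, 0 < (z p).im) (x : ℝ) :
    ∏ q, ((x : ℂ) - z q) ≠ 0 :=
  Finset.prod_ne_zero_iff.mpr fun p _ => sub_ne_zero.mpr (ofReal_ne_pole hz x p).1

theorem eval_criticalPoly_ofReal (hz : ∀ p, 0 < (z p).im) (x : ℝ) :
    (criticalPoly c z lam).eval (x : ℂ) =
      ((lam + potential c z x : ℝ) : ℂ) * ((‖∏ q, ((x : ℂ) - z q)‖ ^ 2 : ℝ) : ℂ) := by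
  rw [criticalPoly_eval c z lam x (fun p => (ofReal_ne_pole hz x p).1)
    (fun p => (ofReal_ne_pole hz x p).2), prod_poles_ofReal, potentialC_ofReal, Complex.ofReal_add]

theorem ofReal_mem_criticalPoints_iff (hz : ∀ p, 0 < (z p).im) (hlam : lam ≠ 0) (x : ℝ) :
    (x : ℂ) ∈ criticalPoints c z lam ↔ potential c z x = -lam := by
  rw [criticalPoints, mem_roots (criticalPoly_ne_zero hlam), IsRoot, eval_criticalPoly_ofReal hz,
    mul_eq_zero, Complex.ofReal_eq_zero, Complex.ofReal_eq_zero]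
  have h : ‖∏ q, ((x : ℂ) - z q)‖ ^ 2 ≠ 0 :=
    pow_ne_zero 2 (norm_ne_zero_iff.mpr (prod_poles_ofReal_ne_zero hz x))
  rw [or_iff_left h]
  constructor <;> intro h <;> linarith

theorem isOpen_ne_poles : IsOpen {x : ℂ | ∀ p, x ≠ z p ∧ x ≠ conj (z p)} := by
  simp only [ofPred_forall]
  exact isOpen_iInter_of_finite fun p => isOpen_ne.inter isOpen_ne

theorem derivative_criticalPoly_ofReal (hz : ∀ p, 0 < (z p).im) {x : ℝ}
    (hx : potential c z x = -lam) :
    (derivative (criticalPoly c z lam)).eval (x : ℂ) =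
      deriv (potentialC c z) x * ((‖∏ q, ((x : ℂ) - z q)‖ ^ 2 : ℝ) : ℂ) := by
  set W : ℂ[X] := ∏ q, ((X - C (z q)) * (X - C (conj (z q)))) with hW
  have hWe : ∀ y, W.eval y = ∏ q, ((y - z q) * (y - conj (z q))) := fun y => by
    simp [hW, eval_prod]
  have h1 : HasDerivAt (fun y => (lam + potentialC c z y) * W.eval y)
      (deriv (potentialC c z) x * W.eval (x : ℂ) +
        (lam + potentialC c z x) * (derivative W).eval (x : ℂ)) x :=
    ((differentiableAt_potentialC_ofReal hz x).hasDerivAt.const_add _).mul (W.hasDerivAt _)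
  have h2 : (fun y => (lam + potentialC c z y) * W.eval y) =ᶠ[𝓝 (x : ℂ)]
      fun y => (criticalPoly c z lam).eval y := by
    filter_upwards [isOpen_ne_poles.mem_nhds (fun p => ofReal_ne_pole hz x p)] with y hy
    rw [criticalPoly_eval c z lam y (fun p => (hy p).1) (fun p => (hy p).2), hWe]
  have h3 := (h2.hasDerivAt_iff.mp h1).unique ((criticalPoly c z lam).hasDerivAt (x : ℂ))
  rw [← h3, potentialC_ofReal, hx, hWe, prod_poles_ofReal]
  simp

theorem deriv_potentialC_ofReal (hz : ∀ p, 0 < (z p).im) (x : ℝ) :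
    deriv (potentialC c z) x = ((deriv (potential c z) x : ℝ) : ℂ) := by
  have h1 : HasDerivAt (fun y : ℝ => potentialC c z y) (deriv (potentialC c z) x) x :=
    (differentiableAt_potentialC_ofReal hz x).hasDerivAt.comp_ofReal
  have h2 : HasDerivAt (fun y : ℝ => ((potential c z y : ℝ) : ℂ))
      ((deriv (potential c z) x : ℝ) : ℂ) x :=
    ((hasDerivAt_potential hz x).differentiableAt.hasDerivAt).ofReal_comp
  simp only [potentialC_ofReal] at h1
  exact h1.unique h2

theorem upperPoints_of_forall_pos (hz : ∀ p, 0 < (z p).im) (hlam : lam ≠ 0)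
    (h : ∀ x : ℝ, potential c z x ≠ -lam) :
    criticalPoints c z lam = upperPoints c z lam + (upperPoints c z lam).map conj ∧
      Multiset.card (upperPoints c z lam) = P := by
  classical
  have h0 : (criticalPoints c z lam).filter (fun w => w.im = 0) = 0 := by
    refine Multiset.filter_eq_nil.mpr fun w hw him => ?_
    have hwr : w = (w.re : ℂ) := Complex.ext (by simp) (by simp [him])
    rw [hwr] at hw
    exact h _ ((ofReal_mem_criticalPoints_iff hz hlam _).mp hw)
  have h1 := criticalPoints_eq_add (c := c) (z := z) (lam := lam)
  rw [h0, zero_add] at h1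
  refine ⟨h1, ?_⟩
  have h2 := card_criticalPoints (c := c) (z := z) hlam
  rw [h1, Multiset.card_add, Multiset.card_map] at h2
  omega

theorem upperPoints_of_two_roots (hz : ∀ p, 0 < (z p).im) (hlam : lam ≠ 0) {a b : ℝ} (hab : a ≠ b)
    (h : {x | potential c z x = -lam} = {a, b}) (ha : deriv (potential c z) a ≠ 0)
    (hb : deriv (potential c z) b ≠ 0) :
    criticalPoints c z lam = {(a : ℂ), (b : ℂ)} +
      (upperPoints c z lam + (upperPoints c z lam).map conj) ∧
      Multiset.card (upperPoints c z lam) + 1 = P := by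
  classical
  have hmem : ∀ x : ℝ, (x : ℂ) ∈ criticalPoints c z lam ↔ x = a ∨ x = b := fun x => by
    rw [ofReal_mem_criticalPoints_iff hz hlam]
    have := Set.ext_iff.mp h x
    simpa using this
  have hcount : ∀ x : ℝ, potential c z x = -lam → deriv (potential c z) x ≠ 0 →
      (criticalPoints c z lam).count (x : ℂ) = 1 := by
    intro x hx hd
    have h1 : (criticalPoints c z lam).count (x : ℂ) ≠ 0 :=
      Multiset.count_ne_zero.mpr ((ofReal_mem_criticalPoints_iff hz hlam x).mpr hx)
    have h2 : ¬ 1 < (criticalPoints c z lam).count (x : ℂ) := by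
      rw [criticalPoints, count_roots, one_lt_rootMultiplicity_iff_isRoot (criticalPoly_ne_zero hlam)]
      rintro ⟨-, h3⟩
      rw [IsRoot, derivative_criticalPoly_ofReal hz hx, deriv_potentialC_ofReal hz,
        mul_eq_zero, Complex.ofReal_eq_zero, Complex.ofReal_eq_zero] at h3
      rcases h3 with h3 | h3
      · exact hd h3
      · exact pow_ne_zero 2 (norm_ne_zero_iff.mpr (prod_poles_ofReal_ne_zero hz x)) h3
    omega
  have hset : ∀ x, x = a ∨ x = b → potential c z x = -lam := fun x hx => by
    have := Set.ext_iff.mp h x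
    simp only [mem_insert_iff, mem_singleton_iff] at this
    exact this.mpr hx
  have h0 : (criticalPoints c z lam).filter (fun w => w.im = 0) = {(a : ℂ), (b : ℂ)} := by
    have habc : (a : ℂ) ≠ b := by exact_mod_cast hab
    ext w
    by_cases him : w.im = 0
    · have hwr : w = (w.re : ℂ) := Complex.ext (by simp) (by simp [him])
      rw [Multiset.count_filter_of_pos (p := fun w : ℂ => w.im = 0) him]
      rw [hwr]
      by_cases hw : w.re = a ∨ w.re = b
      · rcases hw with hw | hw
        · rw [hw, hcount a (hset a (Or.inl rfl)) ha]
          simp [habc]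
        · rw [hw, hcount b (hset b (Or.inr rfl)) hb]
          simp [habc.symm]
      · rw [Multiset.count_eq_zero_of_notMem fun hm => hw ((hmem _).mp hm),
          Multiset.count_eq_zero_of_notMem]
        simpa using hw
    · rw [Multiset.count_filter_of_neg (p := fun w : ℂ => w.im = 0) him,
        Multiset.count_eq_zero_of_notMem]
      simp only [Multiset.insert_eq_cons, Multiset.mem_cons, Multiset.mem_singleton]
      rintro (rfl | rfl) <;> simp at him
  have h1 := criticalPoints_eq_add (c := c) (z := z) (lam := lam)
  rw [h0] at h1
  refine ⟨h1, ?_⟩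
  have h2 := card_criticalPoints (c := c) (z := z) hlam
  rw [h1, Multiset.card_add, Multiset.card_add, Multiset.card_map] at h2
  simp at h2
  omega

/-- The factorization of `h''(x₊) |∏ (x₊ - z_p)|²` over the critical points. -/
theorem deriv_potential_mul_norm_sq (hz : ∀ p, 0 < (z p).im) (hlam : lam ≠ 0) {a b : ℝ}
    (h : criticalPoints c z lam = {(a : ℂ), (b : ℂ)} +
      (upperPoints c z lam + (upperPoints c z lam).map conj)) (hb : potential c z b = -lam) :
    deriv (potential c z) b * ‖∏ q, ((b : ℂ) - z q)‖ ^ 2 =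
      lam * (b - a) * ‖((upperPoints c z lam).map fun w => (b : ℂ) - w).prod‖ ^ 2 := by
  set U := upperPoints c z lam with hU
  have h1 := derivative_criticalPoly_ofReal (lam := lam) hz hb
  set V : ℂ[X] := C (lam : ℂ) * ((X - C (a : ℂ)) * ((U.map fun r => X - C r).prod *
    ((U.map conj).map fun r => X - C r).prod)) with hV
  have h2 : criticalPoly c z lam = (X - C (b : ℂ)) * V := by
    rw [criticalPoly_eq_prod hlam, h]
    simp only [Multiset.insert_eq_cons, Multiset.map_add, Multiset.map_cons,
      Multiset.map_singleton, Multiset.prod_add, Multiset.prod_cons, Multiset.prod_singleton]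
    rw [hV]
    ring
  rw [h2, derivative_mul, deriv_potentialC_ofReal hz] at h1
  simp only [derivative_sub, derivative_X, derivative_C, sub_zero, one_mul, eval_add, eval_mul,
    eval_sub, eval_X, eval_C, sub_self, zero_mul, add_zero, hV] at h1
  have hev : ∀ s : Multiset ℂ, ((s.map fun r => X - C r).prod).eval (b : ℂ) =
      (s.map fun r => (b : ℂ) - r).prod := fun s => by
    rw [eval_multiset_prod, Multiset.map_map]
    congr 1
    exact Multiset.map_congr rfl fun r _ => by simp
  have hc : ((U.map conj).map fun r => (b : ℂ) - r).prod = conj (U.map fun r => (b : ℂ) - r).prod := by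
    rw [map_multiset_prod, Multiset.map_map, Multiset.map_map]
    congr 1
    exact Multiset.map_congr rfl fun r _ => by simp
  rw [hev, hev, hc, Complex.mul_conj'] at h1
  have h3 : ((deriv (potential c z) b * ‖∏ q, ((b : ℂ) - z q)‖ ^ 2 : ℝ) : ℂ) =
      ((lam * (b - a) * ‖(U.map fun w => (b : ℂ) - w).prod‖ ^ 2 : ℝ) : ℂ) := by
    push_cast
    rw [← Complex.ofReal_pow ‖∏ q, ((b : ℂ) - z q)‖, ← h1]
    ring
  exact_mod_cast h3

/-! ### Discs that contain the upper critical points -/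

/-- The numerator of the forcing of every Jost quotient is, up to order `ε`, the multiple
`μ ∏ (x - r)` of the polynomial with the `P` roots `r`. -/
def HasRemainderBound (c z : Fin P → ℂ) (lam : ℝ) (rs : List ℂ) : Prop :=
  ∀ x : ℂ, ∃ K : ℝ, 0 ≤ K ∧ ∀ ε : ℝ, 0 < ε → ε ≤ 1 → ∀ (μ : ℂ) (w : Fin P → ℂ) (Φ n : ℂ → ℂ),
    IsJostQuotient c z lam ε μ w Φ n →
      ‖(remainderPoly z rs μ w).eval x‖ ≤ K * (ε * forcingNorm μ w)

theorem dist_sq_center (y : ℂ) (ξ a : ℝ) :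
    dist y (ξ + a * Complex.I) ^ 2 = ‖y - ξ‖ ^ 2 - 2 * a * y.im + a ^ 2 := by
  rw [dist_eq_norm, ← Complex.normSq_eq_norm_sq, ← Complex.normSq_eq_norm_sq,
    Complex.normSq_apply, Complex.normSq_apply]
  simp
  ring

/-- The circles with centre `ξ + ia` through points close to `ξ` enclose every given finite set in
the open upper half-plane, and exclude every finite set in the lower one, if `a` is large. -/
theorem hasRemainderBound_of_disc (hz : ∀ p, 0 < (z p).im) (hlam : lam ≠ 0) {ξ κ₁ κ₂ κ₃ : ℝ}
    (h₁₂ : κ₁ < κ₂) (h₂₃ : κ₂ < κ₃) {rs : List ℂ} {R : ℂ[X]} (hlen : rs.length = P)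
    (hR : criticalPoly c z lam = (rs.map fun r => X - C r).prod * R)
    (hrs : ∀ r ∈ rs, (r ∈ criticalPoints c z lam ∧ 0 < r.im) ∨ r = ξ ∧ 0 < κ₁)
    (hreal : ∀ r ∈ criticalPoints c z lam, r.im = 0 → ‖r - ξ‖ ^ 2 ≠ κ₂)
    (hn : ∀ᶠ a : ℝ in atTop,
      Metric.closedBall (ξ + a * Complex.I : ℂ) √(a ^ 2 + κ₃) ⊆ lowerCutPlane z ∧
      ∃ Cn : ℝ, ∀ ε : ℝ, 0 < ε → ε ≤ 1 → ∀ (μ : ℂ) (w : Fin P → ℂ) (Φ n : ℂ → ℂ),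
        IsJostQuotient c z lam ε μ w Φ n →
        ∀ x ∈ Metric.closedBall (ξ + a * Complex.I : ℂ) √(a ^ 2 + κ₃),
          ‖n x‖ ≤ Cn * forcingNorm μ w) : HasRemainderBound c z lam rs := by
  have hfin : ({y | y ∈ criticalPoints c z lam} ∪ range z).Finite := by
    refine Set.Finite.union ?_ (finite_range z)
    refine (criticalPoints c z lam).toFinset.finite_toSet.subset fun y hy => ?_
    simpa using hy
  have hev : ∀ᶠ a : ℝ in atTop, ∀ y ∈ {y | y ∈ criticalPoints c z lam} ∪ range z, y.im ≠ 0 →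
      ‖y - ξ‖ ^ 2 + |κ₁| + |κ₂| < 2 * a * |y.im| := by
    rw [eventually_all_finite hfin]
    intro y _
    by_cases him : y.im = 0
    · exact Eventually.of_forall fun a h => absurd him h
    · have hpos : 0 < 2 * |y.im| := by positivity
      filter_upwards [(tendsto_id.const_mul_atTop hpos).eventually_gt_atTop
        (‖y - ξ‖ ^ 2 + |κ₁| + |κ₂|)] with a ha _
      simp only [id] at ha
      linarith
  obtain ⟨a, ha1, ⟨hdom, Cn, hCn⟩, ha0, haκ⟩ := (hev.and (hn.and ((eventually_gt_atTop 0).and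
    ((tendsto_pow_atTop two_ne_zero).eventually_gt_atTop (-κ₁))))).exists
  have hball : ∀ (κ : ℝ) (y : ℂ), dist y (ξ + a * Complex.I) < √(a ^ 2 + κ) ↔
      ‖y - ξ‖ ^ 2 - 2 * a * y.im < κ := fun κ y => by
    rw [Real.lt_sqrt dist_nonneg, dist_sq_center]
    constructor <;> intro h <;> linarith
  have hsph : ∀ y ∈ Metric.sphere (ξ + a * Complex.I : ℂ) √(a ^ 2 + κ₂),
      ‖y - ξ‖ ^ 2 - 2 * a * y.im = κ₂ := fun y hy => by
    have h1 : dist y (ξ + a * Complex.I) ^ 2 = a ^ 2 + κ₂ := by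
      rw [Metric.mem_sphere.mp hy, Real.sq_sqrt (by linarith)]
    rw [dist_sq_center] at h1
    linarith
  have hin : ∀ y ∈ {y | y ∈ criticalPoints c z lam} ∪ range z, 0 < y.im →
      ‖y - ξ‖ ^ 2 - 2 * a * y.im < κ₁ := fun y hy him => by
    have h1 := ha1 y hy him.ne'
    rw [abs_of_pos him] at h1
    linarith [neg_abs_le κ₁, abs_nonneg κ₂]
  have hpole : ∀ x ∈ Metric.sphere (ξ + a * Complex.I : ℂ) √(a ^ 2 + κ₂), ∀ p, x ≠ z p := by
    rintro x hx p rfl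
    have h1 := hin (z p) (Or.inr ⟨p, rfl⟩) (hz p)
    have h2 := hsph _ hx
    linarith
  have hsub : Metric.sphere (ξ + a * Complex.I : ℂ) √(a ^ 2 + κ₂) ⊆
      Metric.closedBall (ξ + a * Complex.I : ℂ) √(a ^ 2 + κ₃) := fun y hy =>
    Metric.mem_closedBall.mpr ((Metric.mem_sphere.mp hy).le.trans
      (Real.sqrt_le_sqrt (by linarith)))
  intro x
  refine exists_norm_remainderPoly_le (c := c) (z := z) (lam := lam) (c₀ := ξ + a * Complex.I)
    (ρ₁ := √(a ^ 2 + κ₁)) (ρ₂ := √(a ^ 2 + κ₂)) (ρ₃ := √(a ^ 2 + κ₃)) (Cn := Cn)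
    (Real.sqrt_pos.mpr (by linarith)) (Real.sqrt_lt_sqrt (by linarith) (by linarith))
    (Real.sqrt_lt_sqrt (by linarith) (by linarith)) hdom hpole (fun y hy h0 => ?_) (fun r hr => ?_)
    hlen hR hCn x
  · have hycp : y ∈ criticalPoints c z lam := by
      rw [criticalPoints, mem_roots (criticalPoly_ne_zero hlam), IsRoot,
        criticalPoly_eval c z lam y (hpole y hy)
          (ne_conj_pole_of_mem_lowerCutPlane (hdom (hsub hy))), h0, zero_mul]
    have h1 := hsph y hy
    rcases lt_trichotomy y.im 0 with him | him | him
    · have h2 := ha1 y (Or.inl hycp) him.ne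
      rw [abs_of_neg him] at h2
      have := le_abs_self κ₂
      have := sq_nonneg ‖y - ξ‖
      have := abs_nonneg κ₁
      linarith
    · exact hreal y hycp him (by rw [him] at h1; linarith)
    · have := hin y (Or.inl hycp) him
      linarith
  · rw [Metric.mem_ball, hball]
    rcases hrs r hr with ⟨h1, h2⟩ | ⟨rfl, h1⟩
    · exact hin r (Or.inl h1) h2
    · simpa using h1

theorem list_prod_map_toList (U : Multiset ℂ) :
    (U.toList.map fun r => (X - C r : ℂ[X])).prod = (U.map fun r => X - C r).prod := by
  conv_rhs => rw [← U.coe_toList]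
  rw [Multiset.map_coe, Multiset.prod_coe]

/-- Outside the bulk all roots lie in the upper half-plane. -/
theorem hasRemainderBound_of_pos (hz : ∀ p, 0 < (z p).im) (hlam : 0 < lam)
    (h : ∀ x : ℝ, potential c z x ≠ -lam) :
    (upperPoints c z lam).toList.length = P ∧
      HasRemainderBound c z lam (upperPoints c z lam).toList := by
  obtain ⟨hS, hcard⟩ := upperPoints_of_forall_pos hz hlam.ne' h
  have hlen : (upperPoints c z lam).toList.length = P := by rw [Multiset.length_toList, hcard]
  refine ⟨hlen, hasRemainderBound_of_disc (ξ := 0) (κ₁ := -3) (κ₂ := -2) (κ₃ := -1)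
    (R := C (lam : ℂ) * (((upperPoints c z lam).map conj).map fun r => X - C r).prod) hz hlam.ne'
    (by norm_num) (by norm_num) hlen ?_ (fun r hr => Or.inl ?_) (fun r _ _ => ?_) ?_⟩
  · rw [criticalPoly_eq_prod hlam.ne', list_prod_map_toList]
    conv_lhs => rw [hS]
    rw [Multiset.map_add, Multiset.prod_add]
    ring
  · exact mem_upperPoints.mp (Multiset.mem_toList.mp hr)
  · have := sq_nonneg ‖r - ((0 : ℝ) : ℂ)‖
    linarith
  · filter_upwards [eventually_gt_atTop 1] with a ha
    have him : ∀ y ∈ Metric.closedBall (((0 : ℝ) : ℂ) + a * Complex.I : ℂ) √(a ^ 2 + -1),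
        0 < y.im := by
      intro y hy
      have h1 := (Real.le_sqrt dist_nonneg (by nlinarith)).mp (Metric.mem_closedBall.mp hy)
      rw [dist_sq_center] at h1
      have := sq_nonneg ‖y - ((0 : ℝ) : ℂ)‖
      by_contra hcon
      push Not at hcon
      nlinarith
    refine ⟨fun y hy => mem_lowerCutPlane_of_im_pos hz (him y hy).le, ?_⟩
    obtain ⟨C, -, hC⟩ := exists_bound_upper (c := c) hz hlam
      (‖(((0 : ℝ) : ℂ) + a * Complex.I : ℂ)‖ + √(a ^ 2 + -1))
    refine ⟨C, fun ε hε hε1 μ w Φ n hJ x hx => hC ε hε hε1 μ w Φ n hJ x (him x hx).le ?_⟩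
    have := norm_le_norm_add_norm_sub' x (((0 : ℝ) : ℂ) + a * Complex.I : ℂ)
    rw [← dist_eq_norm] at this
    linarith [Metric.mem_closedBall.mp hx]

/-- In the bulk, `x₋` takes the place of the missing upper root. -/
theorem hasRemainderBound_of_isWell (hz : ∀ p, 0 < (z p).im) (hlam : 0 < lam) {xc : ℝ}
    (hw : IsWell c z xc) (hl : lam < -potential c z xc) :
    ((xMinus c z lam : ℂ) :: (upperPoints c z lam).toList).length = P ∧
      HasRemainderBound c z lam ((xMinus c z lam : ℂ) :: (upperPoints c z lam).toList) := by
  obtain ⟨hm, hp, hme, hpe, hset⟩ := hw.exists_roots hz hlam hl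
  set a := xMinus c z lam with ha
  set b := xPlus c z lam with hb
  obtain ⟨hS, hcard⟩ := upperPoints_of_two_roots hz hlam.ne' (hm.trans hp).ne hset
    (hw.deriv_neg a hm).ne (hw.deriv_pos b hp).ne'
  have hlen : ((a : ℂ) :: (upperPoints c z lam).toList).length = P := by
    rw [List.length_cons, Multiset.length_toList, hcard]
  set η := (xc - a) / 2 with hη
  have hη0 : 0 < η := by rw [hη]; linarith
  refine ⟨hlen, hasRemainderBound_of_disc (ξ := a) (κ₁ := η ^ 2 / 3) (κ₂ := η ^ 2 / 2) (κ₃ := η ^ 2)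
    (R := C (lam : ℂ) * ((X - C (b : ℂ)) *
      (((upperPoints c z lam).map conj).map fun r => X - C r).prod)) hz hlam.ne'
    (by nlinarith) (by nlinarith) hlen ?_ (fun r hr => ?_) (fun r hr hr0 => ?_) ?_⟩
  · rw [criticalPoly_eq_prod hlam.ne', List.map_cons, List.prod_cons, list_prod_map_toList]
    conv_lhs => rw [hS]
    simp only [Multiset.insert_eq_cons, Multiset.map_add, Multiset.map_cons,
      Multiset.map_singleton, Multiset.prod_add, Multiset.prod_cons, Multiset.prod_singleton]
    ring
  · rcases List.mem_cons.mp hr with rfl | hr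
    · exact Or.inr ⟨rfl, by positivity⟩
    · exact Or.inl (mem_upperPoints.mp (Multiset.mem_toList.mp hr))
  · have hrr : r = (r.re : ℂ) := Complex.ext (by simp) (by simp [hr0])
    rw [hrr] at hr ⊢
    have h1 := (ofReal_mem_criticalPoints_iff hz hlam.ne' _).mp hr
    have h2 : r.re = a ∨ r.re = b := by
      have h3 : r.re ∈ ({a, b} : Set ℝ) := hset ▸ h1
      simpa using h3
    rw [← Complex.ofReal_sub, Complex.norm_real, Real.norm_eq_abs, sq_abs]
    rcases h2 with h2 | h2
    · rw [h2]
      nlinarith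
    · rw [h2]
      have h3 : 2 * η < b - a := by rw [hη]; linarith
      nlinarith
  · obtain ⟨Cl, ρ, hCl, hρ, hρz, hlow⟩ := exists_bound_lower (c := c) (B₁ := a + η) hz hlam
      (fun x hx => by
        have := hw.deriv_neg x (by rw [hη] at hx; linarith)
        rwa [(hasDerivAt_potential hz x).deriv] at this)
    filter_upwards [eventually_gt_atTop 0,
      (tendsto_id.const_mul_atTop hρ).eventually_gt_atTop (η ^ 2)] with A hA hAρ
    simp only [id] at hAρ
    have hy : ∀ y ∈ Metric.closedBall ((a : ℂ) + A * Complex.I : ℂ) √(A ^ 2 + η ^ 2),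
        y.im ≤ 0 → y.re ≤ a + η ∧ -ρ ≤ y.im := by
      intro y hy him
      have h1 := (Real.le_sqrt dist_nonneg (by positivity)).mp (Metric.mem_closedBall.mp hy)
      rw [dist_sq_center] at h1
      have h2 : (y.re - a) ^ 2 ≤ ‖y - (a : ℂ)‖ ^ 2 := by
        rw [← Complex.normSq_eq_norm_sq, Complex.normSq_apply]
        simp
        nlinarith [sq_nonneg y.im]
      constructor
      · have h3 : (y.re - a) ^ 2 ≤ η ^ 2 := by nlinarith
        have := abs_le_of_sq_le_sq h3 hη0.le
        linarith [(abs_le.mp this).2]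
      · by_contra hcon
        push Not at hcon
        nlinarith [sq_nonneg (y.re - a)]
    constructor
    · intro y hyb
      by_cases him : y.im ≤ 0
      · intro p _
        linarith [(hy y hyb him).2, hρz p]
      · exact mem_lowerCutPlane_of_im_pos hz (by linarith)
    · obtain ⟨Cu, hCu, hup⟩ := exists_bound_upper (c := c) hz hlam
        (‖((a : ℂ) + A * Complex.I : ℂ)‖ + √(A ^ 2 + η ^ 2))
      refine ⟨Cl + Cu, fun ε hε hε1 μ w Φ n hJ x hx => ?_⟩
      have hγ := forcingNorm_nonneg μ w
      by_cases him : x.im ≤ 0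
      · refine (hlow ε hε hε1 μ w Φ n hJ x (hy x hx him).1 (hy x hx him).2 him).trans ?_
        gcongr; linarith
      · refine (hup ε hε hε1 μ w Φ n hJ x (by linarith) ?_).trans ?_
        · have := norm_le_norm_add_norm_sub' x ((a : ℂ) + A * Complex.I : ℂ)
          rw [← dist_eq_norm] at this
          linarith [Metric.mem_closedBall.mp hx]
        · gcongr; linarith

/-- For small `ε` the coefficients of the forcing are controlled by its value at infinity. -/
theorem HasRemainderBound.exists_forcingNorm_le (hmono : StrictMono fun p => (z p).re)
    {rs : List ℂ} (h : HasRemainderBound c z lam rs) :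
    ∃ ε₀ C : ℝ, 0 < ε₀ ∧ ε₀ ≤ 1 ∧ 0 ≤ C ∧ ∀ ε : ℝ, 0 < ε → ε ≤ ε₀ →
      ∀ (μ : ℂ) (w : Fin P → ℂ) (Φ n : ℂ → ℂ), IsJostQuotient c z lam ε μ w Φ n →
        forcingNorm μ w ≤ C * ‖μ‖ := by
  choose K hK0 hK using fun p => h (z p)
  set α : Fin P → ℝ := fun p => ‖∏ q ∈ Finset.univ.erase p, (z p - z q)‖ with hα
  have hα0 : ∀ p, 0 < α p := fun p => norm_pos_iff.mpr (Finset.prod_ne_zero_iff.mpr fun q hq =>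
    sub_ne_zero.mpr fun hpq => Finset.ne_of_mem_erase hq (hmono.injective (by simp [hpq])))
  set b : Fin P → ℝ := fun p => ‖(rs.map fun r => z p - r).prod‖ with hb
  set S := ∑ p, K p / α p with hS
  set T := ∑ p, b p / α p with hT
  have hS0 : 0 ≤ S := Finset.sum_nonneg fun p _ => div_nonneg (hK0 p) (hα0 p).le
  have hT0 : 0 ≤ T := Finset.sum_nonneg fun p _ => div_nonneg (norm_nonneg _) (hα0 p).le
  refine ⟨1 / (2 * (S + 1)), 2 * (1 + T), by positivity, ?_, by positivity,
    fun ε hε hε0 μ w Φ n hJ => ?_⟩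
  · rw [div_le_one (by positivity)]; linarith
  have hε1 : ε ≤ 1 := hε0.trans (by rw [div_le_one (by positivity)]; linarith)
  have hγ := forcingNorm_nonneg μ w
  have hwp : ∀ p, ‖w p‖ ≤ K p / α p * (ε * forcingNorm μ w) + ‖μ‖ * (b p / α p) := by
    intro p
    have h1 := hK p ε hε hε1 μ w Φ n hJ
    rw [eval_remainderPoly_pole] at h1
    have h2 : ‖w p‖ * α p ≤ K p * (ε * forcingNorm μ w) + ‖μ‖ * b p := by
      rw [hα, hb]
      simp only
      rw [← norm_mul, ← norm_mul]
      refine (norm_le_norm_sub_add _ (μ * (rs.map fun r => z p - r).prod)).trans ?_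
      linarith
    rw [← le_div_iff₀ (hα0 p)] at h2
    refine h2.trans (le_of_eq ?_)
    ring
  have hsum : ∑ p, ‖w p‖ ≤ S * (ε * forcingNorm μ w) + ‖μ‖ * T := by
    rw [hS, hT, Finset.sum_mul, Finset.mul_sum, ← Finset.sum_add_distrib]
    exact Finset.sum_le_sum fun p _ => hwp p
  have hεS : S * ε ≤ 1 / 2 := by
    rw [le_div_iff₀ (by positivity)] at hε0
    nlinarith
  have hdef : forcingNorm μ w = ‖μ‖ + ∑ p, ‖w p‖ := rfl
  nlinarith

theorem HasRemainderBound.exists_norm_forcing_sub_le (hmono : StrictMono fun p => (z p).re)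
    {rs : List ℂ} (h : HasRemainderBound c z lam rs) {x : ℂ} (hx : ∀ p, x ≠ z p) :
    ∃ ε₀ C : ℝ, 0 < ε₀ ∧ ε₀ ≤ 1 ∧ 0 ≤ C ∧ ∀ ε : ℝ, 0 < ε → ε ≤ ε₀ →
      ∀ (μ : ℂ) (w : Fin P → ℂ) (Φ n : ℂ → ℂ), IsJostQuotient c z lam ε μ w Φ n →
        ‖forcing z μ w x - μ * ((rs.map fun r => x - r).prod / ∏ p, (x - z p))‖ ≤ C * ε * ‖μ‖ := by
  obtain ⟨ε₀, C, hε₀, hε₀1, hC, hle⟩ := h.exists_forcingNorm_le hmono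
  obtain ⟨K, hK0, hK⟩ := h x
  have hZ : ∏ p, (x - z p) ≠ 0 := Finset.prod_ne_zero_iff.mpr fun p _ => sub_ne_zero.mpr (hx p)
  refine ⟨ε₀, K * C / ‖∏ p, (x - z p)‖, hε₀, hε₀1, by positivity, fun ε hε hε0 μ w Φ n hJ => ?_⟩
  have h1 := hK ε hε (hε0.trans hε₀1) μ w Φ n hJ
  have h2 := hle ε hε hε0 μ w Φ n hJ
  have h3 : forcing z μ w x - μ * ((rs.map fun r => x - r).prod / ∏ p, (x - z p)) =
      (remainderPoly z rs μ w).eval x / ∏ p, (x - z p) := by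
    rw [eq_div_iff hZ]
    have := prod_mul_forcing_eq rs μ w hx
    field_simp
    linear_combination this
  rw [h3, norm_div, div_le_iff₀ (norm_pos_iff.mpr hZ)]
  refine h1.trans ?_
  have h4 : K * C / ‖∏ p, (x - z p)‖ * ε * ‖μ‖ * ‖∏ p, (x - z p)‖ = K * (ε * (C * ‖μ‖)) := by
    field_simp
  rw [h4]
  gcongr

/-! ### Solvability of the linear system -/

theorem rowIntegral_forcing_eq_mulVec (hε : 0 < ε) (hlam : 0 < lam) (hz : ∀ p, 0 < (z p).im)
    (hmono : StrictMono fun p => (z p).re) (t : ℂ) (w : Fin P → ℂ) (m : Fin P) :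
    rowIntegral c z lam ε m (forcing z (t * lam) w) =
      (jostMatrix c z lam ε).mulVec w m - t * jostVector c z lam ε m := by
  rw [rowIntegral_forcing hε hlam hz hmono, jostVector, Matrix.mulVec, dotProduct]
  simp only [jostMatrix, Matrix.of_apply]
  rw [Finset.sum_congr rfl fun p _ => mul_comm (w p) _]
  ring

/-- For small `ε` the matrix is invertible. -/
theorem HasRemainderBound.eventually_existsUnique (hlam : 0 < lam) (hz : ∀ p, 0 < (z p).im)
    (hmono : StrictMono fun p => (z p).re) {rs : List ℂ} (h : HasRemainderBound c z lam rs) :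
    ∀ᶠ ε : ℝ in 𝓝[>] 0, ∃! v, (jostMatrix c z lam ε).mulVec v = jostVector c z lam ε := by
  obtain ⟨ε₀, C, hε₀, -, hC, hle⟩ := h.exists_forcingNorm_le hmono
  filter_upwards [Ioc_mem_nhdsGT hε₀] with ε hε
  have hinj : Function.Injective (jostMatrix c z lam ε).mulVec := by
    intro w w' hww
    have hker : (jostMatrix c z lam ε).mulVec (w - w') = 0 := by
      rw [Matrix.mulVec_sub, hww, sub_self]
    have hrow : ∀ m, rowIntegral c z lam ε m (forcing z 0 (w - w')) = 0 := fun m => by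
      have := rowIntegral_forcing_eq_mulVec (c := c) hε.1 hlam hz hmono 0 (w - w') m
      rw [hker, zero_mul] at this
      simpa using this
    obtain ⟨Φ, n, hJ⟩ := exists_isJostQuotient hε.1 hlam hz hmono hrow
    have h1 := hle ε hε.1 hε.2 0 (w - w') Φ n hJ
    rw [norm_zero, mul_zero] at h1
    have h2 := (sum_norm_le_forcingNorm (0 : ℂ) (w - w')).trans h1
    funext p
    have h3 := (Finset.single_le_sum (f := fun p => ‖(w - w') p‖) (fun q _ => norm_nonneg _)
      (Finset.mem_univ p)).trans h2
    exact sub_eq_zero.mp (norm_le_zero_iff.mp h3)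
  have hsurj : Function.Surjective (jostMatrix c z lam ε).mulVec :=
    Matrix.mulVec_surjective_iff_isUnit.mpr (Matrix.mulVec_injective_iff_isUnit.mp hinj)
  obtain ⟨v, hv⟩ := hsurj (jostVector c z lam ε)
  exact ⟨v, hv, fun v' hv' => hinj (hv'.trans hv.symm)⟩

/-- A solution of the linear system yields a Jost quotient whose forcing is `λ` at infinity. -/
theorem exists_isJostQuotient_of_mulVec_eq (hε : 0 < ε) (hlam : 0 < lam) (hz : ∀ p, 0 < (z p).im)
    (hmono : StrictMono fun p => (z p).re) {v : Fin P → ℂ}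
    (hv : (jostMatrix c z lam ε).mulVec v = jostVector c z lam ε) :
    ∃ Φ n, IsJostQuotient c z lam ε lam v Φ n := by
  refine exists_isJostQuotient hε hlam hz hmono fun m => ?_
  have := rowIntegral_forcing_eq_mulVec (c := c) hε hlam hz hmono 1 v m
  rw [one_mul] at this
  rw [this, hv]
  ring

/-! ### The reflection coefficient as a limit at `-i∞` -/

/-- `J` is the limit of `Φ` at `-i∞` to the right of the poles. -/
def HasRightLimit (z : Fin P → ℂ) (Φ : ℂ → ℂ) (J : ℂ) : Prop :=
  ∀ x : ℝ, 2 * outerRadius z ≤ x → Tendsto (fun t : ℝ => Φ (x + t * Complex.I)) atBot (𝓝 J)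

theorem right_mem_branchDomain {x₀ x₁ s t : ℝ} (h₀ : 2 * outerRadius z ≤ x₀)
    (h₁ : 2 * outerRadius z ≤ x₁) (hs : s ∈ uIcc x₀ x₁) :
    (s + t * Complex.I : ℂ) ∈ branchDomain z 0 := by
  have h := one_le_outerRadius z
  have hs1 : 2 * outerRadius z ≤ s := (le_min h₀ h₁).trans hs.1
  exact column_mem_branchDomain_of_far (by rwa [abs_of_nonneg (by linarith)]) 0 t

theorem mem_leftDomain_zero {x : ℂ} (hx : x ∈ branchDomain z 0) : x ∈ leftDomain z 0 :=
  ⟨hx, fun h => (lt_irrefl 0 h).elim⟩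

theorem IsBranchPrimitive.exists_hasRightLimit (hε : 0 < ε) (hlam : 0 < lam) {μ : ℂ}
    {w : Fin P → ℂ} {Φ : ℂ → ℂ} (h : IsBranchPrimitive c z lam ε 0 μ w Φ) :
    ∃ J, HasRightLimit z Φ J := by
  set x₀ := 2 * outerRadius z with hx₀
  have hdom : ∀ t : ℝ, (x₀ + t * Complex.I : ℂ) ∈ branchDomain z 0 := fun t =>
    right_mem_branchDomain le_rfl le_rfl left_mem_uIcc
  have hder : ∀ t : ℝ, HasDerivAt (fun t : ℝ => Φ (x₀ + t * Complex.I))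
      (Complex.I * (branchExp c z lam ε 0 (x₀ + t * Complex.I) *
        forcing z μ w (x₀ + t * Complex.I))) t := fun t =>
    hasDerivAt_comp_line (h.hasDerivAt _ (mem_leftDomain_zero (hdom t)))
  have hint := integrableOn_branchExp_mul (c := c) (a := 0) hε hlam (fun t _ => hdom t) μ w
  refine ⟨limUnder atBot fun t : ℝ => Φ (x₀ + t * Complex.I), fun x hx => ?_⟩
  · have h0 := tendsto_limUnder_of_hasDerivAt_of_integrableOn_Iic (fun t _ => hder t) hint
    have h1 := tendsto_zero_column (c := c) (lam := lam) (μ := μ) (w := w) (x₀ := x₀) (x₁ := x)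
      (Φ := fun y => Φ y - limUnder atBot fun t : ℝ => Φ (x₀ + t * Complex.I)) hε hlam
      (fun s hs t => right_mem_branchDomain le_rfl hx hs)
      (fun s hs t => (h.hasDerivAt _ (mem_leftDomain_zero
        (right_mem_branchDomain le_rfl hx hs))).sub_const _) (by
        have := h0.sub_const (limUnder atBot fun t : ℝ => Φ (x₀ + t * Complex.I))
        rwa [sub_self] at this)
    have h2 := h1.add_const (limUnder atBot fun t : ℝ => Φ (x₀ + t * Complex.I))
    rw [zero_add] at h2
    exact h2.congr fun t => by ring

theorem IsBranchPrimitive.right_bounds (hε : 0 < ε) (hlam : 0 < lam) {μ : ℂ} {w : Fin P → ℂ}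
    {Φ : ℂ → ℂ} (h : IsBranchPrimitive c z lam ε 0 μ w Φ) {J : ℂ} (hJ : HasRightLimit z Φ J) {a : ℂ}
    (hRa : 2 * outerRadius z ≤ a.re)
    (hσ : ∀ x : ℂ, |a.re| ≤ ‖x‖ → ‖potentialC c z x‖ ≤ lam / 2) :
    ‖Φ a - J‖ ≤ 4 * ε / lam * forcingNorm μ w * ‖branchExp c z lam ε 0 a‖ ∧
    ‖Φ a - J - Complex.I * ε * μ / lam * branchExp c z lam ε 0 a‖ ≤
      2 * ε / lam * ((2 * ∑ p, ‖w p‖ + ‖μ‖ / lam * (4 * ∑ p, ‖c p‖)) / |a.re|) *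
        ‖branchExp c z lam ε 0 a‖ := by
  have hdom : ∀ t : ℝ, (a.re + t * Complex.I : ℂ) ∈ branchDomain z 0 := fun t =>
    right_mem_branchDomain hRa hRa left_mem_uIcc
  refine norm_primitive_le_of_far (Φ := fun x => Φ x - J) hε hlam ?_ hσ hdom
    (fun t => (h.hasDerivAt _ (mem_leftDomain_zero (hdom t))).sub_const _) ?_
  · rwa [abs_of_nonneg (by linarith [one_le_outerRadius z])]
  · have := (hJ a.re hRa).sub_const J
    rwa [sub_self] at this

/-- `e^{-ih/ε} (u₀ - ∑ v_p / (x - z_p))` is the derivative of `iε e^{-ih/ε} - Φ`, which vanishes at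
`-∞` and tends to `-J` at `∞`. -/
theorem IsJostQuotient.hasImproperIntegral (hε : 0 < ε) (hlam : 0 < lam) (hz : ∀ p, 0 < (z p).im)
    {v : Fin P → ℂ} {Φ n : ℂ → ℂ} (h : IsJostQuotient c z lam ε lam v Φ n) {J : ℂ}
    (hJ : HasRightLimit z Φ J) :
    HasImproperIntegral (fun x => expFactor c z lam ε x *
      ((potential c z x : ℂ) - ∑ p, v p / ((x : ℂ) - z p))) (-J) := by
  have hεc : (ε : ℂ) ≠ 0 := by exact_mod_cast hε.ne'
  have hlc : (lam : ℂ) ≠ 0 := by exact_mod_cast hlam.ne'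
  set g : ℝ → ℂ := fun x => expFactor c z lam ε x *
      ((potential c z x : ℂ) - ∑ p, v p / ((x : ℂ) - z p)) with hg
  set F : ℝ → ℂ := fun x => Complex.I * ε * branchExp c z lam ε 0 x - Φ x with hF
  have hder : ∀ x : ℝ, HasDerivAt F (g x) x := by
    intro x
    have hx := real_mem_leftDomain hz x
    have h1 := ((hasDerivAt_branchExp (c := c) (lam := lam) (ε := ε) hx.1).const_mul
      (Complex.I * ε)).sub (h.primitive.hasDerivAt _ hx)
    refine h1.comp_ofReal.congr_deriv ?_
    rw [hg]
    simp only [expFactor_eq_branchExp, forcing, ← potentialC_ofReal]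
    field_simp
    ring_nf
    simp only [Complex.I_sq]
    ring
  have hcont : Continuous g := by
    rw [hg]
    simp only [expFactor_eq_branchExp]
    refine Continuous.mul ?_ (Continuous.sub (Complex.continuous_ofReal.comp
      (continuous_potential hz)) (continuous_finsetSum _ fun p _ => ?_))
    · exact continuous_iff_continuousAt.mpr fun x =>
        (hasDerivAt_branchExp (real_mem_leftDomain hz x).1).comp_ofReal.continuousAt
    · exact continuous_const.div (by fun_prop) fun x => sub_ne_zero.mpr (ofReal_ne_pole hz x p).1
  obtain ⟨Y, hYR, hY⟩ := exists_radius_potentialC_le c z (half_pos hlam)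
  set C : ℝ := 2 * ε / lam * (2 * ∑ p, ‖v p‖ + ‖(lam : ℂ)‖ / lam * (4 * ∑ p, ‖c p‖)) with hC
  have hlimC : ∀ l : Filter ℝ, Tendsto (fun x : ℝ => |x|) l atTop →
      Tendsto (fun x : ℝ => C / |x|) l (𝓝 0) := fun l hl => hl.const_div_atTop C
  have hbot : Tendsto F atBot (𝓝 0) := by
    refine squeeze_zero_norm' ?_ (hlimC atBot tendsto_abs_atBot_atTop)
    filter_upwards [eventually_le_atBot (-Y)] with x hx
    have h0 := one_le_outerRadius z
    have hE := norm_branchExp_ofReal (c := c) (lam := lam) (ε := ε) hz x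
    have h1 := (h.left_bounds hε hlam (a := (x : ℂ)) (by rw [Complex.ofReal_re]; linarith)
      fun y hy => hY y (le_trans (by
        rw [Complex.ofReal_re, abs_of_nonpos (by linarith)]; linarith) hy)).2
    rw [hF]
    simp only
    rw [h.eq_mul _ (real_mem_leftDomain hz x).1, mul_comm (Complex.I * ε), ← mul_sub, norm_mul, hE,
      one_mul, norm_sub_rev]
    rw [mul_div_cancel_right₀ _ hlc, Complex.ofReal_re] at h1
    rw [hC]
    refine h1.trans (le_of_eq ?_)
    ring
  have htop : Tendsto F atTop (𝓝 (-J)) := by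
    rw [tendsto_iff_norm_sub_tendsto_zero]
    refine squeeze_zero' (Eventually.of_forall fun x => norm_nonneg _) ?_
      (hlimC atTop tendsto_abs_atTop_atTop)
    filter_upwards [eventually_ge_atTop Y] with x hx
    have h0 := one_le_outerRadius z
    have hE := norm_branchExp_ofReal (c := c) (lam := lam) (ε := ε) hz x
    have h1 := (h.primitive.right_bounds hε hlam hJ (a := (x : ℂ)) (by rw [Complex.ofReal_re]; linarith)
      fun y hy => hY y (le_trans (by
        rw [Complex.ofReal_re, abs_of_nonneg (by linarith)]; linarith) hy)).2
    rw [hE, mul_one, mul_div_cancel_right₀ _ hlc, Complex.ofReal_re, ← norm_neg] at h1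
    rw [hF, hC]
    refine le_trans (le_of_eq ?_) (h1.trans (le_of_eq ?_))
    · congr 1
      ring
    · ring
  refine ⟨fun a b => hcont.intervalIntegrable a b, ?_⟩
  have hI : ∀ a b : ℝ, ∫ x in a..b, g x = F b - F a := fun a b =>
    intervalIntegral.integral_eq_sub_of_hasDerivAt (fun x _ => hder x) (hcont.intervalIntegrable a b)
  simp only [hI]
  have h1 : Tendsto (fun q : ℝ × ℝ => F q.2) (atBot ×ˢ atTop) (𝓝 (-J)) := htop.comp tendsto_snd
  have h2 : Tendsto (fun q : ℝ × ℝ => F q.1) (atBot ×ˢ atTop) (𝓝 0) := hbot.comp tendsto_fst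
  have := h1.sub h2
  rwa [sub_zero] at this

/-- If the linear system is uniquely solvable there is exactly one reflection coefficient. -/
theorem existsUnique_isReflectionCoefficient (hε : 0 < ε) (hlam : 0 < lam)
    (hz : ∀ p, 0 < (z p).im) (hmono : StrictMono fun p => (z p).re)
    (h : ∃! v, (jostMatrix c z lam ε).mulVec v = jostVector c z lam ε) :
    ∃! b : ℂ, IsReflectionCoefficient c z lam ε b := by
  obtain ⟨v, hv, huniq⟩ := h
  obtain ⟨Φ, n, hJ⟩ := exists_isJostQuotient_of_mulVec_eq hε hlam hz hmono hv
  obtain ⟨J, hlim⟩ := hJ.primitive.exists_hasRightLimit hε hlam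
  have hI := hJ.hasImproperIntegral hε hlam hz hlim
  refine ⟨_, ⟨v, hv, -J, hI, rfl⟩, ?_⟩
  rintro b ⟨v', hv', I, hI', rfl⟩
  obtain rfl := huniq v' hv'
  rw [tendsto_nhds_unique hI'.2 hI.2]

/-- Every reflection coefficient is determined by the right limit of a Jost quotient. -/
theorem IsReflectionCoefficient.exists_hasRightLimit (hε : 0 < ε) (hlam : 0 < lam)
    (hz : ∀ p, 0 < (z p).im) (hmono : StrictMono fun p => (z p).re) {b : ℂ}
    (h : IsReflectionCoefficient c z lam ε b) :
    ∃ (v : Fin P → ℂ) (Φ n : ℂ → ℂ) (J : ℂ), IsJostQuotient c z lam ε lam v Φ n ∧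
      HasRightLimit z Φ J ∧ b = -(Complex.I / ε * Complex.exp (Complex.I * mass c / ε) * J) := by
  obtain ⟨v, hv, I, hI, rfl⟩ := h
  obtain ⟨Φ, n, hJ⟩ := exists_isJostQuotient_of_mulVec_eq hε hlam hz hmono hv
  obtain ⟨J, hlim⟩ := hJ.primitive.exists_hasRightLimit hε hlam
  refine ⟨v, Φ, n, J, hJ, hlim, ?_⟩
  rw [tendsto_nhds_unique hI.2 (hJ.hasImproperIntegral hε hlam hz hlim).2]
  ring

theorem mass_eq_ofReal (h : ∑ p, (c p).re = 0) :
    mass c = ((-2 * Real.pi * ∑ p, (c p).im : ℝ) : ℂ) := by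
  have h1 : (∑ p, c p) = ((∑ p, (c p).im : ℝ) : ℂ) * Complex.I := by
    apply Complex.ext <;> simp [h]
  rw [mass, h1]
  push_cast
  linear_combination (2 * (Real.pi : ℂ) * ∑ p, ((c p).im : ℂ)) * Complex.I_sq

theorem norm_exp_mass (h : ∑ p, (c p).re = 0) (ε : ℝ) :
    ‖Complex.exp (Complex.I * mass c / ε)‖ = 1 := by
  rw [mass_eq_ofReal h, mul_div_assoc, ← Complex.ofReal_div, mul_comm, Complex.norm_exp_ofReal_mul_I]

/-! ### Outside the bulk -/

/-- Outside the bulk `Re h'` is bounded below in a strip under the real axis. -/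
theorem exists_strip_re_ge (hz : ∀ p, 0 < (z p).im) (hlam : 0 < lam)
    (h : ∀ x : ℝ, 0 < lam + potential c z x) :
    ∃ δ m : ℝ, 0 < δ ∧ 0 < m ∧ (∀ p, δ < (z p).im) ∧
      ∀ x : ℂ, -δ ≤ x.im → x.im ≤ 0 → m ≤ (lam + potentialC c z x).re := by
  obtain ⟨Y, hYR, hY⟩ := exists_radius_potentialC_le c z (half_pos hlam)
  obtain ⟨d, hd, hdz⟩ := exists_pos_forall_le hz
  have h0 := one_le_outerRadius z
  have hne : (Icc (-Y) Y).Nonempty := ⟨0, by constructor <;> linarith⟩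
  obtain ⟨x₀, -, hx₀⟩ := isCompact_Icc.exists_isMinOn hne
    (continuous_potential (c := c) hz).continuousOn
  set m₀ := lam + potential c z x₀ with hm₀
  have hm₀pos : 0 < m₀ := h x₀
  set V : Set ℂ := {x | |x.im| < d} with hV
  have hVo : IsOpen V := isOpen_lt (by fun_prop) continuous_const
  have hcont : ContinuousOn (fun x => (lam + potentialC c z x).re) V :=
    Complex.continuous_re.comp_continuousOn
      (continuousOn_const.add (differentiableOn_potentialC_strip hdz).continuousOn)
  set O := V ∩ (fun x => (lam + potentialC c z x).re) ⁻¹' Ioi (m₀ / 2) with hO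
  have hOo : IsOpen O := hcont.isOpen_inter_preimage hVo isOpen_Ioi
  set K : Set ℂ := (fun x : ℝ => (x : ℂ)) '' Icc (-Y) Y with hK
  have hKc : IsCompact K := isCompact_Icc.image Complex.continuous_ofReal
  have hKO : K ⊆ O := by
    rintro _ ⟨x, hx, rfl⟩
    refine ⟨by simp [hV, hd], ?_⟩
    have h1 : potential c z x₀ ≤ potential c z x := hx₀ hx
    have h2 : ((lam : ℂ) + potentialC c z x).re = lam + potential c z x := by
      rw [potentialC_ofReal, Complex.add_re, Complex.ofReal_re, Complex.ofReal_re]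
    simp only [mem_preimage, mem_Ioi, h2]
    linarith
  obtain ⟨δ, hδ, hδO⟩ := hKc.exists_thickening_subset_open hOo hKO
  have hmin := min_le_left (δ / 2) (d / 2)
  have hmin' := min_le_right (δ / 2) (d / 2)
  refine ⟨min (δ / 2) (d / 2), min (m₀ / 2) (lam / 2), by positivity, by positivity,
    fun p => by linarith [hdz p], fun x h1 h2 => ?_⟩
  by_cases hx : |x.re| ≤ Y
  · have hmem : x ∈ Metric.thickening δ K := by
      rw [Metric.mem_thickening_iff]
      refine ⟨(x.re : ℂ), ⟨x.re, abs_le.mp hx, rfl⟩, ?_⟩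
      have : x - x.re = x.im * Complex.I := by
        apply Complex.ext <;> simp
      rw [dist_eq_norm, this, norm_mul, Complex.norm_real, Complex.norm_I, mul_one,
        Real.norm_eq_abs, abs_of_nonpos h2]
      linarith
    exact (min_le_left _ _).trans (le_of_lt (hδO hmem).2)
  · push Not at hx
    have h3 := hY x (hx.le.trans (Complex.abs_re_le_norm x))
    have h4 := abs_le.mp ((Complex.abs_re_le_norm _).trans h3)
    rw [Complex.add_re, Complex.ofReal_re]
    refine (min_le_right _ _).trans ?_
    linarith [h4.1]

theorem mem_branchDomain_of_abs_im_lt {d : ℝ} (hdz : ∀ p, d ≤ (z p).im) {x : ℂ}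
    (hx : |x.im| < d) : x ∈ branchDomain z 0 := by
  have h := abs_lt.mp hx
  refine mem_branchDomain_iff.mpr fun p => ⟨fun _ => ⟨fun h0 => (Nat.not_lt_zero _ h0).elim,
    fun _ => ?_⟩, fun _ => ?_⟩
  · linarith [hdz p, h.2]
  · linarith [hdz p, h.1]

/-- Outside the bulk the contour can be shifted below the real axis, where `e^{-ih/ε}` is
exponentially small. -/
theorem exists_norm_rightLimit_le_exp (hz : ∀ p, 0 < (z p).im) (hlam : 0 < lam)
    (h : ∀ x : ℝ, 0 < lam + potential c z x) :
    ∃ C κ : ℝ, 0 ≤ C ∧ 0 < κ ∧ ∀ ε : ℝ, 0 < ε → ε ≤ 1 → ∀ (μ : ℂ) (w : Fin P → ℂ) (Φ n : ℂ → ℂ)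
      (J : ℂ), IsJostQuotient c z lam ε μ w Φ n → HasRightLimit z Φ J →
        ‖J‖ ≤ C * forcingNorm μ w * Real.exp (-κ / ε) := by
  obtain ⟨δ, m, hδ, hm, hδz, hre⟩ := exists_strip_re_ge hz hlam h
  obtain ⟨d, hd, hdz⟩ := exists_pos_forall_le (f := fun p => (z p).im - δ) fun p => by
    linarith [hδz p]
  obtain ⟨Y, hYR, hY⟩ := exists_radius_potentialC_le c z (half_pos hlam)
  have h0 := one_le_outerRadius z
  have hdomd : ∀ x : ℂ, -δ ≤ x.im → x.im ≤ 0 → x ∈ branchDomain z 0 := fun x h1 h2 =>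
    mem_branchDomain_of_abs_im_lt (d := d + δ) (fun p => by linarith [hdz p])
      (abs_lt.mpr ⟨by linarith, by linarith⟩)
  refine ⟨4 / lam + 4 / lam + (1 + 1 / d) * (2 * Y), m * δ, ?_, by positivity,
    fun ε hε hε1 μ w Φ n J hJ hlim => ?_⟩
  · have : 0 ≤ Y := by linarith
    positivity
  have hγ := forcingNorm_nonneg μ w
  set y : ℂ := ((-δ : ℝ) : ℂ) * Complex.I with hy
  have hre' : ∀ s : ℝ, (s + y : ℂ).re = s := fun s => by rw [hy, re_add_mul_I]
  have him' : ∀ s : ℝ, (s + y : ℂ).im = -δ := fun s => by rw [hy, im_add_mul_I]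
  have hdomy : ∀ s : ℝ, (s + y : ℂ) ∈ branchDomain z 0 := fun s =>
    hdomd _ (by rw [him']) (by rw [him']; linarith)
  have hE : ∀ s : ℝ, ‖branchExp c z lam ε 0 (s + y)‖ ≤ Real.exp (-(m * δ) / ε) := by
    intro s
    have := norm_branchExp_le_of_re_ge (c := c) (lam := lam) (k := 0) (a := s) (d := Complex.I)
      (s₀ := -δ) (s₁ := 0) (κ := m) hε (by linarith)
      (fun t ht => hdomd _ (by rw [im_add_mul_I]; exact ht.1) (by rw [im_add_mul_I]; exact ht.2))
      (fun t ht => by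
        have h1 := hre (s + t * Complex.I) (by rw [im_add_mul_I]; exact ht.1)
          (by rw [im_add_mul_I]; exact ht.2)
        refine h1.trans (le_of_eq ?_)
        congr 1
        linear_combination ((lam : ℂ) + potentialC c z (s + t * Complex.I)) * Complex.I_sq)
    rw [Complex.ofReal_zero, zero_mul, add_zero, norm_branchExp_ofReal hz, one_mul] at this
    refine this.trans (le_of_eq ?_)
    congr 1
    ring
  set e := Real.exp (-(m * δ) / ε) with he
  have he0 : 0 < e := Real.exp_pos _
  have hfar : ∀ s : ℝ, |s| = Y → ∀ v : ℂ, |(s + y : ℂ).re| ≤ ‖v‖ → ‖potentialC c z v‖ ≤ lam / 2 :=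
    fun s hs v hv => hY v (by rwa [hre', hs] at hv)
  have hYabs : |Y| = Y := abs_of_nonneg (by linarith)
  have hYabs' : |-Y| = Y := by rw [abs_neg, hYabs]
  have hr := (hJ.primitive.right_bounds hε hlam hlim (a := (Y : ℝ) + y) (by rw [hre']; linarith)
    (hfar Y hYabs)).1
  have hl := (hJ.left_bounds hε hlam (a := ((-Y : ℝ) : ℂ) + y) (by rw [hre']; linarith)
    (hfar (-Y) hYabs')).1
  have hε4 : 4 * ε / lam ≤ 4 / lam := by gcongr; linarith
  have hr' : ‖Φ ((Y : ℝ) + y) - J‖ ≤ 4 / lam * forcingNorm μ w * e :=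
    hr.trans (by gcongr; exact hE Y)
  have hl' : ‖Φ (((-Y : ℝ) : ℂ) + y)‖ ≤ 4 / lam * forcingNorm μ w * e := by
    rw [hJ.eq_mul _ (hdomy _), norm_mul, mul_comm]
    exact mul_le_mul (hl.trans (by gcongr)) (hE _) (norm_nonneg _) (by positivity)
  have hint : Φ ((Y : ℝ) + y) - Φ (((-Y : ℝ) : ℂ) + y) =
      ∫ s in (-Y)..Y, branchExp c z lam ε 0 (s + y) * forcing z μ w (s + y) :=
    (hJ.primitive.integral_horizontal fun s _ => mem_leftDomain_zero (hdomy s)).symm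
  have hint' : ‖∫ s in (-Y)..Y, branchExp c z lam ε 0 (s + y) * forcing z μ w (s + y)‖ ≤
      e * ((1 + 1 / d) * forcingNorm μ w) * |Y - -Y| := by
    refine intervalIntegral.norm_integral_le_of_norm_le_const fun s _ => ?_
    rw [norm_mul]
    refine mul_le_mul (hE s) (norm_forcing_le μ w hd fun p => ?_) (norm_nonneg _) he0.le
    have h1 := Complex.abs_im_le_norm ((s + y : ℂ) - z p)
    rw [Complex.sub_im, him', abs_of_nonpos (by linarith [hz p])] at h1
    linarith [hdz p]
  rw [sub_neg_eq_add, ← two_mul, abs_of_nonneg (by linarith : (0 : ℝ) ≤ 2 * Y), ← hint] at hint'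
  have htri : J = Φ (((-Y : ℝ) : ℂ) + y) + (Φ ((Y : ℝ) + y) - Φ (((-Y : ℝ) : ℂ) + y)) -
    (Φ ((Y : ℝ) + y) - J) := by ring
  rw [htri]
  refine (norm_sub_le _ _).trans ((add_le_add_left (norm_add_le _ _) _).trans ?_)
  calc _ ≤ 4 / lam * forcingNorm μ w * e + e * ((1 + 1 / d) * forcingNorm μ w) * (2 * Y) +
        4 / lam * forcingNorm μ w * e := by gcongr
    _ = _ := by ring

/-! ### Laplace's method at a nondegenerate maximum -/

theorem setIntegral_gaussian_le {b : ℝ} (hb : 0 < b) (S : Set ℝ) :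
    ∫ t in S, Real.exp (-b * t ^ 2) ≤ √(Real.pi / b) := by
  rw [← integral_gaussian b]
  exact setIntegral_le_integral (integrable_exp_neg_mul_sq hb)
    (Eventually.of_forall fun t => (Real.exp_pos _).le)

theorem pow_mul_exp_neg_le {a : ℝ} (ha : 0 < a) (j : ℕ) {q : ℝ} (hq : 0 ≤ q) :
    q ^ j * Real.exp (-(2 * a) * q) ≤ j.factorial / a ^ j * Real.exp (-a * q) := by
  have h1 := Real.pow_div_factorial_le_exp (a * q) (by positivity) j
  have hj : (0 : ℝ) < j.factorial := by exact_mod_cast j.factorial_pos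
  rw [div_le_iff₀ hj, mul_pow] at h1
  have h2 : Real.exp (-(2 * a) * q) = Real.exp (-a * q) * Real.exp (-(a * q)) := by
    rw [← Real.exp_add]; congr 1; ring
  rw [h2]
  have h3 : q ^ j * Real.exp (-(a * q)) ≤ j.factorial / a ^ j := by
    rw [Real.exp_neg, ← div_eq_mul_inv, div_le_div_iff₀ (Real.exp_pos _) (by positivity)]
    linarith
  calc _ = q ^ j * Real.exp (-(a * q)) * Real.exp (-a * q) := by ring
    _ ≤ _ := by gcongr

theorem sqrt_pi_div_div {a : ℝ} (hε : 0 < ε) : √(Real.pi / (a / ε)) = √(Real.pi / a) * √ε := by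
  rw [← Real.sqrt_mul' _ hε.le]
  congr 1
  field_simp

/-- Truncation of the Gaussian integral. -/
theorem exists_abs_integral_gaussian_sub_le {s ρ : ℝ} (hs : 0 < s) (hρ : 0 < ρ) :
    ∃ C : ℝ, 0 ≤ C ∧ ∀ ε : ℝ, 0 < ε →
      |(∫ t in (-ρ)..ρ, Real.exp (-(s / ε) * t ^ 2)) - √(Real.pi / s) * √ε| ≤ C * (ε * √ε) := by
  refine ⟨2 / (s * ρ ^ 2) * √(Real.pi / (s / 2)), by positivity, fun ε hε => ?_⟩
  have hsε : 0 < s / ε := by positivity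
  have hint := integrable_exp_neg_mul_sq hsε
  rw [intervalIntegral.integral_of_le (by linarith), ← sqrt_pi_div_div hε, ← integral_gaussian (s / ε),
    ← integral_add_compl (measurableSet_Ioc (a := -ρ) (b := ρ)) hint, sub_add_cancel_left, abs_neg,
    abs_of_nonneg (setIntegral_nonneg measurableSet_Ioc.compl fun t _ => (Real.exp_pos _).le)]
  have hhalf : 0 < s / 2 / ε := by positivity
  have hle : ∫ t in (Ioc (-ρ) ρ)ᶜ, Real.exp (-(s / ε) * t ^ 2) ≤
      ∫ t in (Ioc (-ρ) ρ)ᶜ, 2 / (s * ρ ^ 2) * ε * Real.exp (-(s / 2 / ε) * t ^ 2) := by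
    refine setIntegral_mono_on hint.integrableOn
      ((integrable_exp_neg_mul_sq hhalf).const_mul _).integrableOn measurableSet_Ioc.compl
      fun t ht => ?_
    have ht2 : ρ ^ 2 ≤ t ^ 2 := by
      have : ρ ≤ |t| := by
        by_contra hcon
        push Not at hcon
        exact ht ⟨(abs_lt.mp hcon).1, (abs_lt.mp hcon).2.le⟩
      rw [← sq_abs t]
      gcongr
    have h1 := pow_mul_exp_neg_le (a := s / 2) (by positivity) 1 (q := t ^ 2 / ε) (by positivity)
    simp only [pow_one, Nat.factorial_one, Nat.cast_one] at h1
    have h2 : -(2 * (s / 2)) * (t ^ 2 / ε) = -(s / ε) * t ^ 2 := by ring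
    have h3 : -(s / 2) * (t ^ 2 / ε) = -(s / 2 / ε) * t ^ 2 := by ring
    rw [h2, h3] at h1
    have h4 : ρ ^ 2 / ε * Real.exp (-(s / ε) * t ^ 2) ≤ 1 / (s / 2) * Real.exp (-(s / 2 / ε) * t ^ 2) :=
      le_trans (by gcongr) h1
    rw [div_mul_eq_mul_div, div_le_iff₀ hε] at h4
    calc Real.exp (-(s / ε) * t ^ 2) = ρ ^ 2 * Real.exp (-(s / ε) * t ^ 2) / ρ ^ 2 := by
          field_simp
      _ ≤ 1 / (s / 2) * Real.exp (-(s / 2 / ε) * t ^ 2) * ε / ρ ^ 2 := by gcongr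
      _ = _ := by field_simp
  refine hle.trans ?_
  rw [integral_const_mul]
  have h5 := setIntegral_gaussian_le hhalf (Ioc (-ρ) ρ)ᶜ
  rw [sqrt_pi_div_div hε] at h5
  calc _ ≤ 2 / (s * ρ ^ 2) * ε * (√(Real.pi / (s / 2)) * √ε) := by gcongr
    _ = _ := by ring

/-- Laplace's method with an error of relative order `ε`: the terms of odd order in the expansions
of phase and amplitude do not contribute. -/
theorem exists_norm_laplace_sub_le {s ρ : ℝ} (hs : 0 < s) (hρ : 0 < ρ) {φ g : ℝ → ℂ}
    (hφ : ContinuousOn φ (Icc (-ρ) ρ)) (hg : ContinuousOn g (Icc (-ρ) ρ)) {k g₀ g₁ : ℂ} {Cφ Cg : ℝ}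
    (hφ4 : ∀ t ∈ Icc (-ρ) ρ, ‖φ t + s * t ^ 2 - k * t ^ 3‖ ≤ Cφ * t ^ 4)
    (hφ2 : ∀ t ∈ Icc (-ρ) ρ, ‖φ t + s * t ^ 2‖ ≤ s / 2 * t ^ 2)
    (hg2 : ∀ t ∈ Icc (-ρ) ρ, ‖g t - g₀ - g₁ * t‖ ≤ Cg * t ^ 2) :
    ∃ C : ℝ, 0 ≤ C ∧ ∀ ε : ℝ, 0 < ε →
      ‖(∫ t in (-ρ)..ρ, Complex.exp (φ t / ε) * g t) - ((√(Real.pi / s) * √ε : ℝ) : ℂ) * g₀‖ ≤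
        C * (ε * √ε) := by
  have hρmem : ρ ∈ Icc (-ρ) ρ := ⟨by linarith, le_rfl⟩
  have hCφ : 0 ≤ Cφ := by
    have := (norm_nonneg _).trans (hφ4 ρ hρmem)
    exact nonneg_of_mul_nonneg_left this (by positivity)
  have hCg : 0 ≤ Cg := by
    have := (norm_nonneg _).trans (hg2 ρ hρmem)
    exact nonneg_of_mul_nonneg_left this (by positivity)
  obtain ⟨C₁, hC₁, hgauss⟩ := exists_abs_integral_gaussian_sub_le hs hρ
  set K := ‖k‖ + Cφ * ρ with hK
  have hK0 : 0 ≤ K := by positivity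
  set N := ‖g₀‖ + ‖g₁‖ * ρ with hN
  have hN0 : 0 ≤ N := by positivity
  -- with `q = t² / ε` all error terms are of the form `ε q ^ j e^{-sq/2}`
  set A₁ := Cg with hA₁
  set A₂ := Cφ * N + ‖k‖ * ‖g₁‖ with hA₂
  set A₃ := K ^ 2 * N with hA₃
  set C₂ := A₁ * (1 / (s / 4)) + A₂ * (2 / (s / 4) ^ 2) + A₃ * (6 / (s / 4) ^ 3) with hC₂
  have hC₂0 : 0 ≤ C₂ := by positivity
  refine ⟨C₂ * √(Real.pi / (s / 4)) + C₁ * ‖g₀‖, by positivity, fun ε hε => ?_⟩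
  have hεc : (ε : ℂ) ≠ 0 := by exact_mod_cast hε.ne'
  set M : ℝ → ℂ := fun t => ((Real.exp (-(s / ε) * t ^ 2) : ℝ) : ℂ) * (g₁ * t + g₀ * k * t ^ 3 / ε)
    with hM
  set G₀ : ℝ → ℂ := fun t => ((Real.exp (-(s / ε) * t ^ 2) : ℝ) : ℂ) * g₀ with hG₀
  have hpt : ∀ t ∈ Icc (-ρ) ρ, ‖Complex.exp (φ t / ε) * g t - (G₀ t + M t)‖ ≤
      C₂ * ε * Real.exp (-(s / 4 / ε) * t ^ 2) := by
    intro t ht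
    have htρ : |t| ≤ ρ := abs_le.mpr ht
    set q := t ^ 2 / ε with hq
    have hq0 : 0 ≤ q := by positivity
    have ht2 : t ^ 2 = ε * q := by rw [hq]; field_simp
    set w : ℂ := (φ t + s * t ^ 2) / ε with hw
    have hwn : ‖w‖ ≤ s / 2 * q := by
      rw [hw, norm_div, Complex.norm_real, Real.norm_eq_abs, abs_of_pos hε, div_le_iff₀ hε]
      have := hφ2 t ht
      rw [ht2] at this
      linarith
    set r : ℂ := w - k * t ^ 3 / ε with hr
    have hrn : ‖r‖ ≤ Cφ * ε * q ^ 2 := by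
      have h1 : r = (φ t + s * t ^ 2 - k * t ^ 3) / ε := by rw [hr, hw]; ring
      rw [h1, norm_div, Complex.norm_real, Real.norm_eq_abs, abs_of_pos hε, div_le_iff₀ hε]
      refine (hφ4 t ht).trans (le_of_eq ?_)
      calc Cφ * t ^ 4 = Cφ * (t ^ 2) ^ 2 := by ring
        _ = _ := by rw [ht2]; ring
    have hw2 : ‖w‖ ^ 2 ≤ K ^ 2 * ε * q ^ 3 := by
      have h1 : ‖φ t + s * t ^ 2‖ ≤ K * |t| ^ 3 := by
        have h2 := norm_le_norm_sub_add (φ t + s * t ^ 2) (k * t ^ 3)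
        have h3 : ‖k * (t : ℂ) ^ 3‖ = ‖k‖ * |t| ^ 3 := by
          rw [norm_mul, norm_pow, Complex.norm_real, Real.norm_eq_abs]
        have h4 : Cφ * t ^ 4 ≤ Cφ * ρ * |t| ^ 3 := by
          have : t ^ 4 = |t| * |t| ^ 3 := by
            calc t ^ 4 = (t ^ 2) ^ 2 := by ring
              _ = (|t| ^ 2) ^ 2 := by rw [sq_abs]
              _ = _ := by ring
          rw [this, mul_assoc]
          gcongr
        have := hφ4 t ht
        rw [hK]
        linarith
      have h5 : ‖w‖ ≤ K * |t| ^ 3 / ε := by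
        rw [hw, norm_div, Complex.norm_real, Real.norm_eq_abs, abs_of_pos hε]
        gcongr
      calc ‖w‖ ^ 2 ≤ (K * |t| ^ 3 / ε) ^ 2 := by gcongr
        _ = K ^ 2 * (|t| ^ 2) ^ 3 / ε ^ 2 := by ring
        _ = _ := by rw [sq_abs, ht2]; field_simp
    have hexp : ‖Complex.exp w - 1 - w‖ ≤ ‖w‖ ^ 2 * Real.exp (s / 2 * q) := by
      have h1 := Complex.norm_exp_sub_sum_le_norm_mul_exp w 2
      simp only [Finset.sum_range_succ, Finset.range_zero, Finset.sum_empty, pow_zero,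
        Nat.factorial_zero, Nat.cast_one, div_one, zero_add, pow_one, Nat.factorial_one] at h1
      rw [sub_sub]
      refine h1.trans ?_
      gcongr
    set e := Real.exp (-(s / ε) * t ^ 2) with he
    have heq : e = Real.exp (-s * q) := by rw [he, hq]; congr 1; ring
    set e' := Real.exp (-(2 * (s / 4)) * q) with he'
    have hee : e ≤ e' := by
      rw [heq, he']
      gcongr
      nlinarith
    have hee' : e * Real.exp (s / 2 * q) = e' := by
      rw [heq, he', ← Real.exp_add]; congr 1; ring
    have hE : Complex.exp (φ t / ε) = (e : ℂ) * Complex.exp w := by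
      rw [he, Complex.ofReal_exp, ← Complex.exp_add, hw]
      congr 1
      push_cast
      field_simp
      ring
    have hEn : ‖Complex.exp (φ t / ε)‖ ≤ e' := by
      rw [hE, norm_mul, Complex.norm_real, Real.norm_eq_abs, abs_of_pos (Real.exp_pos _),
        Complex.norm_exp, ← hee']
      exact mul_le_mul_of_nonneg_left
        (Real.exp_le_exp.mpr ((Complex.re_le_norm w).trans hwn)) (Real.exp_pos _).le
    have hR₁ : ‖(e : ℂ) * (Complex.exp w - 1 - w + r)‖ ≤ e' * (K ^ 2 * ε * q ^ 3 + Cφ * ε * q ^ 2) := by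
      rw [norm_mul, Complex.norm_real, Real.norm_eq_abs, abs_of_pos (Real.exp_pos _)]
      calc e * ‖Complex.exp w - 1 - w + r‖ ≤
            e * (‖w‖ ^ 2 * Real.exp (s / 2 * q) + Cφ * ε * q ^ 2) := by
            gcongr
            exact (norm_add_le _ _).trans (add_le_add hexp hrn)
        _ = ‖w‖ ^ 2 * (e * Real.exp (s / 2 * q)) + e * (Cφ * ε * q ^ 2) := by ring
        _ ≤ (K ^ 2 * ε * q ^ 3) * e' + e' * (Cφ * ε * q ^ 2) := by
            rw [hee']
            gcongr
        _ = _ := by ring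
    have hgn : ‖g₀ + g₁ * t‖ ≤ N := by
      refine (norm_add_le _ _).trans ?_
      rw [norm_mul, Complex.norm_real, Real.norm_eq_abs, hN]
      gcongr
    have hid : Complex.exp (φ t / ε) * g t - (G₀ t + M t) =
        Complex.exp (φ t / ε) * (g t - g₀ - g₁ * t) +
          (e : ℂ) * (Complex.exp w - 1 - w + r) * (g₀ + g₁ * t) +
          (e : ℂ) * (k * g₁ * (t ^ 4 / ε)) := by
      rw [hG₀, hM, hE, hr]
      simp only
      ring
    rw [hid]
    have h4 : ‖(e : ℂ) * (k * g₁ * ((t : ℂ) ^ 4 / ε))‖ ≤ e' * (‖k‖ * ‖g₁‖ * (ε * q ^ 2)) := by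
      have h5 : ((t : ℂ) ^ 4 / ε) = ((ε * q ^ 2 : ℝ) : ℂ) := by
        rw [hq]; push_cast; field_simp
      rw [h5, norm_mul, norm_mul, norm_mul, Complex.norm_real, Complex.norm_real, Real.norm_eq_abs,
        Real.norm_eq_abs, abs_of_pos (Real.exp_pos _), abs_of_nonneg (by positivity)]
      gcongr
    have hp1 := pow_mul_exp_neg_le (a := s / 4) (by positivity) 1 hq0
    have hp2 := pow_mul_exp_neg_le (a := s / 4) (by positivity) 2 hq0
    have hp3 := pow_mul_exp_neg_le (a := s / 4) (by positivity) 3 hq0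
    have hfac : ((1).factorial : ℝ) = 1 ∧ ((2).factorial : ℝ) = 2 ∧ ((3).factorial : ℝ) = 6 := by
      refine ⟨by norm_num, by norm_num [Nat.factorial], by norm_num [Nat.factorial]⟩
    rw [hfac.1, pow_one, pow_one] at hp1
    rw [hfac.2.1] at hp2
    rw [hfac.2.2] at hp3
    have he4 : Real.exp (-(s / 4 / ε) * t ^ 2) = Real.exp (-(s / 4) * q) := by
      rw [hq]; congr 1; ring
    rw [he4]
    calc _ ≤ e' * (Cg * t ^ 2) + e' * (K ^ 2 * ε * q ^ 3 + Cφ * ε * q ^ 2) * N +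
          e' * (‖k‖ * ‖g₁‖ * (ε * q ^ 2)) := by
          refine (norm_add₃_le).trans ?_
          rw [norm_mul, norm_mul (_ * (_ : ℂ)) (g₀ + g₁ * t)]
          have := hg2 t ht
          gcongr
      _ = ε * (A₁ * (q * e') + A₂ * (q ^ 2 * e') + A₃ * (q ^ 3 * e')) := by
          rw [ht2, hA₂, hA₃]; ring
      _ ≤ ε * (A₁ * (1 / (s / 4) * Real.exp (-(s / 4) * q)) +
          A₂ * (2 / (s / 4) ^ 2 * Real.exp (-(s / 4) * q)) +
          A₃ * (6 / (s / 4) ^ 3 * Real.exp (-(s / 4) * q))) := by gcongr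
      _ = _ := by rw [hC₂]; ring
  have hcM : Continuous M := by rw [hM]; fun_prop
  have hcG : Continuous G₀ := by rw [hG₀]; fun_prop
  have hcF : ContinuousOn (fun t => Complex.exp (φ t / ε) * g t) (uIcc (-ρ) ρ) := by
    rw [uIcc_of_le (by linarith)]
    exact ((hφ.div_const _).cexp).mul hg
  have hodd : ∫ t in (-ρ)..ρ, M t = 0 := by
    have h1 : ∫ t in (-ρ)..ρ, M (-t) = ∫ t in (-ρ)..ρ, M t := by
      rw [intervalIntegral.integral_comp_neg, neg_neg]
    have h2 : ∀ t, M (-t) = -M t := fun t => by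
      rw [hM]
      simp only [even_two.neg_pow]
      push_cast
      ring
    simp only [h2, intervalIntegral.integral_neg] at h1
    have h3 : (2 : ℂ) * ∫ t in (-ρ)..ρ, M t = 0 := by linear_combination -h1
    simpa using h3
  have heven : ∫ t in (-ρ)..ρ, G₀ t =
      ((∫ t in (-ρ)..ρ, Real.exp (-(s / ε) * t ^ 2) : ℝ) : ℂ) * g₀ := by
    rw [hG₀, intervalIntegral.integral_mul_const, intervalIntegral.integral_ofReal]
  have hdiff : (∫ t in (-ρ)..ρ, Complex.exp (φ t / ε) * g t) -
      ((∫ t in (-ρ)..ρ, Real.exp (-(s / ε) * t ^ 2) : ℝ) : ℂ) * g₀ =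
      ∫ t in (-ρ)..ρ, (Complex.exp (φ t / ε) * g t - (G₀ t + M t)) := by
    rw [intervalIntegral.integral_sub hcF.intervalIntegrable
      ((by fun_prop : Continuous fun t => G₀ t + M t).intervalIntegrable _ _), intervalIntegral.integral_add
      (hcG.intervalIntegrable _ _) (hcM.intervalIntegrable _ _), hodd, heven, add_zero]
  have h4ε : 0 < s / 4 / ε := by positivity
  have hbd : ‖∫ t in (-ρ)..ρ, (Complex.exp (φ t / ε) * g t - (G₀ t + M t))‖ ≤
      C₂ * ε * (√(Real.pi / (s / 4)) * √ε) := by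
    refine (intervalIntegral.norm_integral_le_of_norm_le (by linarith)
      (Eventually.of_forall fun t ht => hpt t ⟨ht.1.le, ht.2⟩)
      ((by fun_prop : Continuous fun t : ℝ =>
        C₂ * ε * Real.exp (-(s / 4 / ε) * t ^ 2)).intervalIntegrable _ _)).trans ?_
    rw [intervalIntegral.integral_const_mul, intervalIntegral.integral_of_le (by linarith),
      ← sqrt_pi_div_div hε]
    gcongr
    exact setIntegral_gaussian_le h4ε _
  have hg' := hgauss ε hε
  set I₀ := ∫ t in (-ρ)..ρ, Real.exp (-(s / ε) * t ^ 2) with hI₀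
  have hsplit : (∫ t in (-ρ)..ρ, Complex.exp (φ t / ε) * g t) -
      ((√(Real.pi / s) * √ε : ℝ) : ℂ) * g₀ =
      (∫ t in (-ρ)..ρ, (Complex.exp (φ t / ε) * g t - (G₀ t + M t))) +
        ((I₀ - √(Real.pi / s) * √ε : ℝ) : ℂ) * g₀ := by
    rw [← hdiff]; push_cast; ring
  rw [hsplit]
  refine (norm_add_le _ _).trans ?_
  rw [norm_mul, Complex.norm_real, Real.norm_eq_abs]
  calc _ ≤ C₂ * ε * (√(Real.pi / (s / 4)) * √ε) + C₁ * (ε * √ε) * ‖g₀‖ := by gcongr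
    _ = _ := by ring

/-- Taylor's formula for analytic functions. -/
theorem exists_taylor_two {f : ℂ → ℂ} {b : ℂ} {r : ℝ} (hr : 0 < r)
    (hf : DifferentiableOn ℂ f (Metric.ball b r)) :
    ∃ (a : ℂ) (C : ℝ), 0 ≤ C ∧ ∀ w : ℂ, ‖w‖ ≤ r / 2 →
      ‖f (b + w) - f b - deriv f b * w - a * w ^ 2‖ ≤ C * ‖w‖ ^ 3 := by
  have hb : Metric.ball b r ∈ 𝓝 b := Metric.ball_mem_nhds b hr
  have h1 := (Complex.differentiableOn_dslope hb).mpr hf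
  have h2 := (Complex.differentiableOn_dslope hb).mpr h1
  have h3 := (Complex.differentiableOn_dslope hb).mpr h2
  obtain ⟨C, hC⟩ := (isCompact_closedBall b (r / 2)).exists_bound_of_continuousOn
    (h3.continuousOn.mono (Metric.closedBall_subset_ball (by linarith)))
  have hC0 := (norm_nonneg _).trans (hC b (Metric.mem_closedBall_self (by positivity)))
  refine ⟨dslope (dslope f b) b b, C, hC0, fun w hw => ?_⟩
  have hmem : b + w ∈ Metric.closedBall b (r / 2) := by
    rw [mem_closedBall_iff_norm, add_sub_cancel_left]; exact hw
  have key : ∀ F : ℂ → ℂ, F (b + w) = F b + w * dslope F b (b + w) := fun F => by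
    have := sub_smul_dslope F b (b + w)
    rw [add_sub_cancel_left, smul_eq_mul] at this
    rw [this]; ring
  have e1 := key f
  have e2 := key (dslope f b)
  have e3 := key (dslope (dslope f b) b)
  rw [dslope_same] at e2
  have : f (b + w) - f b - deriv f b * w - dslope (dslope f b) b b * w ^ 2 =
      w ^ 3 * dslope (dslope (dslope f b) b) b (b + w) := by
    rw [e1, e2, e3]; ring
  rw [this, norm_mul, norm_pow, mul_comm]
  exact mul_le_mul_of_nonneg_right (hC _ hmem) (by positivity)

/-! ### The contribution of the saddle point -/

/-- On the line of steepest descent through a point `b` with `u₀(b) = -λ`, `u₀'(b) = s > 0`, the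
exponent `-i (h - h(b))` is `-s t² + k t³ + O(t⁴)`. -/
theorem exists_saddle_exponent (hz : ∀ p, 0 < (z p).im) {b : ℝ} (hb : potential c z b = -lam)
    (hs : 0 < deriv (potential c z) b) {ρ₀ : ℝ} (hρ₀ : 0 < ρ₀) :
    ∃ (ρ C : ℝ) (k : ℂ) (φ : ℝ → ℂ), 0 < ρ ∧ ρ ≤ ρ₀ ∧ (∀ p, 2 * ρ ≤ (z p).im) ∧
      ContinuousOn φ (Icc (-ρ) ρ) ∧
      (∀ t ∈ Icc (-ρ) ρ, ‖φ t + deriv (potential c z) b * t ^ 2 - k * t ^ 3‖ ≤ C * t ^ 4) ∧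
      (∀ t ∈ Icc (-ρ) ρ, ‖φ t + deriv (potential c z) b * t ^ 2‖ ≤
        deriv (potential c z) b / 2 * t ^ 2) ∧
      ∀ (ε : ℝ) (t : ℝ), branchExp c z lam ε 0 (b + t * (1 - Complex.I)) =
        branchExp c z lam ε 0 b * Complex.exp (φ t / ε) := by
  set s := deriv (potential c z) b with hsdef
  obtain ⟨d, hd, hdz⟩ := exists_pos_forall_le hz
  have hstrip : ∀ x ∈ Metric.ball (b : ℂ) d, |x.im| < d := fun x hx => by
    have h1 := Complex.abs_im_le_norm (x - b)
    rw [Complex.sub_im, Complex.ofReal_im, sub_zero] at h1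
    exact h1.trans_lt (mem_ball_iff_norm.mp hx)
  obtain ⟨a, C, hC, hT⟩ := exists_taylor_two hd
    ((differentiableOn_potentialC_strip (c := c) hdz).mono fun x hx => hstrip x hx)
  rw [deriv_potentialC_ofReal hz, potentialC_ofReal, hb, ← hsdef] at hT
  have hnI : ‖(1 - Complex.I : ℂ)‖ ≤ 2 :=
    (norm_sub_le _ _).trans (by rw [norm_one, Complex.norm_I]; norm_num)
  set k : ℂ := -2 * (1 - Complex.I) * a / 3 with hk
  set φ : ℝ → ℂ := fun t => -Complex.I * ((lam * (b + t * (1 - Complex.I)) +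
    branchAntideriv c z 0 (b + t * (1 - Complex.I))) - (lam * b + branchAntideriv c z 0 b)) with hφ
  have hI2 := Complex.I_sq
  set ρ := min (min ρ₀ (d / 4)) (min 1 (s / (2 * (‖k‖ + 16 * C + 1)))) with hρ
  have hρpos : 0 < ρ := by positivity
  have hρ1 : ρ ≤ ρ₀ := (min_le_left _ _).trans (min_le_left _ _)
  have hρ2 : ρ ≤ d / 4 := (min_le_left _ _).trans (min_le_right _ _)
  have hρ3 : ρ ≤ 1 := (min_le_right _ _).trans (min_le_left _ _)
  have hρ4 : ρ * (‖k‖ + 16 * C) ≤ s / 2 := by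
    have h1 : ρ ≤ s / (2 * (‖k‖ + 16 * C + 1)) := (min_le_right _ _).trans (min_le_right _ _)
    rw [le_div_iff₀ (by positivity)] at h1
    nlinarith
  have hder : ∀ t : ℝ, |t| ≤ ρ → HasDerivAt φ (-Complex.I * (1 - Complex.I) *
      (lam + potentialC c z (b + t * (1 - Complex.I)))) t := by
    intro t ht
    have hmem : (b + t * (1 - Complex.I) : ℂ) ∈ branchDomain z 0 := by
      refine mem_branchDomain_of_abs_im_lt hdz ?_
      simp only [Complex.add_im, Complex.ofReal_im, Complex.mul_im, Complex.ofReal_re,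
        Complex.sub_im, Complex.one_im, Complex.I_im, Complex.sub_re, Complex.one_re, Complex.I_re]
      ring_nf
      rw [abs_neg]
      linarith
    have h1 : HasDerivAt (fun x : ℂ => lam * x + branchAntideriv c z 0 x)
        (lam + potentialC c z (b + t * (1 - Complex.I))) (b + t * (1 - Complex.I)) := by
      simpa using ((hasDerivAt_id _).const_mul (lam : ℂ)).fun_add (hasDerivAt_branchAntideriv hmem)
    have h2 := ((hasDerivAt_comp_line h1).sub_const
      (lam * b + branchAntideriv c z 0 b)).const_mul (-Complex.I)
    exact h2.congr_deriv (by ring)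
  have hφ0 : φ 0 = 0 := by simp [hφ]
  have h4 : ∀ t ∈ Icc (-ρ) ρ, ‖φ t + s * t ^ 2 - k * t ^ 3‖ ≤ 16 * C * t ^ 4 := by
    intro t ht
    have htρ : |t| ≤ ρ := abs_le.mpr ht
    have hseg : ∀ y ∈ uIcc 0 t, |y| ≤ |t| := fun y hy => by
      simpa using abs_sub_left_of_mem_uIcc hy
    have hd1 : ∀ y ∈ uIcc 0 t, HasDerivWithinAt (fun y : ℝ => φ y + s * (y : ℂ) ^ 2 - k * (y : ℂ) ^ 3)
        (-Complex.I * (1 - Complex.I) * (lam + potentialC c z (b + y * (1 - Complex.I))) +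
          s * (2 * y) - k * (3 * y ^ 2)) (uIcc 0 t) y := by
      intro y hy
      have e0 : HasDerivAt (fun y : ℝ => (y : ℂ)) 1 y := Complex.ofRealCLM.hasDerivAt
      have e1 := ((hder y ((hseg y hy).trans htρ)).add ((e0.fun_pow 2).const_mul (s : ℂ))).sub
        ((e0.fun_pow 3).const_mul k)
      refine (e1.congr_deriv ?_).hasDerivWithinAt
      norm_num
    have hbd : ∀ y ∈ uIcc 0 t, ‖-Complex.I * (1 - Complex.I) *
        (lam + potentialC c z (b + y * (1 - Complex.I))) + s * (2 * y) - k * (3 * y ^ 2)‖ ≤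
          16 * C * |t| ^ 3 := by
      intro y hy
      have hyt := hseg y hy
      have hw : ‖(y * (1 - Complex.I) : ℂ)‖ ≤ 2 * |y| := by
        rw [norm_mul, Complex.norm_real, Real.norm_eq_abs, mul_comm]; gcongr
      have h1 := hT (y * (1 - Complex.I)) (by linarith)
      have h2 : -Complex.I * (1 - Complex.I) *
          (lam + potentialC c z (b + y * (1 - Complex.I))) + s * (2 * y) - k * (3 * y ^ 2) =
          -Complex.I * (1 - Complex.I) * (potentialC c z (b + y * (1 - Complex.I)) -
            ((-lam : ℝ) : ℂ) - s * (y * (1 - Complex.I)) - a * (y * (1 - Complex.I)) ^ 2) := by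
        rw [hk]
        push_cast
        linear_combination
          (s * y * (2 - Complex.I) + a * y ^ 2 * (Complex.I ^ 2 - 3 * Complex.I + 2)) * hI2
      rw [h2, norm_mul, norm_mul, norm_neg, Complex.norm_I, one_mul]
      calc _ ≤ 2 * (C * (2 * |y|) ^ 3) := by
            gcongr
            exact h1.trans (by gcongr)
        _ = 16 * C * |y| ^ 3 := by ring
        _ ≤ _ := by gcongr
    have := (convex_uIcc 0 t).norm_image_sub_le_of_norm_hasDerivWithin_le hd1 hbd
      left_mem_uIcc right_mem_uIcc
    simp only [hφ0, Complex.ofReal_zero, ne_eq, OfNat.ofNat_ne_zero, not_false_eq_true, zero_pow,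
      mul_zero, add_zero, sub_zero, Real.norm_eq_abs] at this
    refine this.trans (le_of_eq ?_)
    rw [mul_assoc, ← pow_succ]
    norm_num [Even.pow_abs]
  refine ⟨ρ, 16 * C, k, φ, hρpos, hρ1, fun p => by linarith [hdz p],
    fun t ht => (hder t (abs_le.mpr ht)).continuousAt.continuousWithinAt, h4, fun t ht => ?_,
    fun ε t => ?_⟩
  · have htρ : |t| ≤ ρ := abs_le.mpr ht
    have h1 := h4 t ht
    have h2 : φ t + s * t ^ 2 = (φ t + s * t ^ 2 - k * t ^ 3) + k * t ^ 3 := by ring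
    rw [h2]
    refine (norm_add_le _ _).trans ?_
    rw [norm_mul, norm_pow, Complex.norm_real, Real.norm_eq_abs]
    have h3 : |t| ^ 3 ≤ ρ * t ^ 2 := by
      rw [pow_succ', sq_abs]; gcongr
    have h5 : t ^ 4 ≤ ρ * t ^ 2 := by
      have h6 : |t| ≤ 1 := htρ.trans hρ3
      calc t ^ 4 = |t| ^ 3 * |t| := by rw [← pow_succ, Even.pow_abs ⟨2, rfl⟩]
        _ ≤ |t| ^ 3 * 1 := by gcongr
        _ ≤ _ := by rw [mul_one]; exact h3
    calc _ ≤ 16 * C * (ρ * t ^ 2) + ‖k‖ * (ρ * t ^ 2) := by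
          gcongr
          exact h1.trans (by gcongr)
      _ = ρ * (‖k‖ + 16 * C) * t ^ 2 := by ring
      _ ≤ _ := by gcongr
  · rw [branchExp, branchExp, ← Complex.exp_add]
    congr 1
    rw [hφ]
    ring

/-- The integral of `e^{-ih/ε} G` along the line of steepest descent. -/
theorem exists_norm_saddle_integral_sub_le (hz : ∀ p, 0 < (z p).im) {b : ℝ}
    (hb : potential c z b = -lam) (hs : 0 < deriv (potential c z) b) {ρ₀ : ℝ} (hρ₀ : 0 < ρ₀) :
    ∃ ρ C : ℝ, 0 < ρ ∧ ρ ≤ ρ₀ ∧ (∀ p, 2 * ρ ≤ (z p).im) ∧ 0 ≤ C ∧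
      (∀ (ε t : ℝ), 0 < ε → |t| ≤ ρ → ‖branchExp c z lam ε 0 (b + t * (1 - Complex.I))‖ ≤
        Real.exp (-(deriv (potential c z) b / 2 * t ^ 2) / ε)) ∧
      ∀ ε : ℝ, 0 < ε → ∀ (μ : ℂ) (w : Fin P → ℂ),
        ‖(∫ t in (-ρ)..ρ, branchExp c z lam ε 0 (b + t * (1 - Complex.I)) *
            forcing z μ w (b + t * (1 - Complex.I))) -
          branchExp c z lam ε 0 b * ((√(Real.pi / deriv (potential c z) b) * √ε : ℝ) : ℂ) *
            forcing z μ w b‖ ≤ C * forcingNorm μ w * (ε * √ε) := by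
  obtain ⟨ρ, Cφ, k, φ, hρ, hρρ₀, hρz, hφc, hφ4, hφ2, hE⟩ := exists_saddle_exponent hz hb hs hρ₀
  set s := deriv (potential c z) b with hsdef
  have him : ∀ t : ℝ, (b + t * (1 - Complex.I) : ℂ).im = -t := fun t => by simp
  have hdist : ∀ t ∈ Icc (-ρ) ρ, ∀ p, ρ ≤ ‖(b + t * (1 - Complex.I) : ℂ) - z p‖ := fun t ht p => by
    have h1 := Complex.abs_im_le_norm ((b + t * (1 - Complex.I) : ℂ) - z p)
    rw [Complex.sub_im, him] at h1
    have h2 := neg_abs_le (-t - (z p).im)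
    have := hρz p
    have := ht.1
    linarith
  have hne : ∀ t ∈ Icc (-ρ) ρ, ∀ p, (b + t * (1 - Complex.I) : ℂ) ≠ z p := fun t ht p h => by
    have := hdist t ht p
    rw [h, sub_self, norm_zero] at this
    linarith
  have hbne : ∀ p, (b : ℂ) - z p ≠ 0 := fun p => sub_ne_zero.mpr (ofReal_ne_pole hz b p).1
  obtain ⟨C₀, hC₀, hL₀⟩ := exists_norm_laplace_sub_le (g := fun _ => 1) (g₀ := 1) (g₁ := 0) (Cg := 0)
    hs hρ hφc continuousOn_const hφ4 hφ2 fun t _ => by simp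
  have hpole : ∀ p, ∃ C : ℝ, 0 ≤ C ∧ ∀ ε : ℝ, 0 < ε →
      ‖(∫ t in (-ρ)..ρ, Complex.exp (φ t / ε) * (1 / ((b + t * (1 - Complex.I) : ℂ) - z p))) -
        ((√(Real.pi / s) * √ε : ℝ) : ℂ) * (1 / (b - z p))‖ ≤ C * (ε * √ε) := fun p => by
    have hcont : ContinuousOn (fun t : ℝ => 1 / ((b + t * (1 - Complex.I) : ℂ) - z p))
        (Icc (-ρ) ρ) :=
      continuousOn_const.div (by fun_prop) fun t ht => sub_ne_zero.mpr (hne t ht p)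
    refine exists_norm_laplace_sub_le (g₁ := -(1 - Complex.I) / (b - z p) ^ 2)
      (Cg := 4 / (‖(b : ℂ) - z p‖ ^ 2 * ρ)) hs hρ hφc hcont hφ4 hφ2 fun t ht => ?_
    have h1 := sub_ne_zero.mpr (hne t ht p)
    have h2 := hbne p
    have h3 : 1 / ((b + t * (1 - Complex.I) : ℂ) - z p) - 1 / (b - z p) -
        -(1 - Complex.I) / (b - z p) ^ 2 * t =
        (t * (1 - Complex.I)) ^ 2 / ((b - z p) ^ 2 * ((b + t * (1 - Complex.I) : ℂ) - z p)) := by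
      field_simp
      ring
    have hnI : ‖(1 - Complex.I : ℂ)‖ ≤ 2 :=
      (norm_sub_le _ _).trans (by rw [norm_one, Complex.norm_I]; norm_num)
    rw [h3, norm_div, norm_mul, norm_pow, norm_pow, norm_mul, Complex.norm_real, Real.norm_eq_abs,
      div_mul_eq_mul_div]
    have h4 : 0 < ‖(b : ℂ) - z p‖ := norm_pos_iff.mpr h2
    gcongr
    · calc (|t| * ‖(1 - Complex.I : ℂ)‖) ^ 2 ≤ (|t| * 2) ^ 2 := by gcongr
        _ = 4 * t ^ 2 := by rw [mul_pow, sq_abs]; ring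
    · exact hdist t ht p
  choose Cp hCp hLp using hpole
  have hEb : ∀ ε, ‖branchExp c z lam ε 0 b‖ = 1 := fun ε => norm_branchExp_ofReal hz b
  refine ⟨ρ, C₀ + ∑ p, Cp p, hρ, hρρ₀, hρz, add_nonneg hC₀ (Finset.sum_nonneg fun p _ => hCp p),
    fun ε t hε ht => ?_, fun ε hε μ w => ?_⟩
  · rw [hE, norm_mul, hEb, one_mul, Complex.norm_exp]
    refine Real.exp_le_exp.mpr ?_
    rw [Complex.div_ofReal_re]
    refine div_le_div_of_nonneg_right ?_ hε.le
    have h1 := (Complex.re_le_norm _).trans (hφ2 t (abs_le.mp ht))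
    have h2 : (φ t + s * t ^ 2 : ℂ).re = (φ t).re + s * t ^ 2 := by
      rw [← Complex.ofReal_pow, ← Complex.ofReal_mul, Complex.add_re, Complex.ofReal_re]
    linarith
  · have hint0 : IntervalIntegrable (fun t : ℝ => Complex.exp (φ t / ε) * 1) volume (-ρ) ρ := by
      refine ContinuousOn.intervalIntegrable ?_
      rw [uIcc_of_le (by linarith)]
      exact ((hφc.div_const _).cexp).mul continuousOn_const
    have hintp : ∀ p, IntervalIntegrable (fun t : ℝ => Complex.exp (φ t / ε) *
        (1 / ((b + t * (1 - Complex.I) : ℂ) - z p))) volume (-ρ) ρ := fun p => by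
      refine ContinuousOn.intervalIntegrable ?_
      rw [uIcc_of_le (by linarith)]
      exact ((hφc.div_const _).cexp).mul (continuousOn_const.div (by fun_prop) fun t ht =>
        sub_ne_zero.mpr (hne t ht p))
    have hsum : IntervalIntegrable (fun t : ℝ => ∑ p, w p * (Complex.exp (φ t / ε) *
        (1 / ((b + t * (1 - Complex.I) : ℂ) - z p)))) volume (-ρ) ρ := by
      have := IntervalIntegrable.sum Finset.univ fun p _ => (hintp p).const_mul (w p)
      rwa [Finset.sum_fn] at this
    have hsplit : (∫ t in (-ρ)..ρ, branchExp c z lam ε 0 (b + t * (1 - Complex.I)) *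
          forcing z μ w (b + t * (1 - Complex.I))) =
        branchExp c z lam ε 0 b * (μ * (∫ t in (-ρ)..ρ, Complex.exp (φ t / ε) * 1) +
          ∑ p, w p * ∫ t in (-ρ)..ρ, Complex.exp (φ t / ε) *
            (1 / ((b + t * (1 - Complex.I) : ℂ) - z p))) := by
      simp only [← intervalIntegral.integral_const_mul]
      rw [← intervalIntegral.integral_finsetSum fun p _ => (hintp p).const_mul _,
        ← intervalIntegral.integral_add (hint0.const_mul _) hsum,
        ← intervalIntegral.integral_const_mul]
      refine intervalIntegral.integral_congr fun t _ => ?_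
      simp only [hE, forcing, mul_add, Finset.mul_sum]
      congr 1
      · ring
      · exact Finset.sum_congr rfl fun p _ => by ring
    set K : ℂ := ((√(Real.pi / s) * √ε : ℝ) : ℂ) with hK
    have hdiff : branchExp c z lam ε 0 b * (μ * (∫ t in (-ρ)..ρ, Complex.exp (φ t / ε) * 1) +
          ∑ p, w p * ∫ t in (-ρ)..ρ, Complex.exp (φ t / ε) *
            (1 / ((b + t * (1 - Complex.I) : ℂ) - z p))) -
        branchExp c z lam ε 0 b * K * forcing z μ w b =
        branchExp c z lam ε 0 b * (μ * ((∫ t in (-ρ)..ρ, Complex.exp (φ t / ε) * 1) - K * 1) +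
          ∑ p, w p * ((∫ t in (-ρ)..ρ, Complex.exp (φ t / ε) *
            (1 / ((b + t * (1 - Complex.I) : ℂ) - z p))) - K * (1 / (b - z p)))) := by
      have : ∑ p, w p * (K * (1 / ((b : ℂ) - z p))) = K * ∑ p, w p / (b - z p) := by
        rw [Finset.mul_sum]
        exact Finset.sum_congr rfl fun p _ => by ring
      simp only [mul_sub, Finset.sum_sub_distrib, this, forcing]
      ring
    rw [hsplit, hdiff, norm_mul, hEb, one_mul]
    refine (norm_add_le _ _).trans ?_
    have hq : 0 ≤ ε * √ε := by positivity
    have h1 : ‖μ * ((∫ t in (-ρ)..ρ, Complex.exp (φ t / ε) * 1) - K * 1)‖ ≤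
        C₀ * forcingNorm μ w * (ε * √ε) := by
      rw [norm_mul]
      calc _ ≤ forcingNorm μ w * (C₀ * (ε * √ε)) := by
            gcongr
            · exact forcingNorm_nonneg μ w
            · exact norm_le_forcingNorm μ w
            · exact hL₀ ε hε
        _ = _ := by ring
    have h2 : ‖∑ p, w p * ((∫ t in (-ρ)..ρ, Complex.exp (φ t / ε) *
            (1 / ((b + t * (1 - Complex.I) : ℂ) - z p))) - K * (1 / (b - z p)))‖ ≤
        (∑ p, Cp p) * forcingNorm μ w * (ε * √ε) := by
      refine (norm_sum_le _ _).trans ?_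
      rw [Finset.sum_mul, Finset.sum_mul]
      refine Finset.sum_le_sum fun p _ => ?_
      rw [norm_mul]
      calc _ ≤ forcingNorm μ w * (Cp p * (ε * √ε)) := by
            gcongr
            · exact forcingNorm_nonneg μ w
            · exact (Finset.single_le_sum (f := fun p => ‖w p‖) (fun q _ => norm_nonneg _)
                (Finset.mem_univ p)).trans (sum_norm_le_forcingNorm μ w)
            · exact hLp p ε hε
        _ = _ := by ring
    linarith

theorem exp_neg_div_le {a : ℝ} (ha : 0 < a) (hε : 0 < ε) (hε1 : ε ≤ 1) :
    Real.exp (-a / ε) ≤ 2 / a ^ 2 * (ε * √ε) := by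
  have h1 := Real.pow_div_factorial_le_exp (a / ε) (by positivity) 2
  have h2 : ε * ε ≤ ε * √ε := by
    gcongr
    exact Real.le_sqrt_of_sq_le (by nlinarith)
  rw [neg_div, Real.exp_neg]
  calc (Real.exp (a / ε))⁻¹ ≤ ((a / ε) ^ 2 / (2 : ℕ).factorial)⁻¹ := by gcongr
    _ = 2 / a ^ 2 * (ε * ε) := by rw [Nat.factorial_two]; push_cast; field_simp
    _ ≤ _ := by gcongr

/-- The real axis is deformed to a contour in the upper half-plane, the line of steepest descent
through `b = x₊`, and a horizontal line below the axis. -/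
theorem exists_norm_rightLimit_sub_le (hz : ∀ p, 0 < (z p).im) (hlam : 0 < lam) {b : ℝ}
    (hb : potential c z b = -lam) (hpos : ∀ x, b ≤ x → 0 < deriv (potential c z) x) :
    ∃ C : ℝ, 0 ≤ C ∧ ∀ ε : ℝ, 0 < ε → ε ≤ 1 → ∀ (μ : ℂ) (w : Fin P → ℂ) (Φ n : ℂ → ℂ) (J : ℂ),
      IsJostQuotient c z lam ε μ w Φ n → HasRightLimit z Φ J →
        ‖J - (1 - Complex.I) * (branchExp c z lam ε 0 b *
          ((√(Real.pi / deriv (potential c z) b) * √ε : ℝ) : ℂ) * forcing z μ w b)‖ ≤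
          C * forcingNorm μ w * (ε * √ε) := by
  have hs := hpos b le_rfl
  obtain ⟨d, hd, hdz⟩ := exists_pos_forall_le hz
  obtain ⟨Y', hYR', hY'⟩ := exists_radius_potentialC_le c z (half_pos hlam)
  set Y := max Y' (b + 1) with hYdef
  have hYY : Y' ≤ Y := le_max_left _ _
  have hYb : b + 1 ≤ Y := le_max_right _ _
  have h0 := one_le_outerRadius z
  obtain ⟨ρ₀, hρ₀, hρ₀d, hstrip⟩ := exists_strip_im_nonpos (A := b) (B := Y) hd
    (differentiableOn_potentialC_strip (c := c) hdz) im_potentialC_ofReal fun x hx => by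
      rw [deriv_potentialC_ofReal hz, Complex.ofReal_re]
      exact hpos x hx.1
  obtain ⟨ρ, C₁, hρ, hρ1, hρz, hC₁, hEd, hsad⟩ := exists_norm_saddle_integral_sub_le hz hb hs
    (lt_min hρ₀ one_pos)
  obtain ⟨C₂, hC₂, hup⟩ := exists_bound_upper (c := c) hz hlam (|b| + 2)
  set s := deriv (potential c z) b with hsdef
  have hρ₀' : ρ ≤ ρ₀ := hρ1.trans (min_le_left _ _)
  have hρ1' : ρ ≤ 1 := hρ1.trans (min_le_right _ _)
  set a := s / 2 * ρ ^ 2 with ha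
  have hapos : 0 < a := by positivity
  set A := C₂ + (1 + 1 / ρ) * (Y - (b + ρ)) + 4 / lam with hA
  have hA0 : 0 ≤ A := by
    have : 0 ≤ Y - (b + ρ) := by linarith
    positivity
  refine ⟨2 * C₁ + A * (2 / a ^ 2), by positivity, fun ε hε hε1 μ w Φ n J hJ hlim => ?_⟩
  have hγ := forcingNorm_nonneg μ w
  set γ := forcingNorm μ w with hγdef
  have hdom : ∀ x : ℂ, |x.im| ≤ ρ → x ∈ branchDomain z 0 := fun x hx =>
    mem_branchDomain_of_abs_im_lt (d := 2 * ρ) hρz (by linarith)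
  have him : ∀ t : ℝ, (b + t * (1 - Complex.I) : ℂ).im = -t := fun t => by simp
  set e := Real.exp (-a / ε) with he
  have he0 : 0 < e := Real.exp_pos _
  set y : ℂ := ((-ρ : ℝ) : ℂ) * Complex.I with hy
  have hre' : ∀ s : ℝ, (s + y : ℂ).re = s := fun s => by rw [hy, re_add_mul_I]
  have him' : ∀ s : ℝ, (s + y : ℂ).im = -ρ := fun s => by rw [hy, im_add_mul_I]
  have hdomy : ∀ s : ℝ, (s + y : ℂ) ∈ branchDomain z 0 := fun s =>
    hdom _ (by rw [him', abs_neg, abs_of_pos hρ])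
  have hlr : (b + (ρ : ℝ) * (1 - Complex.I) : ℂ) = ((b + ρ : ℝ) : ℂ) + y := by
    rw [hy]; push_cast; ring
  set q : ℂ := b + ((-ρ : ℝ) : ℂ) * (1 - Complex.I) with hq
  have hqE : ‖branchExp c z lam ε 0 q‖ ≤ e := by
    have := hEd ε (-ρ) hε (by rw [abs_neg, abs_of_pos hρ])
    rwa [neg_sq] at this
  have hqim : q.im = ρ := by rw [hq, him, neg_neg]
  have hq1 : ‖Φ q‖ ≤ C₂ * γ * e := by
    rw [hJ.eq_mul q (hdom q (by rw [hqim, abs_of_pos hρ])), norm_mul, mul_comm]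
    refine mul_le_mul (hup ε hε hε1 μ w Φ n hJ q (by rw [hqim]; exact hρ.le) ?_) hqE (norm_nonneg _)
      (by positivity)
    rw [hq]
    refine (norm_add_le _ _).trans ?_
    have hnI : ‖(1 - Complex.I : ℂ)‖ ≤ 2 :=
      (norm_sub_le _ _).trans (by rw [norm_one, Complex.norm_I]; norm_num)
    rw [norm_mul, Complex.norm_real, Complex.norm_real, Real.norm_eq_abs, Real.norm_eq_abs, abs_neg,
      abs_of_pos hρ]
    nlinarith
  have hElow : ∀ s : ℝ, b + ρ ≤ s → s ≤ Y → ‖branchExp c z lam ε 0 (s + y)‖ ≤ e := by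
    intro s hs1 hs2
    have h1 := norm_branchExp_le_of_re_ge (c := c) (lam := lam) (k := 0) (a := s + y) (d := -1)
      (s₀ := 0) (s₁ := s - (b + ρ)) (κ := 0) hε (by linarith)
      (fun t _ => by
        have : (s + y + t * (-1) : ℂ) = ((s - t : ℝ) : ℂ) + y := by push_cast; ring
        rw [this]; exact hdomy _)
      (fun t ht => by
        have : (s + y + t * (-1) : ℂ) = ((s - t : ℝ) : ℂ) + y := by push_cast; ring
        rw [this]
        have h2 := hstrip (((s - t : ℝ) : ℂ) + y) (by rw [hre']; linarith [ht.2])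
          (by rw [hre']; linarith [ht.1]) (by rw [him']; linarith) (by rw [him']; linarith)
        have h3 : (-Complex.I * (lam + potentialC c z (((s - t : ℝ) : ℂ) + y)) * -1).re =
            -(potentialC c z (((s - t : ℝ) : ℂ) + y)).im := by simp
        rw [h3]; linarith)
    have h4 : (s + y + ((s - (b + ρ) : ℝ) : ℂ) * (-1) : ℂ) = ((b + ρ : ℝ) : ℂ) + y := by
      push_cast; ring
    rw [h4, zero_mul, zero_div, neg_zero, Real.exp_zero, mul_one, Complex.ofReal_zero, zero_mul,
      add_zero] at h1
    refine h1.trans ?_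
    rw [← hlr]
    exact hEd ε ρ hε (abs_of_pos hρ).le
  have hint : (1 - Complex.I) * (∫ t in (-ρ)..ρ, branchExp c z lam ε 0 (b + t * (1 - Complex.I)) *
      forcing z μ w (b + t * (1 - Complex.I))) = Φ (((b + ρ : ℝ) : ℂ) + y) - Φ q := by
    rw [← hlr, hq, ← intervalIntegral.integral_const_mul]
    have hmem : ∀ t ∈ uIcc (-ρ) ρ, (b + t * (1 - Complex.I) : ℂ) ∈ leftDomain z 0 := fun t ht => by
      rw [uIcc_of_le (by linarith)] at ht
      exact mem_leftDomain_zero (hdom _ (by rw [him, abs_neg]; exact abs_le.mpr ht))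
    refine intervalIntegral.integral_eq_sub_of_hasDerivAt
      (f := fun t : ℝ => Φ (b + t * (1 - Complex.I)))
      (fun t ht => hasDerivAt_comp_line (hJ.primitive.hasDerivAt _ (hmem t ht))) ?_
    exact ((IsBranchPrimitive.continuousOn_integrand.comp (by fun_prop)
      hmem).intervalIntegrable).const_mul _
  have hlow : ‖Φ ((Y : ℂ) + y) - Φ (((b + ρ : ℝ) : ℂ) + y)‖ ≤
      e * ((1 + 1 / ρ) * γ) * (Y - (b + ρ)) := by
    rw [← hJ.primitive.integral_horizontal fun s _ => mem_leftDomain_zero (hdomy s)]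
    have hle : b + ρ ≤ Y := by linarith
    rw [← abs_of_nonneg (by linarith : 0 ≤ Y - (b + ρ))]
    refine intervalIntegral.norm_integral_le_of_norm_le_const fun s hs => ?_
    rw [uIoc_of_le hle] at hs
    rw [norm_mul]
    refine mul_le_mul (hElow s hs.1.le hs.2) (norm_forcing_le μ w hρ fun p => ?_) (norm_nonneg _)
      he0.le
    have h1 := Complex.abs_im_le_norm ((s + y : ℂ) - z p)
    rw [Complex.sub_im, him', abs_of_nonpos (by linarith [hz p])] at h1
    linarith [hz p, hρz p]
  have hr : ‖Φ ((Y : ℂ) + y) - J‖ ≤ 4 / lam * γ * e := by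
    have h1 := (hJ.primitive.right_bounds hε hlam hlim (a := (Y : ℂ) + y) (by rw [hre']; linarith)
      fun v hv => hY' v (hYY.trans (by
        rwa [hre', abs_of_nonneg (by linarith)] at hv))).1
    have hε4 : 4 * ε / lam ≤ 4 / lam := by gcongr; linarith
    exact h1.trans (by gcongr; exact hElow Y (by linarith) le_rfl)
  have hmain := hsad ε hε μ w
  set Int := ∫ t in (-ρ)..ρ, branchExp c z lam ε 0 (b + t * (1 - Complex.I)) *
      forcing z μ w (b + t * (1 - Complex.I)) with hInt
  set T := branchExp c z lam ε 0 b * ((√(Real.pi / s) * √ε : ℝ) : ℂ) * forcing z μ w b with hT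
  have htri : J - (1 - Complex.I) * T = (1 - Complex.I) * (Int - T) + (Φ q +
      (Φ ((Y : ℂ) + y) - Φ (((b + ρ : ℝ) : ℂ) + y)) - (Φ ((Y : ℂ) + y) - J)) := by
    rw [mul_sub, hint]; ring
  have hnI : ‖(1 - Complex.I : ℂ)‖ ≤ 2 :=
    (norm_sub_le _ _).trans (by rw [norm_one, Complex.norm_I]; norm_num)
  have hexp := exp_neg_div_le hapos hε hε1
  rw [htri]
  refine (norm_add_le _ _).trans ?_
  have h5 : ‖(1 - Complex.I) * (Int - T)‖ ≤ 2 * (C₁ * γ * (ε * √ε)) := by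
    rw [norm_mul]; gcongr
  have h6 : ‖Φ q + (Φ ((Y : ℂ) + y) - Φ (((b + ρ : ℝ) : ℂ) + y)) - (Φ ((Y : ℂ) + y) - J)‖ ≤
      A * γ * e := by
    refine (norm_sub_le _ _).trans ((add_le_add_left (norm_add_le _ _) _).trans ?_)
    calc _ ≤ C₂ * γ * e + e * ((1 + 1 / ρ) * γ) * (Y - (b + ρ)) + 4 / lam * γ * e := by gcongr
      _ = _ := by rw [hA]; ring
  have h7 : A * γ * e ≤ A * γ * (2 / a ^ 2 * (ε * √ε)) := by gcongr
  calc _ ≤ 2 * (C₁ * γ * (ε * √ε)) + A * γ * (2 / a ^ 2 * (ε * √ε)) := by linarith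
    _ = _ := by ring

/-! ### The phase at the saddle point -/

/-- As `∑ Re c_p = 0`, the logarithms cancel at infinity and the antiderivative tends to `M`. -/
theorem tendsto_antideriv_ofReal (h : ∑ p, (c p).re = 0) :
    Tendsto (fun x : ℝ => antideriv c z x) atTop (𝓝 (mass c)) := by
  have hlog : ∀ a ω : ℂ, ω ∈ Complex.slitPlane →
      Tendsto (fun x : ℝ => Complex.log (ω * (x - a)) - Real.log x) atTop (𝓝 (Complex.log ω)) := by
    intro a ω hω
    have hω0 : ω ≠ 0 := Complex.slitPlane_ne_zero hω
    have h1 : Tendsto (fun x : ℝ => ω * ((x : ℂ) / (x - a))⁻¹) atTop (𝓝 ω) := by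
      have := ((tendsto_ofReal_div_sub a).inv₀ one_ne_zero).const_mul ω
      rwa [inv_one, mul_one] at this
    refine ((continuousAt_clog hω).tendsto.comp h1).congr' ?_
    filter_upwards [eventually_gt_atTop 0, h1.eventually_ne hω0] with x hx hne
    have hxc : (x : ℂ) ≠ 0 := by exact_mod_cast hx.ne'
    have h2 : ω * (x - a) = (x : ℂ) * (ω * ((x : ℂ) / (x - a))⁻¹) := by
      field_simp
    rw [h2, Complex.log_ofReal_mul hx hne, add_sub_cancel_left, Function.comp_apply]
  have hI : Complex.I ∈ Complex.slitPlane := by simp [Complex.mem_slitPlane_iff]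
  have hI' : -Complex.I ∈ Complex.slitPlane := by simp [Complex.mem_slitPlane_iff]
  have hsum : Tendsto (fun x : ℝ => ∑ p, (c p * (Complex.log (Complex.I * (x - z p)) - Real.log x +
      Real.pi * Complex.I / 2) + conj (c p) * (Complex.log (-Complex.I * (x - conj (z p))) -
        Real.log x - Real.pi * Complex.I / 2))) atTop
      (𝓝 (∑ p, (c p * (Complex.log Complex.I + Real.pi * Complex.I / 2) +
        conj (c p) * (Complex.log (-Complex.I) - Real.pi * Complex.I / 2)))) :=
    tendsto_finsetSum _ fun p _ => (((hlog (z p) _ hI).add_const _).const_mul _).add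
      (((hlog (conj (z p)) _ hI').sub_const _).const_mul _)
  have hcc : ∑ p, (c p + conj (c p)) = 0 := by
    have : ∀ p, c p + conj (c p) = 2 * ((c p).re : ℂ) := fun p => by
      rw [Complex.add_conj]; push_cast; ring
    simp only [this, ← Finset.mul_sum, ← Complex.ofReal_sum, h, Complex.ofReal_zero, mul_zero]
  have hlim : ∑ p, (c p * (Complex.log Complex.I + Real.pi * Complex.I / 2) +
      conj (c p) * (Complex.log (-Complex.I) - Real.pi * Complex.I / 2)) = mass c := by
    rw [Complex.log_I, Complex.log_neg_I, mass]
    have h1 : ∀ p, c p * (Real.pi / 2 * Complex.I + Real.pi * Complex.I / 2) +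
        conj (c p) * (-(Real.pi / 2) * Complex.I - Real.pi * Complex.I / 2) =
        2 * Real.pi * Complex.I * c p - Real.pi * Complex.I * (c p + conj (c p)) := fun p => by ring
    simp only [h1, Finset.sum_sub_distrib, ← Finset.mul_sum, hcc, mul_zero, sub_zero]
  rw [hlim] at hsum
  refine hsum.congr fun x => ?_
  have h1 : ∀ p, (c p * (Complex.log (Complex.I * (x - z p)) - Real.log x +
      Real.pi * Complex.I / 2) + conj (c p) * (Complex.log (-Complex.I * (x - conj (z p))) -
        Real.log x - Real.pi * Complex.I / 2)) =
      (c p * (Complex.log (Complex.I * (x - z p)) + Real.pi * Complex.I / 2) +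
        conj (c p) * (Complex.log (-Complex.I * (x - conj (z p))) - Real.pi * Complex.I / 2)) -
      Real.log x * (c p + conj (c p)) := fun p => by ring
  simp only [h1, Finset.sum_sub_distrib, ← Finset.mul_sum, hcc, mul_zero, sub_zero]
  rfl

section Well

variable {xc : ℝ}

theorem IsWell.lt_xPlus (hz : ∀ p, 0 < (z p).im) (hw : IsWell c z xc) {η x : ℝ} (hη0 : 0 < η)
    (hη : η < -potential c z xc) (hx : xc ≤ x) (h : η < -potential c z x) : x < xPlus c z η := by
  obtain ⟨-, hp, -, hpe, -⟩ := hw.exists_roots hz hη0 hη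
  refine (hw.strictMonoOn hz).lt_iff_lt hx hp.le |>.mp ?_
  rw [hpe]; linarith

theorem IsWell.xPlus_lt (hz : ∀ p, 0 < (z p).im) (hw : IsWell c z xc) {η x : ℝ} (hη0 : 0 < η)
    (hη : η < -potential c z xc) (hx : xc ≤ x) (h : -potential c z x < η) : xPlus c z η < x := by
  obtain ⟨-, hp, -, hpe, -⟩ := hw.exists_roots hz hη0 hη
  refine (hw.strictMonoOn hz).lt_iff_lt hp.le hx |>.mp ?_
  rw [hpe]; linarith

theorem IsWell.continuousAt_xPlus (hz : ∀ p, 0 < (z p).im) (hw : IsWell c z xc) {η : ℝ}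
    (hη0 : 0 < η) (hη : η < -potential c z xc) : ContinuousAt (xPlus c z) η := by
  obtain ⟨-, hp, -, hpe, -⟩ := hw.exists_roots hz hη0 hη
  have hmono := hw.strictMonoOn hz
  have hnear : ∀ᶠ η' in 𝓝 η, 0 < η' ∧ η' < -potential c z xc :=
    (eventually_gt_nhds hη0).and (eventually_lt_nhds hη)
  refine tendsto_order.mpr ⟨fun x hx => ?_, fun x hx => ?_⟩
  · have h1 : η < -potential c z (max x xc) := by
      have := hmono (le_max_right x xc) hp.le (max_lt hx hp)
      rw [hpe] at this; linarith
    filter_upwards [hnear, eventually_lt_nhds h1] with η' h2 h3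
    exact (le_max_left _ _).trans_lt (hw.lt_xPlus hz h2.1 h2.2 (le_max_right _ _) h3)
  · have h1 : -potential c z x < η := by
      have := hmono hp.le (hp.trans hx).le hx
      rw [hpe] at this; linarith
    filter_upwards [hnear, eventually_gt_nhds h1] with η' h2 h3
    exact hw.xPlus_lt hz h2.1 h2.2 (hp.trans hx).le h3

theorem hasDerivAt_re_antideriv (hz : ∀ p, 0 < (z p).im) (x : ℝ) :
    HasDerivAt (fun y : ℝ => (antideriv c z y).re) (potential c z x) x := by
  have h1 := hasDerivAt_branchAntideriv (c := c) (real_mem_leftDomain hz x).1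
  have h2 := h1.real_of_complex
  simp only [← antideriv_eq_branchAntideriv] at h2
  exact h2

/-- The critical value `h(x₊(η); η)` has the derivative `x₊(η)`. -/
theorem IsWell.hasDerivAt_criticalValue (hz : ∀ p, 0 < (z p).im) (hw : IsWell c z xc) {η : ℝ}
    (hη0 : 0 < η) (hη : η < -potential c z xc) :
    HasDerivAt (fun η : ℝ => η * xPlus c z η + (antideriv c z (xPlus c z η)).re)
      (xPlus c z η) η := by
  obtain ⟨-, hp, -, hpe, -⟩ := hw.exists_roots hz hη0 hη
  have hpot := (hasDerivAt_potential (c := c) hz (xPlus c z η)).differentiableAt.hasDerivAt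
  have hx : HasDerivAt (xPlus c z) (-deriv (potential c z) (xPlus c z η))⁻¹ η := by
    refine HasDerivAt.of_local_left_inverse (hw.continuousAt_xPlus hz hη0 hη) hpot.fun_neg
      (neg_ne_zero.mpr (hw.deriv_pos _ hp).ne') ?_
    filter_upwards [eventually_gt_nhds hη0, eventually_lt_nhds hη] with y h1 h2
    rw [(hw.exists_roots hz h1 h2).2.2.2.1, neg_neg]
  have h1 := ((hasDerivAt_id η).mul hx).add ((hasDerivAt_re_antideriv (c := c) hz _).comp η hx)
  refine h1.congr_deriv ?_
  simp only [id]
  rw [hpe]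
  ring

theorem IsWell.tendsto_xPlus (hz : ∀ p, 0 < (z p).im) (hw : IsWell c z xc) :
    Tendsto (xPlus c z) (𝓝[>] 0) atTop := by
  refine tendsto_atTop.mpr fun B => ?_
  have h1 : 0 < -potential c z (max B xc) := neg_pos.mpr (hw.neg _)
  have h2 : 0 < -potential c z xc := neg_pos.mpr (hw.neg _)
  filter_upwards [self_mem_nhdsWithin, nhdsWithin_le_nhds (eventually_lt_nhds h1),
    nhdsWithin_le_nhds (eventually_lt_nhds h2)] with η h3 h4 h5
  exact (le_max_left _ _).trans (hw.lt_xPlus hz h3 h5 (le_max_right _ _) h4).le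

/-- `h(x₊(λ); λ) = M + θ₊(λ)`. -/
theorem IsWell.criticalValue_eq (hz : ∀ p, 0 < (z p).im) (hlam : 0 < lam) (hw : IsWell c z xc)
    (hl : lam < -potential c z xc) (h : ∑ p, (c p).re = 0) :
    (lam * xPlus c z lam + antideriv c z (xPlus c z lam) : ℂ) = mass c + thetaPlus c z lam := by
  set H : ℝ → ℝ := fun η => η * xPlus c z η + (antideriv c z (xPlus c z η)).re with hH
  have hder : ∀ η ∈ Ioo 0 lam, HasDerivAt H (xPlus c z η) η := fun η hη =>
    hw.hasDerivAt_criticalValue hz hη.1 (hη.2.trans hl)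
  have h0 : Tendsto H (𝓝[>] 0) (𝓝 (mass c).re) := by
    have hx := hw.tendsto_xPlus hz
    have h1 := (tendsto_mul_potential c z).comp hx
    rw [h, mul_zero] at h1
    have h2 := (Complex.continuous_re.tendsto _).comp ((tendsto_antideriv_ofReal (z := z) h).comp hx)
    have h3 := h1.neg.add h2
    rw [neg_zero, zero_add] at h3
    refine h3.congr' ?_
    filter_upwards [self_mem_nhdsWithin, nhdsWithin_le_nhds
      (eventually_lt_nhds (neg_pos.mpr (hw.neg xc)))] with η h4 h5
    simp only [Function.comp_apply, (hw.exists_roots hz h4 h5).2.2.2.1, hH]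
    ring
  have hlim : Tendsto H (𝓝[<] lam) (𝓝 (H lam)) :=
    (hw.hasDerivAt_criticalValue hz hlam hl).continuousAt.tendsto.mono_left nhdsWithin_le_nhds
  -- `x₊ - x_c` is integrable as a nonnegative derivative of a function with limits at both ends
  have hint : IntervalIntegrable (xPlus c z) volume 0 lam := by
    have hd2 : ∀ η ∈ Ioo 0 lam, HasDerivAt (fun η => H η - xc * η) (xPlus c z η - xc) η :=
      fun η hη => by
        simpa using (hder η hη).fun_sub ((hasDerivAt_id η).const_mul xc)
    have ha : Tendsto (fun η => H η - xc * η) (𝓝[>] 0) (𝓝 ((mass c).re - xc * 0)) :=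
      h0.sub (((continuous_const.mul continuous_id).tendsto 0).mono_left nhdsWithin_le_nhds)
    have hb : Tendsto (fun η => H η - xc * η) (𝓝[<] lam) (𝓝 (H lam - xc * lam)) :=
      hlim.sub (((continuous_const.mul continuous_id).tendsto lam).mono_left nhdsWithin_le_nhds)
    have hcont := continuousOn_Icc_extendFrom_Ioo (f := fun η => H η - xc * η)
      (fun η hη => (hd2 η hη).continuousAt.continuousWithinAt) ha hb
    have hI := intervalIntegral.integrableOn_deriv_of_nonneg hcont
      (g' := fun η => xPlus c z η - xc) (fun η hη => by
        refine (hd2 η hη).congr_of_eventuallyEq ?_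
        filter_upwards [Ioo_mem_nhds hη.1 hη.2] with y hy
        exact extendFrom_eq (subset_closure hy)
          ((hd2 y hy).continuousAt.tendsto.mono_left nhdsWithin_le_nhds))
      fun η hη => sub_nonneg.mpr (hw.exists_roots hz hη.1 (hη.2.trans hl)).2.1.le
    rw [← intervalIntegrable_iff_integrableOn_Ioc_of_le hlam.le] at hI
    simpa using hI.add (intervalIntegrable_const (c := xc))
  have key : thetaPlus c z lam = H lam - (mass c).re :=
    intervalIntegral.integral_eq_sub_of_hasDerivAt_of_tendsto hlam hder hint h0 hlim
  have hM : (((mass c).re : ℝ) : ℂ) = mass c := by rw [mass_eq_ofReal h, Complex.ofReal_re]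
  have hF : (((antideriv c z (xPlus c z lam)).re : ℝ) : ℂ) = antideriv c z (xPlus c z lam) :=
    Complex.conj_eq_iff_re.mp (conj_antideriv_ofReal hz _)
  rw [key, hH]
  push_cast
  rw [hM, hF]
  ring

end Well

/-! ### Asymptotics of the reflection coefficient -/

theorem IsRationalKlausShaw.potential_ne_of_notMem_closure_bulk (hu : IsRationalKlausShaw c z)
    (hlam : 0 < lam) (h : lam ∉ closure (bulk c z)) (x : ℝ) : potential c z x ≠ -lam := fun hx => by
  have := hu.add_potential_pos hlam h x
  linarith

theorem IsRationalKlausShaw.eventually_existsUnique (hu : IsRationalKlausShaw c z) (hlam : 0 < lam)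
    (h : lam ∈ bulk c z ∨ lam ∉ closure (bulk c z)) :
    ∀ᶠ ε : ℝ in 𝓝[>] 0, ∃! b : ℂ, IsReflectionCoefficient c z lam ε b := by
  have hz := hu.pole_im_pos
  have hmono := hu.pole_re_strictMono
  obtain ⟨rs, hrs⟩ : ∃ rs, HasRemainderBound c z lam rs := by
    rcases h with h | h
    · obtain ⟨xc, hw, hl⟩ := hu.isWell_of_mem_bulk hlam h
      exact ⟨_, (hasRemainderBound_of_isWell hz hlam hw hl).2⟩
    · exact ⟨_, (hasRemainderBound_of_pos hz hlam
        (hu.potential_ne_of_notMem_closure_bulk hlam h)).2⟩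
  filter_upwards [hrs.eventually_existsUnique hlam hz hmono, self_mem_nhdsWithin] with ε hε hpos
  exact existsUnique_isReflectionCoefficient hpos hlam hz hmono hε

theorem IsRationalKlausShaw.exists_norm_le_exp (hu : IsRationalKlausShaw c z) (hlam : 0 < lam)
    (h : lam ∉ closure (bulk c z)) :
    ∃ κ C ε₀ : ℝ, 0 < κ ∧ 0 < ε₀ ∧ ∀ ε : ℝ, 0 < ε → ε ≤ ε₀ → ∀ b : ℂ,
      IsReflectionCoefficient c z lam ε b → ‖b‖ ≤ C * Real.exp (-κ / ε) := by
  have hz := hu.pole_im_pos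
  have hmono := hu.pole_re_strictMono
  obtain ⟨ε₀, C₁, hε₀, hε₀1, hC₁, hγ⟩ := (hasRemainderBound_of_pos hz hlam
    (hu.potential_ne_of_notMem_closure_bulk hlam h)).2.exists_forcingNorm_le hmono
  obtain ⟨C₂, κ, hC₂, hκ, hJ⟩ := exists_norm_rightLimit_le_exp hz hlam (hu.add_potential_pos hlam h)
  refine ⟨κ / 2, 2 / κ * (C₂ * (C₁ * lam)), ε₀, by positivity, hε₀, fun ε hε hεε₀ b hb => ?_⟩
  obtain ⟨v, Φ, n, J, hq, hlim, rfl⟩ := hb.exists_hasRightLimit hε hlam hz hmono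
  have h1 := hJ ε hε (hεε₀.trans hε₀1) lam v Φ n J hq hlim
  have h2 := hγ ε hε hεε₀ lam v Φ n hq
  rw [Complex.norm_real, Real.norm_eq_abs, abs_of_pos hlam] at h2
  rw [norm_neg, norm_mul, norm_mul, norm_exp_mass hu.sum_re_residue_eq_zero, norm_div, Complex.norm_I,
    Complex.norm_real, Real.norm_eq_abs, abs_of_pos hε, mul_one]
  -- the factor `1 / ε` costs half of the exponent
  have h3 : 1 / ε ≤ 2 / κ * Real.exp (κ / 2 / ε) := by
    have h4 : κ / 2 / ε ≤ Real.exp (κ / 2 / ε) := by linarith [Real.add_one_le_exp (κ / 2 / ε)]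
    calc 1 / ε = 2 / κ * (κ / 2 / ε) := by field_simp
      _ ≤ _ := by gcongr
  have h5 : Real.exp (κ / 2 / ε) * Real.exp (-κ / ε) = Real.exp (-(κ / 2) / ε) := by
    rw [← Real.exp_add]; congr 1; ring
  calc 1 / ε * ‖J‖ ≤ 2 / κ * Real.exp (κ / 2 / ε) * (C₂ * (C₁ * lam) * Real.exp (-κ / ε)) := by
        gcongr
        exact h1.trans (by gcongr)
    _ = 2 / κ * (C₂ * (C₁ * lam)) * (Real.exp (κ / 2 / ε) * Real.exp (-κ / ε)) := by ring
    _ = _ := by rw [h5]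

theorem PsiMinus_eq (x : ℂ) : PsiMinus c z lam x =
    (((xMinus c z lam : ℂ) :: (upperPoints c z lam).toList).map fun r => x - r).prod /
      ∏ p, (x - z p) := by
  have h1 : ((upperPoints c z lam).toList.map fun r => x - r).prod =
      ((upperPoints c z lam).map fun r => x - r).prod := by
    conv_rhs => rw [← (upperPoints c z lam).coe_toList]
    rw [Multiset.map_coe, Multiset.prod_coe]
  rw [List.map_cons, List.prod_cons, h1]
  rfl

/-- The amplitude at the saddle point: `h''(x₊) = λ |Ψ⁻(x₊)|² / (x₊ - x₋)`. -/
theorem IsWell.norm_PsiMinus_sq (hz : ∀ p, 0 < (z p).im) (hlam : 0 < lam) {xc : ℝ}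
    (hw : IsWell c z xc) (hl : lam < -potential c z xc) :
    lam * ‖PsiMinus c z lam (xPlus c z lam)‖ ^ 2 =
      (xPlus c z lam - xMinus c z lam) * deriv (potential c z) (xPlus c z lam) := by
  obtain ⟨hm, hp, -, hpe, hset⟩ := hw.exists_roots hz hlam hl
  obtain ⟨hS, -⟩ := upperPoints_of_two_roots hz hlam.ne' (hm.trans hp).ne hset
    (hw.deriv_neg _ hm).ne (hw.deriv_pos _ hp).ne'
  have h1 := deriv_potential_mul_norm_sq hz hlam.ne' hS hpe
  have hZ : ‖∏ q, ((xPlus c z lam : ℂ) - z q)‖ ≠ 0 :=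
    norm_ne_zero_iff.mpr (prod_poles_ofReal_ne_zero hz _)
  have h2 : PsiMinus c z lam (xPlus c z lam) = ((xPlus c z lam : ℂ) - xMinus c z lam) *
      ((upperPoints c z lam).map fun w => (xPlus c z lam : ℂ) - w).prod /
        ∏ q, ((xPlus c z lam : ℂ) - z q) := rfl
  rw [h2, norm_div, norm_mul, ← Complex.ofReal_sub, Complex.norm_real, Real.norm_eq_abs,
    abs_of_pos (by linarith), div_pow, mul_pow]
  field_simp
  linear_combination (xMinus c z lam - xPlus c z lam) * h1

theorem I_mul_one_sub_I_mul_exp :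
    Complex.I * (1 - Complex.I) * Complex.exp (-(Complex.I * Real.pi / 4)) = ((√2 : ℝ) : ℂ) := by
  have h1 : -(Complex.I * Real.pi / 4) = ((-(Real.pi / 4) : ℝ) : ℂ) * Complex.I := by
    push_cast; ring
  rw [h1, Complex.exp_mul_I, ← Complex.ofReal_cos, ← Complex.ofReal_sin, Real.cos_neg, Real.sin_neg,
    Real.cos_pi_div_four, Real.sin_pi_div_four]
  push_cast
  linear_combination (-(((√2 : ℝ) : ℂ)) + (√2 : ℝ) * Complex.I / 2) * Complex.I_sq

/-- The leading term of `-(i/ε) e^{iM/ε} J`. -/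
theorem IsWell.leading_term (hz : ∀ p, 0 < (z p).im) (hlam : 0 < lam) {xc : ℝ}
    (hw : IsWell c z xc) (hl : lam < -potential c z xc) (h : ∑ p, (c p).re = 0) (hε : 0 < ε) {ψ : ℝ}
    (hψ : Complex.exp (-Complex.I * ψ - Complex.I * Real.pi / 4) =
      PsiMinus c z lam (xPlus c z lam) / (‖PsiMinus c z lam (xPlus c z lam)‖ : ℂ)) :
    -(Complex.I / ε * Complex.exp (Complex.I * mass c / ε) * ((1 - Complex.I) *
      (branchExp c z lam ε 0 (xPlus c z lam) *
        ((√(Real.pi / deriv (potential c z) (xPlus c z lam)) * √ε : ℝ) : ℂ) *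
        (lam * PsiMinus c z lam (xPlus c z lam))))) =
    -((√(2 * Real.pi * lam * (xPlus c z lam - xMinus c z lam) / ε) : ℝ) : ℂ) *
      Complex.exp (-Complex.I / ε * thetaPlus c z lam - Complex.I * ψ) := by
  obtain ⟨hm, hp, -, -, -⟩ := hw.exists_roots hz hlam hl
  have hs := hw.deriv_pos _ hp
  have hnorm := hw.norm_PsiMinus_sq hz hlam hl
  have hcrit := hw.criticalValue_eq hz hlam hl h
  set b := xPlus c z lam with hb
  set a := xMinus c z lam with ha
  set s := deriv (potential c z) b with hsd
  set N := ‖PsiMinus c z lam b‖ with hN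
  have hN0 : 0 < N := by
    refine lt_of_le_of_ne (norm_nonneg _) fun h0 => ?_
    rw [← h0] at hnorm
    have : 0 < (b - a) * s := mul_pos (by linarith) hs
    nlinarith
  have hNc : (N : ℂ) ≠ 0 := by exact_mod_cast hN0.ne'
  have hεc : (ε : ℂ) ≠ 0 := by exact_mod_cast hε.ne'
  rw [eq_div_iff hNc] at hψ
  have hE : Complex.exp (Complex.I * mass c / ε) * branchExp c z lam ε 0 b =
      Complex.exp (-Complex.I / ε * thetaPlus c z lam) := by
    rw [branchExp, ← antideriv_eq_branchAntideriv, hcrit, ← Complex.exp_add]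
    congr 1
    ring
  have hreal : √(2 * Real.pi * lam * (b - a) / ε) = √2 * (√(Real.pi / s) * √ε) * lam * N / ε := by
    rw [Real.sqrt_eq_iff_eq_sq (by have : 0 < b - a := by linarith
                                   positivity) (by positivity), div_pow, mul_pow, mul_pow, mul_pow,
      mul_pow, Real.sq_sqrt zero_le_two, Real.sq_sqrt (by positivity), Real.sq_sqrt hε.le]
    field_simp
    linear_combination -hnorm
  have hexp : Complex.exp (-Complex.I / ε * thetaPlus c z lam - Complex.I * ψ) =
      Complex.exp (-Complex.I / ε * thetaPlus c z lam) * Complex.exp (-Complex.I * ψ) := by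
    rw [← Complex.exp_add]; congr 1; ring
  have hexp2 : Complex.exp (-Complex.I * ψ - Complex.I * Real.pi / 4) =
      Complex.exp (-Complex.I * ψ) * Complex.exp (-(Complex.I * Real.pi / 4)) := by
    rw [← Complex.exp_add]; congr 1
  rw [hexp, hreal, ← hψ, hexp2, ← hE]
  push_cast
  rw [← I_mul_one_sub_I_mul_exp]
  field_simp

/-- In the bulk the error term is of order `√ε`. -/
theorem IsRationalKlausShaw.exists_norm_sub_le (hu : IsRationalKlausShaw c z) (hlam : 0 < lam)
    (h : lam ∈ bulk c z) {ψ : ℝ}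
    (hψ : Complex.exp (-Complex.I * ψ - Complex.I * Real.pi / 4) =
      PsiMinus c z lam (xPlus c z lam) / (‖PsiMinus c z lam (xPlus c z lam)‖ : ℂ)) :
    ∃ C ε₀ : ℝ, 0 < ε₀ ∧ ∀ ε : ℝ, 0 < ε → ε ≤ ε₀ → ∀ b : ℂ, IsReflectionCoefficient c z lam ε b →
      ‖b - -((√(2 * Real.pi * lam * (xPlus c z lam - xMinus c z lam) / ε) : ℝ) : ℂ) *
        Complex.exp (-Complex.I / ε * thetaPlus c z lam - Complex.I * ψ)‖ ≤ C * √ε := by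
  have hz := hu.pole_im_pos
  have hmono := hu.pole_re_strictMono
  have hc := hu.sum_re_residue_eq_zero
  obtain ⟨xc, hw, hl⟩ := hu.isWell_of_mem_bulk hlam h
  obtain ⟨-, hp, -, hpe, -⟩ := hw.exists_roots hz hlam hl
  have hR := (hasRemainderBound_of_isWell hz hlam hw hl).2
  obtain ⟨ε₁, C₁, hε₁, hε₁1, hC₁, hγ⟩ := hR.exists_forcingNorm_le hmono
  obtain ⟨ε₂, C₂, hε₂, -, hC₂, hG⟩ := hR.exists_norm_forcing_sub_le hmono (x := xPlus c z lam)
    fun p => (ofReal_ne_pole hz _ p).1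
  simp only [← PsiMinus_eq] at hG
  obtain ⟨C₃, hC₃, hJ⟩ := exists_norm_rightLimit_sub_le hz hlam hpe fun x hx =>
    hw.deriv_pos x (hp.trans_le hx)
  have hlead : ∀ ε : ℝ, 0 < ε → _ := fun ε hε => hw.leading_term hz hlam hl hc hε hψ
  set x := xPlus c z lam with hx
  set s := deriv (potential c z) x with hs
  refine ⟨C₃ * (C₁ * lam) + 2 * √(Real.pi / s) * (C₂ * lam), min ε₁ ε₂, lt_min hε₁ hε₂,
    fun ε hε hεm b hb => ?_⟩
  have hεε₁ : ε ≤ ε₁ := hεm.trans (min_le_left _ _)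
  have hεε₂ : ε ≤ ε₂ := hεm.trans (min_le_right _ _)
  obtain ⟨v, Φ, n, J, hq, hlim, rfl⟩ := hb.exists_hasRightLimit hε hlam hz hmono
  have h1 := hJ ε hε (hεε₁.trans hε₁1) lam v Φ n J hq hlim
  have h2 := hγ ε hε hεε₁ lam v Φ n hq
  have h3 := hG ε hε hεε₂ lam v Φ n hq
  rw [Complex.norm_real, Real.norm_eq_abs, abs_of_pos hlam] at h2 h3
  rw [← hlead ε hε]
  set E := branchExp c z lam ε 0 x with hE
  have hEn : ‖E‖ = 1 := norm_branchExp_ofReal hz x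
  set K : ℝ := √(Real.pi / s) * √ε with hK
  have hK0 : 0 ≤ K := by positivity
  set Ψ := PsiMinus c z lam x with hΨ
  set G := forcing z (lam : ℂ) v x with hGd
  set m := Complex.exp (Complex.I * mass c / ε) with hm
  have hmn : ‖m‖ = 1 := norm_exp_mass hc ε
  have hsplit : -(Complex.I / ε * m * J) - -(Complex.I / ε * m * ((1 - Complex.I) *
      (E * (K : ℂ) * (lam * Ψ)))) = -(Complex.I / ε * m * ((J - (1 - Complex.I) * (E * (K : ℂ) * G)) +
        (1 - Complex.I) * (E * (K : ℂ) * (G - lam * Ψ)))) := by ring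
  have hnI : ‖(1 - Complex.I : ℂ)‖ ≤ 2 :=
    (norm_sub_le _ _).trans (by rw [norm_one, Complex.norm_I]; norm_num)
  rw [hsplit, norm_neg, norm_mul, norm_mul, hmn, norm_div, Complex.norm_I, Complex.norm_real,
    Real.norm_eq_abs, abs_of_pos hε, mul_one]
  have h4 : ‖(1 - Complex.I) * (E * (K : ℂ) * (G - lam * Ψ))‖ ≤ 2 * (K * (C₂ * ε * lam)) := by
    rw [norm_mul, norm_mul, norm_mul, hEn, one_mul, Complex.norm_real, Real.norm_eq_abs,
      abs_of_nonneg hK0]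
    gcongr
  calc _ ≤ 1 / ε * (C₃ * (C₁ * lam) * (ε * √ε) + 2 * (K * (C₂ * ε * lam))) := by
        gcongr
        exact (norm_add_le _ _).trans (add_le_add (h1.trans (by gcongr)) h4)
    _ = _ := by rw [hK]; field_simp

end BenjaminOno

end

theorem theorem1 {P : ℕ} (c z : Fin P → ℂ) (hu : IsRationalKlausShaw c z) (lam : ℝ)
    (hlam : 0 < lam) (hsuit : HasSuitableModification c z lam) :
    (lam ∈ bulk c z ∨ lam ∉ closure (bulk c z) →
      ∀ᶠ ε : ℝ in 𝓝[>] 0, ∃! b : ℂ, IsReflectionCoefficient c z lam ε b) ∧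
    ((∀ x : ℝ, 0 < potential c z x) → lam ∉ closure (bulk c z)) ∧
    ∀ β : ℝ → ℂ, (∀ᶠ ε : ℝ in 𝓝[>] 0, IsReflectionCoefficient c z lam ε (β ε)) →
      (lam ∉ closure (bulk c z) →
        ∃ κ : ℝ, 0 < κ ∧ β =O[𝓝[>] 0] fun ε : ℝ => Real.exp (-κ / ε)) ∧
      (lam ∈ bulk c z → ∀ ψ : ℝ,
        Complex.exp (-Complex.I * ψ - Complex.I * Real.pi / 4) =
          PsiMinus c z lam (xPlus c z lam) / (‖PsiMinus c z lam (xPlus c z lam)‖ : ℂ) →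
        ((fun ε : ℝ => β ε -
            -((Real.sqrt (2 * Real.pi * lam * (xPlus c z lam - xMinus c z lam) / ε) : ℝ) : ℂ) *
              Complex.exp (-Complex.I / ε * thetaPlus c z lam - Complex.I * ψ))
          =o[𝓝[>] 0] fun ε : ℝ => ε ^ (-(1 / 2) : ℝ)) ∧
        (AllCriticalPointsSimple c z lam →
          (fun ε : ℝ => β ε -
            -((Real.sqrt (2 * Real.pi * lam * (xPlus c z lam - xMinus c z lam) / ε) : ℝ) : ℂ) *
              Complex.exp (-Complex.I / ε * thetaPlus c z lam - Complex.I * ψ))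
          =O[𝓝[>] 0] fun ε : ℝ => ε ^ ((1 / 2) : ℝ))) := by
  have hsqrt : ∀ ε : ℝ, ε ^ ((1 / 2) : ℝ) = √ε := fun ε => (Real.sqrt_eq_rpow ε).symm
  refine ⟨hu.eventually_existsUnique hlam, not_mem_closure_bulk_of_pos hlam, fun β hβ =>
    ⟨fun h => ?_, fun h ψ hψ => ?_⟩⟩
  · obtain ⟨κ, C, ε₀, hκ, hε₀, hle⟩ := hu.exists_norm_le_exp hlam h
    refine ⟨κ, hκ, IsBigO.of_bound C ?_⟩
    filter_upwards [hβ, Ioc_mem_nhdsGT hε₀] with ε hb hε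
    rw [Real.norm_eq_abs, Real.abs_exp]
    exact hle ε hε.1 hε.2 _ hb
  · obtain ⟨C, ε₀, hε₀, hle⟩ := hu.exists_norm_sub_le hlam h hψ
    have hO : (fun ε : ℝ => β ε -
        -((Real.sqrt (2 * Real.pi * lam * (xPlus c z lam - xMinus c z lam) / ε) : ℝ) : ℂ) *
          Complex.exp (-Complex.I / ε * thetaPlus c z lam - Complex.I * ψ))
        =O[𝓝[>] 0] fun ε : ℝ => ε ^ ((1 / 2) : ℝ) := by
      refine IsBigO.of_bound C ?_
      filter_upwards [hβ, Ioc_mem_nhdsGT hε₀] with ε hb hε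
      rw [hsqrt, Real.norm_eq_abs, abs_of_nonneg (Real.sqrt_nonneg ε)]
      exact hle ε hε.1 hε.2 _ hb
    refine ⟨hO.trans_isLittleO ?_, fun _ => hO⟩
    have hid : (fun ε : ℝ => ε) =o[𝓝[>] 0] fun _ => (1 : ℝ) :=
      (isLittleO_one_iff ℝ).mpr (tendsto_id.mono_left nhdsWithin_le_nhds)
    refine (hid.mul_isBigO (isBigO_refl (fun ε : ℝ => ε ^ (-(1 / 2) : ℝ)) _)).congr' ?_ ?_
    · filter_upwards [self_mem_nhdsWithin] with ε hε
      have h1 := Real.rpow_add (show 0 < ε from hε) 1 (-(1 / 2))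
      rw [Real.rpow_one] at h1
      rw [← h1]
      norm_num
    · exact Eventually.of_forall fun ε => one_mul _
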